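/- Let $(V,\Omega)$ be a finite-dimensional real symplectic vector space, $\hbar>0$, $h=2\pi\hbar$, and let $j$ be a positive compatible complex structure: $j$ is symplectic, $j^2=-1$, and $G_j(v,w)=\Omega(v,jw)$ is positive definite. Put $\langle v,w\rangle_j=G_j(v,w)-i\,\Omega(v,w)$. Let $\mathcal H$ be the Fock space of holomorphic functions $f$ on $(V,j)$ with $\|f\|^2=h^{-n}\int_V|f(z)|^2e^{-|z|_j^2/2\hbar}\,dz<\infty$, where $\dim V=2n$ and $dz$ is the Lebesgue measure of $G_j$; let $(U_j(v,t)f)(z)=e^{-it/\hbar+\langle z,v\rangle_j/2\hbar-|v|_j^2/4\hbar}f(z-v)$ and $e_v(z)=e^{\langle z,v\rangle_j/2\hbar}$. The group $Mp^c(V,\Omega,j)$ consists of the pairs $(U,g)$ with $U$ unitary on $\mathcal H$, $g\in Sp(V,\Omega)$ and $U_j(gv,t)=U\,U_j(v,t)\,U^{-1}$ for all $(v,t)\in V\times\mathbb R$, with diagonal multiplication; $\sigma(U,g)=g$. For a real linear map $g$ on a space with complex structure $j$ write $C_g=\frac12(g-jgj)$ and $Z_g=C_g^{-1}\cdot\frac12(g+jgj)$.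 The pair $(g,\lambda)$ is called the parameters of $(U,g)$ if $|\lambda^2\mathrm{Det}_jC_g|=1$ and $$(Ue_v)(z)=\lambda\exp\tfrac1{4\hbar}\{2\langle C_g^{-1}z,v\rangle_j-\langle z,Z_{g^{-1}}z\rangle_j-\langle Z_gv,v\rangle_j\}\qquad(z,v\in V);$$ then $\lambda=(Ue_0)(0)$, and $Mp^c(V,\Omega,j)$ is a Lie group with the smooth structure given by $(U,g)\mapsto(g,\lambda)\in Sp(V,\Omega)\times\mathbb C$. A lift of a Lie subgroup $H\subseteq Sp(V,\Omega)$ is a smooth homomorphism $\Phi:H\to Mp^c(V,\Omega,j)$ with $\sigma\circ\Phi=\mathrm{Id}_H$. Let $F\subset V^{\mathbb C}$ be a complex Lagrangian subspace (equal to its own orthogonal for the complex bilinear extension of $\Omega$), $Sp(V,\Omega,F)=\{g\in Sp(V,\Omega): g(F)\subset F\}$, $D=F\cap V$, $D^\perp$ its $\Omega$-orthogonal and $V'=D^\perp/D$. Let $\tilde\jmath'$ be the complex structure on $V'$ whose complex linear extension is multiplication by $i$ on $F/D^{\mathbb C}$. Let $Q=(D+jD)^\perp$, which is $j$-stable and isomorphic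 to $V'$ by the quotient map, let $\jmath'$ be the complex structure on $V'$ (and on $Q$) induced by $j$ on $Q$, and assume that $\jmath'$ commutes with $\tilde\jmath'$. For $g\in Sp(V,\Omega,F)$ let $a=g|_D$, let $b$ be the map induced by $g$ on $V'\cong Q$, and define linear maps $e:D\to Q$ and $s:D\to D$ by $$g(jv)=a\left(s-\tfrac12e^*e\right)v+j(a^T)^{-1}v+b\,e\,v\qquad(v\in D),$$ where $a^T$ is the $G_j$-transpose and $e^*:Q\to D$ is given by $G_j(e^*w,v)=\Omega(w,ev)$. Let $Z'$ be $Z_b$ taken with respect to $\jmath'$, and let $C'^-_b$ be the restriction of $C_b=\frac12(b-\jmath'b\jmath')$ to $\{v\in V':\tilde\jmath'v=-\jmath'v\}$. Let $$M(g)=\tfrac12\left(1+(a^Ta)^{-1}-is\right)-\tfrac14e^*\jmath'e-\tfrac i4e^*Z'e-\tfrac14e^*\jmath'Z'e\in\mathrm{End}(D^{\mathbb C}),$$ and $\delta_D(g)=e^{\frac12\alpha(M(g))}$, where $\alpha$ is the smooth branch, with $\alpha(1)=0$, of $\log\mathrm{Det}$ on the endomorphisms of $D^{\mathbb C}$ with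 positive definite real part. Put $$f_F(g)=\left[\,|\mathrm{Det}_D\,a|^{1/2}\;\mathrm{Det}_{\jmath'}(C'^-_b)\;\delta_D(g)\right]^{-1}.$$ Then for every $g\in Sp(V,\Omega,F)$ the pair $(g,f_F(g))$ is the parameters of an element $F_F(g)$ of $Mp^c(V,\Omega,j)$, and $F_F:Sp(V,\Omega,F)\to Mp^c(V,\Omega,j)$ is a lift of $Sp(V,\Omega,F)$. -/

import Mathlib

namespace SymplecticLift

open scoped TensorProduct ContDiff
open MeasureTheory

noncomputable section

set_option linter.unusedSectionVars false

/-! ### Complex structures on real vector spaces -/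

/-- A complex structure on a real vector space: a linear map `J` with `J² = -1`. -/
structure ComplexStructure (W : Type*) [AddCommGroup W] [Module ℝ W] where
  J : Module.End ℝ W
  sq : ∀ w, J (J w) = -w

section CxSpace

variable {W : Type*} [AddCommGroup W] [Module ℝ W]

/-- The complex vector space `(W, J)`: the same additive group, with `(x + iy) w = x w + y J w`. -/
def CxSpace (_c : ComplexStructure W) : Type _ := W

instance (c : ComplexStructure W) : AddCommGroup (CxSpace c) := inferInstanceAs (AddCommGroup W)

/-- The identity map `W → (W, J)`. -/
def CxSpace.of (c : ComplexStructure W) (w : W) : CxSpace c := w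

/-- The identity map `(W, J) → W`. -/
def CxSpace.val {c : ComplexStructure W} (w : CxSpace c) : W := w

instance (c : ComplexStructure W) : Module ℂ (CxSpace c) where
  smul z w := CxSpace.of c (z.re • w.val + z.im • c.J w.val)
  one_smul w := by
    change (1 : ℂ).re • w.val + (1 : ℂ).im • c.J w.val = w.val
    simp
  mul_smul x y w := by
    change (x * y).re • w.val + (x * y).im • c.J w.val
      = x.re • (y.re • w.val + y.im • c.J w.val)
        + x.im • c.J (y.re • w.val + y.im • c.J w.val)
    simp only [Complex.mul_re, Complex.mul_im, map_add, map_smul, c.sq]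
    module
  smul_zero x := by
    change x.re • (0 : W) + x.im • c.J (0 : W) = 0
    simp
  smul_add x v w := by
    change x.re • (v.val + w.val) + x.im • c.J (v.val + w.val)
      = (x.re • v.val + x.im • c.J v.val) + (x.re • w.val + x.im • c.J w.val)
    simp only [map_add]
    module
  add_smul x y w := by
    change (x + y).re • w.val + (x + y).im • c.J w.val
      = (x.re • w.val + x.im • c.J w.val) + (y.re • w.val + y.im • c.J w.val)
    simp only [Complex.add_re, Complex.add_im]
    module
  zero_smul w := by
    change (0 : ℂ).re • w.val + (0 : ℂ).im • c.J w.val = 0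
    simp

theorem CxSpace.smul_def (c : ComplexStructure W) (z : ℂ) (w : CxSpace c) :
    z • w = CxSpace.of c (z.re • w.val + z.im • c.J w.val) := rfl

/-- The `J`-linear part `C_g = ½ (g - J g J)` of a real linear map `g`. -/
def linearPart (c : ComplexStructure W) (g : Module.End ℝ W) : Module.End ℝ W :=
  (1 / 2 : ℝ) • (g - c.J * g * c.J)

/-- The `J`-antilinear part `D_g = ½ (g + J g J)` of a real linear map `g`. -/
def antilinearPart (c : ComplexStructure W) (g : Module.End ℝ W) : Module.End ℝ W :=
  (1 / 2 : ℝ) • (g + c.J * g * c.J)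

/-- `Z_g = C_g⁻¹ D_g` (used only when `C_g` is invertible). -/
def zPart (c : ComplexStructure W) (g : Module.End ℝ W) : Module.End ℝ W :=
  Ring.inverse (linearPart c g) * antilinearPart c g

theorem linearPart_J (c : ComplexStructure W) (g : Module.End ℝ W) (w : W) :
    linearPart c g (c.J w) = c.J (linearPart c g w) := by
  simp only [linearPart, LinearMap.smul_apply, LinearMap.sub_apply, Module.End.mul_apply, c.sq,
    map_smul, map_sub, map_neg]
  module

/-- `C_g` as a complex linear endomorphism of `(W, J)`. -/
def linearPartCx (c : ComplexStructure W) (g : Module.End ℝ W) : CxSpace c →ₗ[ℂ] CxSpace c where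
  toFun w := CxSpace.of c (linearPart c g w.val)
  map_add' v w := (linearPart c g).map_add v.val w.val
  map_smul' z w := by
    change linearPart c g (z.re • w.val + z.im • c.J w.val)
      = z.re • linearPart c g w.val + z.im • c.J (linearPart c g w.val)
    rw [map_add, map_smul, map_smul, linearPart_J]

/-- `Det_J C_g`, the complex determinant of the `J`-linear part of `g`. -/
def detLinearPart (c : ComplexStructure W) (g : Module.End ℝ W) : ℂ :=
  LinearMap.det (linearPartCx c g)

/-- For a second endomorphism `K` commuting with `J`, the complex subspace `{v | K v = -J v}` of
`(W, J)`. -/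
def minusSpace (c : ComplexStructure W) (K : Module.End ℝ W) (hK : Commute c.J K) :
    Submodule ℂ (CxSpace c) where
  carrier := {w | K w.val = -c.J w.val}
  add_mem' {v w} hv hw := by
    change K (v.val + w.val) = -c.J (v.val + w.val)
    have hv : K v.val = -c.J v.val := hv
    have hw : K w.val = -c.J w.val := hw
    rw [map_add, map_add, hv, hw]
    abel
  zero_mem' := by
    change K (0 : W) = -c.J (0 : W)
    simp
  smul_mem' z w hw := by
    change K (z.re • w.val + z.im • c.J w.val) = -c.J (z.re • w.val + z.im • c.J w.val)
    have hw : K w.val = -c.J w.val := hw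
    have h : K (c.J w.val) = c.J (K w.val) := (LinearMap.congr_fun hK w.val).symm
    simp only [map_add, map_smul, h, hw, map_neg]
    module

theorem linearPartCx_mem_minusSpace (c : ComplexStructure W) (K : Module.End ℝ W)
    (hK : Commute c.J K) (g : Module.End ℝ W) (hg : Commute g K) :
    ∀ w ∈ minusSpace c K hK, linearPartCx c g w ∈ minusSpace c K hK := by
  intro w hw
  have hw : K w.val = -c.J w.val := hw
  change K (linearPart c g w.val) = -c.J (linearPart c g w.val)
  have h1 : ∀ x, K (c.J x) = c.J (K x) := fun x => (LinearMap.congr_fun hK x).symm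
  have h2 : ∀ x, K (g x) = g (K x) := fun x => (LinearMap.congr_fun hg x).symm
  have : K (linearPart c g w.val) = linearPart c g (K w.val) := by
    simp only [linearPart, LinearMap.smul_apply, LinearMap.sub_apply, Module.End.mul_apply,
      map_smul, map_sub, h1, h2]
  rw [this, hw, map_neg, linearPart_J]

end CxSpace

/-! ### Symplectic vector spaces and positive compatible complex structures -/

/-- A symplectic form on a real vector space. -/
structure SymplecticForm (V : Type*) [AddCommGroup V] [Module ℝ V] where
  form : LinearMap.BilinForm ℝ V
  alt : form.IsAlt
  nondegenerate : form.Nondegenerate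

section Symplectic

variable {V : Type*} [AddCommGroup V] [Module ℝ V]

theorem SymplecticForm.neg (Ω : SymplecticForm V) (v w : V) : Ω.form v w = -Ω.form w v :=
  (LinearMap.IsAlt.neg Ω.alt w v).symm

/-- The symplectic group `Sp(V, Ω)`. -/
def Sp (Ω : SymplecticForm V) : Subgroup (V ≃ₗ[ℝ] V) where
  carrier := {g | ∀ v w, Ω.form (g v) (g w) = Ω.form v w}
  mul_mem' {g h} hg hh v w := by
    change Ω.form (g (h v)) (g (h w)) = _
    rw [hg, hh]
  one_mem' _ _ := rfl
  inv_mem' {g} hg v w := by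
    have h := hg (g.symm v) (g.symm w)
    rw [LinearEquiv.apply_symm_apply, LinearEquiv.apply_symm_apply] at h
    exact h.symm

/-- A positive compatible complex structure on `(V, Ω)`. -/
structure PCCS (Ω : SymplecticForm V) extends ComplexStructure V where
  compat : ∀ v w, Ω.form (J v) (J w) = Ω.form v w
  pos : ∀ v, v ≠ 0 → 0 < Ω.form v (J v)

variable {Ω : SymplecticForm V}

/-- The inner product `G_j(v, w) = Ω(v, j w)`. -/
def PCCS.G (j : PCCS Ω) : LinearMap.BilinForm ℝ V := Ω.form.compRight j.J

theorem PCCS.G_apply (j : PCCS Ω) (v w : V) : j.G v w = Ω.form v (j.J w) := rfl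

theorem PCCS.G_comm (j : PCCS Ω) (v w : V) : j.G v w = j.G w v := by
  rw [j.G_apply, j.G_apply, ← j.compat v (j.J w), j.sq, map_neg, Ω.neg]
  simp

theorem PCCS.G_pos (j : PCCS Ω) (v : V) (hv : v ≠ 0) : 0 < j.G v v := j.pos v hv

theorem PCCS.G_nonneg (j : PCCS Ω) (v : V) : 0 ≤ j.G v v := by
  by_cases hv : v = 0
  · simp [hv]
  · exact (j.G_pos v hv).le

theorem PCCS.eq_zero (j : PCCS Ω) {v : V} (h : j.G v v = 0) : v = 0 := by
  by_contra hv
  exact (j.G_pos v hv).ne' h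

/-- The Hermitian form `⟨v, w⟩_j = Ω(v, j w) - i Ω(v, w)`, complex linear in `v`. -/
def PCCS.herm (j : PCCS Ω) (v w : V) : ℂ := (j.G v w : ℂ) - Complex.I * (Ω.form v w : ℂ)

theorem PCCS.disjoint_orthogonal (j : PCCS Ω) (D : Submodule ℝ V) :
    Disjoint D (j.G.orthogonal D) := by
  rw [Submodule.disjoint_def]
  intro x hx hx'
  exact j.eq_zero (hx' x hx)

theorem PCCS.isRefl (j : PCCS Ω) : j.G.IsRefl := fun x y h => by rw [j.G_comm, h]

theorem PCCS.G_restrict_nondegenerate (j : PCCS Ω) (D : Submodule ℝ V) :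
    (j.G.restrict D).Nondegenerate :=
  j.G.nondegenerate_restrict_of_disjoint_orthogonal j.isRefl (j.disjoint_orthogonal D)

variable [FiniteDimensional ℝ V]

theorem PCCS.isCompl_orthogonal (j : PCCS Ω) (D : Submodule ℝ V) :
    IsCompl D (j.G.orthogonal D) :=
  LinearMap.BilinForm.isCompl_orthogonal_of_restrict_nondegenerate j.isRefl
    (j.G_restrict_nondegenerate D)

/-- The `G_j`-orthogonal projection of `V` onto a subspace. -/
def PCCS.proj (j : PCCS Ω) (D : Submodule ℝ V) : V →ₗ[ℝ] D :=
  D.projectionOnto (j.G.orthogonal D) (j.isCompl_orthogonal D)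

theorem PCCS.sub_proj_mem (j : PCCS Ω) (D : Submodule ℝ V) (v d : V) (hd : d ∈ D) :
    j.G d (v - j.proj D v) = 0 := by
  have h : v - j.proj D v ∈ j.G.orthogonal D := by
    rw [← Submodule.projectionOnto_apply_eq_zero_iff (j.isCompl_orthogonal D), map_sub]
    change j.proj D v - j.proj D (j.proj D v : V) = 0
    rw [sub_eq_zero]
    exact (Submodule.projectionOnto_apply_left (j.isCompl_orthogonal D) (j.proj D v)).symm
  exact h d hd

/-- The transpose relative to `G_j` of an endomorphism of a subspace `D`. -/
def PCCS.transpose (j : PCCS Ω) (D : Submodule ℝ V) (a : Module.End ℝ D) : Module.End ℝ D :=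
  (j.G.restrict D).leftAdjointOfNondegenerate (j.G_restrict_nondegenerate D) a

/-- For `e : D → Q` linear, the linear map `e* : Q → D` with `G_j(e* w, v) = Ω(w, e v)`. -/
def PCCS.mixedTranspose (j : PCCS Ω) (D Q : Submodule ℝ V) (e : D →ₗ[ℝ] Q) : Q →ₗ[ℝ] D :=
  ((j.G.restrict D).toDual (j.G_restrict_nondegenerate D)).symm.toLinearMap ∘ₗ
    (Ω.form.domRestrict₁₂ Q Q).compl₂ e

theorem PCCS.G_mixedTranspose (j : PCCS Ω) (D Q : Submodule ℝ V) (e : D →ₗ[ℝ] Q) (w : Q) (v : D) :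
    j.G (j.mixedTranspose D Q e w) v = Ω.form w (e v) :=
  LinearMap.BilinForm.apply_toDual_symm_apply (B := j.G.restrict D)
    (hB := j.G_restrict_nondegenerate D) _ v

end Symplectic

/-! ### Complex Lagrangian subspaces and their stabilisers -/

section Complexification

variable {W : Type*} [AddCommGroup W] [Module ℝ W]

/-- The real part `ℂ ⊗ W → W`. -/
def reTensor : ℂ ⊗[ℝ] W →ₗ[ℝ] W :=
  (TensorProduct.lid ℝ W).toLinearMap ∘ₗ Complex.reLm.rTensor W

theorem reTensor_tmul (z : ℂ) (w : W) : reTensor (z ⊗ₜ[ℝ] w) = z.re • w := by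
  simp [reTensor]

theorem reTensor_real (x y : W) :
    reTensor ((1 : ℂ) ⊗ₜ[ℝ] x + Complex.I ⊗ₜ[ℝ] y) = x := by
  rw [map_add, reTensor_tmul, reTensor_tmul]
  simp

theorem smul_I_tmul (x y : W) :
    Complex.I • ((1 : ℂ) ⊗ₜ[ℝ] x + Complex.I ⊗ₜ[ℝ] y)
      = (1 : ℂ) ⊗ₜ[ℝ] (-y) + Complex.I ⊗ₜ[ℝ] x := by
  rw [smul_add, TensorProduct.smul_tmul', TensorProduct.smul_tmul', smul_eq_mul, smul_eq_mul,
    Complex.I_mul_I, mul_one, TensorProduct.neg_tmul, TensorProduct.tmul_neg, add_comm]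

theorem tmul_injective {x y x' y' : W}
    (h : (1 : ℂ) ⊗ₜ[ℝ] x + Complex.I ⊗ₜ[ℝ] y = (1 : ℂ) ⊗ₜ[ℝ] x' + Complex.I ⊗ₜ[ℝ] y') :
    x = x' ∧ y = y' := by
  refine ⟨by simpa only [reTensor_real] using congrArg reTensor h, ?_⟩
  have h2 := congrArg (fun t => reTensor (Complex.I • t)) h
  simp only [smul_I_tmul, reTensor_real] at h2
  exact neg_injective h2

theorem exists_tmul (t : ℂ ⊗[ℝ] W) :
    ∃ x y : W, t = (1 : ℂ) ⊗ₜ[ℝ] x + Complex.I ⊗ₜ[ℝ] y := by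
  induction t using TensorProduct.induction_on with
  | zero => exact ⟨0, 0, by simp⟩
  | tmul z w =>
    refine ⟨z.re • w, z.im • w, ?_⟩
    rw [← TensorProduct.smul_tmul, ← TensorProduct.smul_tmul, ← TensorProduct.add_tmul]
    congr 1
    apply Complex.ext <;> simp
  | add s t hs ht =>
    obtain ⟨x, y, rfl⟩ := hs
    obtain ⟨x', y', rfl⟩ := ht
    refine ⟨x + x', y + y', ?_⟩
    rw [TensorProduct.tmul_add, TensorProduct.tmul_add]
    abel

end Complexification

/-- A complex Lagrangian subspace: a complex subspace of `V^ℂ = ℂ ⊗ V` equal to its own orthogonal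
for the complex bilinear extension of `Ω`. -/
structure ComplexLagrangian {V : Type*} [AddCommGroup V] [Module ℝ V] (Ω : SymplecticForm V) where
  space : Submodule ℂ (ℂ ⊗[ℝ] V)
  lagrangian : (Ω.form.baseChange ℂ).orthogonal space = space

namespace ComplexLagrangian

variable {V : Type*} [AddCommGroup V] [Module ℝ V] {Ω : SymplecticForm V}

/-- `D = F ∩ V`. -/
def realPart (F : ComplexLagrangian Ω) : Submodule ℝ V :=
  (F.space.restrictScalars ℝ).comap (TensorProduct.mk ℝ ℂ V 1)

/-- `D^⊥`, the `Ω`-orthogonal of `D = F ∩ V`. -/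
def perp (F : ComplexLagrangian Ω) : Submodule ℝ V := Ω.form.orthogonal F.realPart

/-- `D` as a subspace of `D^⊥`. -/
def realPartInPerp (F : ComplexLagrangian Ω) : Submodule ℝ F.perp := F.realPart.submoduleOf F.perp

/-- The symplectic quotient `V' = D^⊥ / D`. -/
abbrev Reduced (F : ComplexLagrangian Ω) : Type _ := F.perp ⧸ F.realPartInPerp

/-- The projection `D^⊥ → V'`. -/
def toReduced (F : ComplexLagrangian Ω) : F.perp →ₗ[ℝ] F.Reduced := F.realPartInPerp.mkQ

/-- `F' = F / D^ℂ` as a subspace of `V'^ℂ`: the image of `F ⊆ (D^⊥)^ℂ`. -/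
def reducedSpace (F : ComplexLagrangian Ω) : Submodule ℂ (ℂ ⊗[ℝ] F.Reduced) :=
  (F.space.comap (F.perp.subtype.baseChange ℂ)).map (F.toReduced.baseChange ℂ)

theorem mem_realPart (F : ComplexLagrangian Ω) (x : V) :
    x ∈ F.realPart ↔ (1 : ℂ) ⊗ₜ[ℝ] x ∈ F.space := Iff.rfl

theorem mem_realPart_of_I (F : ComplexLagrangian Ω) {x : V}
    (h : Complex.I ⊗ₜ[ℝ] x ∈ F.space) : x ∈ F.realPart := by
  rw [mem_realPart]
  have h2 := F.space.smul_mem (-Complex.I) h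
  rw [TensorProduct.smul_tmul'] at h2
  simpa using h2

theorem form_eq_zero (F : ComplexLagrangian Ω) {s t : ℂ ⊗[ℝ] V} (hs : s ∈ F.space)
    (ht : t ∈ F.space) : Ω.form.baseChange ℂ s t = 0 := by
  rw [← F.lagrangian] at ht
  exact ht s hs

theorem form_real (x x' y' : V) :
    Ω.form.baseChange ℂ ((1 : ℂ) ⊗ₜ[ℝ] x' + Complex.I ⊗ₜ[ℝ] y') ((1 : ℂ) ⊗ₜ[ℝ] x)
      = (Ω.form x' x : ℂ) + Complex.I * (Ω.form y' x : ℂ) := by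
  rw [map_add, LinearMap.add_apply, LinearMap.BilinForm.baseChange_tmul,
    LinearMap.BilinForm.baseChange_tmul]
  simp [mul_comm]

theorem swap_mem (F : ComplexLagrangian Ω) {x y : V}
    (h : (1 : ℂ) ⊗ₜ[ℝ] x + Complex.I ⊗ₜ[ℝ] y ∈ F.space) :
    (1 : ℂ) ⊗ₜ[ℝ] (-y) + Complex.I ⊗ₜ[ℝ] x ∈ F.space := by
  rw [← smul_I_tmul]
  exact F.space.smul_mem _ h

theorem left_mem_perp (F : ComplexLagrangian Ω) {x y : V}
    (h : (1 : ℂ) ⊗ₜ[ℝ] x + Complex.I ⊗ₜ[ℝ] y ∈ F.space) : x ∈ F.perp := by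
  intro d hd
  have h1 := F.form_eq_zero h ((F.mem_realPart d).1 hd)
  rw [form_real] at h1
  have h2 := congrArg Complex.re h1
  change Ω.form d x = 0
  rw [Ω.neg]
  simpa using h2

theorem right_mem_perp (F : ComplexLagrangian Ω) {x y : V}
    (h : (1 : ℂ) ⊗ₜ[ℝ] x + Complex.I ⊗ₜ[ℝ] y ∈ F.space) : y ∈ F.perp := by
  simpa using F.perp.neg_mem (F.left_mem_perp (F.swap_mem h))

theorem realPart_le_perp (F : ComplexLagrangian Ω) : F.realPart ≤ F.perp := by
  intro x hx
  apply F.left_mem_perp (y := 0)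
  simpa using (F.mem_realPart x).1 hx

/-- The stabiliser `Sp(V, Ω, F)` of `F` in the symplectic group, where `g` acts on `V^ℂ` by its
complex linear extension. -/
def stabilizer [FiniteDimensional ℝ V] (F : ComplexLagrangian Ω) : Subgroup (V ≃ₗ[ℝ] V) where
  carrier := {g | g ∈ Sp Ω ∧ ∀ x ∈ F.space, g.toLinearMap.baseChange ℂ x ∈ F.space}
  mul_mem' {g h} hg hh := by
    refine ⟨mul_mem hg.1 hh.1, fun x hx => ?_⟩
    have : (g * h).toLinearMap = g.toLinearMap ∘ₗ h.toLinearMap := rfl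
    rw [this, LinearMap.baseChange_comp]
    exact hg.2 _ (hh.2 x hx)
  one_mem' := by
    refine ⟨one_mem _, fun x hx => ?_⟩
    have : (1 : V ≃ₗ[ℝ] V).toLinearMap = LinearMap.id := rfl
    rw [this, LinearMap.baseChange_id]
    exact hx
  inv_mem' {g} hg := by
    refine ⟨inv_mem hg.1, fun x hx => ?_⟩
    have hcomp : g.toLinearMap.baseChange ℂ ∘ₗ (g⁻¹).toLinearMap.baseChange ℂ = LinearMap.id := by
      rw [← LinearMap.baseChange_comp]
      have : g.toLinearMap ∘ₗ (g⁻¹).toLinearMap = LinearMap.id := by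
        ext v
        exact g.apply_symm_apply v
      rw [this, LinearMap.baseChange_id]
    have hcomp' : (g⁻¹).toLinearMap.baseChange ℂ ∘ₗ g.toLinearMap.baseChange ℂ = LinearMap.id := by
      rw [← LinearMap.baseChange_comp]
      have : (g⁻¹).toLinearMap ∘ₗ g.toLinearMap = LinearMap.id := by
        ext v
        exact g.symm_apply_apply v
      rw [this, LinearMap.baseChange_id]
    have hinj : Function.Injective (g.toLinearMap.baseChange ℂ) :=
      Function.LeftInverse.injective (LinearMap.congr_fun hcomp')
    have hle : F.space.map (g.toLinearMap.baseChange ℂ) ≤ F.space := by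
      rintro _ ⟨y, hy, rfl⟩
      exact hg.2 y hy
    have heq : F.space.map (g.toLinearMap.baseChange ℂ) = F.space :=
      Submodule.eq_of_le_of_finrank_eq hle
        (LinearEquiv.finrank_eq (Submodule.equivMapOfInjective _ hinj F.space)).symm
    rw [← heq] at hx
    obtain ⟨y, hy, rfl⟩ := hx
    have := LinearMap.congr_fun hcomp' y
    rw [LinearMap.comp_apply, LinearMap.id_apply] at this
    rw [this]
    exact hy

variable [FiniteDimensional ℝ V]

theorem stabilizer_tmul (F : ComplexLagrangian Ω) (g : F.stabilizer) {x y : V}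
    (h : (1 : ℂ) ⊗ₜ[ℝ] x + Complex.I ⊗ₜ[ℝ] y ∈ F.space) :
    (1 : ℂ) ⊗ₜ[ℝ] (g.1 x) + Complex.I ⊗ₜ[ℝ] (g.1 y) ∈ F.space := by
  have := g.2.2 _ h
  rwa [map_add, LinearMap.baseChange_tmul, LinearMap.baseChange_tmul] at this

theorem stabilizer_realPart (F : ComplexLagrangian Ω) (g : F.stabilizer) :
    ∀ x ∈ F.realPart, g.1.toLinearMap x ∈ F.realPart := by
  intro x hx
  have := F.stabilizer_tmul g (x := x) (y := 0) (by simpa using (F.mem_realPart x).1 hx)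
  rw [mem_realPart]
  simpa using this

theorem stabilizer_perp (F : ComplexLagrangian Ω) (g : F.stabilizer) :
    ∀ x ∈ F.perp, g.1.toLinearMap x ∈ F.perp := by
  intro x hx d hd
  have h1 := hx _ (F.stabilizer_realPart g⁻¹ d hd)
  have h2 := g.2.1 (g.1.symm d) x
  rw [LinearEquiv.apply_symm_apply] at h2
  exact h2.trans h1

/-- `a(g) : D → D`, the restriction of `g`. -/
def aMap (F : ComplexLagrangian Ω) (g : F.stabilizer) : Module.End ℝ F.realPart :=
  g.1.toLinearMap.restrict (F.stabilizer_realPart g)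

/-- `b(g) : V' → V'`, the map induced by `g`. -/
def bMap (F : ComplexLagrangian Ω) (g : F.stabilizer) : Module.End ℝ F.Reduced :=
  F.realPartInPerp.mapQ F.realPartInPerp (g.1.toLinearMap.restrict (F.stabilizer_perp g))
    (fun x hx => F.stabilizer_realPart g x.1 hx)

theorem bMap_toReduced (F : ComplexLagrangian Ω) (g : F.stabilizer) (x : F.perp) :
    F.bMap g (F.toReduced x) = F.toReduced ⟨g.1 x, F.stabilizer_perp g x x.2⟩ := rfl

theorem toReduced_eq_zero (F : ComplexLagrangian Ω) (x : F.perp) : F.toReduced x = 0 ↔ (x : V) ∈ F.realPart :=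
  Submodule.Quotient.mk_eq_zero _

/-- Every vector of `D^⊥` is the real part of an element of `F`. -/
theorem exists_partner (F : ComplexLagrangian Ω) {x : V} (hx : x ∈ F.perp) :
    ∃ y, (1 : ℂ) ⊗ₜ[ℝ] x + Complex.I ⊗ₜ[ℝ] y ∈ F.space := by
  set P : Submodule ℝ V := (F.space.restrictScalars ℝ).map reTensor with hP
  have hre : ∀ {x y : V}, (1 : ℂ) ⊗ₜ[ℝ] x + Complex.I ⊗ₜ[ℝ] y ∈ F.space → x ∈ P :=
    fun {x y} h => ⟨_, h, reTensor_real x y⟩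
  have h1 : Ω.form.orthogonal P ≤ F.realPart := by
    intro v hv
    rw [mem_realPart, ← F.lagrangian]
    intro t ht
    obtain ⟨x, y, rfl⟩ := exists_tmul t
    have hx : Ω.form x v = 0 := hv x (hre ht)
    have hy : Ω.form (-y) v = 0 := hv _ (hre (F.swap_mem ht))
    rw [map_neg, LinearMap.neg_apply, neg_eq_zero] at hy
    change Ω.form.baseChange ℂ _ _ = 0
    rw [form_real, hx, hy]
    simp
  have h2 : F.perp ≤ P := by
    have := LinearMap.BilinForm.orthogonal_le (B := Ω.form) h1
    rwa [LinearMap.BilinForm.orthogonal_orthogonal Ω.nondegenerate Ω.alt.isRefl] at this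
  obtain ⟨t, ht, rfl⟩ := h2 hx
  obtain ⟨x, y, rfl⟩ := exists_tmul t
  exact ⟨y, by rw [reTensor_real]; exact ht⟩

/-- There is exactly one complex structure on `V'` whose complex linear extension is multiplication
by `i` on `F'`. -/
theorem existsUnique_reducedStructure (F : ComplexLagrangian Ω) :
    ∃! c : ComplexStructure F.Reduced, ∀ t ∈ F.reducedSpace, c.J.baseChange ℂ t = Complex.I • t := by
  classical
  have hex : ∀ q : F.Reduced, ∃ x y : F.perp, F.toReduced x = q ∧
      (1 : ℂ) ⊗ₜ[ℝ] (x : V) + Complex.I ⊗ₜ[ℝ] (y : V) ∈ F.space := by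
    intro q
    obtain ⟨x, rfl⟩ := Submodule.mkQ_surjective _ q
    obtain ⟨y, hy⟩ := F.exists_partner x.2
    exact ⟨x, ⟨y, F.right_mem_perp hy⟩, rfl, hy⟩
  choose X Y hX hXY using hex
  have key : ∀ x y : F.perp, (1 : ℂ) ⊗ₜ[ℝ] (x : V) + Complex.I ⊗ₜ[ℝ] (y : V) ∈ F.space →
      F.toReduced x = 0 → F.toReduced y = 0 := by
    intro x y h hx
    rw [toReduced_eq_zero] at hx ⊢
    apply F.mem_realPart_of_I
    have := F.space.sub_mem h ((F.mem_realPart _).1 hx)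
    rwa [add_sub_cancel_left] at this
  have spec : ∀ x y : F.perp, (1 : ℂ) ⊗ₜ[ℝ] (x : V) + Complex.I ⊗ₜ[ℝ] (y : V) ∈ F.space →
      F.toReduced (Y (F.toReduced x)) = F.toReduced y := by
    intro x y h
    rw [← sub_eq_zero, ← map_sub]
    apply key (X (F.toReduced x) - x)
    · have := F.space.sub_mem (hXY (F.toReduced x)) h
      simp only [Submodule.coe_sub, TensorProduct.tmul_sub]
      convert this using 1
      abel
    · rw [map_sub, hX, sub_self]
  let J : Module.End ℝ F.Reduced :=
    { toFun := fun q => -F.toReduced (Y q)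
      map_add' := by
        intro p q
        have h := F.space.add_mem (hXY p) (hXY q)
        have h' := spec (X p + X q) (Y p + Y q) (by
          simp only [Submodule.coe_add, TensorProduct.tmul_add]
          convert h using 1
          abel)
        rw [map_add, hX, hX, map_add] at h'
        rw [h', neg_add]
      map_smul' := by
        intro r q
        have h := F.space.smul_mem (r : ℂ) (hXY q)
        have h' := spec (r • X q) (r • Y q) (by
          convert h using 1
          rw [smul_add, TensorProduct.smul_tmul', TensorProduct.smul_tmul', Submodule.coe_smul,
            Submodule.coe_smul, ← TensorProduct.smul_tmul, ← TensorProduct.smul_tmul,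
            smul_eq_mul, smul_eq_mul, Complex.real_smul, Complex.real_smul])
        rw [map_smul, hX, map_smul] at h'
        rw [h', RingHom.id_apply, smul_neg] }
  have specJ : ∀ x y : F.perp, (1 : ℂ) ⊗ₜ[ℝ] (x : V) + Complex.I ⊗ₜ[ℝ] (y : V) ∈ F.space →
      J (F.toReduced x) = -F.toReduced y := fun x y h => congrArg Neg.neg (spec x y h)
  have mem_reduced : ∀ x y : F.perp, (1 : ℂ) ⊗ₜ[ℝ] (x : V) + Complex.I ⊗ₜ[ℝ] (y : V) ∈ F.space →
      (1 : ℂ) ⊗ₜ[ℝ] (F.toReduced x) + Complex.I ⊗ₜ[ℝ] (F.toReduced y) ∈ F.reducedSpace := by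
    intro x y h
    refine ⟨(1 : ℂ) ⊗ₜ[ℝ] x + Complex.I ⊗ₜ[ℝ] y, ?_, ?_⟩
    · simpa using h
    · simp
  refine ⟨⟨J, ?_⟩, ?_, ?_⟩
  · intro q
    have h1 := specJ _ _ (hXY q)
    have h2 := specJ (-Y q) (X q) (F.swap_mem (hXY q))
    rw [hX] at h1 h2
    rw [h1, ← map_neg, h2]
  · rintro _ ⟨t, ht, rfl⟩
    obtain ⟨x, y, rfl⟩ := exists_tmul t
    have ht' : (1 : ℂ) ⊗ₜ[ℝ] (x : V) + Complex.I ⊗ₜ[ℝ] (y : V) ∈ F.space := by simpa using ht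
    have h1 := specJ _ _ ht'
    have h2 := specJ (-y) x (F.swap_mem ht')
    rw [map_neg, map_neg, neg_inj] at h2
    simp only [map_add, LinearMap.baseChange_tmul]
    rw [smul_I_tmul, h1, h2]
  · intro c hc
    have : c.J = J := by
      refine LinearMap.ext fun q => ?_
      have h := hc _ (mem_reduced _ _ (hXY q))
      rw [smul_I_tmul, map_add, LinearMap.baseChange_tmul, LinearMap.baseChange_tmul, hX] at h
      exact (tmul_injective h).1
    cases c
    congr

/-- The complex structure `j̃'` on `V'` determined by `F`: its complex linear extension is
multiplication by `i` on `F'`. -/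
def reducedStructure (F : ComplexLagrangian Ω) : ComplexStructure F.Reduced :=
  F.existsUnique_reducedStructure.choose

theorem reducedStructure_spec (F : ComplexLagrangian Ω) :
    ∀ t ∈ F.reducedSpace, F.reducedStructure.J.baseChange ℂ t = Complex.I • t :=
  F.existsUnique_reducedStructure.choose_spec.1

theorem reducedStructure_mk (F : ComplexLagrangian Ω) (x y : F.perp)
    (h : (1 : ℂ) ⊗ₜ[ℝ] (x : V) + Complex.I ⊗ₜ[ℝ] (y : V) ∈ F.space) :
    F.reducedStructure.J (F.toReduced x) = -F.toReduced y := by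
  have hmem : (1 : ℂ) ⊗ₜ[ℝ] (F.toReduced x) + Complex.I ⊗ₜ[ℝ] (F.toReduced y) ∈ F.reducedSpace := by
    refine ⟨(1 : ℂ) ⊗ₜ[ℝ] x + Complex.I ⊗ₜ[ℝ] y, ?_, ?_⟩
    · simpa using h
    · simp
  have h := F.reducedStructure_spec _ hmem
  rw [smul_I_tmul, map_add, LinearMap.baseChange_tmul, LinearMap.baseChange_tmul] at h
  exact (tmul_injective h).1

theorem bMap_commute (F : ComplexLagrangian Ω) (g : F.stabilizer) :
    Commute (F.bMap g) F.reducedStructure.J := by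
  refine LinearMap.ext fun q => ?_
  obtain ⟨x, rfl⟩ := Submodule.mkQ_surjective _ q
  obtain ⟨y, hy⟩ := F.exists_partner x.2
  have hyp := F.right_mem_perp hy
  have h1 := F.reducedStructure_mk x ⟨y, hyp⟩ hy
  have h2 := F.reducedStructure_mk ⟨g.1 x, F.stabilizer_perp g x x.2⟩
    ⟨g.1 y, F.stabilizer_perp g y hyp⟩ (F.stabilizer_tmul g hy)
  change F.bMap g (F.reducedStructure.J (F.toReduced x)) = F.reducedStructure.J (F.bMap g (F.toReduced x))
  rw [h1, bMap_toReduced, h2, map_neg, bMap_toReduced]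

/-! ### The decomposition `V = D ⊕ jD ⊕ Q` -/

/-- `Q = (D + jD)^⊥`. -/
def complement (F : ComplexLagrangian Ω) (j : PCCS Ω) : Submodule ℝ V :=
  Ω.form.orthogonal (F.realPart ⊔ F.realPart.map j.J)

theorem mem_complement (F : ComplexLagrangian Ω) (j : PCCS Ω) (q : V) :
    q ∈ F.complement j ↔
      (∀ d ∈ F.realPart, Ω.form d q = 0) ∧ ∀ d ∈ F.realPart, Ω.form (j.J d) q = 0 := by
  constructor
  · intro h
    exact ⟨fun d hd => h d (Submodule.mem_sup_left hd),
      fun d hd => h _ (Submodule.mem_sup_right ⟨d, hd, rfl⟩)⟩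
  · rintro ⟨h1, h2⟩ x hx
    obtain ⟨y, hy, _, ⟨z, hz, rfl⟩, rfl⟩ := Submodule.mem_sup.1 hx
    change Ω.form (y + j.J z) q = 0
    rw [map_add, LinearMap.add_apply, h1 y hy, h2 z hz, add_zero]

theorem complement_le_perp (F : ComplexLagrangian Ω) (j : PCCS Ω) : F.complement j ≤ F.perp :=
  LinearMap.BilinForm.orthogonal_le le_sup_left

theorem J_mem_complement (F : ComplexLagrangian Ω) (j : PCCS Ω) :
    ∀ q ∈ F.complement j, j.J q ∈ F.complement j := by
  intro q hq
  rw [mem_complement] at hq ⊢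
  refine ⟨fun d hd => ?_, fun d hd => ?_⟩
  · rw [← j.compat, j.sq, map_neg, hq.2 d hd, neg_zero]
  · rw [j.compat, hq.1 d hd]

/-- The isomorphism `Q → D^⊥ / D` induced by the inclusion `Q ⊆ D^⊥`. -/
def complementEquiv (F : ComplexLagrangian Ω) (j : PCCS Ω) : F.complement j ≃ₗ[ℝ] F.Reduced :=
  LinearEquiv.ofBijective (F.toReduced ∘ₗ Submodule.inclusion (F.complement_le_perp j)) <| by
    constructor
    · rw [← LinearMap.ker_eq_bot, Submodule.eq_bot_iff]
      intro q hq
      have hD : (q : V) ∈ F.realPart := (F.toReduced_eq_zero _).1 hq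
      have h := ((F.mem_complement j _).1 q.2).2 _ hD
      apply Subtype.ext
      apply j.eq_zero
      rw [j.G_apply, Ω.neg, h, neg_zero]
    · intro p
      obtain ⟨x, rfl⟩ := Submodule.mkQ_surjective _ p
      have hd := (j.proj F.realPart x).2
      have hq : (x : V) - j.proj F.realPart x ∈ F.complement j := by
        rw [mem_complement]
        refine ⟨fun d hd' => ?_, fun d hd' => ?_⟩
        · exact F.perp.sub_mem x.2 (F.realPart_le_perp hd) d hd'
        · have h := j.sub_proj_mem F.realPart x d hd'
          rw [j.G_comm, j.G_apply] at h
          rw [Ω.neg, h, neg_zero]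
      refine ⟨⟨_, hq⟩, ?_⟩
      change F.toReduced _ = F.toReduced x
      rw [← sub_eq_zero, ← map_sub, toReduced_eq_zero]
      simp

/-- The complex structure `j'` on `V' = D^⊥ / D` induced by `j` on `Q`. -/
def inducedStructure (F : ComplexLagrangian Ω) (j : PCCS Ω) : ComplexStructure F.Reduced where
  J := (F.complementEquiv j).conj (j.J.restrict (F.J_mem_complement j))
  sq := by
    intro w
    simp only [LinearEquiv.conj_apply_apply, LinearEquiv.symm_apply_apply]
    have : ∀ q : F.complement j, j.J.restrict (F.J_mem_complement j)
        (j.J.restrict (F.J_mem_complement j) q) = -q := fun q => Subtype.ext (j.sq q)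
    rw [this, map_neg, LinearEquiv.apply_symm_apply]

/-- An endomorphism of `V' = D^⊥ / D` transported to `Q`. -/
def onComplement (F : ComplexLagrangian Ω) (j : PCCS Ω) (x : Module.End ℝ F.Reduced) :
    Module.End ℝ (F.complement j) :=
  (F.complementEquiv j).symm.conj x

/-! The components of `g` relative to `V = D ⊕ jD ⊕ Q` are determined by
`g (j v) = a (s - ½ e* e) v + j (aᵀ)⁻¹ v + b e v` for `v ∈ D`. -/

/-- `e(g) : D → Q`, determined by: `b(g) e(g) v` is the `Q`-component of `g (j v)`. -/
def eMap (F : ComplexLagrangian Ω) (j : PCCS Ω) (g : F.stabilizer) :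
    F.realPart →ₗ[ℝ] F.complement j :=
  F.onComplement j (F.bMap g⁻¹) ∘ₗ j.proj (F.complement j) ∘ₗ g.1.toLinearMap ∘ₗ j.J ∘ₗ
    F.realPart.subtype

/-- `e(g)* : Q → D`. -/
def eStar (F : ComplexLagrangian Ω) (j : PCCS Ω) (g : F.stabilizer) :
    F.complement j →ₗ[ℝ] F.realPart :=
  j.mixedTranspose F.realPart (F.complement j) (F.eMap j g)

/-- `s(g) : D → D`, determined by: `a(g) (s(g) - ½ e(g)* e(g)) v` is the `D`-component of
`g (j v)`. -/
def sMap (F : ComplexLagrangian Ω) (j : PCCS Ω) (g : F.stabilizer) : Module.End ℝ F.realPart :=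
  F.aMap g⁻¹ * (j.proj F.realPart ∘ₗ g.1.toLinearMap ∘ₗ j.J ∘ₗ F.realPart.subtype)
    + (1 / 2 : ℝ) • (F.eStar j g ∘ₗ F.eMap j g)

/-- `Z'_{b(g)}`, relative to `j'`, transported to `Q`. -/
def zReduced (F : ComplexLagrangian Ω) (j : PCCS Ω) (g : F.stabilizer) :
    Module.End ℝ (F.complement j) :=
  F.onComplement j (zPart (F.inducedStructure j) (F.bMap g))

/-- `j'` on `Q`. -/
def jComplement (F : ComplexLagrangian Ω) (j : PCCS Ω) : Module.End ℝ (F.complement j) :=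
  j.J.restrict (F.J_mem_complement j)

/-- The endomorphism
`½ (1 + (aᵀ a)⁻¹ - i s) - ¼ e* j' e - (i/4) e* Z' e - ¼ e* j' Z' e`
of `D^ℂ`, where `a = a(g)`, `s = s(g)`, `e = e(g)`, `Z' = Z'_{b(g)}`. -/
def deltaArg (F : ComplexLagrangian Ω) (j : PCCS Ω) (g : F.stabilizer) :
    Module.End ℂ (ℂ ⊗[ℝ] F.realPart) :=
  (1 / 2 : ℂ) • (1
      + (Ring.inverse (j.transpose F.realPart (F.aMap g) * F.aMap g)).baseChange ℂ
      - Complex.I • (F.sMap j g).baseChange ℂ)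
    - (1 / 4 : ℂ) • (F.eStar j g ∘ₗ F.jComplement j ∘ₗ F.eMap j g).baseChange ℂ
    - (Complex.I / 4) • (F.eStar j g ∘ₗ F.zReduced j g ∘ₗ F.eMap j g).baseChange ℂ
    - (1 / 4 : ℂ) •
      (F.eStar j g ∘ₗ F.jComplement j ∘ₗ F.zReduced j g ∘ₗ F.eMap j g).baseChange ℂ

end ComplexLagrangian

/-! ### The logarithm of the determinant -/

section LogDet

variable {E : Type*} [AddCommGroup E] [Module ℂ E]

/-- The determinant along the segment from `1` to `A`. -/
def segmentDet (A : Module.End ℂ E) (t : ℝ) : ℂ := LinearMap.det (1 + (t : ℂ) • (A - 1))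

/-- The branch `a(A)` of `log Det A` with `a(1) = 0`: the integral of `d log Det` along the segment
from `1` to `A`. On the convex set of all `A` with positive definite real part this is the unique
smooth function with `Det A = exp (a A)` and `a 1 = 0`. -/
def logDet (A : Module.End ℂ E) : ℂ := ∫ t in (0 : ℝ)..1, logDeriv (segmentDet A) t

theorem logDet_one : logDet (1 : Module.End ℂ E) = 0 := by
  have h : segmentDet (1 : Module.End ℂ E) = fun _ => 1 := by
    funext t
    simp [segmentDet]
  simp [logDet, h]

theorem contDiff_segmentDet [FiniteDimensional ℂ E] (A : Module.End ℂ E) :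
    ContDiff ℝ 1 (segmentDet A) := by
  have h : segmentDet A = fun t : ℝ =>
      (1 + (t : ℂ) • (LinearMap.toMatrix (Module.finBasis ℂ E) (Module.finBasis ℂ E) (A - 1))).det := by
    funext t
    rw [segmentDet, ← LinearMap.det_toMatrix (Module.finBasis ℂ E), map_add, map_smul,
      LinearMap.toMatrix_one]
  rw [h]
  simp only [Matrix.det_apply]
  refine ContDiff.sum fun σ _ => ContDiff.const_smul _ (contDiff_prod fun i _ => ?_)
  simp only [Matrix.add_apply, Matrix.smul_apply, smul_eq_mul]
  exact contDiff_const.add (Complex.ofRealCLM.contDiff.mul contDiff_const)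

theorem exp_logDet [FiniteDimensional ℂ E] (A : Module.End ℂ E)
    (hA : ∀ t ∈ Set.Icc (0 : ℝ) 1, segmentDet A t ≠ 0) :
    Complex.exp (logDet A) = LinearMap.det A := by
  have hp := contDiff_segmentDet A
  have hd : Continuous (deriv (segmentDet A)) := hp.continuous_deriv le_rfl
  have hdef : logDeriv (segmentDet A) = fun t => deriv (segmentDet A) t / segmentDet A t := rfl
  have hcont : ∀ t ∈ Set.Icc (0 : ℝ) 1, ContinuousAt (logDeriv (segmentDet A)) t := by
    intro t ht
    rw [hdef]
    exact hd.continuousAt.div hp.continuous.continuousAt (hA t ht)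
  have hmeas : StronglyMeasurable (logDeriv (segmentDet A)) := by
    rw [hdef]
    exact (hd.measurable.div hp.continuous.measurable).stronglyMeasurable
  have hL : ∀ t ∈ Set.Icc (0 : ℝ) 1,
      HasDerivAt (fun u : ℝ => ∫ s in (0 : ℝ)..u, logDeriv (segmentDet A) s)
        (logDeriv (segmentDet A) t) t := by
    intro t ht
    refine intervalIntegral.integral_hasDerivAt_right ?_ hmeas.stronglyMeasurableAtFilter
      (hcont t ht)
    apply ContinuousOn.intervalIntegrable
    intro s hs
    rw [Set.uIcc_of_le ht.1] at hs
    exact (hcont s ⟨hs.1, hs.2.trans ht.2⟩).continuousWithinAt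
  have hq : ∀ t ∈ Set.Icc (0 : ℝ) 1, HasDerivAt (fun u : ℝ => segmentDet A u *
      Complex.exp (-∫ s in (0 : ℝ)..u, logDeriv (segmentDet A) s)) 0 t := by
    intro t ht
    have h1 : HasDerivAt (segmentDet A) (deriv (segmentDet A) t) t :=
      (hp.differentiable one_ne_zero t).hasDerivAt
    have h2 := h1.mul ((hL t ht).neg.cexp)
    have h3 : deriv (segmentDet A) t * Complex.exp (-∫ s in (0 : ℝ)..t, logDeriv (segmentDet A) s)
        + segmentDet A t * (Complex.exp (-∫ s in (0 : ℝ)..t, logDeriv (segmentDet A) s) *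
          -logDeriv (segmentDet A) t) = 0 := by
      have := hA t ht
      rw [logDeriv_apply]
      field_simp
      ring
    rw [← h3]
    exact h2
  have hc := constant_of_has_deriv_right_zero
    (fun t ht => (hq t ht).continuousAt.continuousWithinAt)
    (fun t ht => (hq t ⟨ht.1, ht.2.le⟩).hasDerivWithinAt) 1 (Set.right_mem_Icc.2 zero_le_one)
  simp only [intervalIntegral.integral_same, neg_zero, Complex.exp_zero, mul_one] at hc
  have h0 : segmentDet A 0 = 1 := by simp [segmentDet]
  have h1 : segmentDet A 1 = LinearMap.det A := by simp [segmentDet]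
  rw [h0, h1, Complex.exp_neg] at hc
  change LinearMap.det A * (Complex.exp (logDet A))⁻¹ = 1 at hc
  rwa [mul_inv_eq_one₀ (Complex.exp_ne_zero _), eq_comm] at hc

end LogDet

namespace ComplexLagrangian

variable {V : Type*} [AddCommGroup V] [Module ℝ V] [FiniteDimensional ℝ V] {Ω : SymplecticForm V}

/-- `δ_D(g) = exp (½ a(M))`, the square root of `Det M` normalised by `δ_D(1) = 1`, where `M` is the
endomorphism `deltaArg`. -/
def delta (F : ComplexLagrangian Ω) (j : PCCS Ω) (g : F.stabilizer) : ℂ :=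
  Complex.exp (logDet (F.deltaArg j g) / 2)

/-- `Det_{j'} C'⁻_{b(g)}`, where `C'⁻_{b(g)}` is the restriction of the `j'`-linear part of `b(g)` to
`{v ∈ V' | j̃' v = -j' v}`. -/
def detMinus (F : ComplexLagrangian Ω) (j : PCCS Ω)
    (hj : Commute (F.inducedStructure j).J F.reducedStructure.J) (g : F.stabilizer) : ℂ :=
  LinearMap.det ((linearPartCx (F.inducedStructure j) (F.bMap g)).restrict
    (linearPartCx_mem_minusSpace (F.inducedStructure j) F.reducedStructure.J hj (F.bMap g)
      (F.bMap_commute g)))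

/-- `f_F(g) = (|Det_D a(g)|^{1/2} Det_{j'}(C'⁻_{b(g)}) δ_D(g))⁻¹`. -/
def liftFunction (F : ComplexLagrangian Ω) (j : PCCS Ω)
    (hj : Commute (F.inducedStructure j).J F.reducedStructure.J) (g : F.stabilizer) : ℂ :=
  ((Real.sqrt |LinearMap.det (F.aMap g)| : ℂ) * F.detMinus j hj g * F.delta j g)⁻¹

end ComplexLagrangian

/-! ### The Fock space -/

section Frame

variable {V : Type*} [AddCommGroup V] [Module ℝ V] [FiniteDimensional ℝ V] {Ω : SymplecticForm V}

theorem PCCS.exists_frame (j : PCCS Ω) :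
    ∃ L : EuclideanSpace ℝ (Fin (Module.finrank ℝ V)) ≃ₗ[ℝ] V,
      ∀ x y, j.G (L x) (L y) = inner ℝ x y := by
  let core : InnerProductSpace.Core ℝ V :=
    { inner := fun v w => j.G v w
      conj_inner_symm := fun v w => by simpa using j.G_comm w v
      re_inner_nonneg := fun v => by simpa using j.G_nonneg v
      add_left := fun u v w => by simp
      smul_left := fun v w r => by simp
      definite := fun v h => j.eq_zero h }
  let : NormedAddCommGroup V := core.toNormedAddCommGroup
  let : InnerProductSpace ℝ V := InnerProductSpace.ofCore core.toCore
  refine ⟨(stdOrthonormalBasis ℝ V).repr.symm.toLinearEquiv, fun x y => ?_⟩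
  exact (stdOrthonormalBasis ℝ V).repr.symm.inner_map_map x y

/-- A linear isometry of Euclidean space onto `(V, G_j)`. -/
def PCCS.frame (j : PCCS Ω) : EuclideanSpace ℝ (Fin (Module.finrank ℝ V)) ≃ₗ[ℝ] V :=
  j.exists_frame.choose

theorem PCCS.G_frame (j : PCCS Ω) (x y : EuclideanSpace ℝ (Fin (Module.finrank ℝ V))) :
    j.G (j.frame x) (j.frame y) = inner ℝ x y := j.exists_frame.choose_spec x y

end Frame

section Fock

variable {V : Type*} [NormedAddCommGroup V] [NormedSpace ℝ V] [FiniteDimensional ℝ V]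
  {Ω : SymplecticForm V}

/-- `f` is holomorphic on `(V, J)`: differentiable with complex linear derivative. -/
def IsHolomorphic (c : ComplexStructure V) (f : V → ℂ) : Prop :=
  Differentiable ℝ f ∧ ∀ z v, fderiv ℝ f z (c.J v) = Complex.I * fderiv ℝ f z v

theorem IsHolomorphic.add {c : ComplexStructure V} {f g : V → ℂ} (hf : IsHolomorphic c f)
    (hg : IsHolomorphic c g) : IsHolomorphic c (f + g) := by
  refine ⟨hf.1.add hg.1, fun z v => ?_⟩
  rw [fderiv_add (hf.1 z) (hg.1 z), add_apply, add_apply,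
    hf.2, hg.2, mul_add]

theorem IsHolomorphic.mul {c : ComplexStructure V} {f g : V → ℂ} (hf : IsHolomorphic c f)
    (hg : IsHolomorphic c g) : IsHolomorphic c (f * g) := by
  refine ⟨hf.1.mul hg.1, fun z v => ?_⟩
  rw [fderiv_mul (hf.1 z) (hg.1 z)]
  simp only [add_apply, smul_apply, smul_eq_mul, hf.2, hg.2]
  ring

theorem IsHolomorphic.const (c : ComplexStructure V) (a : ℂ) : IsHolomorphic c (fun _ => a) :=
  ⟨differentiable_const a, fun z v => by simp⟩

theorem IsHolomorphic.cexp {c : ComplexStructure V} {f : V → ℂ} (hf : IsHolomorphic c f) :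
    IsHolomorphic c (fun z => Complex.exp (f z)) := by
  refine ⟨hf.1.cexp, fun z v => ?_⟩
  rw [((hf.1 z).hasFDerivAt.cexp).fderiv]
  simp only [smul_apply, smul_eq_mul, hf.2]
  ring

theorem IsHolomorphic.comp_sub {c : ComplexStructure V} {f : V → ℂ} (hf : IsHolomorphic c f)
    (v : V) : IsHolomorphic c (fun z => f (z - v)) := by
  refine ⟨hf.1.comp (differentiable_id.sub_const v), fun z w => ?_⟩
  rw [fderiv_comp_sub]
  exact hf.2 _ _

theorem IsHolomorphic.of_linear {c : ComplexStructure V} (l : V →ₗ[ℝ] ℂ)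
    (hl : ∀ v, l (c.J v) = Complex.I * l v) : IsHolomorphic c l := by
  have h : (l : V → ℂ) = LinearMap.toContinuousLinearMap l := rfl
  rw [h]
  refine ⟨ContinuousLinearMap.differentiable _, fun z v => ?_⟩
  rw [ContinuousLinearMap.fderiv]
  exact hl v

/-- `z ↦ ⟨z, v⟩_j` as a real linear map. -/
def PCCS.hermLeft (j : PCCS Ω) (v : V) : V →ₗ[ℝ] ℂ where
  toFun z := j.herm z v
  map_add' x y := by
    simp only [PCCS.herm, map_add, LinearMap.add_apply, Complex.ofReal_add]
    ring
  map_smul' r x := by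
    simp only [PCCS.herm, map_smul, LinearMap.smul_apply, smul_eq_mul, Complex.ofReal_mul,
      Complex.real_smul, RingHom.id_apply]
    ring

theorem PCCS.herm_J (j : PCCS Ω) (z v : V) : j.herm (j.J z) v = Complex.I * j.herm z v := by
  have h1 : j.G (j.J z) v = Ω.form z v := j.compat z v
  have h2 : Ω.form (j.J z) v = -j.G z v := by
    rw [← j.compat (j.J z) v, j.sq, map_neg, LinearMap.neg_apply, j.G_apply]
  rw [PCCS.herm, PCCS.herm, h1, h2]
  push_cast
  linear_combination (Ω.form z v : ℂ) * Complex.I_mul_I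

theorem PCCS.isHolomorphic_herm (j : PCCS Ω) (v : V) :
    IsHolomorphic j.toComplexStructure (fun z => j.herm z v) :=
  IsHolomorphic.of_linear (j.hermLeft v) (fun z => j.herm_J z v)

/-- The Gaussian weight `exp (-|z|_j² / 2ħ)`. -/
def PCCS.weight (j : PCCS Ω) (ħ : ℝ) (z : V) : ℝ := Real.exp (-(j.G z z) / (2 * ħ))

theorem PCCS.continuous_G (j : PCCS Ω) : Continuous fun z => j.G z z := by
  have h : (fun z => j.G z z) = fun z => ‖j.frame.symm z‖ ^ 2 := by
    funext z
    rw [← real_inner_self_eq_norm_sq, ← j.G_frame, LinearEquiv.apply_symm_apply]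
  rw [h]
  exact ((LinearMap.continuous_of_finiteDimensional j.frame.symm.toLinearMap).norm).pow 2

theorem PCCS.continuous_weight (j : PCCS Ω) (ħ : ℝ) : Continuous (j.weight ħ) :=
  Real.continuous_exp.comp (j.continuous_G.neg.div_const _)

variable [MeasurableSpace V] [BorelSpace V]

/-- The Lebesgue measure `dz` on `V` normalised by the norm `|·|_j`: the image of the Lebesgue
measure of Euclidean space under an isometry. -/
def PCCS.lebesgue (j : PCCS Ω) : Measure V := Measure.map j.frame volume

instance (j : PCCS Ω) : j.lebesgue.IsAddHaarMeasure :=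
  j.frame.toContinuousLinearEquiv.isAddHaarMeasure_map volume

/-- The Fock space `H(V, Ω, j)`: holomorphic functions on `(V, j)` with
`∫ |f(z)|² exp (-|z|_j² / 2ħ) dz < ∞`. -/
def Fock (j : PCCS Ω) (ħ : ℝ) : Submodule ℂ (V → ℂ) where
  carrier := {f | IsHolomorphic j.toComplexStructure f ∧
    Integrable (fun z => ‖f z‖ ^ 2 * j.weight ħ z) j.lebesgue}
  add_mem' {f g} hf hg := by
    refine ⟨hf.1.add hg.1, ?_⟩
    refine ((hf.2.const_mul 2).add (hg.2.const_mul 2)).mono' ?_ (Filter.Eventually.of_forall ?_)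
    · exact (((hf.1.1.add hg.1.1).continuous.norm.pow 2).mul
        (j.continuous_weight ħ)).aestronglyMeasurable
    · intro z
      have hw : 0 ≤ j.weight ħ z := (Real.exp_pos _).le
      rw [Real.norm_of_nonneg (mul_nonneg (sq_nonneg _) hw)]
      have h1 : ‖f z + g z‖ ≤ ‖f z‖ + ‖g z‖ := norm_add_le _ _
      have h2 : ‖f z + g z‖ ^ 2 ≤ 2 * ‖f z‖ ^ 2 + 2 * ‖g z‖ ^ 2 := by
        nlinarith [norm_nonneg (f z + g z), sq_nonneg (‖f z‖ - ‖g z‖)]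
      calc ‖(f + g) z‖ ^ 2 * j.weight ħ z
          ≤ (2 * ‖f z‖ ^ 2 + 2 * ‖g z‖ ^ 2) * j.weight ħ z :=
            mul_le_mul_of_nonneg_right h2 hw
        _ = _ := by
            simp only [Pi.add_apply]
            ring
  zero_mem' := ⟨IsHolomorphic.const _ 0, by simp⟩
  smul_mem' a f hf := by
    refine ⟨(IsHolomorphic.const _ a).mul hf.1, ?_⟩
    refine (hf.2.const_mul (‖a‖ ^ 2)).congr (Filter.Eventually.of_forall fun z => ?_)
    simp only [Pi.smul_apply, smul_eq_mul, norm_mul]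
    ring

/-- The inner product `(f, g)_j = h⁻ⁿ ∫ f(z) conj(g(z)) exp (-|z|_j² / 2ħ) dz` of the Fock space,
where `h = 2πħ` and `2n = dim V`. -/
def fockInner (j : PCCS Ω) (ħ : ℝ) (f g : Fock j ħ) : ℂ :=
  (((2 * Real.pi * ħ) ^ (Module.finrank ℝ V / 2) : ℝ) : ℂ)⁻¹ *
    ∫ z, (f : V → ℂ) z * (starRingEnd ℂ) ((g : V → ℂ) z) * (j.weight ħ z : ℂ) ∂j.lebesgue

/-- The factor `exp (-i t / ħ + ⟨z, v⟩_j / 2ħ - |v|_j² / 4ħ)`. -/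
def weylFactor (j : PCCS Ω) (ħ : ℝ) (v : V) (t : ℝ) (z : V) : ℂ :=
  Complex.exp (-(Complex.I * t / ħ) + j.herm z v / (2 * ħ) - (j.G v v : ℂ) / (4 * ħ))

theorem weylFactor_norm (j : PCCS Ω) (ħ : ℝ) (v : V) (t : ℝ) (z : V) :
    ‖weylFactor j ħ v t z‖ ^ 2 * j.weight ħ z = j.weight ħ (z - v) := by
  have hre : (-(Complex.I * t / ħ) + j.herm z v / (2 * ħ) - (j.G v v : ℂ) / (4 * ħ)).re
      = j.G z v / (2 * ħ) - j.G v v / (4 * ħ) := by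
    have h1 : -(Complex.I * t / ħ) + j.herm z v / (2 * ħ) - (j.G v v : ℂ) / (4 * ħ)
        = ((j.G z v / (2 * ħ) - j.G v v / (4 * ħ) : ℝ) : ℂ)
          + ((-(t / ħ) - Ω.form z v / (2 * ħ) : ℝ) : ℂ) * Complex.I := by
      rw [PCCS.herm]
      push_cast
      ring
    rw [h1, Complex.add_re, Complex.ofReal_re, Complex.re_ofReal_mul, Complex.I_re, mul_zero,
      add_zero]
  rw [weylFactor, Complex.norm_exp, hre, PCCS.weight, PCCS.weight, ← Real.exp_nat_mul,
    ← Real.exp_add]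
  congr 1
  simp only [map_sub, LinearMap.sub_apply]
  rw [j.G_comm v z]
  by_cases h : ħ = 0
  · simp [h]
  · field_simp
    push_cast
    ring

theorem weyl_mem (j : PCCS Ω) (ħ : ℝ) (v : V) (t : ℝ) {f : V → ℂ} (hf : f ∈ Fock j ħ) :
    (fun z => weylFactor j ħ v t z * f (z - v)) ∈ Fock j ħ := by
  constructor
  · have h1 : IsHolomorphic j.toComplexStructure (weylFactor j ħ v t) := by
      apply IsHolomorphic.cexp
      have h := ((IsHolomorphic.const j.toComplexStructure
        (-(Complex.I * t / ħ) - (j.G v v : ℂ) / (4 * ħ))).add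
        ((IsHolomorphic.const j.toComplexStructure ((2 * ħ : ℂ)⁻¹)).mul (j.isHolomorphic_herm v)))
      convert h using 1
      funext z
      simp only [Pi.add_apply, Pi.mul_apply]
      ring
    exact h1.mul (hf.1.comp_sub v)
  · refine (hf.2.comp_sub_right v).congr (Filter.Eventually.of_forall fun z => ?_)
    simp only [norm_mul, mul_pow]
    rw [← weylFactor_norm j ħ v t z]
    ring

/-- The operator `U_j(v, t)` by which `(v, t)` in the Heisenberg group acts on the Fock space:
`(U_j(v, t) f)(z) = exp (-i t / ħ + ⟨z, v⟩_j / 2ħ - |v|_j² / 4ħ) f(z - v)`. -/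
def weyl (j : PCCS Ω) (ħ : ℝ) (v : V) (t : ℝ) : Fock j ħ →ₗ[ℂ] Fock j ħ where
  toFun f := ⟨fun z => weylFactor j ħ v t z * (f : V → ℂ) (z - v), weyl_mem j ħ v t f.2⟩
  map_add' f g := by
    apply Subtype.ext
    funext z
    simp [mul_add]
  map_smul' a f := by
    apply Subtype.ext
    funext z
    simp only [Submodule.coe_smul, Pi.smul_apply, smul_eq_mul, RingHom.id_apply]
    ring

theorem one_mem_fock (j : PCCS Ω) {ħ : ℝ} (hħ : 0 < ħ) : (fun _ => (1 : ℂ)) ∈ Fock j ħ := by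
  refine ⟨IsHolomorphic.const _ 1, ?_⟩
  have hL : (j.frame.toContinuousLinearEquiv.toHomeomorph.toMeasurableEquiv :
      EuclideanSpace ℝ (Fin (Module.finrank ℝ V)) → V) = j.frame := rfl
  rw [PCCS.lebesgue, ← hL, integrable_map_equiv]
  have h := (GaussianFourier.integrable_cexp_neg_mul_sq_norm_add
    (V := EuclideanSpace ℝ (Fin (Module.finrank ℝ V))) (b := ((2 * ħ)⁻¹ : ℝ))
    (by rw [Complex.ofReal_re]; positivity) 0 0).norm
  refine h.congr (Filter.Eventually.of_forall fun x => ?_)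
  simp only [Function.comp_apply, hL, PCCS.weight, j.G_frame, real_inner_self_eq_norm_sq,
    Complex.norm_exp]
  simp only [norm_one, one_pow, one_mul, zero_mul, add_zero]
  congr 1
  rw [← Complex.ofReal_pow, ← Complex.ofReal_neg, ← Complex.ofReal_mul, Complex.ofReal_re]
  ring

/-- The coherent state `e_v(z) = exp (⟨z, v⟩_j / 2ħ)`. -/
def coherent (j : PCCS Ω) {ħ : ℝ} (hħ : 0 < ħ) (v : V) : Fock j ħ :=
  ⟨fun z => Complex.exp (j.herm z v / (2 * ħ)), by
    have h := (Fock j ħ).smul_mem (Complex.exp ((j.G v v : ℂ) / (4 * ħ)))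
      (weyl_mem j ħ v 0 (one_mem_fock j hħ))
    convert h using 1
    funext z
    simp only [Pi.smul_apply, smul_eq_mul, weylFactor, mul_one]
    rw [← Complex.exp_add]
    congr 1
    simp⟩

/-! ### The group `Mp^c` -/

/-- `Mp^c(V, Ω, j)`: the pairs `(U, g)` of a unitary transformation `U` of the Fock space and
`g ∈ Sp(V, Ω)` with `U_j(g v, t) = U U_j(v, t) U⁻¹` for all `v, t`, with diagonal multiplication. -/
def MpC (j : PCCS Ω) (ħ : ℝ) : Subgroup ((Fock j ħ ≃ₗ[ℂ] Fock j ħ) × (V ≃ₗ[ℝ] V)) where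
  carrier := {x | (∀ f₁ f₂, fockInner j ħ (x.1 f₁) (x.1 f₂) = fockInner j ħ f₁ f₂) ∧ x.2 ∈ Sp Ω ∧
    ∀ v t, weyl j ħ (x.2 v) t = x.1.toLinearMap ∘ₗ weyl j ħ v t ∘ₗ x.1.symm.toLinearMap}
  mul_mem' {x y} hx hy := by
    refine ⟨fun f₁ f₂ => (hx.1 _ _).trans (hy.1 f₁ f₂), mul_mem hx.2.1 hy.2.1, fun v t => ?_⟩
    change weyl j ħ (x.2 (y.2 v)) t = _
    rw [hx.2.2, hy.2.2]
    rfl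
  one_mem' := ⟨fun _ _ => rfl, one_mem _, fun _ _ => rfl⟩
  inv_mem' {x} hx := by
    refine ⟨fun f₁ f₂ => ?_, inv_mem hx.2.1, fun v t => ?_⟩
    · change fockInner j ħ (x.1.symm f₁) (x.1.symm f₂) = _
      rw [← hx.1, LinearEquiv.apply_symm_apply, LinearEquiv.apply_symm_apply]
    · have h := hx.2.2 (x.2.symm v) t
      rw [LinearEquiv.apply_symm_apply] at h
      change weyl j ħ (x.2.symm v) t = x.1.symm.toLinearMap ∘ₗ weyl j ħ v t ∘ₗ x.1.toLinearMap
      rw [h]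
      refine LinearMap.ext fun f => ?_
      simp

/-- The projection `σ : Mp^c(V, Ω, j) → Sp(V, Ω)`, `(U, g) ↦ g`. -/
def MpC.sigma (j : PCCS Ω) (ħ : ℝ) : MpC j ħ →* Sp Ω where
  toFun x := ⟨x.1.2, x.2.2.1⟩
  map_one' := rfl
  map_mul' _ _ := rfl

/-- `(g, l)` are the parameters of `(U, g) ∈ Mp^c(V, Ω, j)`: `|l² Det_j C_g| = 1` and the Berezin
kernel `U(z, v) = (U e_v)(z)` is
`l exp (1/4ħ) {2 ⟨C_g⁻¹ z, v⟩_j - ⟨z, Z_{g⁻¹} z⟩_j - ⟨Z_g v, v⟩_j}`. -/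
structure MpC.HasParameters {j : PCCS Ω} {ħ : ℝ} (hħ : 0 < ħ) (x : MpC j ħ) (g : V ≃ₗ[ℝ] V)
    (l : ℂ) : Prop where
  sigma_eq : (MpC.sigma j ħ x : V ≃ₗ[ℝ] V) = g
  norm_eq : ‖l ^ 2 * detLinearPart j.toComplexStructure g.toLinearMap‖ = 1
  kernel : ∀ z v, (x.1.1 (coherent j hħ v) : V → ℂ) z = l * Complex.exp (1 / (4 * ħ) *
    (2 * j.herm (Ring.inverse (linearPart j.toComplexStructure g.toLinearMap) z) v
      - j.herm z (zPart j.toComplexStructure (g⁻¹).toLinearMap z)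
      - j.herm (zPart j.toComplexStructure g.toLinearMap v) v))

/-- The parameter `λ = (U e_0)(0)` of `(U, g)`. -/
def MpC.lam {j : PCCS Ω} {ħ : ℝ} (hħ : 0 < ħ) (x : MpC j ħ) : ℂ :=
  (x.1.1 (coherent j hħ 0) : V → ℂ) 0

/-! ### Smooth maps on subgroups of `Sp(V, Ω)` and lifts -/

/-- A linear automorphism of `V` as a point of the normed space `End(V)`. -/
def toEnd (g : V ≃ₗ[ℝ] V) : V →L[ℝ] V := LinearMap.toContinuousLinearMap g.toLinearMap

/-- Smoothness of a map on a closed linear group `H ⊆ GL(V) ⊆ End(V)`: locally the map extends to a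
smooth map on an open subset of `End(V)`. -/
def SmoothOnSubgroup (H : Subgroup (V ≃ₗ[ℝ] V)) {E : Type*} [NormedAddCommGroup E]
    [NormedSpace ℝ E] (f : H → E) : Prop :=
  ∀ g : H, ∃ (N : Set (V →L[ℝ] V)) (φ : (V →L[ℝ] V) → E), IsOpen N ∧ toEnd g.1 ∈ N ∧
    ContDiffOn ℝ ∞ φ N ∧ ∀ h : H, toEnd h.1 ∈ N → φ (toEnd h.1) = f h

/-- A homomorphism `Φ : H → Mp^c(V, Ω, j)` is a lift of `H ⊆ Sp(V, Ω)`: it is smooth and `σ ∘ Φ` is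
the inclusion. The Lie group structure of `Mp^c(V, Ω, j)` is the one for which the parameters
`(U, g) ↦ (g, λ)` identify it with the submanifold `{(g, λ) | |λ² Det_j C_g| = 1}` of
`Sp(V, Ω) × ℂ`. -/
structure IsLift {j : PCCS Ω} {ħ : ℝ} (hħ : 0 < ħ) {H : Subgroup (V ≃ₗ[ℝ] V)}
    (Φ : H →* MpC j ħ) : Prop where
  sigma_comp : ∀ g : H, (MpC.sigma j ħ (Φ g) : V ≃ₗ[ℝ] V) = g
  smooth : SmoothOnSubgroup H fun g =>
    (toEnd (MpC.sigma j ħ (Φ g) : V ≃ₗ[ℝ] V), MpC.lam hħ (Φ g))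

end Fock

end

end SymplecticLift

namespace SymplecticLift

open scoped TensorProduct ContDiff
open MeasureTheory

noncomputable section

set_option linter.unusedSectionVars false

/-! ### Complex determinants -/

/-! Over a given g, an element of Mp^c is fixed by its λ as soon as λ ≠ 0, because a unitary
operator commuting with all Weyl operators is scalar (`MpC.ext_of_lam`); and every (g, λ) with |λ²
Det_j C_g| = 1 occurs (`exists_hasParameters`). So the theorem is about the function f = f_F alone:
|f(g)² Det_j C_g| = 1, f obeys the multiplication law of the parameters, and f is smooth.

Existence. The Gaussian kernel with parameters (g, λ) defines states u_v that are covariant under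
the Weyl operators. The function w ↦ (u_0, u_w) is holomorphic and passes to its conjugate under w ↦
-w, hence is constant, equal to ‖u_0‖² = 1. Covariance then gives the u_v the Gram matrix of the
coherent states e_v. The states with parameters (g⁻¹, conj λ) supply the adjoint, so e_v ↦ u_v
extends to a unitary operator.

Multiplication. One has λ(xx') = λ(x) λ(x') J, where J is a Gaussian integral pairing Z_{g'⁻¹} with
Z_g (`MpC.HasParameters.lam_mul`). Analytic continuation from real Gaussians gives J² Det_j(1 - Z_g
Z_{g'⁻¹}) = 1 (`gaussPairing_sq_mul`), which matches C_{gg'} = C_g (1 - Z_g Z_{g'⁻¹}) C_{g'}.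

The square of f. A Schur complement relative to V = (D ⊕ jD) ⊕ Q gives Det C_g = Det a · Det C_b ·
Det M(g) (`detLinearPart_eq`), and δ_D² = Det M(g). As b commutes with the second complex structure,
Det C_b is the product of determinants on the spaces where the two structures are opposite and
equal. The quotient χ of these determinants is a unitary character: antilinear operators commuting
with the second structure exchange the two spaces, so 1 - Z Z' has the same determinant on both.
Hence f(g)² Det C_g χ(g) = sign Det a (`liftFunction_sq`). This gives the norm condition, and f(g)
f(g') J = ± f(gg').

The sign. Let h_τ act by τ on D, by τ⁻¹ on jD, trivially on Q. The conjugates g_τ of g by h_τ extend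
continuously to τ = 0, remain in the stabiliser, and are multiplicative in g for each τ. By
continuity the sign does not depend on τ. At τ = 0 the element preserves D, jD and Q, so e = s = 0
and δ_D > 0; moreover J times the determinant of 1 - Z_b Z_{b'⁻¹} on the space of opposite
structures is positive, as is seen by shrinking all Z to 0. The two sides of the law then differ by
a positive factor, and the sign is + (`liftFunction_mul`).

Smoothness. Up to the locally constant sign of Det a, f² is a quotient of smooth functions on
End(V), and f is continuous, so locally f is a branch of a square root. -/

theorem det_eq_of_pairing {𝕜 E₁ E₂ : Type*} [Field 𝕜] [AddCommGroup E₁] [Module 𝕜 E₁] [FiniteDimensional 𝕜 E₁]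
    [AddCommGroup E₂] [Module 𝕜 E₂] [FiniteDimensional 𝕜 E₂] (B : E₁ →ₗ[𝕜] E₂ →ₗ[𝕜] 𝕜)
    (h₁ : ∀ x, (∀ y, B x y = 0) → x = 0) (h₂ : ∀ y, (∀ x, B x y = 0) → y = 0)
    (A₁ : Module.End 𝕜 E₁) (A₂ : Module.End 𝕜 E₂) (hA : ∀ x y, B (A₁ x) y = B x (A₂ y)) :
    LinearMap.det A₁ = LinearMap.det A₂ := by
  have hi₁ : Function.Injective B := by
    rw [injective_iff_map_eq_zero]
    exact fun x hx => h₁ x fun y => by rw [hx]; rfl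
  have hi₂ : Function.Injective B.flip := by
    rw [injective_iff_map_eq_zero]
    exact fun y hy => h₂ y fun x => by
      have := LinearMap.congr_fun hy x
      simpa using this
  have d₁ := LinearMap.finrank_le_finrank_of_injective hi₁
  have d₂ := LinearMap.finrank_le_finrank_of_injective hi₂
  rw [Subspace.dual_finrank_eq] at d₁ d₂
  -- A nondegenerate pairing identifies E₁ with the dual of E₂ and turns A₁ into the transpose of
  -- A₂.
  let e : E₁ ≃ₗ[𝕜] Module.Dual 𝕜 E₂ := LinearEquiv.ofInjectiveOfFinrankEq B hi₁
    (by rw [Subspace.dual_finrank_eq]; exact le_antisymm d₁ d₂)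
  have he : ∀ x y, e x y = B x y := fun x y => rfl
  have hconj : (e : E₁ →ₗ[𝕜] Module.Dual 𝕜 E₂) ∘ₗ A₁ ∘ₗ (e.symm : Module.Dual 𝕜 E₂ →ₗ[𝕜] E₁)
      = A₂.dualMap := by
    refine LinearMap.ext fun φ => LinearMap.ext fun y => ?_
    simp only [LinearMap.comp_apply, LinearEquiv.coe_coe, LinearMap.dualMap_apply, he, hA]
    rw [← he, LinearEquiv.apply_symm_apply]
  rw [← LinearMap.det_conj A₁ e, hconj, LinearMap.det_dualMap]

theorem det_one_sub_comp_comm {E₁ E₂ : Type*} [AddCommGroup E₁] [Module ℂ E₁]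
    [FiniteDimensional ℂ E₁] [AddCommGroup E₂] [Module ℂ E₂] [FiniteDimensional ℂ E₂]
    (A : E₁ →ₗ[ℂ] E₂) (B : E₂ →ₗ[ℂ] E₁) :
    LinearMap.det (1 - B ∘ₗ A) = LinearMap.det (1 - A ∘ₗ B) := by
  classical
  let b₁ := Module.finBasis ℂ E₁
  let b₂ := Module.finBasis ℂ E₂
  rw [← LinearMap.det_toMatrix b₁, ← LinearMap.det_toMatrix b₂, map_sub, map_sub,
    LinearMap.toMatrix_one, LinearMap.toMatrix_one, LinearMap.toMatrix_comp b₁ b₂ b₁,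
    LinearMap.toMatrix_comp b₂ b₁ b₂, Matrix.det_one_sub_mul_comm]

section CxDet

variable {W : Type*} [AddCommGroup W] [Module ℝ W]

/-- The identity `(W, J) → W` as a real linear equivalence. -/
def CxSpace.realEquiv (c : ComplexStructure W) : CxSpace c ≃ₗ[ℝ] W where
  toFun w := w.val
  invFun w := CxSpace.of c w
  map_add' _ _ := rfl
  map_smul' r w := by
    change ((r : ℂ) • w : CxSpace c).val = r • w.val
    rw [CxSpace.smul_def]
    change (r : ℂ).re • w.val + (r : ℂ).im • c.J w.val = _
    simp
  left_inv _ := rfl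
  right_inv _ := rfl

instance [FiniteDimensional ℝ W] (c : ComplexStructure W) : FiniteDimensional ℝ (CxSpace c) :=
  Module.Finite.equiv (CxSpace.realEquiv c).symm

instance [FiniteDimensional ℝ W] (c : ComplexStructure W) : FiniteDimensional ℂ (CxSpace c) :=
  Module.Finite.of_restrictScalars_finite ℝ ℂ _

/-- The conjugate complex structure `-J`. -/
def ComplexStructure.conj (c : ComplexStructure W) : ComplexStructure W :=
  ⟨-c.J, fun w => by simp [c.sq]⟩

theorem ComplexStructure.conj_J (c : ComplexStructure W) : c.conj.J = -c.J := rfl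

theorem ComplexStructure.J_mul_J (c : ComplexStructure W) : c.J * c.J = -1 :=
  LinearMap.ext fun w => c.sq w

theorem linearPart_eq_of_commute (c : ComplexStructure W) {A : Module.End ℝ W}
    (hA : Commute c.J A) : linearPart c A = A := by
  rw [linearPart, hA.eq, mul_assoc, c.J_mul_J]
  simp only [mul_neg, mul_one, sub_neg_eq_add]
  rw [← two_smul ℝ, smul_smul]
  norm_num

theorem linearPart_commute (c : ComplexStructure W) (A : Module.End ℝ W) :
    Commute c.J (linearPart c A) :=
  LinearMap.ext fun w => (linearPart_J c A w).symm

theorem linearPart_add_antilinearPart (c : ComplexStructure W) (A : Module.End ℝ W) :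
    linearPart c A + antilinearPart c A = A := by
  rw [linearPart, antilinearPart]
  module

theorem antilinearPart_J (c : ComplexStructure W) (A : Module.End ℝ W) (w : W) :
    antilinearPart c A (c.J w) = -c.J (antilinearPart c A w) := by
  simp only [antilinearPart, LinearMap.smul_apply, LinearMap.add_apply, Module.End.mul_apply, c.sq,
    map_smul, map_add, map_neg]
  module

theorem linearPart_mul_of_commute (c : ComplexStructure W) {A : Module.End ℝ W}
    (hA : Commute c.J A) (B : Module.End ℝ W) : linearPart c (A * B) = A * linearPart c B := by
  rw [linearPart, linearPart, mul_smul_comm, mul_sub, ← mul_assoc, hA.eq, mul_assoc, mul_assoc,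
    mul_assoc]

theorem detLinearPart_mul (c : ComplexStructure W) {A : Module.End ℝ W}
    (hA : Commute c.J A) (B : Module.End ℝ W) :
    detLinearPart c (A * B) = detLinearPart c A * detLinearPart c B := by
  rw [detLinearPart, detLinearPart, detLinearPart, ← map_mul]
  congr 1
  refine LinearMap.ext fun w => ?_
  change linearPart c (A * B) w = linearPart c A (linearPart c B w)
  rw [linearPart_mul_of_commute c hA, linearPart_eq_of_commute c hA]
  rfl

theorem linearPart_linearPart (c : ComplexStructure W) (A : Module.End ℝ W) :
    linearPart c (linearPart c A) = linearPart c A :=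
  linearPart_eq_of_commute c (linearPart_commute c A)

theorem detLinearPart_linearPart (c : ComplexStructure W) (A : Module.End ℝ W) :
    detLinearPart c (linearPart c A) = detLinearPart c A := by
  rw [detLinearPart, detLinearPart]
  congr 1
  refine LinearMap.ext fun w => ?_
  change linearPart c (linearPart c A) w = linearPart c A w
  rw [linearPart_linearPart]

theorem detLinearPart_one (c : ComplexStructure W) : detLinearPart c 1 = 1 := by
  have h : linearPartCx c 1 = 1 := by
    refine LinearMap.ext fun w => ?_
    change linearPart c 1 w = w
    rw [linearPart_eq_of_commute c (Commute.one_right _)]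
    rfl
  rw [detLinearPart, h, map_one]

/-- Restriction of scalars replaces a determinant by its norm, and the norm of ℂ over ℝ is the
squared modulus. -/
theorem normSq_detLinearPart (c : ComplexStructure W) (A : Module.End ℝ W) :
    Complex.normSq (detLinearPart c A) = LinearMap.det (linearPart c A) := by
  rw [detLinearPart, ← Algebra.norm_complex_apply, ← LinearMap.det_restrictScalars,
    ← LinearMap.det_conj _ (CxSpace.realEquiv c)]
  rfl

/-- A complex basis for J is also one for -J; coordinates, and hence matrix entries, are conjugated.
-/
theorem detLinearPart_conj [FiniteDimensional ℝ W] (c : ComplexStructure W) {A : Module.End ℝ W}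
    (hA : Commute c.J A) :
    detLinearPart c.conj A = (starRingEnd ℂ) (detLinearPart c A) := by
  classical
  have hA' : Commute c.conj.J A := by rw [c.conj_J]; exact hA.neg_left
  let b := Module.finBasis ℂ (CxSpace c)
  have hsmul : ∀ (z : ℂ) (w : CxSpace c.conj),
      CxSpace.of c (z • w).val = (starRingEnd ℂ z) • CxSpace.of c w.val := by
    intro z w
    rw [CxSpace.smul_def, CxSpace.smul_def]
    change z.re • w.val + z.im • (-c.J w.val)
      = (starRingEnd ℂ z).re • w.val + (starRingEnd ℂ z).im • c.J w.val
    simp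
  let e : CxSpace c.conj ≃ₗ[ℂ] (Fin (Module.finrank ℂ (CxSpace c)) → ℂ) :=
    { toFun := fun w i => starRingEnd ℂ (b.repr (CxSpace.of c w.val) i)
      map_add' := fun v w => by
        funext i
        have : CxSpace.of c (v + w).val = CxSpace.of c v.val + CxSpace.of c w.val := rfl
        rw [this, map_add, Finsupp.add_apply, map_add]
        rfl
      map_smul' := fun z w => by
        funext i
        rw [hsmul, map_smul]
        simp
      invFun := fun x => CxSpace.of c.conj (b.equivFun.symm fun i => starRingEnd ℂ (x i)).val
      left_inv := fun w => by
        have : (fun i => starRingEnd ℂ (starRingEnd ℂ (b.repr (CxSpace.of c w.val) i)))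
            = b.equivFun (CxSpace.of c w.val) := by
          funext i
          simp
        simp only [this, LinearEquiv.symm_apply_apply]
        rfl
      right_inv := fun x => by
        funext i
        change starRingEnd ℂ (b.equivFun (b.equivFun.symm fun i => starRingEnd ℂ (x i)) i) = x i
        rw [LinearEquiv.apply_symm_apply]
        simp }
  let b' : Module.Basis _ ℂ (CxSpace c.conj) := Module.Basis.ofEquivFun e
  have hb' : ∀ i, b' i = CxSpace.of c.conj (b i).val := by
    intro i
    apply e.injective
    rw [Module.Basis.coe_ofEquivFun, LinearEquiv.apply_symm_apply]
    funext k
    change _ = starRingEnd ℂ (b.repr (b i) k)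
    rw [b.repr_self, Finsupp.single_apply, Pi.single_apply]
    by_cases h : k = i
    · simp [h]
    · simp [h, Ne.symm h]
  rw [detLinearPart, detLinearPart, ← LinearMap.det_toMatrix b, ← LinearMap.det_toMatrix b',
    RingHom.map_det]
  congr 1
  ext i k
  rw [LinearMap.toMatrix_apply, hb', RingHom.mapMatrix_apply, Matrix.map_apply,
    LinearMap.toMatrix_apply]
  change starRingEnd ℂ (b.repr (CxSpace.of c (linearPart c.conj A (b k).val)) i) = _
  rw [linearPart_eq_of_commute _ hA']
  change _ = starRingEnd ℂ (b.repr (CxSpace.of c (linearPart c A (b k).val)) i)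
  rw [linearPart_eq_of_commute _ hA]

end CxDet

/-! ### Conjugation by a linear equivalence -/

section Transport

variable {W W' : Type*} [AddCommGroup W] [Module ℝ W] [AddCommGroup W'] [Module ℝ W']
  {c : ComplexStructure W} {c' : ComplexStructure W'} (φ : W ≃ₗ[ℝ] W')

/-- A real linear equivalence intertwining complex structures, as a complex linear one. -/
def cxEquiv (h : ∀ w, φ (c.J w) = c'.J (φ w)) : CxSpace c ≃ₗ[ℂ] CxSpace c' where
  toFun w := CxSpace.of c' (φ w.val)
  invFun w := CxSpace.of c (φ.symm w.val)
  map_add' v w := φ.map_add v.val w.val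
  map_smul' z w := by
    change φ (z.re • w.val + z.im • c.J w.val) = z.re • φ w.val + z.im • c'.J (φ w.val)
    rw [map_add, map_smul, map_smul, h]
  left_inv w := φ.symm_apply_apply w.val
  right_inv w := φ.apply_symm_apply w.val

theorem conj_mul (A B : Module.End ℝ W) : φ.conj (A * B) = φ.conj A * φ.conj B :=
  LinearEquiv.conj_comp φ B A

theorem linearPart_conj (h : ∀ w, φ (c.J w) = c'.J (φ w)) (A : Module.End ℝ W) :
    linearPart c' (φ.conj A) = φ.conj (linearPart c A) := by
  have hJ : c'.J = φ.conj c.J := LinearMap.ext fun w => by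
    rw [LinearEquiv.conj_apply_apply, h, LinearEquiv.apply_symm_apply]
  rw [linearPart, linearPart, hJ, ← conj_mul, ← conj_mul, ← map_sub, map_smul]

theorem antilinearPart_conj (h : ∀ w, φ (c.J w) = c'.J (φ w)) (A : Module.End ℝ W) :
    antilinearPart c' (φ.conj A) = φ.conj (antilinearPart c A) := by
  have hJ : c'.J = φ.conj c.J := LinearMap.ext fun w => by
    rw [LinearEquiv.conj_apply_apply, h, LinearEquiv.apply_symm_apply]
  rw [antilinearPart, antilinearPart, hJ, ← conj_mul, ← conj_mul, ← map_add, map_smul]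

theorem zPart_conj (h : ∀ w, φ (c.J w) = c'.J (φ w)) (A : Module.End ℝ W)
    (hA : IsUnit (linearPart c A)) :
    zPart c' (φ.conj A) = φ.conj (zPart c A) := by
  rw [zPart, zPart, linearPart_conj φ h, antilinearPart_conj φ h, conj_mul]
  congr 1
  obtain ⟨u, hu⟩ := hA
  rw [← hu, Ring.inverse_unit]
  have h1 : φ.conj (u : Module.End ℝ W) * φ.conj ((u⁻¹ : (Module.End ℝ W)ˣ) : Module.End ℝ W) = 1 := by
    rw [← conj_mul, Units.mul_inv]
    exact LinearEquiv.conj_id φ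
  have h2 : φ.conj ((u⁻¹ : (Module.End ℝ W)ˣ) : Module.End ℝ W) * φ.conj (u : Module.End ℝ W) = 1 := by
    rw [← conj_mul, Units.inv_mul]
    exact LinearEquiv.conj_id φ
  exact Ring.inverse_unit ⟨_, _, h1, h2⟩

end Transport

/-! ### Products of linear and antilinear parts -/

section Parts

variable {W : Type*} [AddCommGroup W] [Module ℝ W] (c : ComplexStructure W)

theorem linearPart_mul (A B : Module.End ℝ W) :
    linearPart c (A * B) = linearPart c A * linearPart c B
      + antilinearPart c A * antilinearPart c B := by
  refine LinearMap.ext fun w => ?_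
  simp only [linearPart, antilinearPart, LinearMap.smul_apply, LinearMap.add_apply,
    LinearMap.sub_apply, Module.End.mul_apply, map_smul, map_add, map_sub, c.sq, map_neg]
  module

theorem antilinearPart_mul (A B : Module.End ℝ W) :
    antilinearPart c (A * B) = linearPart c A * antilinearPart c B
      + antilinearPart c A * linearPart c B := by
  refine LinearMap.ext fun w => ?_
  simp only [linearPart, antilinearPart, LinearMap.smul_apply, LinearMap.add_apply,
    LinearMap.sub_apply, Module.End.mul_apply, map_smul, map_add, map_sub, c.sq, map_neg]
  module

theorem antilinearPart_one : antilinearPart c 1 = 0 := by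
  rw [antilinearPart, mul_one, c.J_mul_J, add_neg_cancel, smul_zero]

end Parts

/-! ### Determinants on `{K v = -J v}` -/

section Minus

variable {W : Type*} [AddCommGroup W] [Module ℝ W] [FiniteDimensional ℝ W]
  (c : ComplexStructure W) (K : Module.End ℝ W) (hK : Commute c.J K)

/-- The determinant of the `J`-linear part of `A` on the complex space `{v | K v = -J v}`. -/
def detOnMinus (A : Module.End ℝ W) (hA : Commute A K) : ℂ :=
  LinearMap.det ((linearPartCx c A).restrict (linearPartCx_mem_minusSpace c K hK A hA))

theorem detOnMinus_congr {A B : Module.End ℝ W} (hA : Commute A K) (hB : Commute B K)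
    (h : linearPart c A = linearPart c B) : detOnMinus c K hK A hA = detOnMinus c K hK B hB := by
  rw [detOnMinus, detOnMinus]
  congr 1
  refine LinearMap.ext fun w => Subtype.ext ?_
  exact LinearMap.congr_fun h (w : CxSpace c).val

theorem detOnMinus_mul {A B : Module.End ℝ W} (hA : Commute A K) (hB : Commute B K)
    (hAJ : Commute c.J A) :
    detOnMinus c K hK (A * B) (hA.mul_left hB) = detOnMinus c K hK A hA * detOnMinus c K hK B hB := by
  rw [detOnMinus, detOnMinus, detOnMinus, ← map_mul]
  congr 1
  refine LinearMap.ext fun w => Subtype.ext ?_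
  change linearPart c (A * B) _ = linearPart c A (linearPart c B _)
  rw [linearPart_mul_of_commute c hAJ, linearPart_eq_of_commute c hAJ]
  rfl

theorem detOnMinus_one : detOnMinus c K hK 1 (Commute.one_left K) = 1 := by
  rw [detOnMinus, ← map_one (LinearMap.det (A := ℂ) (M := minusSpace c K hK))]
  congr 1
  refine LinearMap.ext fun w => Subtype.ext ?_
  change linearPart c 1 _ = _
  rw [linearPart_eq_of_commute c (Commute.one_right _)]
  rfl

/-- Since J and K commute and both have square -1, JK is an involution; the two spaces are its
eigenspaces for 1 and -1. -/
theorem isCompl_minusSpace (hKK : ∀ w, K (K w) = -w) :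
    IsCompl (minusSpace c K hK) (minusSpace c (-K) hK.neg_right) := by
  have hc : ∀ x, K (c.J x) = c.J (K x) := fun x => (LinearMap.congr_fun hK x).symm
  constructor
  · rw [Submodule.disjoint_def]
    intro w h1 h2
    have h1 : K w.val = -c.J w.val := h1
    have h2 : -K w.val = -c.J w.val := h2
    have h3 : c.J w.val = 0 := by
      have : (2 : ℝ) • c.J w.val = 0 := by
        rw [two_smul]
        nth_rewrite 1 [← neg_neg (c.J w.val), ← h1, ← neg_neg (c.J w.val), ← h2]
        simp
      simpa using this
    have := c.sq w.val
    rw [h3, map_zero] at this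
    exact neg_eq_zero.1 this.symm
  · rw [codisjoint_iff, Submodule.eq_top_iff']
    intro w
    rw [Submodule.mem_sup]
    refine ⟨CxSpace.of c ((1 / 2 : ℝ) • (w.val + c.J (K w.val))), ?_,
      CxSpace.of c ((1 / 2 : ℝ) • (w.val - c.J (K w.val))), ?_, ?_⟩
    · change K ((1 / 2 : ℝ) • (w.val + c.J (K w.val))) = -c.J ((1 / 2 : ℝ) • (w.val + c.J (K w.val)))
      simp only [map_smul, map_add, hc, hKK, c.sq, map_neg]
      module
    · change -K ((1 / 2 : ℝ) • (w.val - c.J (K w.val))) = -c.J ((1 / 2 : ℝ) • (w.val - c.J (K w.val)))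
      simp only [map_smul, map_sub, hc, hKK, c.sq, map_neg]
      module
    · change (1 / 2 : ℝ) • (w.val + c.J (K w.val)) + (1 / 2 : ℝ) • (w.val - c.J (K w.val)) = w.val
      module

theorem detLinearPart_eq_mul (hKK : ∀ w, K (K w) = -w) {A : Module.End ℝ W} (hA : Commute A K) :
    detLinearPart c A = detOnMinus c K hK A hA
      * detOnMinus c (-K) hK.neg_right A hA.neg_right := by
  let e := Submodule.prodEquivOfIsCompl _ _ (isCompl_minusSpace c K hK hKK)
  rw [detOnMinus, detOnMinus, ← LinearMap.det_prodMap, ← LinearMap.det_conj _ e, detLinearPart]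
  congr 1
  refine LinearMap.ext fun w => ?_
  obtain ⟨⟨x, y⟩, rfl⟩ := e.surjective w
  simp only [LinearMap.comp_apply, LinearEquiv.coe_coe, LinearEquiv.symm_apply_apply]
  change linearPartCx c A ((x : CxSpace c) + y) = linearPartCx c A x + linearPartCx c A y
  rw [map_add]

end Minus

/-! ### The symplectic group and a positive compatible complex structure -/

section Symp

variable {V : Type*} [AddCommGroup V] [Module ℝ V] {Ω : SymplecticForm V} (j : PCCS Ω)

theorem PCCS.form_J (v w : V) : Ω.form v (j.J w) = -Ω.form (j.J v) w := by
  rw [← j.compat v (j.J w), j.sq, map_neg]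

theorem PCCS.form_eq (v w : V) : Ω.form v w = -j.G v (j.J w) := by
  rw [j.G_apply, j.sq, map_neg, neg_neg]

theorem PCCS.G_J (v w : V) : j.G (j.J v) w = -j.G v (j.J w) := by
  rw [j.G_apply, j.G_apply, j.compat, j.sq, map_neg, neg_neg]

theorem PCCS.G_JJ (v w : V) : j.G (j.J v) (j.J w) = j.G v w := by
  rw [j.G_apply, j.G_apply, j.compat]

theorem PCCS.G_ext {v w : V} (h : ∀ x, j.G x v = j.G x w) : v = w := by
  rw [← sub_eq_zero]
  apply j.eq_zero
  rw [map_sub, h, sub_self]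

theorem PCCS.herm_conj (v w : V) : (starRingEnd ℂ) (j.herm v w) = j.herm w v := by
  simp only [PCCS.herm, map_sub, map_mul, Complex.conj_I, Complex.conj_ofReal]
  rw [j.G_comm v w, Ω.neg v w]
  push_cast
  ring

theorem PCCS.herm_self (v : V) : j.herm v v = (j.G v v : ℂ) := by
  rw [PCCS.herm, Ω.alt v]
  simp

theorem PCCS.herm_add_left (u v w : V) : j.herm (u + v) w = j.herm u w + j.herm v w := by
  simp only [PCCS.herm, map_add, LinearMap.add_apply]
  push_cast
  ring

theorem PCCS.herm_add_right (u v w : V) : j.herm u (v + w) = j.herm u v + j.herm u w := by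
  simp only [PCCS.herm, map_add]
  push_cast
  ring

theorem PCCS.herm_neg_left (v w : V) : j.herm (-v) w = -j.herm v w := by
  simp only [PCCS.herm, map_neg, LinearMap.neg_apply]
  push_cast
  ring

theorem PCCS.herm_neg_right (v w : V) : j.herm v (-w) = -j.herm v w := by
  simp only [PCCS.herm, map_neg]
  push_cast
  ring

theorem PCCS.herm_sub_left (u v w : V) : j.herm (u - v) w = j.herm u w - j.herm v w := by
  rw [sub_eq_add_neg, j.herm_add_left, j.herm_neg_left, sub_eq_add_neg]

theorem PCCS.herm_sub_right (u v w : V) : j.herm u (v - w) = j.herm u v - j.herm u w := by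
  rw [sub_eq_add_neg, j.herm_add_right, j.herm_neg_right, sub_eq_add_neg]

theorem PCCS.herm_zero_left (w : V) : j.herm 0 w = 0 := by simp [PCCS.herm]

theorem PCCS.herm_zero_right (w : V) : j.herm w 0 = 0 := by simp [PCCS.herm]

theorem PCCS.herm_smul_left (r : ℝ) (v w : V) : j.herm (r • v) w = r * j.herm v w := by
  simp only [PCCS.herm, map_smul, LinearMap.smul_apply, smul_eq_mul]
  push_cast
  ring

theorem PCCS.herm_smul_right (r : ℝ) (v w : V) : j.herm v (r • w) = r * j.herm v w := by
  simp only [PCCS.herm, map_smul, smul_eq_mul]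
  push_cast
  ring

theorem PCCS.herm_J_left (v w : V) : j.herm (j.J v) w = Complex.I * j.herm v w := by
  have h1 : j.G (j.J v) w = Ω.form v w := j.compat v w
  rw [PCCS.herm, PCCS.herm, h1, ← neg_neg (Ω.form (j.J v) w), ← j.form_J, ← j.G_apply]
  push_cast
  linear_combination (Ω.form v w : ℂ) * Complex.I_mul_I

theorem PCCS.herm_J_right (v w : V) : j.herm v (j.J w) = -Complex.I * j.herm v w := by
  rw [← j.herm_conj, j.herm_J_left, map_mul, Complex.conj_I, j.herm_conj]

theorem PCCS.herm_re (v w : V) : (j.herm v w).re = j.G v w := by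
  simp [PCCS.herm]

/-- Real operators that are adjoint for `G_j`, one being `j`-linear, are adjoint for the Hermitian
form. -/
theorem PCCS.herm_adjoint {A B : Module.End ℝ V} (h : ∀ v w, j.G (A v) w = j.G v (B w))
    (hA : Commute j.J A) (v w : V) : j.herm (A v) w = j.herm v (B w) := by
  have hB : B (j.J w) = j.J (B w) := by
    apply j.G_ext
    intro x
    have h1 : A (j.J x) = j.J (A x) := (LinearMap.congr_fun hA x).symm
    rw [← h, ← neg_neg (j.G x (j.J (B w))), ← j.G_J, ← h, h1, j.G_J, neg_neg]
  rw [PCCS.herm, PCCS.herm, h, j.form_eq, h, hB, ← j.form_eq]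

/-- Antilinear operators that are symmetric for `G_j`. -/
structure PCCS.IsSymmAnti (Z : Module.End ℝ V) : Prop where
  anti : ∀ w, Z (j.J w) = -j.J (Z w)
  symm : ∀ v w, j.G (Z v) w = j.G v (Z w)

variable {j}

theorem PCCS.IsSymmAnti.herm_comm {Z : Module.End ℝ V} (hZ : j.IsSymmAnti Z) (v w : V) :
    j.herm (Z v) w = j.herm (Z w) v := by
  have h : Ω.form (Z v) w = Ω.form (Z w) v := by
    rw [j.form_eq, hZ.symm, hZ.anti, map_neg, neg_neg, j.form_eq, j.G_comm, ← j.G_J]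
  rw [PCCS.herm, PCCS.herm, hZ.symm v w, j.G_comm v, h]

theorem PCCS.IsSymmAnti.herm_comm' {Z : Module.End ℝ V} (hZ : j.IsSymmAnti Z) (v w : V) :
    j.herm v (Z w) = j.herm w (Z v) := by
  rw [← j.herm_conj, hZ.herm_comm, j.herm_conj]

theorem PCCS.IsSymmAnti.add {Y Z : Module.End ℝ V} (hY : j.IsSymmAnti Y) (hZ : j.IsSymmAnti Z) :
    j.IsSymmAnti (Y + Z) where
  anti w := by
    rw [LinearMap.add_apply, LinearMap.add_apply, hY.anti, hZ.anti, map_add, neg_add]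
  symm v w := by
    rw [LinearMap.add_apply, LinearMap.add_apply, map_add, map_add, LinearMap.add_apply, hY.symm,
      hZ.symm]

theorem PCCS.IsSymmAnti.smul {Z : Module.End ℝ V} (hZ : j.IsSymmAnti Z) (r : ℝ) :
    j.IsSymmAnti (r • Z) where
  anti w := by
    rw [LinearMap.smul_apply, LinearMap.smul_apply, hZ.anti, smul_neg, map_smul]
  symm v w := by
    rw [LinearMap.smul_apply, LinearMap.smul_apply, map_smul, map_smul, LinearMap.smul_apply,
      hZ.symm]

theorem PCCS.IsSymmAnti.J_mul {Z : Module.End ℝ V} (hZ : j.IsSymmAnti Z) :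
    j.IsSymmAnti (j.J * Z) where
  anti w := by
    rw [Module.End.mul_apply, Module.End.mul_apply, hZ.anti, map_neg]
  symm v w := by
    rw [Module.End.mul_apply, Module.End.mul_apply, j.G_J, hZ.symm, hZ.anti, map_neg, neg_neg]

theorem PCCS.IsSymmAnti.commute_mul {Y Z : Module.End ℝ V} (hY : j.IsSymmAnti Y)
    (hZ : j.IsSymmAnti Z) : Commute j.J (Y * Z) := by
  refine LinearMap.ext fun w => ?_
  simp only [Module.End.mul_apply, hZ.anti, map_neg, hY.anti, neg_neg]

variable (j)

theorem Sp_form {g : V ≃ₗ[ℝ] V} (hg : g ∈ Sp Ω) (v w : V) : Ω.form (g v) (g w) = Ω.form v w :=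
  hg v w

theorem Sp_form_inv {g : V ≃ₗ[ℝ] V} (hg : g ∈ Sp Ω) (v w : V) :
    Ω.form (g v) w = Ω.form v (g⁻¹ w) := by
  rw [← Sp_form hg v]
  congr 1
  exact (g.apply_symm_apply w).symm

/-- The G_j-transpose of a symplectic g is -j g⁻¹ j. Its linear part is C_{g⁻¹} and its antilinear
part is -D_{g⁻¹}, which explains the sign in `antilinearPart_adjoint`. -/
theorem linearPart_adjoint {g : V ≃ₗ[ℝ] V} (hg : g ∈ Sp Ω) (v w : V) :
    j.G (linearPart j.toComplexStructure g.toLinearMap v) w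
      = j.G v (linearPart j.toComplexStructure (g⁻¹).toLinearMap w) := by
  simp only [linearPart, LinearMap.smul_apply, LinearMap.sub_apply, Module.End.mul_apply, map_smul,
    map_sub, LinearEquiv.coe_coe, j.G_apply, j.compat, Sp_form_inv hg, j.sq, map_neg]
  rw [j.form_J]
  simp only [smul_eq_mul]
  ring

theorem antilinearPart_adjoint {g : V ≃ₗ[ℝ] V} (hg : g ∈ Sp Ω) (v w : V) :
    j.G (antilinearPart j.toComplexStructure g.toLinearMap v) w
      = -j.G v (antilinearPart j.toComplexStructure (g⁻¹).toLinearMap w) := by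
  simp only [antilinearPart, LinearMap.smul_apply, LinearMap.add_apply, Module.End.mul_apply,
    map_smul, map_add, LinearEquiv.coe_coe, j.G_apply, j.compat, Sp_form_inv hg, j.sq, map_neg]
  rw [j.form_J]
  simp only [smul_eq_mul]
  ring

theorem inv_mul_toLinearMap (g : V ≃ₗ[ℝ] V) : (g⁻¹).toLinearMap * g.toLinearMap = 1 :=
  LinearMap.ext fun v => g.symm_apply_apply v

theorem mul_inv_toLinearMap (g : V ≃ₗ[ℝ] V) : g.toLinearMap * (g⁻¹).toLinearMap = 1 :=
  LinearMap.ext fun v => g.apply_symm_apply v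

/-- The linear part of g⁻¹ g = 1 reads C_{g⁻¹} C_g + D_{g⁻¹} D_g = 1, and C_{g⁻¹}, -D_{g⁻¹} are the
adjoints of C_g, D_g. -/
theorem norm_linearPart_sub {g : V ≃ₗ[ℝ] V} (hg : g ∈ Sp Ω) (v : V) :
    j.G (linearPart j.toComplexStructure g.toLinearMap v)
        (linearPart j.toComplexStructure g.toLinearMap v)
      - j.G (antilinearPart j.toComplexStructure g.toLinearMap v)
        (antilinearPart j.toComplexStructure g.toLinearMap v) = j.G v v := by
  have h := linearPart_mul j.toComplexStructure (g⁻¹).toLinearMap g.toLinearMap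
  rw [inv_mul_toLinearMap, linearPart_eq_of_commute _ (Commute.one_right _)] at h
  rw [linearPart_adjoint j hg, antilinearPart_adjoint j hg, sub_neg_eq_add, ← map_add]
  have := LinearMap.congr_fun h v
  simp only [Module.End.one_apply, LinearMap.add_apply, Module.End.mul_apply] at this
  rw [← this]

variable [FiniteDimensional ℝ V]

/-- From |C_g v|² = |v|² + |D_g v|² the operator C_g is injective. -/
theorem isUnit_linearPart {g : V ≃ₗ[ℝ] V} (hg : g ∈ Sp Ω) :
    IsUnit (linearPart j.toComplexStructure g.toLinearMap) := by
  refine (Module.End.isUnit_iff _).2 (IsArtinian.bijective_of_injective_endomorphism _ ?_)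
  rw [injective_iff_map_eq_zero]
  intro v hv
  have h := norm_linearPart_sub j hg v
  rw [hv] at h
  apply j.eq_zero
  have h1 := j.G_nonneg v
  have h2 := j.G_nonneg (antilinearPart j.toComplexStructure g.toLinearMap v)
  simp only [map_zero, zero_sub] at h
  linarith

theorem inverse_linearPart_mul {g : V ≃ₗ[ℝ] V} (hg : g ∈ Sp Ω) :
    Ring.inverse (linearPart j.toComplexStructure g.toLinearMap)
      * linearPart j.toComplexStructure g.toLinearMap = 1 :=
  Ring.inverse_mul_cancel _ (isUnit_linearPart j hg)

theorem linearPart_mul_inverse {g : V ≃ₗ[ℝ] V} (hg : g ∈ Sp Ω) :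
    linearPart j.toComplexStructure g.toLinearMap
      * Ring.inverse (linearPart j.toComplexStructure g.toLinearMap) = 1 :=
  Ring.mul_inverse_cancel _ (isUnit_linearPart j hg)

theorem linearPart_mul_zPart {g : V ≃ₗ[ℝ] V} (hg : g ∈ Sp Ω) :
    linearPart j.toComplexStructure g.toLinearMap * zPart j.toComplexStructure g.toLinearMap
      = antilinearPart j.toComplexStructure g.toLinearMap := by
  rw [zPart, ← mul_assoc, linearPart_mul_inverse j hg, one_mul]

theorem inverse_linearPart_mul_self {g : V ≃ₗ[ℝ] V} (hg : g ∈ Sp Ω) :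
    Ring.inverse (linearPart j.toComplexStructure g.toLinearMap) * g.toLinearMap
      = 1 + zPart j.toComplexStructure g.toLinearMap := by
  nth_rewrite 2 [← linearPart_add_antilinearPart j.toComplexStructure g.toLinearMap]
  rw [mul_add, inverse_linearPart_mul j hg, zPart]

theorem commute_inverse_linearPart {g : V ≃ₗ[ℝ] V} (hg : g ∈ Sp Ω) :
    Commute j.J (Ring.inverse (linearPart j.toComplexStructure g.toLinearMap)) := by
  obtain ⟨u, hu⟩ := isUnit_linearPart j hg
  have h := linearPart_commute j.toComplexStructure g.toLinearMap
  rw [← hu] at h ⊢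
  rw [Ring.inverse_unit]
  exact h.units_inv_right

theorem inverse_linearPart_adjoint {g : V ≃ₗ[ℝ] V} (hg : g ∈ Sp Ω) (v w : V) :
    j.G (Ring.inverse (linearPart j.toComplexStructure g.toLinearMap) v) w
      = j.G v (Ring.inverse (linearPart j.toComplexStructure (g⁻¹).toLinearMap) w) := by
  have h1 : linearPart j.toComplexStructure (g⁻¹).toLinearMap
      (Ring.inverse (linearPart j.toComplexStructure (g⁻¹).toLinearMap) w) = w :=
    LinearMap.congr_fun (linearPart_mul_inverse j (inv_mem hg)) w
  have h2 : linearPart j.toComplexStructure g.toLinearMap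
      (Ring.inverse (linearPart j.toComplexStructure g.toLinearMap) v) = v :=
    LinearMap.congr_fun (linearPart_mul_inverse j hg) v
  nth_rewrite 1 [← h1]
  rw [← linearPart_adjoint j hg, h2]

/-- `Z_g C_{g⁻¹} = -D_{g⁻¹}`. -/
theorem zPart_mul_linearPart_inv {g : V ≃ₗ[ℝ] V} (hg : g ∈ Sp Ω) :
    zPart j.toComplexStructure g.toLinearMap * linearPart j.toComplexStructure (g⁻¹).toLinearMap
      = -antilinearPart j.toComplexStructure (g⁻¹).toLinearMap := by
  have h := antilinearPart_mul j.toComplexStructure g.toLinearMap (g⁻¹).toLinearMap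
  rw [mul_inv_toLinearMap, antilinearPart_one, eq_comm, add_eq_zero_iff_eq_neg'] at h
  rw [zPart, mul_assoc, h, mul_neg, ← mul_assoc, inverse_linearPart_mul j hg, one_mul]

/-- The adjoint of C_g⁻¹ D_g is -D_{g⁻¹} C_{g⁻¹}⁻¹, which equals Z_g again by
`zPart_mul_linearPart_inv`. -/
theorem isSymmAnti_zPart {g : V ≃ₗ[ℝ] V} (hg : g ∈ Sp Ω) :
    j.IsSymmAnti (zPart j.toComplexStructure g.toLinearMap) where
  anti w := by
    have h : ∀ x, Ring.inverse (linearPart j.toComplexStructure g.toLinearMap) (j.J x)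
        = j.J (Ring.inverse (linearPart j.toComplexStructure g.toLinearMap) x) := fun x =>
      (LinearMap.congr_fun (commute_inverse_linearPart j hg) x).symm
    rw [zPart, Module.End.mul_apply, Module.End.mul_apply, antilinearPart_J, map_neg, h]
  symm v w := by
    have h1 : linearPart j.toComplexStructure (g⁻¹).toLinearMap
        (Ring.inverse (linearPart j.toComplexStructure (g⁻¹).toLinearMap) w) = w :=
      LinearMap.congr_fun (linearPart_mul_inverse j (inv_mem hg)) w
    have h2 := LinearMap.congr_fun (zPart_mul_linearPart_inv j hg)
      (Ring.inverse (linearPart j.toComplexStructure (g⁻¹).toLinearMap) w)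
    rw [Module.End.mul_apply, h1] at h2
    rw [h2, zPart, Module.End.mul_apply, inverse_linearPart_adjoint j hg,
      antilinearPart_adjoint j hg, LinearMap.neg_apply, map_neg]

/-- `|v|² - |Z_g v|² = |C_{g⁻¹}⁻¹ v|²`. -/
theorem norm_sub_norm_zPart {g : V ≃ₗ[ℝ] V} (hg : g ∈ Sp Ω) (v : V) :
    j.G v v - j.G (zPart j.toComplexStructure g.toLinearMap v)
        (zPart j.toComplexStructure g.toLinearMap v)
      = j.G (Ring.inverse (linearPart j.toComplexStructure (g⁻¹).toLinearMap) v)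
        (Ring.inverse (linearPart j.toComplexStructure (g⁻¹).toLinearMap) v) := by
  set C' := linearPart j.toComplexStructure (g⁻¹).toLinearMap with hC'
  set w := Ring.inverse C' v with hw
  have h1 : C' w = v := LinearMap.congr_fun (linearPart_mul_inverse j (inv_mem hg)) v
  have h2 := LinearMap.congr_fun (zPart_mul_linearPart_inv j hg) w
  rw [Module.End.mul_apply, ← hC', h1] at h2
  rw [h2, ← norm_linearPart_sub j (inv_mem hg) w, ← hC', h1]
  simp

/-- Strict contraction is what makes the Gaussians exp(-⟨z, Z z⟩ / 4ħ) square integrable against the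
Fock weight. -/
theorem norm_zPart_lt {g : V ≃ₗ[ℝ] V} (hg : g ∈ Sp Ω) (v : V) (hv : v ≠ 0) :
    j.G (zPart j.toComplexStructure g.toLinearMap v) (zPart j.toComplexStructure g.toLinearMap v)
      < j.G v v := by
  rw [← sub_pos, norm_sub_norm_zPart j hg]
  apply j.G_pos
  intro h
  apply hv
  have h1 := LinearMap.congr_fun (linearPart_mul_inverse j (inv_mem hg)) v
  rw [Module.End.mul_apply, h, map_zero] at h1
  exact h1.symm

/-- `C_{gg'} = C_g (1 - Z_g Z_{g'⁻¹}) C_{g'}`. -/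
theorem linearPart_mul_eq {g g' : V ≃ₗ[ℝ] V} (hg : g ∈ Sp Ω) (hg' : g' ∈ Sp Ω) :
    linearPart j.toComplexStructure (g * g').toLinearMap
      = linearPart j.toComplexStructure g.toLinearMap
        * ((1 - zPart j.toComplexStructure g.toLinearMap
            * zPart j.toComplexStructure (g'⁻¹).toLinearMap)
          * linearPart j.toComplexStructure g'.toLinearMap) := by
  have h := zPart_mul_linearPart_inv j (inv_mem hg')
  rw [inv_inv] at h
  have hm : (g * g').toLinearMap = g.toLinearMap * g'.toLinearMap := rfl
  rw [hm, linearPart_mul, sub_mul, one_mul, mul_assoc, h, mul_sub, mul_neg, mul_neg, ← mul_assoc _ _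
    (antilinearPart _ _), linearPart_mul_zPart j hg, sub_neg_eq_add]

end Symp

/-! ### Determinants of C_g and of 1 + Z -/

section Det

variable {V : Type*} [AddCommGroup V] [Module ℝ V] [FiniteDimensional ℝ V] {Ω : SymplecticForm V}
  (j : PCCS Ω)

theorem continuous_det_one_add_smul (B : Module.End ℝ V) :
    Continuous fun s : ℝ => LinearMap.det (1 + s • B) := by
  have h : (fun s : ℝ => LinearMap.det (1 + s • B)) = fun s : ℝ =>
      (1 + s • (LinearMap.toMatrix (Module.finBasis ℝ V) (Module.finBasis ℝ V) B)).det := by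
    funext s
    rw [← LinearMap.det_toMatrix (Module.finBasis ℝ V), map_add, map_smul, LinearMap.toMatrix_one]
  rw [h]
  exact Continuous.matrix_det (by fun_prop)

theorem det_ne_zero_of_G_pos {A : Module.End ℝ V} (hA : ∀ v, v ≠ 0 → 0 < j.G (A v) v) :
    LinearMap.det A ≠ 0 := by
  intro h
  obtain ⟨v, hv, hv0⟩ := (Submodule.ne_bot_iff _).1 (LinearMap.bot_lt_ker_of_det_eq_zero h).ne'
  have := hA v hv0
  rw [LinearMap.mem_ker.1 hv] at this
  simp at this

/-- Positivity persists along the segment from 1 to A, so the determinant cannot change sign on the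
way. -/
theorem det_pos_of_G_pos {A : Module.End ℝ V} (hA : ∀ v, v ≠ 0 → 0 < j.G (A v) v) :
    0 < LinearMap.det A := by
  by_contra hneg
  have hc := (continuous_det_one_add_smul (A - 1)).continuousOn (s := Set.Icc 0 1)
  have h0 : LinearMap.det (1 + (0 : ℝ) • (A - 1)) = 1 := by simp
  have h1 : LinearMap.det (1 + (1 : ℝ) • (A - 1)) = LinearMap.det A := by simp
  obtain ⟨s, hs, hs0⟩ := intermediate_value_Icc' zero_le_one hc
    (show (0 : ℝ) ∈ Set.Icc _ _ by rw [h0, h1]; exact ⟨not_lt.1 hneg, zero_le_one⟩)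
  refine det_ne_zero_of_G_pos j (A := 1 + s • (A - 1)) (fun v hv => ?_) hs0
  simp only [LinearMap.add_apply, LinearMap.smul_apply, LinearMap.sub_apply, Module.End.one_apply,
    map_add, map_smul, map_sub, smul_eq_mul]
  have h2 := hA v hv
  have h3 := j.G_pos v hv
  rcases hs.1.eq_or_lt with h | h
  · simpa [← h] using h3
  · nlinarith [mul_pos h h2, mul_nonneg (sub_nonneg.2 hs.2) h3.le]

variable {j}

theorem PCCS.G_one_add_pos {Z : Module.End ℝ V}
    (hc : ∀ v, v ≠ 0 → j.G (Z v) (Z v) < j.G v v) (v : V) (hv : v ≠ 0) :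
    0 < j.G ((1 + Z) v) v := by
  have h1 := j.G_nonneg (v + Z v)
  have h2 := hc v hv
  simp only [map_add, LinearMap.add_apply, Module.End.one_apply] at h1 ⊢
  rw [j.G_comm v (Z v)] at h1
  linarith

variable (j)

/-- The Hermitian form as a complex bilinear pairing of `(V, j)` with `(V, -j)`. -/
def hermPairing : CxSpace j.toComplexStructure →ₗ[ℂ] CxSpace j.conj →ₗ[ℂ] ℂ :=
  LinearMap.mk₂ ℂ (fun v w => j.herm v.val w.val)
    (fun u v w => j.herm_add_left u.val v.val w.val)
    (fun z v w => by
      change j.herm (z.re • v.val + z.im • j.J v.val) w.val = z * j.herm v.val w.val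
      rw [j.herm_add_left, j.herm_smul_left, j.herm_smul_left, j.herm_J_left]
      nth_rewrite 3 [← Complex.re_add_im z]
      ring)
    (fun u v w => j.herm_add_right u.val v.val w.val)
    (fun z v w => by
      change j.herm v.val (z.re • w.val + z.im • (-j.J w.val)) = z * j.herm v.val w.val
      rw [j.herm_add_right, j.herm_smul_right, j.herm_smul_right, j.herm_neg_right, j.herm_J_right]
      nth_rewrite 3 [← Complex.re_add_im z]
      ring)

/-- The Hermitian form pairs (V, j) with (V, -j) bilinearly; adjoint operators have equal
determinants there, and passing from -j back to j conjugates one of them. -/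
theorem detLinearPart_adjoint {A B : Module.End ℝ V} (h : ∀ v w, j.G (A v) w = j.G v (B w))
    (hA : Commute j.J A) (hB : Commute j.J B) :
    detLinearPart j.toComplexStructure A
      = (starRingEnd ℂ) (detLinearPart j.toComplexStructure B) := by
  have hB' : Commute j.conj.J B := hB.neg_left
  rw [← detLinearPart_conj _ hB]
  have hdef : ∀ w : V, j.herm w w = 0 → w = 0 := fun w hw => by
    rw [j.herm_self, Complex.ofReal_eq_zero] at hw
    exact j.eq_zero hw
  refine det_eq_of_pairing (hermPairing j) (fun x hx => hdef x.val (hx x.val))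
    (fun y hy => hdef y.val (hy y.val)) _ _ fun x y => ?_
  change j.herm (linearPart _ A x.val) y.val = j.herm x.val (linearPart j.conj B y.val)
  rw [linearPart_eq_of_commute _ hA, linearPart_eq_of_commute _ hB', j.herm_adjoint h hA]

theorem norm_detLinearPart_inv {g : V ≃ₗ[ℝ] V} (hg : g ∈ Sp Ω) :
    ‖detLinearPart j.toComplexStructure (g⁻¹).toLinearMap‖
      = ‖detLinearPart j.toComplexStructure g.toLinearMap‖ := by
  rw [← detLinearPart_linearPart, ← detLinearPart_linearPart _ g.toLinearMap,
    detLinearPart_adjoint j (linearPart_adjoint j hg) (linearPart_commute _ _)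
      (linearPart_commute _ _), RCLike.norm_conj]

theorem detLinearPart_ne_zero {g : V ≃ₗ[ℝ] V} (hg : g ∈ Sp Ω) :
    detLinearPart j.toComplexStructure g.toLinearMap ≠ 0 := by
  rw [← Complex.normSq_pos, normSq_detLinearPart]
  refine lt_of_le_of_ne ?_ (LinearMap.isUnit_det _ (isUnit_linearPart j hg)).ne_zero.symm
  rw [← normSq_detLinearPart]
  exact Complex.normSq_nonneg _

variable {j}

/-- As Z anticommutes with j, conjugation by j carries 1 + Z to 1 - Z. -/
theorem det_one_add_eq_one_sub {Z : Module.End ℝ V} (hZ : j.IsSymmAnti Z) :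
    LinearMap.det (1 + Z) = LinearMap.det (1 - Z) := by
  have h : j.J * (1 + Z) = (1 - Z) * j.J := by
    refine LinearMap.ext fun w => ?_
    simp [hZ.anti]
  have h2 := congrArg LinearMap.det h
  rw [map_mul, map_mul, mul_comm] at h2
  refine mul_right_cancel₀ ?_ h2
  have h3 : LinearMap.det j.J * LinearMap.det j.J = LinearMap.det (-1 : Module.End ℝ V) := by
    rw [← map_mul, j.J_mul_J]
  intro h0
  rw [h0, zero_mul] at h3
  exact (LinearMap.isUnit_det (-1 : Module.End ℝ V) isUnit_one.neg).ne_zero h3.symm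

/-- Both sides have the same square: Det(1 + Z)² = Det(1 + Z) Det(1 - Z) is the real determinant of
1 - Z², hence |Det_j(1 - Z²)|². Both are positive: the left one because Z is a contraction, the
right one because 1 - s Z² is self-adjoint and invertible for 0 ≤ s ≤ 1, so that its complex
determinant is real and never vanishes on the way from the value 1. -/
theorem det_one_add_eq_detLinearPart {Z : Module.End ℝ V} (hZ : j.IsSymmAnti Z)
    (hc : ∀ v, v ≠ 0 → j.G (Z v) (Z v) < j.G v v) :
    ((LinearMap.det (1 + Z) : ℝ) : ℂ) = detLinearPart j.toComplexStructure (1 - Z * Z) := by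
  have hcomm : ∀ s : ℝ, Commute j.J (1 - s • (Z * Z)) := fun s =>
    (Commute.one_right _).sub_right ((hZ.commute_mul hZ).smul_right s)
  have hsymm : ∀ (s : ℝ) v w, j.G ((1 - s • (Z * Z)) v) w = j.G v ((1 - s • (Z * Z)) w) := by
    intro s v w
    simp only [LinearMap.sub_apply, LinearMap.smul_apply, Module.End.one_apply,
      Module.End.mul_apply, map_sub, map_smul, hZ.symm]
  have hreal : ∀ s : ℝ, (detLinearPart j.toComplexStructure (1 - s • (Z * Z))).im = 0 := by
    intro s
    have := detLinearPart_adjoint j (hsymm s) (hcomm s) (hcomm s)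
    rw [eq_comm, Complex.conj_eq_iff_im] at this
    exact this
  have hne : ∀ s ∈ Set.Icc (0 : ℝ) 1,
      detLinearPart j.toComplexStructure (1 - s • (Z * Z)) ≠ 0 := by
    intro s hs
    rw [← Complex.normSq_pos, normSq_detLinearPart, linearPart_eq_of_commute _ (hcomm s)]
    apply det_pos_of_G_pos j
    intro v hv
    simp only [LinearMap.sub_apply, LinearMap.smul_apply, Module.End.one_apply,
      Module.End.mul_apply, map_sub, map_smul, hZ.symm, smul_eq_mul]
    have h1 := hc v hv
    have h2 := j.G_nonneg (Z v)
    rw [hZ.symm] at h1 h2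
    nlinarith [hs.1, hs.2, mul_le_of_le_one_left h2 hs.2]
  have hseg : ∀ s : ℝ, detLinearPart j.toComplexStructure (1 - s • (Z * Z))
      = segmentDet (linearPartCx j.toComplexStructure (1 - (Z * Z))) s := by
    intro s
    rw [segmentDet, detLinearPart]
    congr 1
    refine LinearMap.ext fun w => ?_
    have h1 : linearPart j.toComplexStructure (1 - Z * Z) = 1 - Z * Z :=
      linearPart_eq_of_commute _ (by simpa using hcomm 1)
    change linearPart _ _ w.val
      = w.val + ((s : ℂ).re • (linearPart j.toComplexStructure (1 - Z * Z) w.val - w.val)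
        + (s : ℂ).im • j.J _)
    rw [linearPart_eq_of_commute _ (hcomm s), h1]
    simp only [Complex.ofReal_re, Complex.ofReal_im, zero_smul, LinearMap.sub_apply,
      LinearMap.smul_apply, Module.End.one_apply]
    module
  have hpos : 0 < (detLinearPart j.toComplexStructure (1 - Z * Z)).re := by
    by_contra hneg
    have hcont : ContinuousOn (fun s : ℝ =>
        (segmentDet (linearPartCx j.toComplexStructure (1 - (Z * Z))) s).re) (Set.Icc 0 1) :=
      (Complex.continuous_re.comp (contDiff_segmentDet _).continuous).continuousOn
    have h0 : (segmentDet (linearPartCx j.toComplexStructure (1 - (Z * Z))) 0).re = 1 := by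
      rw [← hseg]
      simp [detLinearPart_one]
    have h1 : (segmentDet (linearPartCx j.toComplexStructure (1 - (Z * Z))) 1).re
        = (detLinearPart j.toComplexStructure (1 - Z * Z)).re := by
      rw [← hseg]
      simp
    obtain ⟨s, hs, hs0⟩ := intermediate_value_Icc' zero_le_one hcont
      (show (0 : ℝ) ∈ Set.Icc _ _ by rw [h0, h1]; exact ⟨not_lt.1 hneg, zero_le_one⟩)
    apply hne s hs
    apply Complex.ext
    · rw [hseg]
      exact hs0
    · exact hreal s
  have hpos' : 0 < LinearMap.det (1 + Z) := det_pos_of_G_pos j (j.G_one_add_pos hc)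
  have him : (detLinearPart j.toComplexStructure (1 - Z * Z)).im = 0 := by
    simpa using hreal 1
  have hsq : LinearMap.det (1 + Z) * LinearMap.det (1 + Z)
      = Complex.normSq (detLinearPart j.toComplexStructure (1 - Z * Z)) := by
    nth_rewrite 2 [det_one_add_eq_one_sub hZ]
    rw [normSq_detLinearPart, linearPart_eq_of_commute _ (by simpa using hcomm 1), ← map_mul]
    congr 1
    noncomm_ring
  rw [Complex.normSq_apply, him, mul_zero, add_zero] at hsq
  apply Complex.ext
  · rw [Complex.ofReal_re]
    nlinarith
  · rw [Complex.ofReal_im, him]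

end Det

/-! ### Symmetric antilinear operators commuting with a second complex structure -/

section Second

variable {V : Type*} [AddCommGroup V] [Module ℝ V] [FiniteDimensional ℝ V] {Ω : SymplecticForm V}
  (j : PCCS Ω) (c : ComplexStructure V) (hc : Commute j.J c.J)

/-- The Hermitian form as a bilinear pairing on `{v | K v = -j v}` with the complex structures `j`
and `K`. -/
def minusPairing : minusSpace j.toComplexStructure c.J hc →ₗ[ℂ] minusSpace c j.J hc.symm →ₗ[ℂ] ℂ :=
  LinearMap.mk₂ ℂ (fun v w => j.herm v.1.val w.1.val)
    (fun u v w => j.herm_add_left u.1.val v.1.val w.1.val)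
    (fun z v w => by
      change j.herm (z.re • v.1.val + z.im • j.J v.1.val) w.1.val = z * j.herm v.1.val w.1.val
      rw [j.herm_add_left, j.herm_smul_left, j.herm_smul_left, j.herm_J_left]
      nth_rewrite 3 [← Complex.re_add_im z]
      ring)
    (fun u v w => j.herm_add_right u.1.val v.1.val w.1.val)
    (fun z v w => by
      change j.herm v.1.val (z.re • w.1.val + z.im • (c.J w.1.val)) = z * j.herm v.1.val w.1.val
      have hw : j.J w.1.val = -c.J w.1.val := w.2
      rw [← neg_neg (c.J w.1.val), ← hw, j.herm_add_right, j.herm_smul_right, j.herm_smul_right,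
        j.herm_neg_right, j.herm_J_right]
      nth_rewrite 3 [← Complex.re_add_im z]
      ring)

/-- The two spaces are the same real subspace {K = -j} with opposite complex structures, so the
sesquilinear Hermitian form becomes a bilinear pairing between them, and no conjugation appears. -/
theorem detOnMinus_adjoint {A B : Module.End ℝ V} (h : ∀ v w, j.G (A v) w = j.G v (B w))
    (hA : Commute j.J A) (hAc : Commute A c.J) (hBj : Commute B j.J) (hBc : Commute c.J B) :
    detOnMinus j.toComplexStructure c.J hc A hAc = detOnMinus c j.J hc.symm B hBj := by
  have hdef : ∀ w : V, j.herm w w = 0 → w = 0 := fun w hw => by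
    rw [j.herm_self, Complex.ofReal_eq_zero] at hw
    exact j.eq_zero hw
  refine det_eq_of_pairing (minusPairing j c hc) (fun x hx => ?_) (fun y hy => ?_) _ _ fun x y => ?_
  · have h1 : c.J x.1.val = -j.J x.1.val := x.2
    exact Subtype.ext (hdef x.1.val (hx ⟨x.1.val, by
      change j.J x.1.val = -c.J x.1.val
      rw [h1, neg_neg]⟩))
  · have h1 : j.J y.1.val = -c.J y.1.val := y.2
    exact Subtype.ext (hdef y.1.val (hy ⟨y.1.val, by
      change c.J y.1.val = -j.J y.1.val
      rw [h1, neg_neg]⟩))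
  · change j.herm (linearPart _ A x.1.val) y.1.val = j.herm x.1.val (linearPart c B y.1.val)
    rw [linearPart_eq_of_commute _ hA, linearPart_eq_of_commute _ hBc, j.herm_adjoint h hA]

/-- Both sides are the real determinant of A on the one real subspace {K = -j}. -/
theorem normSq_detOnMinus_swap {A : Module.End ℝ V} (hA : Commute A j.J) (hAc : Commute A c.J) :
    Complex.normSq (detOnMinus j.toComplexStructure c.J hc A hAc)
      = Complex.normSq (detOnMinus c j.J hc.symm A hA) := by
  let e : minusSpace j.toComplexStructure c.J hc ≃ₗ[ℝ] minusSpace c j.J hc.symm :=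
    { toFun := fun w => ⟨w.1.val, by
        have h1 : c.J w.1.val = -j.J w.1.val := w.2
        change j.J w.1.val = -c.J w.1.val
        rw [h1, neg_neg]⟩
      invFun := fun w => ⟨w.1.val, by
        have h1 : j.J w.1.val = -c.J w.1.val := w.2
        change c.J w.1.val = -j.J w.1.val
        rw [h1, neg_neg]⟩
      map_add' := fun _ _ => rfl
      map_smul' := fun r w => by
        apply Subtype.ext
        change (r : ℂ).re • w.1.val + (r : ℂ).im • j.J w.1.val
          = (r : ℂ).re • w.1.val + (r : ℂ).im • c.J w.1.val
        simp
      left_inv := fun _ => rfl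
      right_inv := fun _ => rfl }
  rw [detOnMinus, detOnMinus, ← Algebra.norm_complex_apply, ← Algebra.norm_complex_apply,
    ← LinearMap.det_restrictScalars, ← LinearMap.det_restrictScalars, ← LinearMap.det_conj _ e]
  congr 1
  refine LinearMap.ext fun w => Subtype.ext ?_
  change linearPart j.toComplexStructure A w.1.val = linearPart c A w.1.val
  rw [linearPart_eq_of_commute _ hA.symm, linearPart_eq_of_commute _ hAc.symm]

theorem norm_detOnMinus_adjoint {A B : Module.End ℝ V} (h : ∀ v w, j.G (A v) w = j.G v (B w))
    (hA : Commute j.J A) (hAc : Commute A c.J) (hBj : Commute B j.J) (hBc : Commute B c.J) :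
    ‖detOnMinus j.toComplexStructure c.J hc A hAc‖
      = ‖detOnMinus j.toComplexStructure c.J hc B hBc‖ := by
  have h1 := normSq_detOnMinus_swap j c hc hBj hBc
  rw [← detOnMinus_adjoint j c hc h hA hAc hBj hBc.symm, Complex.normSq_eq_norm_sq,
    Complex.normSq_eq_norm_sq] at h1
  exact ((sq_eq_sq₀ (norm_nonneg _) (norm_nonneg _)).1 h1).symm

/-- On {K = j} the two complex structures coincide. -/
theorem detOnMinus_neg_eq {A : Module.End ℝ V} (hAj : Commute A j.J) (hA : Commute A c.J) :
    detOnMinus j.toComplexStructure (-c.J) hc.neg_right A hA.neg_right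
      = detOnMinus c (-j.J) hc.symm.neg_right A hAj.neg_right := by
  let e : minusSpace j.toComplexStructure (-c.J) hc.neg_right
      ≃ₗ[ℂ] minusSpace c (-j.J) hc.symm.neg_right :=
    { toFun := fun w => ⟨w.1.val, by
        have h1 : -c.J w.1.val = -j.J w.1.val := w.2
        change -j.J w.1.val = -c.J w.1.val
        rw [h1]⟩
      invFun := fun w => ⟨w.1.val, by
        have h1 : -j.J w.1.val = -c.J w.1.val := w.2
        change -c.J w.1.val = -j.J w.1.val
        rw [h1]⟩
      map_add' := fun _ _ => rfl
      map_smul' := fun z w => by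
        apply Subtype.ext
        have h1 : -c.J w.1.val = -j.J w.1.val := w.2
        change z.re • w.1.val + z.im • j.J w.1.val = z.re • w.1.val + z.im • c.J w.1.val
        rw [neg_inj.1 h1]
      left_inv := fun _ => rfl
      right_inv := fun _ => rfl }
  rw [detOnMinus, detOnMinus, ← LinearMap.det_conj _ e]
  congr 1
  refine LinearMap.ext fun w => Subtype.ext ?_
  change linearPart j.toComplexStructure A w.1.val = linearPart c A w.1.val
  rw [linearPart_eq_of_commute _ hAj.symm, linearPart_eq_of_commute _ hA.symm]

/-- An operator commuting with `K` and anticommuting with `j` exchanges `{K = -j}` and `{K = j}`,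
complex linearly for `K`. -/
def exchangeMap {A : Module.End ℝ V} (hA : ∀ w, A (j.J w) = -j.J (A w)) (hAc : Commute A c.J) :
    minusSpace c j.J hc.symm →ₗ[ℂ] minusSpace c (-j.J) hc.symm.neg_right where
  toFun w := ⟨CxSpace.of c (A w.1.val), by
    have h1 : j.J w.1.val = -c.J w.1.val := w.2
    have h2 : A (c.J w.1.val) = c.J (A w.1.val) := LinearMap.congr_fun hAc w.1.val
    change -j.J (A w.1.val) = -c.J (A w.1.val)
    rw [← hA, h1, map_neg, h2]⟩
  map_add' v w := Subtype.ext (A.map_add v.1.val w.1.val)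
  map_smul' z w := by
    apply Subtype.ext
    have h2 : A (c.J w.1.val) = c.J (A w.1.val) := LinearMap.congr_fun hAc w.1.val
    change A (z.re • w.1.val + z.im • c.J w.1.val) = z.re • A w.1.val + z.im • c.J (A w.1.val)
    rw [map_add, map_smul, map_smul, h2]

def exchangeMap' {A : Module.End ℝ V} (hA : ∀ w, A (j.J w) = -j.J (A w)) (hAc : Commute A c.J) :
    minusSpace c (-j.J) hc.symm.neg_right →ₗ[ℂ] minusSpace c j.J hc.symm where
  toFun w := ⟨CxSpace.of c (A w.1.val), by
    have h1 : -j.J w.1.val = -c.J w.1.val := w.2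
    have h2 : A (c.J w.1.val) = c.J (A w.1.val) := LinearMap.congr_fun hAc w.1.val
    change j.J (A w.1.val) = -c.J (A w.1.val)
    rw [← neg_neg (j.J (A _)), ← hA, neg_inj.1 h1, h2]⟩
  map_add' v w := Subtype.ext (A.map_add v.1.val w.1.val)
  map_smul' z w := by
    apply Subtype.ext
    have h2 : A (c.J w.1.val) = c.J (A w.1.val) := LinearMap.congr_fun hAc w.1.val
    change A (z.re • w.1.val + z.im • c.J w.1.val) = z.re • A w.1.val + z.im • c.J (A w.1.val)
    rw [map_add, map_smul, map_smul, h2]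

variable {j} in
theorem commute_one_sub_mul {c : ComplexStructure V} {Y Z : Module.End ℝ V} (hYc : Commute Y c.J)
    (hZc : Commute Z c.J) : Commute (1 - Z * Y) c.J :=
  (Commute.one_left _).sub_left (hZc.mul_left hYc)

/-- For symmetric antilinear operators commuting with a second complex structure `K`, the operator
`1 - Z Y` has the same determinant on `{K = -j}` and on `{K = j}`. -/
theorem detOnMinus_one_sub_mul {Y Z : Module.End ℝ V} (hY : j.IsSymmAnti Y) (hZ : j.IsSymmAnti Z)
    (hYc : Commute Y c.J) (hZc : Commute Z c.J) :
    detOnMinus j.toComplexStructure c.J hc (1 - Z * Y) (commute_one_sub_mul hYc hZc)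
      = detOnMinus j.toComplexStructure (-c.J) hc.neg_right (1 - Z * Y)
        (commute_one_sub_mul hYc hZc).neg_right := by
  have h1 : ∀ {A B : Module.End ℝ V}, j.IsSymmAnti A → j.IsSymmAnti B →
      Commute j.J (1 - A * B) := fun hA hB =>
    (Commute.one_right _).sub_right (hA.commute_mul hB)
  have hadj : ∀ v w, j.G ((1 - Z * Y) v) w = j.G v ((1 - Y * Z) w) := by
    intro v w
    simp only [LinearMap.sub_apply, Module.End.one_apply, Module.End.mul_apply, map_sub, hZ.symm,
      hY.symm]
  -- Everything is rewritten with K as the complex structure: on {K = -j} the pairing replaces 1 -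
  -- ZY by 1 - YZ, on {K = j} the operator stays 1 - ZY. Since Y and Z exchange the two spaces
  -- K-linearly, the claim is then Det(1 - BA) = Det(1 - AB) for maps between different spaces.
  rw [detOnMinus_neg_eq j c hc (h1 hZ hY).symm (commute_one_sub_mul hYc hZc),
    detOnMinus_adjoint j c hc hadj (h1 hZ hY) _ (h1 hY hZ).symm (commute_one_sub_mul hZc hYc).symm]
  have e1 : (linearPartCx c (1 - Y * Z)).restrict (linearPartCx_mem_minusSpace c j.J hc.symm
      (1 - Y * Z) (h1 hY hZ).symm)
      = 1 - exchangeMap' j c hc hY.anti hYc ∘ₗ exchangeMap j c hc hZ.anti hZc := by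
    refine LinearMap.ext fun w => Subtype.ext ?_
    change linearPart c (1 - Y * Z) w.1.val = w.1.val - Y (Z w.1.val)
    rw [linearPart_eq_of_commute _ (commute_one_sub_mul hZc hYc).symm]
    rfl
  have e2 : (linearPartCx c (1 - Z * Y)).restrict (linearPartCx_mem_minusSpace c (-j.J)
      hc.symm.neg_right (1 - Z * Y) (h1 hZ hY).symm.neg_right)
      = 1 - exchangeMap j c hc hZ.anti hZc ∘ₗ exchangeMap' j c hc hY.anti hYc := by
    refine LinearMap.ext fun w => Subtype.ext ?_
    change linearPart c (1 - Z * Y) w.1.val = w.1.val - Z (Y w.1.val)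
    rw [linearPart_eq_of_commute _ (commute_one_sub_mul hYc hZc).symm]
    rfl
  rw [detOnMinus, detOnMinus, e1, e2, det_one_sub_comp_comm]

end Second

/-! ### Real Gaussian integrals and the Gaussian probability measure -/

section WithDensity

variable {α E : Type*} [MeasurableSpace α] [NormedAddCommGroup E] [NormedSpace ℝ E]
  (m : Measure α) {ρ : α → ℝ} (hρ : Measurable ρ) (hρ0 : ∀ x, 0 ≤ ρ x)

include hρ hρ0

theorem integral_withDensity_ofReal (f : α → E) :
    ∫ x, f x ∂(m.withDensity fun x => ENNReal.ofReal (ρ x)) = ∫ x, ρ x • f x ∂m := by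
  rw [integral_withDensity_eq_integral_toReal_smul hρ.ennreal_ofReal
    (Filter.Eventually.of_forall fun _ => ENNReal.ofReal_lt_top)]
  simp only [ENNReal.toReal_ofReal (hρ0 _)]

theorem integrable_withDensity_ofReal (f : α → E) :
    Integrable f (m.withDensity fun x => ENNReal.ofReal (ρ x))
      ↔ Integrable (fun x => ρ x • f x) m := by
  rw [integrable_withDensity_iff_integrable_smul' hρ.ennreal_ofReal
    (Filter.Eventually.of_forall fun _ => ENNReal.ofReal_lt_top)]
  simp only [ENNReal.toReal_ofReal (hρ0 _)]

end WithDensity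

section Frame

variable {V : Type*} [AddCommGroup V] [Module ℝ V] [FiniteDimensional ℝ V] {Ω : SymplecticForm V}
  (j : PCCS Ω)

theorem PCCS.finrank_eq : Module.finrank ℝ V = 2 * Module.finrank ℂ (CxSpace j.toComplexStructure) := by
  rw [← (CxSpace.realEquiv j.toComplexStructure).finrank_eq, finrank_real_of_complex]

/-- These are orthonormal coordinates for the inner product G_j(A v, w); in them the Gaussian with
quadratic form A is standard. -/
theorem exists_frame_of_pos {A : Module.End ℝ V} (hs : ∀ v w, j.G (A v) w = j.G v (A w))
    (hp : ∀ v, v ≠ 0 → 0 < j.G (A v) v) :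
    ∃ L : EuclideanSpace ℝ (Fin (Module.finrank ℝ V)) ≃ₗ[ℝ] V,
      ∀ x y, j.G (A (L x)) (L y) = inner ℝ x y := by
  have h0 : ∀ v, 0 ≤ j.G (A v) v := fun v => by
    by_cases hv : v = 0
    · simp [hv]
    · exact (hp v hv).le
  let core : InnerProductSpace.Core ℝ V :=
    { inner := fun v w => j.G (A v) w
      conj_inner_symm := fun v w => by
        change j.G (A w) v = j.G (A v) w
        rw [hs, j.G_comm]
      re_inner_nonneg := fun v => h0 v
      add_left := fun u v w => by simp
      smul_left := fun v w r => by simp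
      definite := fun v h => by
        by_contra hv
        exact (hp v hv).ne' h }
  let : NormedAddCommGroup V := core.toNormedAddCommGroup
  let : InnerProductSpace ℝ V := InnerProductSpace.ofCore core.toCore
  refine ⟨(stdOrthonormalBasis ℝ V).repr.symm.toLinearEquiv, fun x y => ?_⟩
  exact (stdOrthonormalBasis ℝ V).repr.symm.inner_map_map x y

/-- Positive quadratic forms are bounded below. -/
theorem PCCS.exists_lower_bound (B : LinearMap.BilinForm ℝ V) (hB : ∀ v, v ≠ 0 → 0 < B v v) :
    ∃ κ : ℝ, 0 < κ ∧ ∀ v, κ * j.G v v ≤ B v v := by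
  let q : EuclideanSpace ℝ (Fin (Module.finrank ℝ V)) → ℝ := fun x => B (j.frame x) (j.frame x)
  have hq : Continuous q := by
    have h2 : Continuous fun p : EuclideanSpace ℝ (Fin (Module.finrank ℝ V))
        × EuclideanSpace ℝ (Fin (Module.finrank ℝ V)) => B (j.frame p.1) (j.frame p.2) := by
      let B' := (B.compl₁₂ j.frame.toLinearMap j.frame.toLinearMap).toContinuousBilinearMap
      exact (B'.continuous.comp continuous_fst).clm_apply continuous_snd
    exact h2.comp (continuous_id.prodMk continuous_id)
  have hscale : ∀ (r : ℝ) x, q (r • x) = r ^ 2 * q x := by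
    intro r x
    simp only [q, map_smul, LinearMap.smul_apply, smul_eq_mul]
    ring
  have hGq : ∀ v, j.G v v = ‖j.frame.symm v‖ ^ 2 := fun v => by
    rw [← real_inner_self_eq_norm_sq, ← j.G_frame, LinearEquiv.apply_symm_apply]
  -- The sphere is empty only when V = 0. Otherwise its compactness yields the constant, as the
  -- minimum of the form on it.
  rcases (Metric.sphere (0 : EuclideanSpace ℝ (Fin (Module.finrank ℝ V))) 1).eq_empty_or_nonempty
    with he | hne
  · refine ⟨1, one_pos, fun v => ?_⟩
    have hv : v = 0 := by
      by_contra hv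
      have hx : j.frame.symm v ≠ 0 := by simpa using hv
      have : ‖j.frame.symm v‖⁻¹ • j.frame.symm v
          ∈ Metric.sphere (0 : EuclideanSpace ℝ (Fin (Module.finrank ℝ V))) 1 := by
        rw [mem_sphere_zero_iff_norm, norm_smul, norm_inv, norm_norm,
          inv_mul_cancel₀ (norm_ne_zero_iff.2 hx)]
      rw [he] at this
      exact this
    simp [hv]
  · obtain ⟨x, hx, hmin⟩ := (isCompact_sphere _ _).exists_isMinOn hne hq.continuousOn
    have hx0 : j.frame x ≠ 0 := by
      rw [mem_sphere_zero_iff_norm] at hx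
      intro h
      rw [LinearEquiv.map_eq_zero_iff] at h
      rw [h] at hx
      simp at hx
    refine ⟨q x, hB _ hx0, fun v => ?_⟩
    by_cases hv : v = 0
    · simp [hv]
    have hy : j.frame.symm v ≠ 0 := by simpa using hv
    have hmem : ‖j.frame.symm v‖⁻¹ • j.frame.symm v
        ∈ Metric.sphere (0 : EuclideanSpace ℝ (Fin (Module.finrank ℝ V))) 1 := by
      rw [mem_sphere_zero_iff_norm, norm_smul, norm_inv, norm_norm,
        inv_mul_cancel₀ (norm_ne_zero_iff.2 hy)]
    have h1 := hmin hmem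
    have hn : 0 < ‖j.frame.symm v‖ := norm_pos_iff.2 hy
    change q x ≤ q (‖j.frame.symm v‖⁻¹ • j.frame.symm v) at h1
    rw [hscale, inv_pow, inv_mul_eq_div, le_div_iff₀ (by positivity), ← hGq] at h1
    simpa [q] using h1

end Frame

section Gaussian

variable {V : Type*} [NormedAddCommGroup V] [NormedSpace ℝ V] [FiniteDimensional ℝ V]
  {Ω : SymplecticForm V} (j : PCCS Ω) (ħ : ℝ)

theorem continuous_quadratic (B : LinearMap.BilinForm ℝ V) : Continuous fun z => B z z :=
  (B.toContinuousBilinearMap.continuous).clm_apply continuous_id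

/-- `z ↦ G_j(A z, z)` as the diagonal of a bilinear form. -/
theorem PCCS.continuous_G_comp (A : Module.End ℝ V) : Continuous fun z => j.G (A z) z :=
  continuous_quadratic (j.G ∘ₗ A)

theorem PCCS.continuous_herm_comp (A : Module.End ℝ V) : Continuous fun z => j.herm z (A z) := by
  have h1 := continuous_quadratic (j.G.compl₂ A)
  have h2 := continuous_quadratic (Ω.form.compl₂ A)
  simp only [PCCS.herm]
  exact (Complex.continuous_ofReal.comp h1).sub
    (continuous_const.mul (Complex.continuous_ofReal.comp h2))

variable [MeasurableSpace V] [BorelSpace V]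

/-- The normalising factor `h⁻ⁿ`, with `h = 2πħ` and `2n = dim V`. -/
def gaussConst (V : Type*) [AddCommGroup V] [Module ℝ V] (ħ : ℝ) : ℝ :=
  ((2 * Real.pi * ħ) ^ (Module.finrank ℝ V / 2))⁻¹

/-- A frame for G_j(A ·, ·) and the frame for G_j differ by an operator T of Euclidean space with
T*T conjugate to A. Substituting T reduces to the standard Gaussian, with Jacobian |Det T| = √Det A.
-/
theorem integral_gaussian_of_pos {ħ : ℝ} (hħ : 0 < ħ) {A : Module.End ℝ V}
    (hs : ∀ v w, j.G (A v) w = j.G v (A w)) (hp : ∀ v, v ≠ 0 → 0 < j.G (A v) v) :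
    Integrable (fun z => Real.exp (-(j.G (A z) z) / (2 * ħ))) j.lebesgue ∧
    gaussConst V ħ * ∫ z, Real.exp (-(j.G (A z) z) / (2 * ħ)) ∂j.lebesgue
      = (Real.sqrt (LinearMap.det A))⁻¹ := by
  obtain ⟨L, hL⟩ := exists_frame_of_pos j hs hp
  let E := EuclideanSpace ℝ (Fin (Module.finrank ℝ V))
  let T : E ≃ₗ[ℝ] E := j.frame.trans L.symm
  have hT : ∀ x, L (T x) = j.frame x := fun x => L.apply_symm_apply _
  have hTin : ∀ x y, inner ℝ (T x) (T y) = j.G (A (j.frame x)) (j.frame y) := fun x y => by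
    rw [← hL, hT, hT]
  have hdet : LinearMap.det T.toLinearMap ^ 2 = LinearMap.det A := by
    have h1 : LinearMap.adjoint T.toLinearMap * T.toLinearMap
        = j.frame.symm.toLinearMap ∘ₗ A ∘ₗ j.frame.symm.symm.toLinearMap := by
      refine LinearMap.ext fun x => ext_inner_right ℝ fun y => ?_
      rw [Module.End.mul_apply, LinearMap.adjoint_inner_left]
      simp only [LinearEquiv.coe_coe, LinearMap.comp_apply, LinearEquiv.symm_symm]
      rw [hTin, ← j.G_frame, LinearEquiv.apply_symm_apply]
    have h2 : LinearMap.det (LinearMap.adjoint T.toLinearMap) = LinearMap.det T.toLinearMap := by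
      rw [← LinearMap.det_toMatrix (EuclideanSpace.basisFun (Fin (Module.finrank ℝ V)) ℝ).toBasis,
        LinearMap.toMatrix_adjoint, Matrix.det_conjTranspose, LinearMap.det_toMatrix]
      rfl
    rw [← LinearMap.det_conj A j.frame.symm, ← h1, map_mul, h2, sq]
  have hTdet : LinearMap.det T.toLinearMap ≠ 0 := T.isUnit_det'.ne_zero
  have hmap : Measure.map T (volume : Measure E)
      = ENNReal.ofReal |(LinearMap.det T.toLinearMap)⁻¹| • volume :=
    Measure.map_linearMap_addHaar_eq_smul_addHaar volume hTdet
  have hframe : (j.frame.toContinuousLinearEquiv.toHomeomorph.toMeasurableEquiv : E → V)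
      = j.frame := rfl
  have hTe : (T.toContinuousLinearEquiv.toHomeomorph.toMeasurableEquiv : E → E) = T := rfl
  have hfun : ∀ x : E, Real.exp (-(j.G (A (j.frame x)) (j.frame x)) / (2 * ħ))
      = Real.exp (-((2 * ħ)⁻¹) * ‖T x‖ ^ 2) := by
    intro x
    rw [← hTin, real_inner_self_eq_norm_sq]
    congr 1
    ring
  have hb : 0 < (2 * ħ)⁻¹ := by positivity
  have hint : Integrable (fun x : E => Real.exp (-((2 * ħ)⁻¹) * ‖x‖ ^ 2)) := by
    have h := (GaussianFourier.integrable_cexp_neg_mul_sq_norm_add (V := E) (b := ((2 * ħ)⁻¹ : ℝ))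
      (by rw [Complex.ofReal_re]; exact hb) 0 0).norm
    refine h.congr (Filter.Eventually.of_forall fun x => ?_)
    simp only [Complex.norm_exp, zero_mul, add_zero]
    rw [← Complex.ofReal_pow, ← Complex.ofReal_neg, ← Complex.ofReal_mul, Complex.ofReal_re]
  constructor
  · rw [PCCS.lebesgue, ← hframe, integrable_map_equiv, hframe]
    simp only [Function.comp_def, hfun]
    have h := (integrable_map_equiv (μ := (volume : Measure E))
      T.toContinuousLinearEquiv.toHomeomorph.toMeasurableEquiv
      (fun x : E => Real.exp (-((2 * ħ)⁻¹) * ‖x‖ ^ 2)))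
    rw [hTe, hmap] at h
    exact h.1 (hint.smul_measure ENNReal.ofReal_ne_top)
  · have h := (integral_map_equiv (μ := (volume : Measure E))
      T.toContinuousLinearEquiv.toHomeomorph.toMeasurableEquiv
      (fun x : E => Real.exp (-((2 * ħ)⁻¹) * ‖x‖ ^ 2)))
    rw [hTe, hmap, integral_smul_measure, GaussianFourier.integral_rexp_neg_mul_sq_norm hb,
      ENNReal.toReal_ofReal (abs_nonneg _), abs_inv] at h
    rw [PCCS.lebesgue, ← hframe, integral_map_equiv, hframe]
    simp only [hfun]
    rw [← h, ← hdet, Real.sqrt_sq_eq_abs, smul_eq_mul]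
    have hfin : Module.finrank ℝ E = Module.finrank ℝ V := finrank_euclideanSpace_fin
    -- The natural number division by 2 in the normalising constant is exact, because a space with a
    -- complex structure has even real dimension.
    have hpow : (Real.pi / (2 * ħ)⁻¹) ^ ((Module.finrank ℝ E : ℝ) / 2)
        = (2 * Real.pi * ħ) ^ (Module.finrank ℝ V / 2) := by
      rw [hfin, j.finrank_eq, Nat.mul_div_cancel_left _ two_pos, ← Real.rpow_natCast]
      congr 1
      · field_simp
      · push_cast
        ring
    rw [hpow, gaussConst]
    have : (2 * Real.pi * ħ) ^ (Module.finrank ℝ V / 2) ≠ 0 := by positivity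
    field_simp

theorem PCCS.continuous_gaussDensity (j : PCCS Ω) (ħ : ℝ) :
    Continuous fun z => gaussConst V ħ * j.weight ħ z :=
  continuous_const.mul (j.continuous_weight ħ)

/-- The Gaussian probability measure `h⁻ⁿ exp (-|z|_j² / 2ħ) dz`. -/
def PCCS.gauss : Measure V :=
  j.lebesgue.withDensity fun z => ENNReal.ofReal (gaussConst V ħ * j.weight ħ z)

variable {ħ} (hħ : 0 < ħ)

theorem gaussConst_pos (V : Type*) [AddCommGroup V] [Module ℝ V] {ħ : ℝ} (hħ : 0 < ħ) :
    0 < gaussConst V ħ := by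
  rw [gaussConst]
  positivity

theorem PCCS.gaussDensity_pos {ħ : ℝ} (hħ : 0 < ħ) (z : V) :
    0 < gaussConst V ħ * j.weight ħ z :=
  mul_pos (gaussConst_pos V hħ) (Real.exp_pos _)

include hħ

theorem integral_gauss {E : Type*} [NormedAddCommGroup E] [NormedSpace ℝ E] (f : V → E) :
    ∫ z, f z ∂(j.gauss ħ) = ∫ z, (gaussConst V ħ * j.weight ħ z) • f z ∂j.lebesgue :=
  integral_withDensity_ofReal _ (j.continuous_gaussDensity ħ).measurable
    (fun z => (j.gaussDensity_pos hħ z).le) f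

theorem integrable_gauss {E : Type*} [NormedAddCommGroup E] [NormedSpace ℝ E] (f : V → E) :
    Integrable f (j.gauss ħ)
      ↔ Integrable (fun z => (gaussConst V ħ * j.weight ħ z) • f z) j.lebesgue :=
  integrable_withDensity_ofReal _ (j.continuous_gaussDensity ħ).measurable
    (fun z => (j.gaussDensity_pos hħ z).le) f

theorem gaussDensity_mul_exp (A : Module.End ℝ V) (z : V) :
    (gaussConst V ħ * j.weight ħ z) * Real.exp (-(j.G (A z) z) / (2 * ħ))
      = gaussConst V ħ * Real.exp (-(j.G ((1 + A) z) z) / (2 * ħ)) := by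
  rw [mul_assoc, PCCS.weight, ← Real.exp_add, LinearMap.add_apply, Module.End.one_apply, map_add,
    LinearMap.add_apply]
  congr 2
  ring

theorem integrable_gauss_exp {A : Module.End ℝ V} (hs : ∀ v w, j.G (A v) w = j.G v (A w))
    (hp : ∀ v, v ≠ 0 → 0 < j.G ((1 + A) v) v) :
    Integrable (fun z => Real.exp (-(j.G (A z) z) / (2 * ħ))) (j.gauss ħ) := by
  rw [integrable_gauss j hħ]
  simp only [smul_eq_mul, gaussDensity_mul_exp j hħ]
  exact (integral_gaussian_of_pos j hħ (fun v w => by simp [hs]) hp).1.const_mul _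

theorem integral_gauss_exp {A : Module.End ℝ V} (hs : ∀ v w, j.G (A v) w = j.G v (A w))
    (hp : ∀ v, v ≠ 0 → 0 < j.G ((1 + A) v) v) :
    ∫ z, Real.exp (-(j.G (A z) z) / (2 * ħ)) ∂(j.gauss ħ)
      = (Real.sqrt (LinearMap.det (1 + A)))⁻¹ := by
  rw [integral_gauss j hħ]
  simp only [smul_eq_mul, gaussDensity_mul_exp j hħ]
  rw [integral_const_mul]
  exact (integral_gaussian_of_pos j hħ (fun v w => by simp [hs]) hp).2

theorem isProbabilityMeasure_gauss : IsProbabilityMeasure (j.gauss ħ) := by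
  have hp : ∀ v, v ≠ 0 → 0 < j.G ((1 + (0 : Module.End ℝ V)) v) v := fun v hv => by
    simpa using j.G_pos v hv
  have h1 := integrable_gauss_exp j hħ (A := 0) (by simp) hp
  have h2 := integral_gauss_exp j hħ (A := 0) (by simp) hp
  simp only [LinearMap.zero_apply, map_zero, neg_zero, zero_div, Real.exp_zero, add_zero, map_one,
    Real.sqrt_one, inv_one] at h1 h2
  have hfin : IsFiniteMeasure (j.gauss ħ) := by
    rw [integrable_const_iff] at h1
    exact h1.resolve_left one_ne_zero
  rw [integral_const, smul_eq_mul, mul_one] at h2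
  exact ⟨(ENNReal.toReal_eq_one_iff _).1 h2⟩

theorem gauss_absolutelyContinuous : j.lebesgue ≪ j.gauss ħ := by
  refine withDensity_absolutelyContinuous' ?_ ?_
  · exact (j.continuous_gaussDensity ħ).measurable.ennreal_ofReal.aemeasurable
  · refine Filter.Eventually.of_forall fun z => ?_
    simpa using j.gaussDensity_pos hħ z

/-- This is what makes a Fock function, being continuous, determined by its class in L². -/
theorem isOpenPosMeasure_gauss : (j.gauss ħ).IsOpenPosMeasure :=
  (gauss_absolutelyContinuous j hħ).isOpenPosMeasure

end Gaussian

/-! ### Strict contractions and their perturbations -/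

section Contraction

variable {V : Type*} [AddCommGroup V] [Module ℝ V] [FiniteDimensional ℝ V] {Ω : SymplecticForm V}
  {j : PCCS Ω}

variable (j) in
/-- Strict contractions of `(V, G_j)`. -/
def PCCS.IsContr (Z : Module.End ℝ V) : Prop := ∀ v, v ≠ 0 → j.G (Z v) (Z v) < j.G v v

theorem PCCS.two_G_le (v w : V) : 2 * j.G v w ≤ j.G v v + j.G w w := by
  have h := j.G_nonneg (v - w)
  simp only [map_sub, LinearMap.sub_apply] at h
  rw [j.G_comm w v] at h
  linarith

theorem PCCS.neg_two_G_le (v w : V) : -(2 * j.G v w) ≤ j.G v v + j.G w w := by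
  have h := j.G_nonneg (v + w)
  simp only [map_add, LinearMap.add_apply] at h
  rw [j.G_comm w v] at h
  linarith

theorem PCCS.IsContr.le {Z : Module.End ℝ V} (hZ : j.IsContr Z) (v : V) :
    j.G (Z v) (Z v) ≤ j.G v v := by
  by_cases hv : v = 0
  · simp [hv]
  · exact (hZ v hv).le

theorem PCCS.IsContr.half_add {Y Z : Module.End ℝ V} (hY : j.IsContr Y) (hZ : j.IsContr Z) :
    j.IsContr ((1 / 2 : ℝ) • (Z + Y)) := by
  intro v hv
  have h1 := hY v hv
  have h2 := hZ v hv
  have h3 := j.two_G_le (Z v) (Y v)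
  simp only [LinearMap.smul_apply, LinearMap.add_apply, map_smul, map_add, smul_eq_mul]
  rw [j.G_comm (Y v) (Z v)]
  linarith

theorem PCCS.IsContr.half_sub_le {Y Z : Module.End ℝ V} (hY : j.IsContr Y) (hZ : j.IsContr Z)
    (v : V) : j.G (((1 / 2 : ℝ) • (Y - Z)) v) (((1 / 2 : ℝ) • (Y - Z)) v) ≤ j.G v v := by
  have h1 := hY.le v
  have h2 := hZ.le v
  have h3 := j.neg_two_G_le (Z v) (Y v)
  simp only [LinearMap.smul_apply, LinearMap.sub_apply, map_smul, map_sub, smul_eq_mul]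
  rw [j.G_comm (Y v) (Z v)]
  linarith

theorem PCCS.IsContr.smul {Z : Module.End ℝ V} (hZ : j.IsContr Z) {t : ℝ}
    (ht : t ∈ Set.Icc (0 : ℝ) 1) : j.IsContr (t • Z) := by
  intro v hv
  have h1 := hZ v hv
  have h2 := j.G_nonneg (Z v)
  simp only [LinearMap.smul_apply, map_smul, smul_eq_mul]
  have : t * (t * j.G (Z v) (Z v)) ≤ j.G (Z v) (Z v) := by
    rw [← mul_assoc]
    exact mul_le_of_le_one_left h2 (by nlinarith [ht.1, ht.2])
  linarith

theorem PCCS.IsContr.exists_gap {S : Module.End ℝ V} (hS : j.IsContr S) :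
    ∃ κ : ℝ, 0 < κ ∧ ∀ v, j.G (S v) (S v) ≤ (1 - κ) * j.G v v := by
  obtain ⟨κ, h0, h⟩ := j.exists_lower_bound (j.G - j.G.compl₁₂ S S) (fun v hv => by
    simpa using hS v hv)
  refine ⟨κ, h0, fun v => ?_⟩
  have := h v
  simp only [LinearMap.sub_apply, LinearMap.compl₁₂_apply] at this
  linarith

/-- The bound on y comes from expanding |Sv + y Rv|²: since |Sv| and |Rv| are at most |v|, the cross
term costs at most 2|y| |v|² and the last term y² |v|², which the gap κ has to absorb. -/
theorem PCCS.IsContr.add_smul {S R : Module.End ℝ V} {κ : ℝ}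
    (hS : ∀ v, j.G (S v) (S v) ≤ (1 - κ) * j.G v v) (hS' : j.IsContr S)
    (hR : ∀ v, j.G (R v) (R v) ≤ j.G v v) {y : ℝ} (hy : 2 * |y| + y ^ 2 < κ) :
    j.IsContr (S + y • R) := by
  intro v hv
  have h1 := hS v
  have h2 := hR v
  have h3 := hS'.le v
  have h4 : |j.G (S v) (R v)| ≤ j.G v v := by
    rw [abs_le]
    have a1 := j.two_G_le (S v) (R v)
    have a2 := j.neg_two_G_le (S v) (R v)
    constructor <;> linarith
  have h5 : y * j.G (S v) (R v) ≤ |y| * j.G v v := by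
    refine (le_abs_self _).trans ?_
    rw [abs_mul]
    exact mul_le_mul_of_nonneg_left h4 (abs_nonneg _)
  have h6 : y ^ 2 * j.G (R v) (R v) ≤ y ^ 2 * j.G v v :=
    mul_le_mul_of_nonneg_left h2 (sq_nonneg _)
  have h7 : (2 * |y| + y ^ 2) * j.G v v < κ * j.G v v :=
    mul_lt_mul_of_pos_right hy (j.G_pos v hv)
  simp only [LinearMap.smul_apply, LinearMap.add_apply, map_smul, map_add, smul_eq_mul]
  rw [j.G_comm (R v) (S v)]
  nlinarith

end Contraction

/-! ### The complex Gaussian integral and its square -/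

section Pairing

variable {V : Type*} [NormedAddCommGroup V] [NormedSpace ℝ V] [FiniteDimensional ℝ V]
  {Ω : SymplecticForm V} (j : PCCS Ω) [MeasurableSpace V] [BorelSpace V]

/-- The pairing of the Gaussians `exp (-⟨z, Z z⟩ / 4ħ)` and `exp (-⟨z, Y z⟩ / 4ħ)`. -/
def gaussPairing (ħ : ℝ) (Z Y : Module.End ℝ V) : ℂ :=
  ∫ z, Complex.exp (-(j.herm z (Z z) + (starRingEnd ℂ) (j.herm z (Y z))) / (4 * ħ)) ∂(j.gauss ħ)

variable {j} {ħ : ℝ} (hħ : 0 < ħ)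

/-- The shape prepares the analytic continuation: the exponent is that of a real Gaussian with form
S = ½(Z + Y), plus s times a real quadratic form with operator R = ½ j(Y - Z), taken at s = -i. Both
S and R are symmetric and antilinear. -/
theorem gaussPairing_exponent (Y Z : Module.End ℝ V) (z : V) : -(j.herm z (Z z) + (starRingEnd ℂ) (j.herm z (Y z))) / (4 * ħ)
      = ((-(j.G (((1 / 2 : ℝ) • (Z + Y)) z) z) / (2 * ħ) : ℝ) : ℂ)
        + -Complex.I * ((-(j.G ((j.J * ((1 / 2 : ℝ) • (Y - Z))) z) z) / (2 * ħ) : ℝ) : ℂ) := by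
  have h1 : j.G (Z z) z = j.G z (Z z) := j.G_comm _ _
  have h2 : j.G (Y z) z = j.G z (Y z) := j.G_comm _ _
  have h3 : j.G (j.J (Z z)) z = Ω.form z (Z z) * (-1) := by
    rw [j.form_eq, j.G_comm]; ring
  have h4 : j.G (j.J (Y z)) z = Ω.form z (Y z) * (-1) := by
    rw [j.form_eq, j.G_comm]; ring
  simp only [PCCS.herm, Module.End.mul_apply, LinearMap.smul_apply, LinearMap.add_apply,
    LinearMap.sub_apply, map_smul, map_add, map_sub, smul_eq_mul, h1, h2, h3, h4, map_mul,
    Complex.conj_ofReal, Complex.conj_I]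
  push_cast
  ring

theorem norm_gaussPairing_integrand (Y Z : Module.End ℝ V) (z : V) :
    ‖Complex.exp (-(j.herm z (Z z) + (starRingEnd ℂ) (j.herm z (Y z))) / (4 * ħ))‖
      = Real.exp (-(j.G (((1 / 2 : ℝ) • (Z + Y)) z) z) / (2 * ħ)) := by
  rw [gaussPairing_exponent Y Z, Complex.norm_exp, Complex.add_re, Complex.ofReal_re]
  congr 1
  rw [neg_mul, Complex.neg_re, Complex.re_mul_ofReal, Complex.I_re, zero_mul, neg_zero,
    add_zero]

theorem PCCS.IsSymmAnti.half_add {Y Z : Module.End ℝ V} (hY : j.IsSymmAnti Y)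
    (hZ : j.IsSymmAnti Z) : j.IsSymmAnti ((1 / 2 : ℝ) • (Z + Y)) := (hZ.add hY).smul _

theorem PCCS.IsSymmAnti.half_sub {Y Z : Module.End ℝ V} (hY : j.IsSymmAnti Y)
    (hZ : j.IsSymmAnti Z) : j.IsSymmAnti ((1 / 2 : ℝ) • (Y - Z)) := by
  have : Y - Z = Y + (-1 : ℝ) • Z := by module
  rw [this]
  exact (hY.add (hZ.smul _)).smul _

include hħ

theorem integrable_gaussPairing {Y Z : Module.End ℝ V} (hY : j.IsSymmAnti Y)
    (hZ : j.IsSymmAnti Z) (hYc : j.IsContr Y) (hZc : j.IsContr Z) :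
    Integrable (fun z =>
      Complex.exp (-(j.herm z (Z z) + (starRingEnd ℂ) (j.herm z (Y z))) / (4 * ħ))) (j.gauss ħ) := by
  have h := integrable_gauss_exp j hħ (hY.half_add hZ).symm
    (j.G_one_add_pos (hYc.half_add hZc))
  refine h.mono' ?_ (Filter.Eventually.of_forall fun z =>
    (norm_gaussPairing_integrand Y Z z).le)
  refine Continuous.aestronglyMeasurable (Complex.continuous_exp.comp ?_)
  exact ((j.continuous_herm_comp Z).add
    (Complex.continuous_conj.comp (j.continuous_herm_comp Y))).neg.div_const _

theorem gaussPairing_self {Z : Module.End ℝ V} (hZ : j.IsSymmAnti Z) (hZc : j.IsContr Z) :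
    gaussPairing j ħ Z Z = (((Real.sqrt (LinearMap.det (1 + Z)))⁻¹ : ℝ) : ℂ) := by
  rw [gaussPairing, ← integral_gauss_exp j hħ hZ.symm (j.G_one_add_pos hZc), ← integral_complex_ofReal]
  congr 1
  funext z
  rw [Complex.ofReal_exp, gaussPairing_exponent Z Z]
  congr 1
  simp only [sub_self, smul_zero, mul_zero, LinearMap.zero_apply, map_zero, neg_zero, zero_div,
    Complex.ofReal_zero, add_zero]
  congr 5
  rw [← two_smul ℝ Z, smul_smul]
  norm_num

open ProbabilityTheory in
/-- The value of the Gaussian integral, up to sign: it is the inverse of a square root of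
`Det_j (1 - Y Z)`. -/
theorem gaussPairing_sq_mul {Y Z : Module.End ℝ V} (hY : j.IsSymmAnti Y) (hZ : j.IsSymmAnti Z)
    (hYc : j.IsContr Y) (hZc : j.IsContr Z) :
    gaussPairing j ħ Z Y ^ 2 * detLinearPart j.toComplexStructure (1 - Y * Z) = 1 := by
  classical
  -- With density ρ from S and random variable X from R, the pairing is the value at s = -i of the
  -- moment generating function of X. At real s = y it is a Gaussian integral with the operator S +
  -- yR, which can be evaluated.
  set S := (1 / 2 : ℝ) • (Z + Y) with hSdef
  set T := (1 / 2 : ℝ) • (Y - Z) with hTdef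
  set R := j.J * T with hRdef
  have hS : j.IsSymmAnti S := hY.half_add hZ
  have hT : j.IsSymmAnti T := hY.half_sub hZ
  have hR : j.IsSymmAnti R := hT.J_mul
  have hSc : j.IsContr S := hYc.half_add hZc
  have hRc : ∀ v, j.G (R v) (R v) ≤ j.G v v := fun v => by
    rw [hRdef, Module.End.mul_apply, j.G_JJ]
    exact hYc.half_sub_le hZc v
  obtain ⟨κ, hκ, hgap⟩ := hSc.exists_gap
  have hcontr : ∀ y : ℝ, 2 * |y| + y ^ 2 < κ → j.IsContr (S + y • R) := fun y hy =>
    PCCS.IsContr.add_smul hgap hSc hRc hy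
  have hsymm : ∀ y : ℝ, j.IsSymmAnti (S + y • R) := fun y => hS.add (hR.smul y)
  set ρ : V → ℝ := fun z => Real.exp (-(j.G (S z) z) / (2 * ħ)) with hρ
  have hρm : Measurable ρ := by
    refine (Real.continuous_exp.comp ?_).measurable
    exact (j.continuous_G_comp S).neg.div_const _
  have hρ0 : ∀ z, 0 ≤ ρ z := fun z => (Real.exp_pos _).le
  set m : Measure V := (j.gauss ħ).withDensity fun z => ENNReal.ofReal (ρ z) with hm
  set X : V → ℝ := fun z => -(j.G (R z) z) / (2 * ħ) with hX
  have hmul : ∀ (y : ℝ) z, ρ z • Real.exp (y * X z)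
      = Real.exp (-(j.G ((S + y • R) z) z) / (2 * ħ)) := by
    intro y z
    rw [smul_eq_mul, hρ, ← Real.exp_add]
    simp only [hX, LinearMap.add_apply, LinearMap.smul_apply, map_add, map_smul, smul_eq_mul]
    congr 1
    ring
  have hmem : ∀ y : ℝ, 2 * |y| + y ^ 2 < κ → y ∈ integrableExpSet X m := by
    intro y hy
    change Integrable (fun z => Real.exp (y * X z)) m
    rw [hm, integrable_withDensity_ofReal _ hρm hρ0]
    simp only [hmul]
    exact integrable_gauss_exp j hħ (hsymm y).symm (j.G_one_add_pos (hcontr y hy))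
  have hmgf : ∀ y : ℝ, 2 * |y| + y ^ 2 < κ →
      mgf X m y = (Real.sqrt (LinearMap.det (1 + (S + y • R))))⁻¹ := by
    intro y hy
    rw [mgf, hm, integral_withDensity_ofReal _ hρm hρ0]
    simp only [hmul]
    exact integral_gauss_exp j hħ (hsymm y).symm (j.G_one_add_pos (hcontr y hy))
  have hopen : IsOpen {y : ℝ | 2 * |y| + y ^ 2 < κ} :=
    isOpen_lt (by fun_prop) continuous_const
  have h0mem : (0 : ℝ) ∈ {y : ℝ | 2 * |y| + y ^ 2 < κ} := by simpa using hκ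
  have h0 : (0 : ℝ) ∈ interior (integrableExpSet X m) :=
    mem_interior.2 ⟨_, fun y hy => hmem y hy, hopen, h0mem⟩
  set c := j.toComplexStructure with hc
  set A₀ := linearPartCx c (S * S) with hA₀
  set A₁ := linearPartCx c (T * S - S * T) with hA₁
  set A₂ := linearPartCx c (T * T) with hA₂
  let b := Module.finBasis ℂ (CxSpace c)
  -- With R = jT one finds (S + yR)² = S² + y j(TS - ST) + y² T² for real y. As j is multiplication
  -- by i, this is S² + (iy)(TS - ST) - (iy)² T², a polynomial in y that continues to complex s. At
  -- s = -i it becomes (S + T)(S - T) = YZ.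
  let P : ℂ → ℂ := fun s => LinearMap.det
    (1 - (A₀ + (Complex.I * s) • A₁ - (Complex.I * s) ^ 2 • A₂))
  have hPan : AnalyticOnNhd ℂ P Set.univ := by
    have hP : P = fun s => (1 - (LinearMap.toMatrix b b A₀
        + (Complex.I * s) • LinearMap.toMatrix b b A₁
        - (Complex.I * s) ^ 2 • LinearMap.toMatrix b b A₂)).det := by
      funext s
      simp only [P]
      rw [← LinearMap.det_toMatrix b]
      simp only [map_sub, map_add, map_smul, LinearMap.toMatrix_one]
    rw [hP]
    refine fun s _ => Differentiable.analyticAt ?_ s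
    simp only [Matrix.det_apply]
    refine Differentiable.fun_sum fun σ _ => Differentiable.const_smul ?_ _
    refine Differentiable.fun_finsetProd fun i _ => ?_
    simp only [Matrix.sub_apply, Matrix.add_apply, Matrix.smul_apply, smul_eq_mul]
    fun_prop
  have hlin : ∀ {A : Module.End ℝ V}, Commute j.J A → ∀ w : CxSpace c,
      linearPartCx c A w = CxSpace.of c (A w.val) := fun {A} hA w => by
    change linearPart c A w.val = A w.val
    rw [linearPart_eq_of_commute c hA]
  have hSa : ∀ w, S (c.J w) = -c.J (S w) := hS.anti
  have hTa : ∀ w, T (c.J w) = -c.J (T w) := hT.anti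
  have cSS := hS.commute_mul hS
  have cTT := hT.commute_mul hT
  have cTS : Commute j.J (T * S - S * T) := (hT.commute_mul hS).sub_right (hS.commute_mul hT)
  have hPreal : ∀ y : ℝ, P y = detLinearPart c (1 - (S + y • R) * (S + y • R)) := by
    intro y
    simp only [P]
    rw [detLinearPart]
    congr 1
    refine LinearMap.ext fun w => ?_
    have hcm : Commute j.J (1 - (S + y • R) * (S + y • R)) :=
      (Commute.one_right _).sub_right ((hsymm y).commute_mul (hsymm y))
    rw [hlin hcm]
    have hI : Complex.I * (y : ℂ) = (y : ℂ) * Complex.I := mul_comm _ _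
    have hI2 : (Complex.I * (y : ℂ)) ^ 2 = ((-(y ^ 2) : ℝ) : ℂ) := by
      rw [mul_pow, Complex.I_sq]; push_cast; ring
    rw [hI2, hI]
    simp only [LinearMap.sub_apply, LinearMap.add_apply, LinearMap.smul_apply,
      Module.End.one_apply, hA₀, hA₁, hA₂, hlin cSS, hlin cTT, hlin cTS, CxSpace.smul_def]
    change w.val - ((S * S) w.val + (((y : ℂ) * Complex.I).re • (T * S - S * T) w.val
      + ((y : ℂ) * Complex.I).im • j.J ((T * S - S * T) w.val))
      - (((-(y ^ 2) : ℝ) : ℂ).re • (T * T) w.val + ((-(y ^ 2) : ℝ) : ℂ).im • j.J _))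
      = w.val - ((S + y • R) * (S + y • R)) w.val
    simp only [hRdef, Complex.ofReal_re, Complex.ofReal_im, Complex.re_ofReal_mul,
      Complex.im_ofReal_mul, Complex.I_re, Complex.I_im, mul_zero, mul_one, zero_smul, zero_add,
      add_zero, Module.End.mul_apply, LinearMap.sub_apply, LinearMap.add_apply,
      LinearMap.smul_apply, map_sub, map_add, map_smul, hSa, hTa, map_neg, c.sq]
    module
  have hPI : P (-Complex.I) = detLinearPart c (1 - Y * Z) := by
    simp only [P]
    rw [detLinearPart]
    congr 1
    have hI : Complex.I * -Complex.I = 1 := by rw [mul_neg, Complex.I_mul_I, neg_neg]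
    rw [hI, one_pow, one_smul, one_smul]
    refine LinearMap.ext fun w => ?_
    have hcm : Commute j.J (1 - Y * Z) := (Commute.one_right _).sub_right (hY.commute_mul hZ)
    rw [hlin hcm]
    simp only [LinearMap.sub_apply, LinearMap.add_apply,
      Module.End.one_apply, hA₀, hA₁, hA₂, hlin cSS, hlin cTT, hlin cTS]
    change w.val - ((S * S) w.val + (T * S - S * T) w.val - (T * T) w.val) = w.val - (Y * Z) w.val
    have hYZ : Y * Z = (S + T) * (S - T) := by
      congr 1
      · rw [hSdef, hTdef]; module
      · rw [hSdef, hTdef]; module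
    rw [hYZ]
    simp only [Module.End.mul_apply, LinearMap.sub_apply, LinearMap.add_apply, map_sub]
    abel
  have hstrip := convex_integrableExpSet (X := X) (μ := m)
  -- The identity holds at real s near 0 by the real Gaussian integral and
  -- `det_one_add_eq_detLinearPart`. The identity theorem extends it to the whole vertical strip,
  -- which contains -i because the real part of -i is 0.
  have key : Set.EqOn (fun s => complexMGF X m s ^ 2 * P s) (fun _ => (1 : ℂ))
      {s | s.re ∈ interior (integrableExpSet X m)} := by
    refine AnalyticOnNhd.eqOn_of_preconnected_of_frequently_eq
      ((analyticOnNhd_complexMGF.pow 2).mul (hPan.mono (Set.subset_univ _))) analyticOnNhd_const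
      (hstrip.interior.linear_preimage Complex.reLm).isPreconnected (z₀ := ((0 : ℝ) : ℂ))
      (by simpa using h0) ?_
    have hreal : ∃ᶠ y : ℝ in nhdsWithin 0 {0}ᶜ, complexMGF X m y ^ 2 * P y = 1 := by
      refine Filter.Eventually.frequently ?_
      filter_upwards [nhdsWithin_le_nhds (hopen.mem_nhds h0mem)] with y hy
      rw [complexMGF_ofReal, hmgf y hy, hPreal, ← det_one_add_eq_detLinearPart (hsymm y)
        (hcontr y hy), ← Complex.ofReal_pow, inv_pow,
        Real.sq_sqrt (det_pos_of_G_pos j (j.G_one_add_pos (hcontr y hy))).le, ← Complex.ofReal_mul,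
        inv_mul_cancel₀ (det_pos_of_G_pos j (j.G_one_add_pos (hcontr y hy))).ne', Complex.ofReal_one]
    have htend : Filter.Tendsto (fun y : ℝ => (y : ℂ)) (nhdsWithin 0 {0}ᶜ)
        (nhdsWithin ((0 : ℝ) : ℂ) {((0 : ℝ) : ℂ)}ᶜ) := by
      refine tendsto_nhdsWithin_of_tendsto_nhds_of_eventually_within _
        (Complex.continuous_ofReal.continuousAt.tendsto.mono_left nhdsWithin_le_nhds) ?_
      filter_upwards [self_mem_nhdsWithin] with y hy
      simpa using hy
    exact htend.frequently hreal
  have hval : complexMGF X m (-Complex.I) = gaussPairing j ħ Z Y := by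
    rw [complexMGF, hm, integral_withDensity_ofReal _ hρm hρ0, gaussPairing]
    congr 1
    funext z
    rw [gaussPairing_exponent Y Z, Complex.exp_add, Complex.real_smul, hρ, ← Complex.ofReal_exp]
  rw [← hPI, ← hval]
  exact key (x := -Complex.I) (by simpa using h0)

/-- Gaussian integrals depend continuously on their quadratic forms. -/
theorem continuousAt_gaussPairing {Y Z : ℝ → Module.End ℝ V} {t₀ : ℝ}
    (hYs : ∀ t, j.IsSymmAnti (Y t)) (hZs : ∀ t, j.IsSymmAnti (Z t))
    (hYc : j.IsContr (Y t₀)) (hZc : j.IsContr (Z t₀))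
    (hYt : ∀ v, ContinuousAt (fun t => Y t v) t₀) (hZt : ∀ v, ContinuousAt (fun t => Z t v) t₀) :
    ContinuousAt (fun t => gaussPairing j ħ (Z t) (Y t)) t₀ := by
  set S : ℝ → Module.End ℝ V := fun t => (1 / 2 : ℝ) • (Z t + Y t) with hS
  obtain ⟨κ, hκ, hlow⟩ := j.exists_lower_bound (j.G ∘ₗ (1 + S t₀))
    (fun v hv => j.G_one_add_pos (hYc.half_add hZc) v hv)
  let Gc := j.G.toContinuousBilinearMap
  let L := LinearMap.toContinuousLinearMap j.frame.toLinearMap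
  have hnorm : ∀ v, ‖v‖ ^ 2 ≤ ‖L‖ ^ 2 * j.G v v := by
    intro v
    have h1 : L (j.frame.symm v) = v := j.frame.apply_symm_apply v
    have h2 := L.le_opNorm (j.frame.symm v)
    rw [h1] at h2
    have h3 : j.G v v = ‖j.frame.symm v‖ ^ 2 := by
      rw [← real_inner_self_eq_norm_sq, ← j.G_frame, LinearEquiv.apply_symm_apply]
    rw [h3, ← mul_pow]
    exact pow_le_pow_left₀ (norm_nonneg _) h2 2
  have hcont : ContinuousAt (fun t => LinearMap.toContinuousLinearMap (S t - S t₀)) t₀ := by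
    rw [continuousAt_clm_apply]
    intro v
    change ContinuousAt (fun t => (1 / 2 : ℝ) • (Z t v + Y t v) - (1 / 2 : ℝ) • (Z t₀ v + Y t₀ v)) t₀
    exact (((hZt v).add (hYt v)).const_smul _).sub continuousAt_const
  have hsmall : ∀ᶠ t in nhds t₀, ‖Gc‖ * ‖LinearMap.toContinuousLinearMap (S t - S t₀)‖ * ‖L‖ ^ 2
      < κ / 2 := by
    have h1 : ContinuousAt (fun t => ‖Gc‖ * ‖LinearMap.toContinuousLinearMap (S t - S t₀)‖
        * ‖L‖ ^ 2) t₀ := (continuousAt_const.mul hcont.norm).mul continuousAt_const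
    have h2 : ‖Gc‖ * ‖LinearMap.toContinuousLinearMap (S t₀ - S t₀)‖ * ‖L‖ ^ 2 < κ / 2 := by
      rw [sub_self, map_zero, norm_zero, mul_zero, zero_mul]
      positivity
    exact h1.eventually_lt continuousAt_const h2
  have hmeas : ∀ t, AEStronglyMeasurable (fun z => Complex.exp
      (-(j.herm z (Z t z) + (starRingEnd ℂ) (j.herm z (Y t z))) / (4 * ħ))) (j.gauss ħ) := by
    intro t
    refine Continuous.aestronglyMeasurable (Complex.continuous_exp.comp ?_)
    exact ((j.continuous_herm_comp (Z t)).add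
      (Complex.continuous_conj.comp (j.continuous_herm_comp (Y t)))).neg.div_const _
  -- The dominating Gaussian spends half of the gap κ on the variation of S near t₀; the other half
  -- keeps 1 + A positive, so the bound is integrable.
  set A : Module.End ℝ V := S t₀ - (κ / 2) • 1 with hA
  have hAs : ∀ v w, j.G (A v) w = j.G v (A w) := by
    intro v w
    have hSs : j.G (S t₀ v) w = j.G v (S t₀ w) := ((hYs t₀).half_add (hZs t₀)).symm v w
    simp only [hA, LinearMap.sub_apply, LinearMap.smul_apply, Module.End.one_apply, map_sub,
      map_smul, hSs]
  have hAp : ∀ v, v ≠ 0 → 0 < j.G ((1 + A) v) v := by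
    intro v hv
    have h1 := hlow v
    have h2 := j.G_pos v hv
    simp only [hA, LinearMap.comp_apply, LinearMap.add_apply, LinearMap.sub_apply,
      LinearMap.smul_apply, Module.End.one_apply, map_add, map_sub, map_smul, smul_eq_mul] at h1 ⊢
    nlinarith
  refine continuousAt_of_dominated (Filter.Eventually.of_forall hmeas) ?_
    (integrable_gauss_exp j hħ hAs hAp) ?_
  · filter_upwards [hsmall] with t ht
    refine Filter.Eventually.of_forall fun z => ?_
    rw [norm_gaussPairing_integrand (Y t) (Z t)]
    apply Real.exp_le_exp.2
    apply div_le_div_of_nonneg_right _ (by positivity)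
    have h1 : -(κ / 2 * j.G z z) ≤ j.G ((S t - S t₀) z) z := by
      have h2 : |j.G ((S t - S t₀) z) z|
          ≤ ‖Gc‖ * ‖(LinearMap.toContinuousLinearMap (S t - S t₀)) z‖ * ‖z‖ :=
        Gc.le_opNorm₂ _ _
      have h3 := (LinearMap.toContinuousLinearMap (S t - S t₀)).le_opNorm z
      have h4 : ‖Gc‖ * ‖(LinearMap.toContinuousLinearMap (S t - S t₀)) z‖ * ‖z‖
          ≤ ‖Gc‖ * ‖LinearMap.toContinuousLinearMap (S t - S t₀)‖ * ‖z‖ ^ 2 := by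
        rw [sq, ← mul_assoc]
        rw [mul_assoc ‖Gc‖, mul_assoc ‖Gc‖, mul_assoc ‖Gc‖]
        refine mul_le_mul_of_nonneg_left ?_ (norm_nonneg Gc)
        exact mul_le_mul_of_nonneg_right h3 (norm_nonneg z)
      have h5 : ‖Gc‖ * ‖LinearMap.toContinuousLinearMap (S t - S t₀)‖ * ‖z‖ ^ 2
          ≤ κ / 2 * j.G z z := by
        calc _ ≤ ‖Gc‖ * ‖LinearMap.toContinuousLinearMap (S t - S t₀)‖ * (‖L‖ ^ 2 * j.G z z) := by
              gcongr
              exact hnorm z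
          _ = ‖Gc‖ * ‖LinearMap.toContinuousLinearMap (S t - S t₀)‖ * ‖L‖ ^ 2 * j.G z z := by ring
          _ ≤ _ := mul_le_mul_of_nonneg_right ht.le (j.G_nonneg z)
      have := neg_abs_le (j.G ((S t - S t₀) z) z)
      linarith
    change -(j.G (S t z) z) ≤ -(j.G (A z) z)
    simp only [hA, LinearMap.sub_apply, LinearMap.smul_apply, Module.End.one_apply, map_sub,
      map_smul, smul_eq_mul] at h1 ⊢
    linarith
  · refine Filter.Eventually.of_forall fun z => ?_
    have hh : ∀ {A : ℝ → Module.End ℝ V}, ContinuousAt (fun t => A t z) t₀ →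
        ContinuousAt (fun t => j.herm z (A t z)) t₀ := by
      intro A hAt
      have hl : Continuous fun w => j.herm z w := by
        simp only [PCCS.herm]
        have h1 : Continuous (j.G z) := LinearMap.continuous_of_finiteDimensional _
        have h2 : Continuous (Ω.form z) := LinearMap.continuous_of_finiteDimensional _
        fun_prop
      exact hl.continuousAt.comp' hAt
    refine Complex.continuous_exp.continuousAt.comp' ?_
    exact ((hh (hZt z)).add (Complex.continuous_conj.continuousAt.comp' (hh (hYt z)))).neg.div_const _

end Pairing

/-! ### Holomorphic functions and holomorphic integral transforms -/

section Holomorphic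

variable {V : Type*} [NormedAddCommGroup V] [NormedSpace ℝ V] [FiniteDimensional ℝ V]
  {Ω : SymplecticForm V} (j : PCCS Ω)

/-- The restriction of a holomorphic function to a complex line. -/
theorem IsHolomorphic.differentiable_line {c : ComplexStructure V} {f : V → ℂ}
    (hf : IsHolomorphic c f) (v : V) :
    Differentiable ℂ fun ζ : ℂ => f (ζ.re • v + ζ.im • c.J v) := by
  intro ζ
  let l : ℂ →L[ℝ] V := Complex.reCLM.smulRight v + Complex.imCLM.smulRight (c.J v)
  have hl : ∀ ζ : ℂ, l ζ = ζ.re • v + ζ.im • c.J v := fun ζ => rfl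
  have h1 : HasFDerivAt (fun ζ : ℂ => f (l ζ)) ((fderiv ℝ f (l ζ)).comp l) ζ :=
    (hf.1 (l ζ)).hasFDerivAt.comp ζ l.hasFDerivAt
  let L : ℂ →L[ℂ] ℂ := (fderiv ℝ f (l ζ) v) • ContinuousLinearMap.id ℂ ℂ
  have h2 : L.restrictScalars ℝ = (fderiv ℝ f (l ζ)).comp l := by
    refine ContinuousLinearMap.ext fun w => ?_
    change fderiv ℝ f (l ζ) v * w = fderiv ℝ f (l ζ) (l w)
    rw [hl w, map_add, map_smul, map_smul, hf.2, Complex.real_smul, Complex.real_smul]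
    nth_rewrite 1 [← Complex.re_add_im w]
    ring
  exact (hasFDerivAt_of_restrictScalars ℝ h1 h2).differentiableAt

theorem IsHolomorphic.comp_linear {c : ComplexStructure V} {f : V → ℂ}
    (hf : IsHolomorphic c f) {A : Module.End ℝ V} (hA : Commute c.J A) :
    IsHolomorphic c fun z => f (A z) := by
  have hd : ∀ z, HasFDerivAt (fun z => f (A z))
      ((fderiv ℝ f (A z)).comp (LinearMap.toContinuousLinearMap A)) z := fun z =>
    (hf.1 (A z)).hasFDerivAt.comp z (LinearMap.toContinuousLinearMap A).hasFDerivAt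
  refine ⟨fun z => (hd z).differentiableAt, fun z v => ?_⟩
  rw [(hd z).fderiv]
  change fderiv ℝ f (A z) (A (c.J v)) = Complex.I * fderiv ℝ f (A z) (A v)
  rw [← hf.2]
  congr 1
  exact (LinearMap.congr_fun hA v).symm

/-- By symmetry of Z the derivative at z in the direction v is 2⟨v, Z z⟩, which is complex linear in
v. -/
theorem isHolomorphic_herm_comp {Z : Module.End ℝ V} (hZ : j.IsSymmAnti Z) :
    IsHolomorphic j.toComplexStructure fun z => j.herm z (Z z) := by
  let B : V →ₗ[ℝ] V →ₗ[ℝ] ℂ := LinearMap.mk₂ ℝ (fun z w => j.herm z (Z w))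
    (fun _ _ _ => j.herm_add_left _ _ _)
    (fun r z w => by rw [j.herm_smul_left, Complex.real_smul])
    (fun _ _ _ => by rw [map_add, j.herm_add_right])
    (fun r z w => by rw [map_smul, j.herm_smul_right, Complex.real_smul])
  let Bc := B.toContinuousBilinearMap
  have hd : ∀ z, HasFDerivAt (fun z => j.herm z (Z z))
      (Bc.precompR V z (ContinuousLinearMap.id ℝ V)
        + Bc.precompL V (ContinuousLinearMap.id ℝ V) z) z := fun z =>
    Bc.hasFDerivAt_of_bilinear (hasFDerivAt_id z) (hasFDerivAt_id z)
  have happ : ∀ z v, (Bc.precompR V z (ContinuousLinearMap.id ℝ V)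
        + Bc.precompL V (ContinuousLinearMap.id ℝ V) z) v = 2 * j.herm v (Z z) := by
    intro z v
    change j.herm z (Z v) + j.herm v (Z z) = _
    rw [hZ.herm_comm', two_mul]
  refine ⟨fun z => (hd z).differentiableAt, fun z v => ?_⟩
  rw [(hd z).fderiv, happ, happ, j.herm_J_left]
  ring

/-- A holomorphic function with `f(-v)` conjugate to `f(v)` is constant. -/
theorem IsHolomorphic.eq_of_neg_eq_conj {c : ComplexStructure V} {f : V → ℂ}
    (hf : IsHolomorphic c f) (h : ∀ v, f (-v) = (starRingEnd ℂ) (f v)) (v : V) : f v = f 0 := by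
  -- Differentiating the relation equates a complex linear form in the direction with a conjugate
  -- linear one, so both vanish.
  have h0 : ∀ z, fderiv ℝ f z = 0 := by
    intro z
    have h1 : ∀ w, -(fderiv ℝ f (-z) w) = (starRingEnd ℂ) (fderiv ℝ f z w) := by
      have e1 : HasFDerivAt (fun x => f (-x)) (-(fderiv ℝ f (-z))) z := by
        have := (hf.1 (-z)).hasFDerivAt.comp z (hasFDerivAt_id z).neg
        simpa [Function.comp_def] using this
      have e2 : HasFDerivAt (fun x => (starRingEnd ℂ) (f x))
          ((Complex.conjCLE : ℂ →L[ℝ] ℂ).comp (fderiv ℝ f z)) z :=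
        (Complex.conjCLE : ℂ →L[ℝ] ℂ).hasFDerivAt.comp z (hf.1 z).hasFDerivAt
      have e3 : (fun x => f (-x)) = fun x => (starRingEnd ℂ) (f x) := funext h
      rw [e3] at e1
      intro w
      exact congrArg (fun L : V →L[ℝ] ℂ => L w) (e1.unique e2)
    refine ContinuousLinearMap.ext fun w => ?_
    have h2 := h1 (c.J w)
    rw [hf.2, hf.2, map_mul, Complex.conj_I, ← h1 w] at h2
    have h3 : fderiv ℝ f (-z) w = 0 := by
      have : Complex.I * fderiv ℝ f (-z) w = 0 := by linear_combination (-1 / 2 : ℂ) * h2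
      exact (mul_eq_zero.1 this).resolve_left Complex.I_ne_zero
    have h4 := h1 w
    rw [h3, neg_zero, eq_comm, map_eq_zero] at h4
    rw [h4]
    rfl
  exact is_const_of_fderiv_eq_zero hf.1 h0 v 0

end Holomorphic

section Transform

/-- One of the sign patterns is that of the a i. The point of the bound is that its right side
consists of exponentials of linear forms, so exponential growth in z is controlled by finitely many
values of the transform's own kernel. -/
theorem exp_sum_abs_le {ι : Type*} [Fintype ι] [DecidableEq ι] (a : ι → ℝ) :
    Real.exp (∑ i, |a i|) ≤ ∑ s : ι → Bool, Real.exp (∑ i, (if s i then 1 else -1) * a i) := by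
  let s₀ : ι → Bool := fun i => decide (0 ≤ a i)
  have h : ∀ i, |a i| = (if s₀ i then 1 else -1) * a i := by
    intro i
    by_cases hi : 0 ≤ a i
    · simp [s₀, hi, abs_of_nonneg]
    · simp [s₀, hi, abs_of_neg (not_le.1 hi)]
  have h2 : Real.exp (∑ i, |a i|) = Real.exp (∑ i, (if s₀ i then 1 else -1) * a i) := by
    congr 1
    exact Finset.sum_congr rfl fun i _ => h i
  rw [h2]
  exact Finset.single_le_sum (f := fun s : ι → Bool => Real.exp (∑ i, (if s i then 1 else -1) * a i))
    (fun s _ => (Real.exp_pos _).le) (Finset.mem_univ s₀)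

variable {V : Type*} [NormedAddCommGroup V] [NormedSpace ℝ V] [FiniteDimensional ℝ V]
  {Ω : SymplecticForm V} (j : PCCS Ω) [MeasurableSpace V] [BorelSpace V]

theorem PCCS.exists_abs_G_le : ∃ K : ℝ, 0 ≤ K ∧ ∀ v z : V, |j.G v z|
    ≤ K * ‖v‖ * ∑ i, |j.G (j.frame (EuclideanSpace.single i 1)) z| := by
  let L := LinearMap.toContinuousLinearMap j.frame.symm.toLinearMap
  refine ⟨‖L‖, norm_nonneg _, fun v z => ?_⟩
  have h1 : v = ∑ i, (L v) i • j.frame (EuclideanSpace.single i 1) := by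
    have h2 : L v = ∑ i, (L v) i • EuclideanSpace.single i (1 : ℝ) := by
      have := (EuclideanSpace.basisFun (Fin (Module.finrank ℝ V)) ℝ).sum_repr (L v)
      simpa using this.symm
    have h3 : j.frame (L v) = v := j.frame.apply_symm_apply v
    nth_rewrite 1 [← h3, h2]
    simp [map_sum]
  nth_rewrite 1 [h1]
  rw [map_sum, LinearMap.sum_apply, Finset.mul_sum]
  refine (Finset.abs_sum_le_sum_abs _ _).trans (Finset.sum_le_sum fun i _ => ?_)
  rw [map_smul, LinearMap.smul_apply, smul_eq_mul, abs_mul]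
  refine mul_le_mul_of_nonneg_right ?_ (abs_nonneg _)
  have h4 : |(L v) i| ≤ ‖L v‖ := by
    simpa using PiLp.norm_apply_le (L v) i
  exact h4.trans (L.le_opNorm v)

/-- Integral transforms with kernel `exp (⟨v, z⟩ / 2ħ)` are holomorphic. -/
theorem isHolomorphic_integral {ħ : ℝ} (hħ : 0 < ħ) {m : Measure V} {h : V → ℂ}
    (hm : AEStronglyMeasurable h m)
    (hint : ∀ v, Integrable (fun z => h z * Complex.exp (j.herm v z / (2 * ħ))) m) :
    IsHolomorphic j.toComplexStructure
      fun v => ∫ z, h z * Complex.exp (j.herm v z / (2 * ħ)) ∂m := by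
  obtain ⟨K, hK0, hK⟩ := j.exists_abs_G_le
  let LJ := LinearMap.toContinuousLinearMap j.J
  set N : V → ℝ := fun z => ∑ i, |j.G (j.frame (EuclideanSpace.single i 1)) z| with hN
  have hN0 : ∀ z, 0 ≤ N z := fun z => Finset.sum_nonneg fun i _ => abs_nonneg _
  let D : V → V →L[ℝ] ℂ := fun z => LinearMap.toContinuousLinearMap (j.hermLeft z)
  have hDapp : ∀ z v, D z v = j.herm v z := fun z v => rfl
  have hform : ∀ v z, Ω.form v z = j.G (j.J v) z := fun v z => by
    rw [j.form_eq, j.G_J]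
  have hDnorm : ∀ z, ‖D z‖ ≤ K * (1 + ‖LJ‖) * N z := by
    intro z
    refine ContinuousLinearMap.opNorm_le_bound _ (by have := hN0 z; positivity) fun v => ?_
    rw [hDapp, PCCS.herm, hform]
    refine (norm_sub_le _ _).trans ?_
    rw [norm_mul, Complex.norm_I, one_mul, Complex.norm_real, Complex.norm_real, Real.norm_eq_abs,
      Real.norm_eq_abs]
    have h1 := hK v z
    have h2 := hK (j.J v) z
    have h3 : ‖j.J v‖ ≤ ‖LJ‖ * ‖v‖ := LJ.le_opNorm v
    calc _ ≤ K * ‖v‖ * N z + K * (‖LJ‖ * ‖v‖) * N z := by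
          refine add_le_add h1 (h2.trans ?_)
          exact mul_le_mul_of_nonneg_right (mul_le_mul_of_nonneg_left h3 hK0) (hN0 z)
      _ = _ := by ring
  let F' : V → V → V →L[ℝ] ℂ := fun v z =>
    (h z * Complex.exp (j.herm v z / (2 * ħ)) * (2 * (ħ : ℂ))⁻¹) • D z
  have hdiff : ∀ z v, HasFDerivAt (fun v => h z * Complex.exp (j.herm v z / (2 * ħ))) (F' v z) v := by
    intro z v
    have h1 : HasFDerivAt (fun v => j.herm v z) (D z) v := (D z).hasFDerivAt
    have h2 := ((h1.mul_const ((2 * (ħ : ℂ))⁻¹)).cexp).const_mul (h z)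
    convert! h2 using 1
    refine ContinuousLinearMap.ext fun w => ?_
    simp only [F', smul_apply, smul_eq_mul, div_eq_mul_inv]
    ring
  have hnormexp : ∀ v z, ‖Complex.exp (j.herm v z / (2 * ħ))‖ = Real.exp (j.G v z / (2 * ħ)) := by
    intro v z
    have : (j.herm v z / (2 * ħ)).re = j.G v z / (2 * ħ) := by
      have h2 : (2 * (ħ : ℂ)) = ((2 * ħ : ℝ) : ℂ) := by push_cast; ring
      rw [h2, Complex.div_ofReal_re, j.herm_re]
    rw [Complex.norm_exp, this]
  have hmF' : ∀ v, AEStronglyMeasurable (F' v) m := by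
    intro v
    have hc1 : Continuous fun z => Complex.exp (j.herm v z / (2 * ħ)) * (2 * (ħ : ℂ))⁻¹ := by
      have h1 : Continuous (j.G v) := LinearMap.continuous_of_finiteDimensional _
      have h2 : Continuous (Ω.form v) := LinearMap.continuous_of_finiteDimensional _
      simp only [PCCS.herm]
      fun_prop
    have hc2 : Continuous D := by
      let DD : V →ₗ[ℝ] V →L[ℝ] ℂ :=
        { toFun := D
          map_add' := fun x y => ContinuousLinearMap.ext fun v => j.herm_add_right v x y
          map_smul' := fun r x => ContinuousLinearMap.ext fun v => by
            change j.herm v (r • x) = r • j.herm v x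
            rw [j.herm_smul_right, Complex.real_smul] }
      exact DD.continuous_of_finiteDimensional
    have := (hm.mul hc1.aestronglyMeasurable).smul hc2.aestronglyMeasurable (μ := m)
    refine this.congr (Filter.Eventually.of_forall fun z => ?_)
    simp only [F', Pi.mul_apply, Pi.smul_apply', mul_assoc]
  -- The summand K / 2ħ pays for moving v by at most 1 from v₀ in the exponential, the summand 1 for
  -- the linear factor N z produced by differentiation.
  set M : ℝ := K / (2 * ħ) + 1 with hM
  have hM0 : 0 ≤ M := by positivity
  -- The shifts are chosen so that exp(M N z) is at most the sum of the exp(G_j(u_s, z) / 2ħ). Thus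
  -- the derivative is dominated by kernels at the points v₀ + u_s, whose integrability is assumed.
  let u : (Fin (Module.finrank ℝ V) → Bool) → V := fun s =>
    (2 * ħ * M) • ∑ i, (if s i then (1 : ℝ) else -1) • j.frame (EuclideanSpace.single i 1)
  have hu : ∀ s z, j.G (u s) z / (2 * ħ)
      = ∑ i, (if s i then 1 else -1) * (M * j.G (j.frame (EuclideanSpace.single i 1)) z) := by
    intro s z
    simp only [u, map_smul, map_sum, LinearMap.smul_apply, LinearMap.sum_apply, smul_eq_mul]
    rw [mul_div_assoc, Finset.sum_div, Finset.mul_sum]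
    refine Finset.sum_congr rfl fun i _ => ?_
    field_simp
  have hexpN : ∀ z, Real.exp (M * N z) ≤ ∑ s, Real.exp (j.G (u s) z / (2 * ħ)) := by
    intro z
    have h1 := exp_sum_abs_le fun i => M * j.G (j.frame (EuclideanSpace.single i 1)) z
    have h2 : ∑ i, |M * j.G (j.frame (EuclideanSpace.single i 1)) z| = M * N z := by
      rw [hN, Finset.mul_sum]
      exact Finset.sum_congr rfl fun i _ => by rw [abs_mul, abs_of_nonneg hM0]
    rw [h2] at h1
    refine h1.trans (le_of_eq (Finset.sum_congr rfl fun s _ => ?_))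
    rw [hu]
  have hmain : ∀ v₀ : V, HasFDerivAt (fun v => ∫ z, h z * Complex.exp (j.herm v z / (2 * ħ)) ∂m)
      (∫ z, F' v₀ z ∂m) v₀ := by
    intro v₀
    set C : ℝ := (2 * ħ)⁻¹ * (K * (1 + ‖LJ‖)) with hC
    have hC0 : 0 ≤ C := by positivity
    let bound : V → ℝ := fun z => C * ∑ s, ‖h z * Complex.exp (j.herm (v₀ + u s) z / (2 * ħ))‖
    refine hasFDerivAt_integral_of_dominated_of_fderiv_le (bound := bound)
      (Metric.ball_mem_nhds v₀ one_pos) (Filter.Eventually.of_forall fun v => (hint v).1) (hint v₀)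
      (hmF' v₀) (Filter.Eventually.of_forall fun z v hv => ?_) ?_
      (Filter.Eventually.of_forall fun z v _ => hdiff z v)
    · have e1 : ‖F' v z‖ = ‖h z‖ * Real.exp (j.G v z / (2 * ħ)) * (2 * ħ)⁻¹ * ‖D z‖ := by
        simp only [F']
        rw [norm_smul, norm_mul, norm_mul, hnormexp, norm_inv]
        congr 3
        simp [abs_of_pos hħ]
      have e2 : j.G v z / (2 * ħ) ≤ j.G v₀ z / (2 * ħ) + K / (2 * ħ) * N z := by
        have h1 : j.G (v - v₀) z ≤ K * N z := by
          refine (le_abs_self _).trans ((hK _ z).trans ?_)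
          have h2 : ‖v - v₀‖ ≤ 1 := by
            rw [← dist_eq_norm]
            exact (Metric.mem_ball.1 hv).le
          calc K * ‖v - v₀‖ * N z ≤ K * 1 * N z :=
                mul_le_mul_of_nonneg_right (mul_le_mul_of_nonneg_left h2 hK0) (hN0 z)
            _ = K * N z := by ring
        rw [map_sub, LinearMap.sub_apply] at h1
        rw [div_mul_eq_mul_div, ← add_div]
        apply div_le_div_of_nonneg_right _ (by positivity)
        linarith
      have e3 : N z ≤ Real.exp (N z) := by
        have := Real.add_one_le_exp (N z)
        linarith
      have e4 : Real.exp (j.G v z / (2 * ħ)) * N z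
          ≤ Real.exp (j.G v₀ z / (2 * ħ)) * Real.exp (M * N z) := by
        calc Real.exp (j.G v z / (2 * ħ)) * N z
            ≤ Real.exp (j.G v₀ z / (2 * ħ) + K / (2 * ħ) * N z) * Real.exp (N z) :=
              mul_le_mul (Real.exp_le_exp.2 e2) e3 (hN0 z) (Real.exp_pos _).le
          _ = _ := by
              rw [← Real.exp_add, ← Real.exp_add, hM]
              congr 1
              ring
      have e5 : Real.exp (j.G v₀ z / (2 * ħ)) * Real.exp (M * N z)
          ≤ ∑ s, Real.exp (j.G (v₀ + u s) z / (2 * ħ)) := by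
        refine (mul_le_mul_of_nonneg_left (hexpN z) (Real.exp_pos _).le).trans ?_
        rw [Finset.mul_sum]
        refine le_of_eq (Finset.sum_congr rfl fun s _ => ?_)
        rw [← Real.exp_add, map_add, LinearMap.add_apply, add_div]
      calc ‖F' v z‖ ≤ ‖h z‖ * Real.exp (j.G v z / (2 * ħ)) * (2 * ħ)⁻¹
            * (K * (1 + ‖LJ‖) * N z) := by
            rw [e1]
            exact mul_le_mul_of_nonneg_left (hDnorm z) (by positivity)
        _ = C * (‖h z‖ * (Real.exp (j.G v z / (2 * ħ)) * N z)) := by rw [hC]; ring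
        _ ≤ C * (‖h z‖ * ∑ s, Real.exp (j.G (v₀ + u s) z / (2 * ħ))) :=
            mul_le_mul_of_nonneg_left
              (mul_le_mul_of_nonneg_left (e4.trans e5) (norm_nonneg _)) hC0
        _ = bound z := by
            simp only [bound]
            rw [Finset.mul_sum]
            congr 1
            refine Finset.sum_congr rfl fun s _ => ?_
            rw [norm_mul, hnormexp]
    · exact (integrable_finsetSum _ fun s _ => (hint (v₀ + u s)).norm).const_mul C
  have hF'int : ∀ v, Integrable (F' v) m := by
    intro v
    refine Integrable.mono' (g := fun z => (2 * ħ)⁻¹ * (K * (1 + ‖LJ‖))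
      * ∑ s, ‖h z * Complex.exp (j.herm (v + u s) z / (2 * ħ))‖)
      ((integrable_finsetSum _ fun s _ => (hint (v + u s)).norm).const_mul _) (hmF' v)
      (Filter.Eventually.of_forall fun z => ?_)
    have e1 : ‖F' v z‖ = ‖h z‖ * Real.exp (j.G v z / (2 * ħ)) * (2 * ħ)⁻¹ * ‖D z‖ := by
      simp only [F']
      rw [norm_smul, norm_mul, norm_mul, hnormexp, norm_inv]
      congr 3
      simp [abs_of_pos hħ]
    have e3 : N z ≤ Real.exp (M * N z) := by
      have h1 := Real.add_one_le_exp (M * N z)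
      have h2 : N z ≤ M * N z := by
        have : 1 ≤ M := by rw [hM]; have : 0 ≤ K / (2 * ħ) := by positivity
                           linarith
        exact le_mul_of_one_le_left (hN0 z) this
      linarith
    have e5 : Real.exp (j.G v z / (2 * ħ)) * N z
        ≤ ∑ s, Real.exp (j.G (v + u s) z / (2 * ħ)) := by
      refine (mul_le_mul_of_nonneg_left (e3.trans (hexpN z)) (Real.exp_pos _).le).trans ?_
      rw [Finset.mul_sum]
      refine le_of_eq (Finset.sum_congr rfl fun s _ => ?_)
      rw [← Real.exp_add, map_add, LinearMap.add_apply, add_div]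
    calc ‖F' v z‖ ≤ ‖h z‖ * Real.exp (j.G v z / (2 * ħ)) * (2 * ħ)⁻¹
          * (K * (1 + ‖LJ‖) * N z) := by
          rw [e1]
          exact mul_le_mul_of_nonneg_left (hDnorm z) (by positivity)
      _ = (2 * ħ)⁻¹ * (K * (1 + ‖LJ‖)) * (‖h z‖ * (Real.exp (j.G v z / (2 * ħ)) * N z)) := by ring
      _ ≤ (2 * ħ)⁻¹ * (K * (1 + ‖LJ‖))
          * (‖h z‖ * ∑ s, Real.exp (j.G (v + u s) z / (2 * ħ))) := by
          refine mul_le_mul_of_nonneg_left (mul_le_mul_of_nonneg_left e5 (norm_nonneg _)) ?_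
          positivity
      _ = _ := by
          rw [Finset.mul_sum]
          congr 1
          refine Finset.sum_congr rfl fun s _ => ?_
          rw [norm_mul, hnormexp]
  refine ⟨fun v => (hmain v).differentiableAt, fun v w => ?_⟩
  rw [(hmain v).fderiv, ContinuousLinearMap.integral_apply (hF'int v),
    ContinuousLinearMap.integral_apply (hF'int v), ← integral_const_mul]
  congr 1
  funext z
  simp only [F', smul_apply, smul_eq_mul, hDapp]

  rw [j.herm_J_left]
  ring

end Transform

/-! ### The Fock space inside L², Weyl operators and reproducing kernel -/

section FockInner

variable {V : Type*} [NormedAddCommGroup V] [NormedSpace ℝ V] [FiniteDimensional ℝ V]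
  {Ω : SymplecticForm V} {j : PCCS Ω} [MeasurableSpace V] [BorelSpace V] {ħ : ℝ} (hħ : 0 < ħ)

theorem Fock.continuous (f : Fock j ħ) : Continuous (f : V → ℂ) := f.2.1.1.continuous

include hħ

theorem mem_fock_iff (f : V → ℂ) :
    f ∈ Fock j ħ ↔ IsHolomorphic j.toComplexStructure f ∧ MemLp f 2 (j.gauss ħ) := by
  refine and_congr_right fun hf => ?_
  rw [memLp_two_iff_integrable_sq_norm hf.1.continuous.aestronglyMeasurable, integrable_gauss j hħ]
  have h : (fun z => (gaussConst V ħ * j.weight ħ z) • ‖f z‖ ^ 2)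
      = fun z => gaussConst V ħ * (‖f z‖ ^ 2 * j.weight ħ z) := by
    funext z
    rw [smul_eq_mul]
    ring
  rw [h]
  exact (integrable_const_mul_iff (isUnit_iff_ne_zero.2 (gaussConst_pos V hħ).ne') _).symm

theorem Fock.memLp (f : Fock j ħ) : MemLp (f : V → ℂ) 2 (j.gauss ħ) := ((mem_fock_iff hħ _).1 f.2).2

theorem Fock.integrable (f : Fock j ħ) : Integrable (f : V → ℂ) (j.gauss ħ) :=
  haveI := isProbabilityMeasure_gauss j hħ
  (Fock.memLp hħ f).integrable (by norm_num)

theorem fockInner_eq (f g : Fock j ħ) :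
    fockInner j ħ f g = ∫ z, (f : V → ℂ) z * (starRingEnd ℂ) ((g : V → ℂ) z) ∂(j.gauss ħ) := by
  rw [integral_gauss j hħ, fockInner, gaussConst, ← Complex.ofReal_inv, ← integral_const_mul]
  congr 1
  funext z
  rw [Complex.real_smul]
  push_cast
  ring

/-- A Fock space function as an element of `L²`. -/
def Fock.toLp : Fock j ħ →ₗ[ℂ] Lp ℂ 2 (j.gauss ħ) where
  toFun f := (Fock.memLp hħ f).toLp f
  map_add' _ _ := rfl
  map_smul' _ _ := rfl

theorem Fock.coeFn_toLp (f : Fock j ħ) : (Fock.toLp hħ f : V → ℂ) =ᵐ[j.gauss ħ] f :=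
  MemLp.coeFn_toLp (Fock.memLp hħ f)

theorem inner_toLp (f g : Fock j ħ) :
    inner ℂ (Fock.toLp hħ g) (Fock.toLp hħ f) = fockInner j ħ f g := by
  rw [fockInner_eq hħ, L2.inner_def]
  refine integral_congr_ae ?_
  filter_upwards [Fock.coeFn_toLp hħ f, Fock.coeFn_toLp hħ g] with z h1 h2
  rw [h1, h2]
  rfl

theorem Fock.toLp_injective : Function.Injective (Fock.toLp (j := j) hħ) := by
  intro f g h
  have h1 : (f : V → ℂ) =ᵐ[j.gauss ħ] g :=
    (Fock.coeFn_toLp hħ f).symm.trans ((by rw [h] : (Fock.toLp hħ f : V → ℂ) =ᵐ[j.gauss ħ]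
      Fock.toLp hħ g).trans (Fock.coeFn_toLp hħ g))
  have := isOpenPosMeasure_gauss j hħ
  exact Subtype.ext (Continuous.ae_eq_iff_eq _ (Fock.continuous f) (Fock.continuous g) |>.1 h1)

theorem fockInner_smul_left (a : ℂ) (f g : Fock j ħ) :
    fockInner j ħ (a • f) g = a * fockInner j ħ f g := by
  rw [← inner_toLp hħ, ← inner_toLp hħ, map_smul, inner_smul_right]

theorem fockInner_smul_right (a : ℂ) (f g : Fock j ħ) :
    fockInner j ħ f (a • g) = (starRingEnd ℂ) a * fockInner j ħ f g := by
  rw [← inner_toLp hħ, ← inner_toLp hħ, map_smul, inner_smul_left]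

theorem fockInner_conj (f g : Fock j ħ) :
    (starRingEnd ℂ) (fockInner j ħ f g) = fockInner j ħ g f := by
  rw [← inner_toLp hħ, ← inner_toLp hħ, inner_conj_symm]

omit hħ in
-- This is the pointwise form of U(v, t)* = U(-v, -t), after a translation of the integration
-- variable by v.
theorem weylFactor_mul_weight (v : V) (t : ℝ) (w : V) :
    weylFactor j ħ v t (w + v) * (j.weight ħ (w + v) : ℂ)
      = (starRingEnd ℂ) (weylFactor j ħ (-v) (-t) w) * (j.weight ħ w : ℂ) := by
  rw [weylFactor, weylFactor, PCCS.weight, PCCS.weight, Complex.ofReal_exp, Complex.ofReal_exp,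
    ← Complex.exp_conj, ← Complex.exp_add, ← Complex.exp_add]
  congr 1
  simp only [PCCS.herm, map_add, map_neg, LinearMap.add_apply, LinearMap.neg_apply, map_sub, map_div₀,
    map_mul, Complex.conj_I, Complex.conj_ofReal, Ω.alt v, j.G_comm v w]
  simp only [Complex.ofReal_add, Complex.ofReal_neg, Complex.ofReal_div, Complex.ofReal_mul, map_ofNat]
  by_cases h : (ħ : ℂ) = 0
  · simp [h]
  · field_simp
    push_cast
    ring

omit hħ in
theorem fockInner_weyl (v : V) (t : ℝ) (f g : Fock j ħ) :
    fockInner j ħ (weyl j ħ v t f) g = fockInner j ħ f (weyl j ħ (-v) (-t) g) := by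
  rw [fockInner, fockInner]
  congr 1
  rw [← integral_add_right_eq_self _ v]
  congr 1
  funext w
  change weylFactor j ħ v t (w + v) * (f : V → ℂ) (w + v - v) * _ * _
    = (f : V → ℂ) w * (starRingEnd ℂ) (weylFactor j ħ (-v) (-t) w * (g : V → ℂ) (w - -v)) * _
  rw [add_sub_cancel_right, sub_neg_eq_add, map_mul]
  linear_combination (f : V → ℂ) w * (starRingEnd ℂ) ((g : V → ℂ) (w + v))
    * weylFactor_mul_weight (j := j) (ħ := ħ) v t w

omit hħ in
theorem measurePreserving_lebesgue (A : V ≃ₗ[ℝ] V) (hA : ∀ v w, j.G (A v) (A w) = j.G v w) :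
    MeasurePreserving A j.lebesgue j.lebesgue := by
  let L := (j.frame.trans A).trans j.frame.symm
  let I : EuclideanSpace ℝ (Fin (Module.finrank ℝ V)) ≃ₗᵢ[ℝ]
      EuclideanSpace ℝ (Fin (Module.finrank ℝ V)) := L.isometryOfInner fun x y => by
    rw [← j.G_frame]
    simp only [L, LinearEquiv.trans_apply, LinearEquiv.apply_symm_apply, hA, j.G_frame]
  have hI : ∀ x, j.frame (I x) = A (j.frame x) := fun x => by
    change j.frame (j.frame.symm (A (j.frame x))) = _
    rw [LinearEquiv.apply_symm_apply]
  have hAm : Measurable A := (LinearMap.continuous_of_finiteDimensional A.toLinearMap).measurable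
  have hFm : Measurable j.frame :=
    (LinearMap.continuous_of_finiteDimensional j.frame.toLinearMap).measurable
  refine ⟨hAm, ?_⟩
  rw [PCCS.lebesgue, Measure.map_map hAm hFm]
  have : (A ∘ j.frame : _ → V) = j.frame ∘ I := funext fun x => (hI x).symm
  rw [this, ← Measure.map_map hFm I.continuous.measurable, I.measurePreserving.map_eq]

theorem integral_gauss_comp {E : Type*} [NormedAddCommGroup E] [NormedSpace ℝ E]
    (A : V ≃ₗ[ℝ] V) (hA : ∀ v w, j.G (A v) (A w) = j.G v w) (f : V → E) :
    ∫ z, f (A z) ∂(j.gauss ħ) = ∫ z, f z ∂(j.gauss ħ) := by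
  rw [integral_gauss j hħ, integral_gauss j hħ]
  have hAe : MeasurableEmbedding A := A.toContinuousLinearEquiv.toHomeomorph.measurableEmbedding
  rw [← (measurePreserving_lebesgue A hA).integral_comp hAe
    fun z => (gaussConst V ħ * j.weight ħ z) • f z]
  congr 1
  funext z
  rw [PCCS.weight, PCCS.weight, hA]

omit hħ in
/-- Multiplication by `exp (iθ)` on `(V, j)`. -/
def PCCS.rotation (j : PCCS Ω) (θ : ℝ) : V ≃ₗ[ℝ] V :=
  LinearEquiv.ofLinearMap (Real.cos θ • LinearMap.id + Real.sin θ • j.J)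
    (Real.cos θ • LinearMap.id - Real.sin θ • j.J)
    (by
      refine LinearMap.ext fun v => ?_
      simp only [LinearMap.comp_apply, LinearMap.add_apply, LinearMap.sub_apply,
        LinearMap.smul_apply, LinearMap.id_apply, map_sub, map_smul, j.sq]
      match_scalars
      · linear_combination Real.cos_sq_add_sin_sq θ
      · ring)
    (by
      refine LinearMap.ext fun v => ?_
      simp only [LinearMap.comp_apply, LinearMap.add_apply, LinearMap.sub_apply,
        LinearMap.smul_apply, LinearMap.id_apply, map_add, map_smul, j.sq]
      match_scalars
      · linear_combination Real.cos_sq_add_sin_sq θ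
      · ring)

omit hħ in
theorem PCCS.rotation_apply (θ : ℝ) (v : V) :
    j.rotation θ v = Real.cos θ • v + Real.sin θ • j.J v := rfl

omit hħ in
theorem PCCS.G_rotation (θ : ℝ) (v w : V) : j.G (j.rotation θ v) (j.rotation θ w) = j.G v w := by
  have h1 : j.G (j.J v) (j.J w) = j.G v w := j.G_JJ v w
  have h2 : j.G (j.J v) w = - j.G v (j.J w) := by
    rw [← j.G_JJ v (j.J w), j.sq, map_neg, neg_neg]
  have := Real.cos_sq_add_sin_sq θ
  simp only [PCCS.rotation_apply, map_add, map_smul, LinearMap.add_apply, LinearMap.smul_apply,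
    smul_eq_mul, h1, h2]
  linear_combination (j.G v w) * this

/-- The Gaussian measure is invariant under the rotations exp(iθ) of (V, j). Averaging over θ and
exchanging the integrals turns the integrand into circle averages of a holomorphic function of one
variable, all equal to the value at 0. -/
theorem integral_fock (f : Fock j ħ) : ∫ z, (f : V → ℂ) z ∂(j.gauss ħ) = (f : V → ℂ) 0 := by
  have := isProbabilityMeasure_gauss j hħ
  let ν : Measure ℝ := volume.restrict (Set.Ioc 0 (2 * Real.pi))
  have hcont : Continuous fun p : ℝ × V => (f : V → ℂ) (j.rotation p.1 p.2) := by
    refine (Fock.continuous f).comp ?_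
    simp only [PCCS.rotation_apply]
    have hJ : Continuous j.J := LinearMap.continuous_of_finiteDimensional _
    fun_prop
  have hrot : ∀ θ, Integrable (fun z => (f : V → ℂ) (j.rotation θ z)) (j.gauss ħ) := by
    intro θ
    have hfi := (integrable_gauss j hħ _).1 (Fock.integrable hħ f)
    rw [integrable_gauss j hħ]
    have hAe : MeasurableEmbedding (j.rotation θ) :=
      (j.rotation θ).toContinuousLinearEquiv.toHomeomorph.measurableEmbedding
    have h2 := ((measurePreserving_lebesgue (j.rotation θ) (j.G_rotation θ)).integrable_comp_emb
      hAe).2 hfi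
    refine h2.congr (Filter.Eventually.of_forall fun z => ?_)
    simp only [Function.comp_apply, PCCS.weight, j.G_rotation]
  have hnorm : ∀ θ, ∫ z, ‖(f : V → ℂ) (j.rotation θ z)‖ ∂(j.gauss ħ)
      = ∫ z, ‖(f : V → ℂ) z‖ ∂(j.gauss ħ) := fun θ =>
    integral_gauss_comp hħ (j.rotation θ) (j.G_rotation θ) fun z => ‖(f : V → ℂ) z‖
  have hint : Integrable (Function.uncurry fun θ z => (f : V → ℂ) (j.rotation θ z))
      (ν.prod (j.gauss ħ)) := by
    refine (integrable_prod_iff hcont.aestronglyMeasurable).2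
      ⟨Filter.Eventually.of_forall hrot, ?_⟩
    simp only [Function.uncurry, hnorm]
    exact integrable_const _
  have hswap := integral_integral_swap hint
  have h1 : ∀ θ, ∫ z, (f : V → ℂ) (j.rotation θ z) ∂(j.gauss ħ) = ∫ z, (f : V → ℂ) z ∂(j.gauss ħ) :=
    fun θ => integral_gauss_comp hħ (j.rotation θ) (j.G_rotation θ) (f : V → ℂ)
  have h2 : ∀ z, ∫ θ, (f : V → ℂ) (j.rotation θ z) ∂ν = (2 * Real.pi : ℝ) • (f : V → ℂ) 0 := by
    intro z
    have hd := f.2.1.differentiable_line z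
    have h3 := DiffContOnCl.circleAverage (c := 0) (R := 1) (f := fun ζ : ℂ =>
      (f : V → ℂ) (ζ.re • z + ζ.im • j.J z)) hd.diffContOnCl
    rw [Real.circleAverage, intervalIntegral.integral_of_le Real.two_pi_pos.le,
      inv_smul_eq_iff₀ Real.two_pi_pos.ne'] at h3
    simp only [Complex.zero_re, Complex.zero_im, zero_smul, add_zero] at h3
    rw [← h3]
    congr 1
    funext θ
    rw [PCCS.rotation_apply]
    simp [circleMap, Complex.exp_ofReal_mul_I_re, Complex.exp_ofReal_mul_I_im]
  simp only [h1, h2, integral_const] at hswap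
  have h4 : ν.real Set.univ = 2 * Real.pi := by
    simp [ν, Measure.real, Real.volume_Ioc, Real.two_pi_pos.le, Real.pi_pos.le]
  rw [h4] at hswap
  simpa using hswap

/-- The coherent states reproduce. -/
theorem fockInner_coherent (f : Fock j ħ) (v : V) :
    fockInner j ħ f (coherent j hħ v) = (f : V → ℂ) v := by
  have h0 : ∀ f : Fock j ħ, fockInner j ħ f (coherent j hħ 0) = (f : V → ℂ) 0 := by
    intro f
    rw [fockInner_eq hħ, ← integral_fock hħ f]
    congr 1
    funext z
    simp [coherent, PCCS.herm]
  -- The point v is moved to 0 by the Weyl operator of -v; its adjoint carries e_0 to a multiple of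
  -- e_v with the same real factor.
  have h1 := h0 (weyl j ħ (-v) 0 f)
  rw [fockInner_weyl, neg_neg, neg_zero] at h1
  have h2 : weyl j ħ v 0 (coherent j hħ 0)
      = Complex.exp (-((j.G v v : ℂ) / (4 * ħ))) • coherent j hħ v := by
    apply Subtype.ext
    funext z
    change weylFactor j ħ v 0 z * Complex.exp (j.herm (z - v) 0 / (2 * ħ))
      = Complex.exp _ * Complex.exp _
    rw [weylFactor, ← Complex.exp_add, ← Complex.exp_add, j.herm_zero_right]
    congr 1
    push_cast
    ring
  have h3 : (weyl j ħ (-v) 0 f : V → ℂ) 0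
      = Complex.exp (-((j.G v v : ℂ) / (4 * ħ))) * (f : V → ℂ) v := by
    change weylFactor j ħ (-v) 0 0 * (f : V → ℂ) (0 - -v) = _
    rw [weylFactor, j.herm_zero_left, zero_sub, neg_neg]
    congr 2
    simp
  rw [h2, h3, fockInner_smul_right hħ, ← Complex.exp_conj] at h1
  have h4 : (starRingEnd ℂ) (-((j.G v v : ℂ) / (4 * ħ))) = -((j.G v v : ℂ) / (4 * ħ)) := by
    have : -((j.G v v : ℂ) / (4 * ħ)) = ((-(j.G v v / (4 * ħ)) : ℝ) : ℂ) := by push_cast; ring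
    rw [this, Complex.conj_ofReal]
  rw [h4] at h1
  exact mul_left_cancel₀ (Complex.exp_ne_zero _) h1

theorem fockInner_coherent_left (f : Fock j ħ) (v : V) :
    fockInner j ħ (coherent j hħ v) f = (starRingEnd ℂ) ((f : V → ℂ) v) := by
  rw [← fockInner_conj hħ, fockInner_coherent]

end FockInner

/-! ### Unitary operators from Gram matrices -/

section Hilbert

variable {H : Type*} [NormedAddCommGroup H] [InnerProductSpace ℂ H] [CompleteSpace H] {ι : Type*}

theorem denseRange_linearCombination {e : ι → H} (he : ∀ x, (∀ i, inner ℂ (e i) x = 0) → x = 0) :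
    DenseRange (Finsupp.linearCombination ℂ e) := by
  have h1 : (Submodule.span ℂ (Set.range e))ᗮ = ⊥ := by
    rw [Submodule.eq_bot_iff]
    exact fun x hx => he x fun i => hx _ (Submodule.subset_span ⟨i, rfl⟩)
  rw [← Submodule.topologicalClosure_eq_top_iff, ← Submodule.dense_iff_topologicalClosure_eq_top,
    ← Finsupp.range_linearCombination] at h1
  exact h1

/-- A total family and a family with the same Gram matrix are related by an isometry. -/
theorem exists_isometry_of_gram {e u : ι → H} (he : ∀ x, (∀ i, inner ℂ (e i) x = 0) → x = 0)
    (hu : ∀ i k, inner ℂ (u i) (u k) = inner ℂ (e i) (e k)) :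
    ∃ U : H →L[ℂ] H, (∀ x, ‖U x‖ = ‖x‖) ∧ ∀ i, U (e i) = u i := by
  have hd := denseRange_linearCombination he
  have hin : ∀ x y : ι →₀ ℂ, inner ℂ (Finsupp.linearCombination ℂ u x)
      (Finsupp.linearCombination ℂ u y) = inner ℂ (Finsupp.linearCombination ℂ e x)
      (Finsupp.linearCombination ℂ e y) := by
    intro x y
    simp only [Finsupp.linearCombination_apply, Finsupp.sum_inner, Finsupp.inner_sum,
      inner_smul_left, inner_smul_right, hu]
  have hnorm : ∀ x, ‖Finsupp.linearCombination ℂ u x‖ = ‖Finsupp.linearCombination ℂ e x‖ := by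
    intro x
    rw [@norm_eq_sqrt_re_inner ℂ, @norm_eq_sqrt_re_inner ℂ _ _ _ _ (Finsupp.linearCombination ℂ e x), hin]
  let U : H →L[ℂ] H :=
    (Finsupp.linearCombination ℂ u).extendOfNorm (Finsupp.linearCombination ℂ e)
  have hU : ∀ x, U (Finsupp.linearCombination ℂ e x) = Finsupp.linearCombination ℂ u x := fun x =>
    LinearMap.extendOfNorm_eq hd ⟨1, fun x => by rw [one_mul, hnorm]⟩ x
  refine ⟨U, fun x => ?_, fun i => ?_⟩
  · refine hd.induction_on x (isClosed_eq U.continuous.norm continuous_norm) fun y => ?_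
    rw [hU, hnorm]
  · have := hU (Finsupp.single i 1)
    simpa using this

/-- Two families with the Gram matrix of a total family, with adjoint mixed Gram matrices, are
related to it by a unitary operator. -/
theorem exists_unitary_of_gram {e u u' : ι → H} (he : ∀ x, (∀ i, inner ℂ (e i) x = 0) → x = 0)
    (hu : ∀ i k, inner ℂ (u i) (u k) = inner ℂ (e i) (e k))
    (hu' : ∀ i k, inner ℂ (u' i) (u' k) = inner ℂ (e i) (e k))
    (huu' : ∀ i k, inner ℂ (e i) (u' k) = inner ℂ (u i) (e k)) :
    ∃ U : H ≃ₗ[ℂ] H, (∀ x y, inner ℂ (U x) (U y) = inner ℂ x y) ∧ ∀ i, U (e i) = u i := by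
  obtain ⟨U, hUn, hUe⟩ := exists_isometry_of_gram he hu
  obtain ⟨U', hUn', hUe'⟩ := exists_isometry_of_gram he hu'
  -- The mixed Gram matrices say that the adjoint of the isometry U agrees with the isometry U' on
  -- the total family, hence everywhere. An isometry whose adjoint is isometric is unitary.
  have hd := denseRange_linearCombination he
  have h1 : ∀ k, ContinuousLinearMap.adjoint U (e k) = u' k := by
    intro k
    rw [← sub_eq_zero]
    refine he _ fun i => ?_
    rw [inner_sub_right, ContinuousLinearMap.adjoint_inner_right, hUe, huu', sub_self]
  have h2 : ∀ x, ContinuousLinearMap.adjoint U x = U' x := by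
    intro x
    refine hd.induction_on x (isClosed_eq (ContinuousLinearMap.continuous _) U'.continuous)
      fun y => ?_
    simp only [Finsupp.linearCombination_apply, Finsupp.sum, map_sum, map_smul, h1, hUe']
  have h3 := (ContinuousLinearMap.norm_map_iff_adjoint_comp_self U).1 hUn
  have h4 := (ContinuousLinearMap.norm_map_iff_adjoint_comp_self
    (ContinuousLinearMap.adjoint U)).1 fun x => by rw [h2, hUn']
  rw [ContinuousLinearMap.adjoint_adjoint] at h4
  refine ⟨LinearEquiv.ofLinearMap U.toLinearMap (ContinuousLinearMap.adjoint U).toLinearMap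
    (LinearMap.ext fun x => congrArg (fun L : H →L[ℂ] H => L x) h4)
    (LinearMap.ext fun x => congrArg (fun L : H →L[ℂ] H => L x) h3), fun x y => ?_, hUe⟩
  change inner ℂ (U x) (U y) = _
  rw [← ContinuousLinearMap.adjoint_inner_right]
  congr 1
  exact congrArg (fun L : H →L[ℂ] H => L y) h3

end Hilbert

/-! ### Completeness of the Fock space -/

section FockComplete

variable {V : Type*} [NormedAddCommGroup V] [NormedSpace ℝ V] [FiniteDimensional ℝ V]
  {Ω : SymplecticForm V} {j : PCCS Ω} [MeasurableSpace V] [BorelSpace V] {ħ : ℝ} (hħ : 0 < ħ)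

theorem conj_coherent (v z : V) :
    (starRingEnd ℂ) ((coherent j hħ v : V → ℂ) z) = Complex.exp (j.herm v z / (2 * ħ)) := by
  change (starRingEnd ℂ) (Complex.exp _) = _
  rw [← Complex.exp_conj]
  congr 1
  rw [map_div₀, j.herm_conj]
  congr 1
  have : (2 * (ħ : ℂ)) = ((2 * ħ : ℝ) : ℂ) := by push_cast; ring
  rw [this, Complex.conj_ofReal]

include hħ

/-- The Bargmann transform of a square integrable function is holomorphic. -/
theorem isHolomorphic_transform {x : V → ℂ} (hx : MemLp x 2 (j.gauss ħ)) :
    IsHolomorphic j.toComplexStructure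
      fun v => ∫ z, x z * Complex.exp (j.herm v z / (2 * ħ)) ∂(j.gauss ħ) := by
  refine isHolomorphic_integral j hħ hx.1 fun v => ?_
  have h := hx.integrable_mul (Fock.memLp hħ (coherent j hħ v)).star
  refine h.congr (Filter.Eventually.of_forall fun z => ?_)
  change x z * (starRingEnd ℂ) ((coherent j hħ v : V → ℂ) z) = _
  rw [conj_coherent]

/-- Values at v are inner products with e_v, so an L²-convergent sequence of Fock functions
converges pointwise to the transform of its limit, which is holomorphic. Almost everywhere
convergence of a subsequence identifies the limit with this transform. -/
theorem isClosed_range_toLp :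
    IsClosed (LinearMap.range (Fock.toLp (j := j) hħ) : Set (Lp ℂ 2 (j.gauss ħ))) := by
  refine isClosed_of_closure_subset fun x hx => ?_
  obtain ⟨y, hy, hyx⟩ := mem_closure_iff_seq_limit.1 hx
  choose f hf using hy
  have hin : ∀ (y : Lp ℂ 2 (j.gauss ħ)) v, inner ℂ (Fock.toLp hħ (coherent j hħ v)) y
      = ∫ z, y z * Complex.exp (j.herm v z / (2 * ħ)) ∂(j.gauss ħ) := by
    intro y v
    rw [L2.inner_def]
    refine integral_congr_ae ?_
    filter_upwards [Fock.coeFn_toLp hħ (coherent j hħ v)] with z hz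
    rw [hz, ← conj_coherent hħ]
    rfl
  set X : V → ℂ := fun v => ∫ z, x z * Complex.exp (j.herm v z / (2 * ħ)) ∂(j.gauss ħ) with hX
  have hhol : IsHolomorphic j.toComplexStructure X := isHolomorphic_transform hħ (Lp.memLp x)
  have hlim : ∀ v, Filter.Tendsto (fun n => (f n : V → ℂ) v) Filter.atTop (nhds (X v)) := by
    intro v
    have h1 : ∀ n, (f n : V → ℂ) v = inner ℂ (Fock.toLp hħ (coherent j hħ v)) (y n) := by
      intro n
      rw [← hf n, inner_toLp, fockInner_coherent]
    simp only [h1, hX, ← hin]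
    exact tendsto_const_nhds.inner hyx
  obtain ⟨ns, hns, hae⟩ := (tendstoInMeasure_of_tendsto_Lp hyx).exists_seq_tendsto_ae
  have hfy : ∀ᵐ z ∂(j.gauss ħ), ∀ n, (y n : V → ℂ) z = (f n : V → ℂ) z := by
    rw [ae_all_iff]
    intro n
    rw [← hf n]
    exact Fock.coeFn_toLp hħ (f n)
  have hxX : (x : V → ℂ) =ᵐ[j.gauss ħ] X := by
    filter_upwards [hae, hfy] with z h1 h2
    refine tendsto_nhds_unique h1 ?_
    simp only [h2]
    exact (hlim z).comp hns.tendsto_atTop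
  have hXm : X ∈ Fock j ħ := (mem_fock_iff hħ X).2 ⟨hhol, (memLp_congr_ae hxX).1 (Lp.memLp x)⟩
  refine ⟨⟨X, hXm⟩, ?_⟩
  apply Lp.ext
  exact (Fock.coeFn_toLp hħ ⟨X, hXm⟩).trans hxX.symm

/-- A family with the Gram matrix of the coherent states, with an adjoint family, is the image of
the coherent states under a unitary operator. -/
theorem exists_fock_unitary {u u' : V → Fock j ħ}
    (hu : ∀ z w, fockInner j ħ (u z) (u w) = (coherent j hħ z : V → ℂ) w)
    (hu' : ∀ z w, fockInner j ħ (u' z) (u' w) = (coherent j hħ z : V → ℂ) w)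
    (huu' : ∀ z w, (u' z : V → ℂ) w = (starRingEnd ℂ) ((u w : V → ℂ) z)) :
    ∃ U : Fock j ħ ≃ₗ[ℂ] Fock j ħ,
      (∀ f g, fockInner j ħ (U f) (U g) = fockInner j ħ f g) ∧ ∀ v, U (coherent j hħ v) = u v := by
  let K := LinearMap.range (Fock.toLp (j := j) hħ)
  have : CompleteSpace K := (isClosed_range_toLp hħ).completeSpace_coe
  let L : Fock j ħ ≃ₗ[ℂ] K := LinearEquiv.ofInjective (Fock.toLp hħ) (Fock.toLp_injective hħ)
  have hL : ∀ f g, inner ℂ (L g) (L f) = fockInner j ħ f g := fun f g => inner_toLp hħ f g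
  obtain ⟨U, hU1, hU2⟩ := exists_unitary_of_gram (e := fun v => L (coherent j hħ v))
    (u := fun v => L (u v)) (u' := fun v => L (u' v)) (fun x hx => by
      obtain ⟨f, rfl⟩ := L.surjective x
      simp only [hL, fockInner_coherent] at hx
      have : f = 0 := Subtype.ext (funext hx)
      rw [this, map_zero])
    (fun z w => by rw [hL, hL, hu, fockInner_coherent])
    (fun z w => by rw [hL, hL, hu', fockInner_coherent])
    (fun z w => by rw [hL, hL, fockInner_coherent, fockInner_coherent_left, huu'])
  refine ⟨(L.trans U).trans L.symm, fun f g => ?_, fun v => ?_⟩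
  · rw [← hL, ← hL]
    simp only [LinearEquiv.trans_apply, LinearEquiv.apply_symm_apply, hU1]
  · simp only [LinearEquiv.trans_apply, hU2, LinearEquiv.symm_apply_apply]

end FockComplete

/-! ### Berezin kernels and the existence of elements with given parameters -/

section Kernel

variable {V : Type*} [AddCommGroup V] [Module ℝ V] [FiniteDimensional ℝ V] {Ω : SymplecticForm V}
  (j : PCCS Ω) (ħ : ℝ)

/-- The Berezin kernel with parameters `(g, l)`. -/
def berezin (g : V ≃ₗ[ℝ] V) (l : ℂ) (v z : V) : ℂ := l * Complex.exp (1 / (4 * ħ) *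
    (2 * j.herm (Ring.inverse (linearPart j.toComplexStructure g.toLinearMap) z) v
      - j.herm z (zPart j.toComplexStructure (g⁻¹).toLinearMap z)
      - j.herm (zPart j.toComplexStructure g.toLinearMap v) v))

variable {ħ} {g : V ≃ₗ[ℝ] V} (hg : g ∈ Sp Ω)
include hg

theorem herm_inverse_linearPart_adjoint (v w : V) :
    j.herm (Ring.inverse (linearPart j.toComplexStructure (g⁻¹).toLinearMap) v) w
      = j.herm v (Ring.inverse (linearPart j.toComplexStructure g.toLinearMap) w) := by
  have h := inverse_linearPart_adjoint j (inv_mem hg)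
  rw [inv_inv] at h
  exact j.herm_adjoint h (commute_inverse_linearPart j (inv_mem hg)) v w

theorem herm_inverse_linearPart_apply (x v : V) :
    j.herm (Ring.inverse (linearPart j.toComplexStructure g.toLinearMap) (g x)) v
      = j.herm x v + j.herm (zPart j.toComplexStructure g.toLinearMap x) v := by
  have h := LinearMap.congr_fun (inverse_linearPart_mul_self j hg) x
  rw [← j.herm_add_left]
  exact congrArg (fun y => j.herm y v) h

theorem herm_apply_add_zPart (x z : V) :
    j.herm z (g x) + j.herm z (zPart j.toComplexStructure (g⁻¹).toLinearMap (g x))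
      = j.herm (Ring.inverse (linearPart j.toComplexStructure g.toLinearMap) z) x := by
  have h := LinearMap.congr_fun (inverse_linearPart_mul_self j (inv_mem hg)) (g x)
  have h3 : Ring.inverse (linearPart j.toComplexStructure (g⁻¹).toLinearMap) x
      = g x + zPart j.toComplexStructure (g⁻¹).toLinearMap (g x) := by
    rw [Module.End.mul_apply] at h
    have h4 : (g⁻¹ : V ≃ₗ[ℝ] V).toLinearMap (g x) = x := g.symm_apply_apply x
    rw [h4] at h
    exact h
  rw [← j.herm_add_right, ← h3]
  have := herm_inverse_linearPart_adjoint j (inv_mem hg) z x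
  rw [inv_inv] at this
  exact this.symm

/-- This covariance of the kernel under U(gx, s) amounts to C_g⁻¹ g = 1 + Z_g and C_{g⁻¹}⁻¹ = (1 +
Z_{g⁻¹}) g, together with the symmetry of Z_g and Z_{g⁻¹}. -/
theorem weylFactor_mul_berezin (hħ : 0 < ħ) (l : ℂ) (x v z : V) (s : ℝ) :
    Complex.exp (-(Complex.I * s / ħ) + j.herm z (g x) / (2 * ħ) - (j.G (g x) (g x) : ℂ) / (4 * ħ))
        * berezin j ħ g l v (z - g x)
      = (starRingEnd ℂ) (Complex.exp (-(Complex.I * (-s : ℝ) / ħ) + j.herm v (-x) / (2 * ħ)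
          - (j.G (-x) (-x) : ℂ) / (4 * ħ))) * berezin j ħ g l (v + x) z := by
  have e1 := herm_inverse_linearPart_apply j hg x v
  have e2 := herm_apply_add_zPart j hg x z
  have e3 := herm_apply_add_zPart j hg x (g x)
  rw [herm_inverse_linearPart_apply j hg, j.herm_self, j.herm_self] at e3
  have e4 := (isSymmAnti_zPart j hg).herm_comm v x
  have e5 := (isSymmAnti_zPart j (inv_mem hg)).herm_comm' z (g x)
  have hh : (ħ : ℂ) ≠ 0 := by exact_mod_cast hħ.ne'
  rw [← Complex.exp_conj, berezin, berezin, mul_left_comm, mul_left_comm _ l, ← Complex.exp_add,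
    ← Complex.exp_add]
  congr 2
  simp only [map_add, map_sub, map_neg, map_mul, map_div₀, Complex.conj_I, Complex.conj_ofReal,
    j.herm_add_left, j.herm_add_right, j.herm_sub_left, j.herm_sub_right, j.herm_neg_right,
    j.herm_conj, LinearMap.neg_apply, neg_neg, e1]
  have c2 : (starRingEnd ℂ) 2 = 2 := Complex.conj_ofNat 2
  have c4 : (starRingEnd ℂ) 4 = 4 := Complex.conj_ofNat 4
  rw [c2, c4]
  field_simp
  push_cast
  linear_combination 4 * e2 - 2 * e3 + 2 * e4 - 2 * e5

end Kernel

section State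

variable {V : Type*} [NormedAddCommGroup V] [NormedSpace ℝ V] [FiniteDimensional ℝ V]
  {Ω : SymplecticForm V} {j : PCCS Ω} [MeasurableSpace V] [BorelSpace V] {ħ : ℝ} (hħ : 0 < ħ)
  {g : V ≃ₗ[ℝ] V} (hg : g ∈ Sp Ω)
include hħ hg

/-- The adjoint operator has the parameters of the inverse: C_g⁻¹ and C_{g⁻¹}⁻¹ are adjoint, and the
two quadratic terms trade places. -/
theorem conj_berezin (l : ℂ) (z w : V) :
    (starRingEnd ℂ) (berezin j ħ g l w z) = berezin j ħ g⁻¹ ((starRingEnd ℂ) l) z w := by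
  have c : (1 / (4 * ħ) : ℂ) = ((1 / (4 * ħ) : ℝ) : ℂ) := by push_cast; ring
  have c2 : (starRingEnd ℂ) 2 = 2 := Complex.conj_ofNat 2
  rw [berezin, berezin, map_mul, ← Complex.exp_conj, inv_inv,
    herm_inverse_linearPart_adjoint j hg]
  simp only [c, map_mul, map_sub, j.herm_conj, Complex.conj_ofReal, c2]
  congr 3
  ring

theorem berezin_zero_mem (l : ℂ) : berezin j ħ g l 0 ∈ Fock j ħ := by
  have hZ := isSymmAnti_zPart j (inv_mem hg)
  have h0 : berezin j ħ g l 0 = fun z => l * Complex.exp (-(1 / (4 * ħ)) *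
      j.herm z (zPart j.toComplexStructure (g⁻¹).toLinearMap z)) := by
    funext z
    rw [berezin, map_zero, j.herm_zero_right, j.herm_zero_right]
    congr 2
    ring
  have hhol : IsHolomorphic j.toComplexStructure (berezin j ħ g l 0) := by
    rw [h0]
    exact (IsHolomorphic.const _ l).mul (((IsHolomorphic.const _ (-(1 / (4 * ħ) : ℂ))).mul
      (isHolomorphic_herm_comp j hZ)).cexp)
  refine (mem_fock_iff hħ _).2 ⟨hhol, ?_⟩
  rw [memLp_two_iff_integrable_sq_norm hhol.1.continuous.aestronglyMeasurable]
  have h1 := (integrable_gaussPairing hħ hZ hZ (norm_zPart_lt j (inv_mem hg))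
    (norm_zPart_lt j (inv_mem hg))).norm.const_mul (‖l‖ ^ 2)
  refine h1.congr (Filter.Eventually.of_forall fun z => ?_)
  simp only [h0, norm_mul, mul_pow]
  congr 1
  rw [Complex.norm_exp, Complex.norm_exp, ← Real.exp_nat_mul]
  congr 1
  have c : (4 * ħ : ℂ) = ((4 * ħ : ℝ) : ℂ) := by push_cast; ring
  rw [c, Complex.div_ofReal_re, ← Complex.ofReal_one, ← Complex.ofReal_div, ← Complex.ofReal_neg,
    Complex.re_ofReal_mul, Complex.neg_re, Complex.add_re, Complex.conj_re]
  push_cast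
  ring

/-- By covariance the kernel at v is a multiple of a Weyl translate of the kernel at 0, so only one
Gaussian has to be estimated. -/
theorem berezin_mem (l : ℂ) (v : V) : berezin j ħ g l v ∈ Fock j ħ := by
  have h := (Fock j ħ).smul_mem (Complex.exp ((j.G v v : ℂ) / (4 * ħ)))
    (weyl_mem j ħ (g v) 0 (berezin_zero_mem hħ hg l))
  convert h using 1
  funext z
  have h1 := weylFactor_mul_berezin j hg hħ l v 0 z 0
  simp only [Pi.smul_apply, smul_eq_mul, weylFactor]
  rw [h1, j.herm_zero_left, zero_add, ← mul_assoc, ← Complex.exp_conj, ← Complex.exp_add]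
  have c : (4 * ħ : ℂ) = ((4 * ħ : ℝ) : ℂ) := by push_cast; ring
  have : (j.G v v : ℂ) / (4 * ħ) + (starRingEnd ℂ) (-(Complex.I * ((-0 : ℝ) : ℂ) / ħ) + 0 / (2 * ħ)
      - (j.G (-v) (-v) : ℂ) / (4 * ħ)) = 0 := by
    simp [c, Complex.conj_ofReal, -Complex.ofReal_mul]
  rw [this, Complex.exp_zero, one_mul]

/-- The image of the coherent state `e_v` under the operator with Berezin kernel of parameters
`(g, l)`. -/
def metaState (l : ℂ) (v : V) : Fock j ħ := ⟨berezin j ħ g l v, berezin_mem hħ hg l v⟩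

theorem weyl_metaState (l : ℂ) (x v : V) (s : ℝ) :
    weyl j ħ (g x) s (metaState hħ hg l v)
      = (starRingEnd ℂ) (weylFactor j ħ (-x) (-s) v) • metaState hħ hg l (v + x) :=
  Subtype.ext (funext fun z => weylFactor_mul_berezin j hg hħ l x v z s)

/-- With Z = Z_{g⁻¹} the norm is |l|² Det(1 + Z)^{-1/2}. From C_{g⁻¹}(1 - Z²) C_g = 1 and |Det
C_{g⁻¹}| = |Det C_g| this Gaussian factor is |Det C_g|, so the normalisation of l is exactly what
makes the state a unit vector. -/
theorem fockInner_metaState_self {l : ℂ}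
    (hl : ‖l ^ 2 * detLinearPart j.toComplexStructure g.toLinearMap‖ = 1) :
    fockInner j ħ (metaState hħ hg l 0) (metaState hħ hg l 0) = 1 := by
  have hg' := inv_mem hg
  have hZ := isSymmAnti_zPart j hg'
  set Z := zPart j.toComplexStructure (g⁻¹).toLinearMap with hZdef
  have h1 : fockInner j ħ (metaState hħ hg l 0) (metaState hħ hg l 0)
      = (‖l‖ ^ 2 : ℝ) * gaussPairing j ħ Z Z := by
    rw [fockInner_eq hħ, gaussPairing, ← integral_const_mul]
    congr 1
    funext z
    change berezin j ħ g l 0 z * (starRingEnd ℂ) (berezin j ħ g l 0 z) = _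
    have c : (1 / (4 * ħ) : ℂ) = ((1 / (4 * ħ) : ℝ) : ℂ) := by push_cast; ring
    rw [berezin, map_zero, j.herm_zero_right, j.herm_zero_right, map_mul, ← Complex.exp_conj,
      mul_mul_mul_comm, Complex.mul_conj, ← Complex.sq_norm, ← Complex.exp_add]
    congr 2
    simp only [mul_zero, zero_sub, sub_zero]
    rw [map_mul, map_neg, c, Complex.conj_ofReal]
    push_cast
    ring
  have h2 := gaussPairing_sq_mul hħ hZ hZ (norm_zPart_lt j hg') (norm_zPart_lt j hg')
  have h3 := gaussPairing_self hħ hZ (norm_zPart_lt j hg')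
  have h4 : detLinearPart j.toComplexStructure (g⁻¹).toLinearMap
      * (detLinearPart j.toComplexStructure (1 - Z * Z)
      * detLinearPart j.toComplexStructure g.toLinearMap) = 1 := by
    have h := linearPart_mul_eq j hg' hg
    rw [inv_mul_cancel, ← hZdef] at h
    have h5 := congrArg (detLinearPart j.toComplexStructure) h
    rw [detLinearPart_linearPart, detLinearPart_mul _ (linearPart_commute _ _),
      detLinearPart_mul _ ((Commute.one_right _).sub_right (hZ.commute_mul hZ)),
      detLinearPart_linearPart, detLinearPart_linearPart] at h5
    rw [← h5]
    exact detLinearPart_one _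
  have h6 := norm_detLinearPart_inv j hg
  set r := (Real.sqrt (LinearMap.det (1 + Z)))⁻¹ with hr
  have hr0 : 0 ≤ r := inv_nonneg.2 (Real.sqrt_nonneg _)
  rw [h3] at h2
  have n2 := congrArg norm h2
  have n4 := congrArg norm h4
  rw [norm_mul, norm_pow, Complex.norm_real, Real.norm_of_nonneg hr0, norm_one] at n2
  rw [norm_mul, norm_mul, h6, norm_one] at n4
  rw [norm_mul, norm_pow] at hl
  rw [h1, h3, ← Complex.ofReal_mul]
  set d := ‖detLinearPart j.toComplexStructure g.toLinearMap‖
  have hd : 0 ≤ d := norm_nonneg _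
  have hrd : r = d := by
    have : r ^ 2 = d ^ 2 := by linear_combination d ^ 2 * n2 - r ^ 2 * n4
    exact (pow_left_inj₀ hr0 hd two_ne_zero).1 this
  rw [hrd, hl, Complex.ofReal_one]

/-- In the conjugated kernel w occurs holomorphically: through a quadratic factor independent of z,
and through exp(⟨A w, z⟩ / 2ħ) with the j-linear A = C_{g⁻¹}⁻¹. What remains is a holomorphic
integral transform evaluated at A w. -/
theorem isHolomorphic_fockInner_metaState (l : ℂ) :
    IsHolomorphic j.toComplexStructure
      fun w => fockInner j ħ (metaState hħ hg l 0) (metaState hħ hg l w) := by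
  have hg' := inv_mem hg
  set A := Ring.inverse (linearPart j.toComplexStructure (g⁻¹).toLinearMap) with hA
  have hAJ : Commute j.J A := commute_inverse_linearPart j hg'
  let x : V → ℂ := fun z => berezin j ħ g l 0 z * (starRingEnd ℂ) (berezin j ħ g l 0 z)
  have hcb : Continuous (berezin j ħ g l 0) := (metaState (j := j) hħ hg l 0).2.1.1.continuous
  have hkey : ∀ w z, berezin j ħ g l 0 z * (starRingEnd ℂ) (berezin j ħ g l w z)
      = Complex.exp (-(1 / (4 * ħ)) * j.herm w (zPart j.toComplexStructure g.toLinearMap w))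
        * (x z * Complex.exp (j.herm (A w) z / (2 * ħ))) := by
    intro w z
    simp only [x]
    rw [conj_berezin hħ hg, conj_berezin hħ hg, berezin, berezin, berezin]
    simp only [inv_inv, map_zero, j.herm_zero_left, j.herm_zero_right]
    rw [mul_mul_mul_comm, ← Complex.exp_add, mul_mul_mul_comm l, ← Complex.exp_add, mul_assoc (l * _),
      mul_left_comm _ (l * _), ← Complex.exp_add, ← Complex.exp_add]
    congr 2
    rw [← hA]
    field_simp
    ring
  have hpre : IsHolomorphic j.toComplexStructure fun w =>
      Complex.exp (-(1 / (4 * ħ)) * j.herm w (zPart j.toComplexStructure g.toLinearMap w)) :=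
    ((IsHolomorphic.const _ (-(1 / (4 * ħ) : ℂ))).mul
      (isHolomorphic_herm_comp j (isSymmAnti_zPart j hg))).cexp
  have hint : ∀ v, Integrable (fun z => x z * Complex.exp (j.herm v z / (2 * ħ))) (j.gauss ħ) := by
    intro v
    have hv : A (linearPart j.toComplexStructure (g⁻¹).toLinearMap v) = v :=
      LinearMap.congr_fun (inverse_linearPart_mul j hg') v
    have h := (Fock.memLp hħ (metaState (j := j) hħ hg l 0)).integrable_mul (Fock.memLp hħ
      (metaState (j := j) hħ hg l (linearPart j.toComplexStructure (g⁻¹).toLinearMap v))).star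
    have h2 : Integrable (fun z => Complex.exp (-(1 / (4 * ħ)) * j.herm
        (linearPart j.toComplexStructure (g⁻¹).toLinearMap v)
        (zPart j.toComplexStructure g.toLinearMap
          (linearPart j.toComplexStructure (g⁻¹).toLinearMap v)))
        * (x z * Complex.exp (j.herm v z / (2 * ħ)))) (j.gauss ħ) := by
      refine h.congr (Filter.Eventually.of_forall fun z => ?_)
      have := hkey (linearPart j.toComplexStructure (g⁻¹).toLinearMap v) z
      rw [hv] at this
      exact this
    exact (integrable_const_mul_iff (isUnit_iff_ne_zero.2 (Complex.exp_ne_zero _)) _).1 h2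
  have hhol := (isHolomorphic_integral j hħ
    ((hcb.mul (Complex.continuous_conj.comp hcb)).aestronglyMeasurable) hint).comp_linear hAJ
  convert hpre.mul hhol using 1
  funext w
  rw [fockInner_eq hħ]
  simp only [Pi.mul_apply]
  rw [← integral_const_mul]
  congr 1
  funext z
  exact hkey w z

omit hħ hg in
theorem weylFactor_zero_zero (v : V) :
    weylFactor j ħ v 0 0 = Complex.exp (-((j.G v v : ℂ) / (4 * ħ))) := by
  rw [weylFactor, j.herm_zero_left]
  congr 1
  simp

theorem metaState_eq (l : ℂ) (v : V) : metaState hħ hg l v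
    = Complex.exp ((j.G v v : ℂ) / (4 * ħ)) • weyl j ħ (g v) 0 (metaState hħ hg l 0) := by
  have c : (j.G v v : ℂ) / (4 * ħ) = ((j.G v v / (4 * ħ) : ℝ) : ℂ) := by push_cast; ring
  rw [weyl_metaState, neg_zero, weylFactor_zero_zero, zero_add, ← Complex.exp_conj, smul_smul,
    ← Complex.exp_add]
  simp only [map_neg, LinearMap.neg_apply, neg_neg, c, Complex.conj_ofReal]
  simp

/-- Covariance shows that the holomorphic function w ↦ (u_0, u_w) becomes its conjugate under w ↦
-w; so it is constant, equal to ‖u_0‖² = 1. Moving u_z to u_0 by a Weyl operator then produces the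
exponential. -/
theorem fockInner_metaState {l : ℂ}
    (hl : ‖l ^ 2 * detLinearPart j.toComplexStructure g.toLinearMap‖ = 1) (z w : V) :
    fockInner j ħ (metaState hħ hg l z) (metaState hħ hg l w) = (coherent j hħ z : V → ℂ) w := by
  have c : ∀ v, (j.G v v : ℂ) / (4 * ħ) = ((j.G v v / (4 * ħ) : ℝ) : ℂ) := by
    intro v
    push_cast
    ring
  have h0 : ∀ w, fockInner j ħ (metaState hħ hg l 0) (metaState hħ hg l w) = 1 := by
    intro w
    rw [(isHolomorphic_fockInner_metaState hħ hg l).eq_of_neg_eq_conj (fun v => ?_) w,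
      fockInner_metaState_self hħ hg hl]
    rw [fockInner_conj hħ, metaState_eq hħ hg l v, metaState_eq hħ hg l (-v),
      fockInner_smul_left hħ, fockInner_smul_right hħ, fockInner_weyl, neg_zero]
    simp only [map_neg, LinearMap.neg_apply, neg_neg]
    rw [c v, ← Complex.exp_conj, Complex.conj_ofReal]
  rw [metaState_eq hħ hg l z, fockInner_smul_left hħ, fockInner_weyl, neg_zero, ← map_neg,
    weyl_metaState, neg_zero, neg_neg, fockInner_smul_right hħ, h0, Complex.conj_conj, mul_one,
    weylFactor, ← Complex.exp_add]
  change _ = Complex.exp _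
  congr 1
  simp

/-- Every pair `(g, l)` with `|l² Det C_g| = 1` is the parameters of an element of `Mp^c`. -/
theorem exists_hasParameters {l : ℂ}
    (hl : ‖l ^ 2 * detLinearPart j.toComplexStructure g.toLinearMap‖ = 1) :
    ∃ x : MpC j ħ, MpC.HasParameters hħ x g l := by
  have hg' := inv_mem hg
  have hl' : ‖((starRingEnd ℂ) l) ^ 2
      * detLinearPart j.toComplexStructure (g⁻¹).toLinearMap‖ = 1 := by
    rw [norm_mul, norm_pow, norm_detLinearPart_inv j hg, RCLike.norm_conj, ← norm_pow, ← norm_mul, hl]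
  obtain ⟨U, hU, hUe⟩ := exists_fock_unitary hħ (fockInner_metaState hħ hg hl)
    (fockInner_metaState hħ hg' hl') fun z w => (conj_berezin hħ hg l z w).symm
  -- Since U⁻¹ e_z is the state with parameters g⁻¹ and conj l, values of U f are inner products
  -- with explicit states. The intertwining relation for arbitrary f thereby follows from the
  -- covariance of these states.
  have hUf : ∀ f z, (U f : V → ℂ) z
      = fockInner j ħ f (metaState hħ hg' ((starRingEnd ℂ) l) z) := by
    intro f z
    have h1 : U.symm (coherent j hħ z) = metaState hħ hg' ((starRingEnd ℂ) l) z := by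
      apply Subtype.ext
      funext w
      rw [← fockInner_coherent hħ (U.symm _) w, ← hU, LinearEquiv.apply_symm_apply, hUe,
        fockInner_coherent_left]
      exact conj_berezin hħ hg l z w
    rw [← fockInner_coherent hħ, ← h1, ← hU f, LinearEquiv.apply_symm_apply]
  refine ⟨⟨(U, g), hU, hg, fun v t => ?_⟩, rfl, hl, fun z v => ?_⟩
  · refine LinearMap.ext fun f => ?_
    obtain ⟨f, rfl⟩ := U.surjective f
    change weyl j ħ (g v) t (U f) = U (weyl j ħ v t (U.symm (U f)))
    rw [LinearEquiv.symm_apply_apply]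
    apply Subtype.ext
    funext z
    have h2 : (g⁻¹ : V ≃ₗ[ℝ] V) (-(g v)) = -v := by
      rw [map_neg]
      exact congrArg Neg.neg (g.symm_apply_apply v)
    have h3 := weyl_metaState (j := j) hħ hg' ((starRingEnd ℂ) l) (-(g v)) z (-t)
    rw [h2, neg_neg, neg_neg, ← sub_eq_add_neg] at h3
    rw [hUf, fockInner_weyl, h3, fockInner_smul_right hħ, Complex.conj_conj, ← hUf]
    rfl
  · change (U (coherent j hħ v) : V → ℂ) z = _
    rw [hUe]
    rfl

end State

/-! ### Uniqueness of elements with given parameters, and their products -/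

section Composition

variable {V : Type*} [NormedAddCommGroup V] [NormedSpace ℝ V] [FiniteDimensional ℝ V]
  {Ω : SymplecticForm V} {j : PCCS Ω} [MeasurableSpace V] [BorelSpace V] {ħ : ℝ} (hħ : 0 < ħ)

theorem weyl_coherent_zero (v : V) : weyl j ħ v 0 (coherent j hħ 0)
    = Complex.exp (-((j.G v v : ℂ) / (4 * ħ))) • coherent j hħ v := by
  apply Subtype.ext
  funext z
  change weylFactor j ħ v 0 z * Complex.exp (j.herm (z - v) 0 / (2 * ħ))
    = Complex.exp _ * Complex.exp _
  rw [weylFactor, ← Complex.exp_add, ← Complex.exp_add, j.herm_zero_right]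
  congr 1
  push_cast
  ring

theorem coherent_eq (v : V) : coherent j hħ v
    = Complex.exp ((j.G v v : ℂ) / (4 * ħ)) • weyl j ħ v 0 (coherent j hħ 0) := by
  rw [weyl_coherent_zero, smul_smul, ← Complex.exp_add, add_neg_cancel, Complex.exp_zero, one_smul]

theorem coherent_zero_apply (z : V) : (coherent j hħ 0 : V → ℂ) z = 1 := by
  change Complex.exp _ = 1
  rw [j.herm_zero_right, zero_div, Complex.exp_zero]

include hħ

/-- A unitary operator commuting with the Weyl operators is scalar. -/
theorem eq_smul_of_commute_weyl (B : Fock j ħ ≃ₗ[ℂ] Fock j ħ)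
    (hB : ∀ f g, fockInner j ħ (B f) (B g) = fockInner j ħ f g)
    (hW : ∀ v f, B (weyl j ħ v 0 f) = weyl j ħ v 0 (B f)) (f : Fock j ħ) :
    B f = ((B (coherent j hħ 0) : V → ℂ) 0) • f := by
  let p : V → ℂ := ((B (coherent j hħ 0) : Fock j ħ) : V → ℂ)
  have hp : p = ((B (coherent j hħ 0) : Fock j ħ) : V → ℂ) := rfl
  let q : V → ℂ := ((B.symm (coherent j hħ 0) : Fock j ħ) : V → ℂ)
  have c : ∀ v, (j.G v v : ℂ) / (4 * ħ) = ((j.G v v / (4 * ħ) : ℝ) : ℂ) := by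
    intro v
    push_cast
    ring
  have hpq : ∀ z, p (-z) = (starRingEnd ℂ) (q z) := by
    intro z
    have ha : ∀ f g, fockInner j ħ f (weyl j ħ (-z) 0 g) = fockInner j ħ (weyl j ħ z 0 f) g := by
      intro f g
      have h := fockInner_weyl z 0 f g
      rw [neg_zero] at h
      exact h.symm
    rw [hp, ← fockInner_coherent hħ, coherent_eq hħ (-z), fockInner_smul_right hħ, ha, ← hW,
      weyl_coherent_zero, map_smul, fockInner_smul_left hħ, ← mul_assoc, c, ← Complex.exp_conj,
      Complex.conj_ofReal, ← Complex.exp_add]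
    have h1 : fockInner j ħ (B (coherent j hħ z)) (coherent j hħ 0) = (starRingEnd ℂ) (q z) := by
      rw [← fockInner_coherent_left hħ, ← hB (coherent j hħ z), LinearEquiv.apply_symm_apply]
    have hG : j.G (-z) (-z) = j.G z z := by simp
    rw [h1, hG, c, add_neg_cancel, Complex.exp_zero, one_mul]
  have hqp : ∀ z, q (-z) = (starRingEnd ℂ) (p z) := by
    intro z
    rw [← neg_neg z, hpq, neg_neg, Complex.conj_conj]
  have hph : IsHolomorphic j.toComplexStructure p := (B (coherent j hħ 0)).2.1
  have hqh : IsHolomorphic j.toComplexStructure q := (B.symm (coherent j hħ 0)).2.1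
  -- Both p = B e_0 and q = B⁻¹ e_0 are holomorphic, and p(-z) is conjugate to q(z). Hence p + q and
  -- i(p - q) satisfy the hypothesis of `IsHolomorphic.eq_of_neg_eq_conj`, and p is constant.
  have hconst : ∀ z, p z = p 0 := by
    intro z
    have h1 := (hph.add hqh).eq_of_neg_eq_conj (fun v => by
      simp only [Pi.add_apply, hpq, hqp, map_add]
      ring) z
    have h2 := (((IsHolomorphic.const _ Complex.I).mul hph).add
      ((IsHolomorphic.const _ (-Complex.I)).mul hqh)).eq_of_neg_eq_conj (fun v => by
      simp only [Pi.add_apply, Pi.mul_apply, hpq, hqp, map_add, map_mul, map_neg, Complex.conj_I]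
      ring) z
    simp only [Pi.add_apply, Pi.mul_apply] at h1 h2
    linear_combination (1 / 2 : ℂ) * h1 - (1 / 2 : ℂ) * Complex.I * h2
      + (1 / 2 : ℂ) * (p z - q z - p 0 + q 0) * Complex.I_sq
  have h0 : B (coherent j hħ 0) = p 0 • coherent j hħ 0 := by
    apply Subtype.ext
    funext z
    change p z = p 0 * (coherent j hħ 0 : V → ℂ) z
    rw [coherent_zero_apply, mul_one, hconst]
  have hv : ∀ v, B (coherent j hħ v) = p 0 • coherent j hħ v := by
    intro v
    rw [coherent_eq hħ v, map_smul, hW, h0, map_smul, smul_comm]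
  have hn : p 0 * (starRingEnd ℂ) (p 0) = 1 := by
    have h := hB (coherent j hħ 0) (coherent j hħ 0)
    rw [h0, fockInner_smul_left hħ, fockInner_smul_right hħ, fockInner_coherent,
      coherent_zero_apply, mul_one] at h
    exact h
  apply Subtype.ext
  funext z
  change (B f : V → ℂ) z = p 0 * (f : V → ℂ) z
  have h := hB f (coherent j hħ z)
  rw [hv, fockInner_smul_right hħ, fockInner_coherent, fockInner_coherent] at h
  linear_combination (p 0) * h - (B f : V → ℂ) z * hn

/-- The operators intertwine the Weyl operators in the same way, so their quotient is scalar; the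
common nonzero λ forces the scalar to be 1. -/
theorem MpC.ext_of_lam {x y : MpC j ħ} (h : MpC.sigma j ħ x = MpC.sigma j ħ y)
    (hl : MpC.lam hħ x = MpC.lam hħ y) (h0 : MpC.lam hħ x ≠ 0) : x = y := by
  obtain ⟨⟨U, g⟩, hU1, hg, hU2⟩ := x
  obtain ⟨⟨U', g'⟩, hU1', hg', hU2'⟩ := y
  have hgg : g = g' := congrArg Subtype.val h
  subst hgg
  simp only at hU1 hU1' hU2 hU2'
  change (U (coherent j hħ 0) : V → ℂ) 0 = (U' (coherent j hħ 0) : V → ℂ) 0 at hl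
  change (U (coherent j hħ 0) : V → ℂ) 0 ≠ 0 at h0
  have hUw : ∀ v f, weyl j ħ (g v) 0 (U f) = U (weyl j ħ v 0 f) := fun v f => by
    rw [hU2]
    simp
  have hUw' : ∀ v f, weyl j ħ (g v) 0 (U' f) = U' (weyl j ħ v 0 f) := fun v f => by
    rw [hU2']
    simp
  have hB := eq_smul_of_commute_weyl hħ (U.trans U'.symm) (fun f₁ f₂ => by
      rw [← hU1', LinearEquiv.trans_apply, LinearEquiv.trans_apply, LinearEquiv.apply_symm_apply,
        LinearEquiv.apply_symm_apply, hU1])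
    (fun v f => by
      simp only [LinearEquiv.trans_apply]
      rw [LinearEquiv.symm_apply_eq, ← hUw', LinearEquiv.apply_symm_apply, hUw])
  set c := (((U.trans U'.symm) (coherent j hħ 0) : Fock j ħ) : V → ℂ) 0 with hc
  have hUf : ∀ f, U f = c • U' f := by
    intro f
    rw [← map_smul, ← hB f, LinearEquiv.trans_apply, LinearEquiv.apply_symm_apply]
  have hc1 : c = 1 := by
    have h2 := congrArg (fun f : Fock j ħ => (f : V → ℂ) 0) (hUf (coherent j hħ 0))
    change (U (coherent j hħ 0) : V → ℂ) 0 = c * (U' (coherent j hħ 0) : V → ℂ) 0 at h2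
    rw [← hl] at h2
    exact mul_right_cancel₀ h0 (by rw [← h2, one_mul])
  have hUU : U = U' := LinearEquiv.ext fun f => by rw [hUf, hc1, one_smul]
  subst hUU
  rfl

theorem MpC.HasParameters.lam_eq {x : MpC j ħ} {g : V ≃ₗ[ℝ] V} {l : ℂ}
    (h : MpC.HasParameters hħ x g l) : MpC.lam hħ x = l := by
  rw [MpC.lam, h.kernel]
  simp [j.herm_zero_right]

/-- The value (U U' e_0)(0) is the inner product of U' e_0 with U⁻¹ e_0. These are Gaussians with
quadratic forms Z_{g'⁻¹} and Z_g and amplitudes l' and conj l. -/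
theorem MpC.HasParameters.lam_mul {x x' : MpC j ħ} {g g' : V ≃ₗ[ℝ] V} {l l' : ℂ}
    (h : MpC.HasParameters hħ x g l) (h' : MpC.HasParameters hħ x' g' l') :
    MpC.lam hħ (x * x') = l * l' * gaussPairing j ħ
      (zPart j.toComplexStructure (g'⁻¹).toLinearMap) (zPart j.toComplexStructure g.toLinearMap) := by
  have h1 : MpC.lam hħ (x * x')
      = fockInner j ħ (x'.1.1 (coherent j hħ 0)) (x.1.1.symm (coherent j hħ 0)) := by
    rw [← x.2.1, LinearEquiv.apply_symm_apply, fockInner_coherent]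
    rfl
  have h2 : ∀ w, (starRingEnd ℂ) ((x.1.1.symm (coherent j hħ 0) : V → ℂ) w)
      = (x.1.1 (coherent j hħ w) : V → ℂ) 0 := by
    intro w
    rw [← fockInner_coherent_left hħ, ← x.2.1, LinearEquiv.apply_symm_apply, fockInner_coherent]
  rw [h1, fockInner_eq hħ, gaussPairing, ← integral_const_mul]
  congr 1
  funext w
  rw [h2, h.kernel, h'.kernel]
  simp only [map_zero, j.herm_zero_left, j.herm_zero_right, j.herm_conj]
  rw [mul_mul_mul_comm, ← Complex.exp_add, mul_comm l' l]
  congr 2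
  field_simp
  ring

end Composition

/-! ### The unitary character given by the ratio of the two partial determinants -/

section MinusRatio

variable {W W' : Type*} [AddCommGroup W] [Module ℝ W] [AddCommGroup W'] [Module ℝ W']
  {c : ComplexStructure W} {c' : ComplexStructure W'} (φ : W ≃ₗ[ℝ] W')

theorem detOnMinus_conj_equiv (h : ∀ w, φ (c.J w) = c'.J (φ w)) {K : Module.End ℝ W}
    {K' : Module.End ℝ W'} (hK : Commute c.J K) (hK' : Commute c'.J K')
    (hφ : ∀ w, φ (K w) = K' (φ w)) {A : Module.End ℝ W} (hA : Commute A K)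
    (hA' : Commute (φ.conj A) K') :
    detOnMinus c' K' hK' (φ.conj A) hA' = detOnMinus c K hK A hA := by
  let e : minusSpace c K hK ≃ₗ[ℂ] minusSpace c' K' hK' :=
    { toFun := fun w => ⟨cxEquiv φ h w.1, by
        have h1 : K w.1.val = -c.J w.1.val := w.2
        change K' (φ w.1.val) = -c'.J (φ w.1.val)
        rw [← hφ, h1, map_neg, h]⟩
      invFun := fun w => ⟨(cxEquiv φ h).symm w.1, by
        have h1 : K' w.1.val = -c'.J w.1.val := w.2
        change K (φ.symm w.1.val) = -c.J (φ.symm w.1.val)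
        apply φ.injective
        rw [hφ, map_neg, h, φ.apply_symm_apply, h1]⟩
      map_add' := fun v w => Subtype.ext ((cxEquiv φ h).map_add v.1 w.1)
      map_smul' := fun z w => Subtype.ext ((cxEquiv φ h).map_smul z w.1)
      left_inv := fun w => Subtype.ext ((cxEquiv φ h).symm_apply_apply w.1)
      right_inv := fun w => Subtype.ext ((cxEquiv φ h).apply_symm_apply w.1) }
  rw [detOnMinus, detOnMinus, ← LinearMap.det_conj _ e]
  congr 1
  refine LinearMap.ext fun w => Subtype.ext ?_
  change linearPart c' (φ.conj A) w.1.val = φ (linearPart c A (φ.symm w.1.val))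
  rw [linearPart_conj φ h]
  rfl

variable {V : Type*} [AddCommGroup V] [Module ℝ V] [FiniteDimensional ℝ V] {Ω : SymplecticForm V}
  (j : PCCS Ω) (c : ComplexStructure V) (hc : Commute j.J c.J)

theorem linearPart_commute_right {K A : Module.End ℝ V} (hK : Commute j.J K) (hA : Commute A K) :
    Commute (linearPart j.toComplexStructure A) K := by
  rw [linearPart]
  exact (hA.sub_left ((hK.mul_left hA).mul_left hK)).smul_left _

theorem zPart_commute {g : V ≃ₗ[ℝ] V} (hg : g ∈ Sp Ω) {K : Module.End ℝ V} (hK : Commute j.J K)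
    (hA : Commute g.toLinearMap K) : Commute (zPart j.toComplexStructure g.toLinearMap) K := by
  have h1 := linearPart_commute_right j hK hA
  have h2 : Commute (antilinearPart j.toComplexStructure g.toLinearMap) K := by
    rw [antilinearPart]
    exact (hA.add_left ((hK.mul_left hA).mul_left hK)).smul_left _
  rw [zPart]
  refine Commute.mul_left ?_ h2
  obtain ⟨u, hu⟩ := isUnit_linearPart j hg
  rw [← hu] at h1 ⊢
  rw [Ring.inverse_unit]
  exact h1.units_inv_left

theorem commute_inv_of_commute {g : V ≃ₗ[ℝ] V} {K : Module.End ℝ V}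
    (hA : Commute g.toLinearMap K) : Commute (g⁻¹).toLinearMap K := by
  refine LinearMap.ext fun v => ?_
  change g.symm (K v) = K (g.symm v)
  rw [LinearEquiv.symm_apply_eq]
  have := LinearMap.congr_fun hA (g.symm v)
  change g (K (g.symm v)) = K (g (g.symm v)) at this
  rw [this, LinearEquiv.apply_symm_apply]

theorem detOnMinus_linearPart {K : Module.End ℝ V} (hK : Commute j.J K) {A : Module.End ℝ V}
    (hA : Commute A K) :
    detOnMinus j.toComplexStructure K hK (linearPart j.toComplexStructure A)
      (linearPart_commute_right j hK hA) = detOnMinus j.toComplexStructure K hK A hA :=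
  detOnMinus_congr _ _ _ _ _ (linearPart_linearPart _ _)

/-- The factorisation C_{gg'} = C_g (1 - Z_g Z_{g'⁻¹}) C_{g'} restricts to {K = -j}; the middle
factor is the defect of multiplicativity. -/
theorem detOnMinus_apply_mul {K : Module.End ℝ V} (hK : Commute j.J K) {g g' : V ≃ₗ[ℝ] V} (hg : g ∈ Sp Ω) (hg' : g' ∈ Sp Ω)
    (hA : Commute g.toLinearMap K) (hA' : Commute g'.toLinearMap K)
    (hAA' : Commute (g * g').toLinearMap K)
    (hZ : Commute (1 - zPart j.toComplexStructure g.toLinearMap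
        * zPart j.toComplexStructure (g'⁻¹).toLinearMap) K) :
    detOnMinus j.toComplexStructure K hK (g * g').toLinearMap hAA'
      = detOnMinus j.toComplexStructure K hK g.toLinearMap hA
        * (detOnMinus j.toComplexStructure K hK (1 - zPart j.toComplexStructure g.toLinearMap
        * zPart j.toComplexStructure (g'⁻¹).toLinearMap) hZ
        * detOnMinus j.toComplexStructure K hK g'.toLinearMap hA') := by
  have h := linearPart_mul_eq j hg hg'
  have h1 := linearPart_commute_right j hK hA
  have h1' := linearPart_commute_right j hK hA'
  have hJ := (Commute.one_right _).sub_right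
    ((isSymmAnti_zPart j hg).commute_mul (isSymmAnti_zPart j (inv_mem hg')))
  rw [← detOnMinus_linearPart j hK hAA', ← detOnMinus_linearPart j hK hA,
    ← detOnMinus_linearPart j hK hA', ← detOnMinus_mul _ _ _ hZ h1' hJ,
    ← detOnMinus_mul _ _ _ h1 (hZ.mul_left h1') (linearPart_commute _ _)]
  exact detOnMinus_congr _ _ _ _ _ (congrArg _ h)

/-- The ratio of the determinants of the complex linear part of `g` on `{c = -j}` and `{c = j}`. -/
def minusRatio (g : V ≃ₗ[ℝ] V) (hA : Commute g.toLinearMap c.J) : ℂ :=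
  detOnMinus j.toComplexStructure c.J hc g.toLinearMap hA
    / detOnMinus j.toComplexStructure (-c.J) hc.neg_right g.toLinearMap hA.neg_right

theorem detOnMinus_ne_zero {g : V ≃ₗ[ℝ] V} (hg : g ∈ Sp Ω) (hA : Commute g.toLinearMap c.J) :
    detOnMinus j.toComplexStructure c.J hc g.toLinearMap hA ≠ 0 ∧
    detOnMinus j.toComplexStructure (-c.J) hc.neg_right g.toLinearMap hA.neg_right ≠ 0 := by
  have h := detLinearPart_ne_zero j hg
  rw [detLinearPart_eq_mul _ c.J hc c.sq hA] at h
  exact mul_ne_zero_iff.1 h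

/-- The defect Det(1 - Z_g Z_{g'⁻¹}) is the same on {c = -j} and {c = j} by
`detOnMinus_one_sub_mul`, so it cancels in the quotient. -/
theorem minusRatio_mul {g g' : V ≃ₗ[ℝ] V} (hg : g ∈ Sp Ω) (hg' : g' ∈ Sp Ω)
    (hA : Commute g.toLinearMap c.J) (hA' : Commute g'.toLinearMap c.J)
    (hAA' : Commute (g * g').toLinearMap c.J) :
    minusRatio j c hc (g * g') hAA' = minusRatio j c hc g hA * minusRatio j c hc g' hA' := by
  have hZ := zPart_commute j hg hc hA
  have hZ' := zPart_commute j (inv_mem hg') hc (commute_inv_of_commute hA')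
  have hS := detOnMinus_one_sub_mul j c hc (isSymmAnti_zPart j (inv_mem hg'))
    (isSymmAnti_zPart j hg) hZ' hZ
  have h1 := detOnMinus_apply_mul j hc hg hg' hA hA' hAA' (commute_one_sub_mul hZ' hZ)
  have h2 := detOnMinus_apply_mul j hc.neg_right hg hg' hA.neg_right hA'.neg_right hAA'.neg_right
    (commute_one_sub_mul hZ' hZ).neg_right
  have h0 := (detOnMinus_ne_zero j c hc (mul_mem hg hg') hAA').1
  rw [minusRatio, minusRatio, minusRatio, h2, ← hS, h1]
  rw [h1] at h0
  obtain ⟨h3, h4⟩ := mul_ne_zero_iff.1 h0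
  obtain ⟨h5, h6⟩ := mul_ne_zero_iff.1 h4
  field_simp

/-- As C_{g⁻¹} is the adjoint of C_g, the ratios of g and g⁻¹ have the same modulus, while their
product is 1. -/
theorem norm_minusRatio {g : V ≃ₗ[ℝ] V} (hg : g ∈ Sp Ω) (hA : Commute g.toLinearMap c.J) :
    ‖minusRatio j c hc g hA‖ = 1 := by
  have hA' := commute_inv_of_commute hA
  have h1 := minusRatio_mul j c hc hg (inv_mem hg) hA hA' (by
    rw [mul_inv_cancel]
    exact Commute.one_left _)
  have hadj : ∀ v w, j.G (linearPart j.toComplexStructure g.toLinearMap v) w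
      = j.G v (linearPart j.toComplexStructure (g⁻¹).toLinearMap w) := linearPart_adjoint j hg
  have n1 := norm_detOnMinus_adjoint j c hc hadj (linearPart_commute _ _)
    (linearPart_commute_right j hc hA) (linearPart_commute _ _).symm
    (linearPart_commute_right j hc hA')
  have n2 := norm_detOnMinus_adjoint j (ComplexStructure.conj c) hc.neg_right hadj
    (linearPart_commute _ _)
    (linearPart_commute_right j hc.neg_right hA.neg_right) (linearPart_commute _ _).symm
    (linearPart_commute_right j hc.neg_right hA'.neg_right)
  rw [detOnMinus_linearPart j hc hA, detOnMinus_linearPart j hc hA'] at n1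
  have n2' : ‖detOnMinus j.toComplexStructure (-c.J) hc.neg_right g.toLinearMap hA.neg_right‖
      = ‖detOnMinus j.toComplexStructure (-c.J) hc.neg_right (g⁻¹).toLinearMap hA'.neg_right‖ := by
    rw [← detOnMinus_linearPart j hc.neg_right hA.neg_right,
      ← detOnMinus_linearPart j hc.neg_right hA'.neg_right]
    exact n2
  have h2 : ‖minusRatio j c hc g⁻¹ hA'‖ = ‖minusRatio j c hc g hA‖ := by
    rw [minusRatio, minusRatio, norm_div, norm_div, n1, n2']
  have h3 : minusRatio j c hc (g * g⁻¹) (by rw [mul_inv_cancel]; exact Commute.one_left _) = 1 := by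
    have e : (g * g⁻¹).toLinearMap = 1 := by rw [mul_inv_cancel]; rfl
    rw [minusRatio, detOnMinus_congr _ _ _ _ (Commute.one_left _) (congrArg _ e),
      detOnMinus_congr _ _ _ _ (Commute.one_left _) (congrArg _ e), detOnMinus_one, detOnMinus_one, div_one]
  rw [h3] at h1
  have h4 := congrArg norm h1
  rw [norm_mul, h2, norm_one] at h4
  nlinarith [norm_nonneg (minusRatio j c hc g hA)]

end MinusRatio

/-! ### The reduced space Q and the action of the stabiliser on it -/

namespace ComplexLagrangian

variable {V : Type*} [AddCommGroup V] [Module ℝ V] [FiniteDimensional ℝ V] {Ω : SymplecticForm V}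
  (F : ComplexLagrangian Ω) (j : PCCS Ω)

/-- The symplectic form of `Q = (D + jD)^⊥`. -/
def complementForm : SymplecticForm (F.complement j) where
  form := Ω.form.restrict (F.complement j)
  alt v := Ω.alt v
  nondegenerate := by
    refine LinearMap.BilinForm.nondegenerate_restrict_of_disjoint_orthogonal _ Ω.alt.isRefl ?_
    rw [Submodule.disjoint_def]
    intro x hx hx'
    apply j.eq_zero
    have := hx' (j.J x) (F.J_mem_complement j x hx)
    rw [j.G_apply, Ω.neg, this, neg_zero]

/-- The restriction of `j` to `Q = (D + jD)^⊥`. -/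
def complementPCCS : PCCS (F.complementForm j) where
  J := F.jComplement j
  sq w := Subtype.ext (j.sq w)
  compat v w := j.compat v w
  pos v hv := j.pos v fun h => hv (Subtype.ext h)

theorem complementForm_apply (v w : F.complement j) :
    (F.complementForm j).form v w = Ω.form v w := rfl

theorem complementPCCS_J (v : F.complement j) : ((F.complementPCCS j).J v : V) = j.J v := rfl

/-- The complex structure on `Q` defined by `F`. -/
def complementStructure : ComplexStructure (F.complement j) where
  J := F.onComplement j F.reducedStructure.J
  sq w := by
    simp only [onComplement, LinearEquiv.conj_apply_apply, LinearEquiv.symm_symm,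
      LinearEquiv.apply_symm_apply, F.reducedStructure.sq, map_neg, LinearEquiv.symm_apply_apply]

theorem complementEquiv_symm_J (w : F.Reduced) : (F.complementEquiv j).symm
    ((F.inducedStructure j).J w) = (F.complementPCCS j).J ((F.complementEquiv j).symm w) := by
  change (F.complementEquiv j).symm ((F.complementEquiv j).conj (F.jComplement j) w) = _
  rw [LinearEquiv.conj_apply_apply, LinearEquiv.symm_apply_apply]
  rfl

theorem complementEquiv_symm_reducedStructure (w : F.Reduced) : (F.complementEquiv j).symm
    (F.reducedStructure.J w) = (F.complementStructure j).J ((F.complementEquiv j).symm w) := by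
  change _ = (F.complementEquiv j).symm.conj F.reducedStructure.J ((F.complementEquiv j).symm w)
  rw [LinearEquiv.conj_apply_apply, LinearEquiv.symm_symm, LinearEquiv.apply_symm_apply]

theorem onComplement_mul (A B : Module.End ℝ F.Reduced) :
    F.onComplement j (A * B) = F.onComplement j A * F.onComplement j B := conj_mul _ A B

theorem onComplement_one : F.onComplement j 1 = 1 := (F.complementEquiv j).symm.conj_id

theorem commute_onComplement {A B : Module.End ℝ F.Reduced} (h : Commute A B) :
    Commute (F.onComplement j A) (F.onComplement j B) := by
  rw [Commute, SemiconjBy, ← onComplement_mul, ← onComplement_mul, h.eq]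

variable {j} in
theorem commute_complementStructure (hj : Commute (F.inducedStructure j).J F.reducedStructure.J) :
    Commute (F.complementPCCS j).J (F.complementStructure j).J := by
  have h : F.onComplement j (F.inducedStructure j).J = (F.complementPCCS j).J := by
    refine LinearMap.ext fun w => ?_
    obtain ⟨w, rfl⟩ := (F.complementEquiv j).symm.surjective w
    change (F.complementEquiv j).symm.conj _ _ = _
    rw [LinearEquiv.conj_apply_apply, LinearEquiv.symm_symm, LinearEquiv.apply_symm_apply,
      complementEquiv_symm_J]
  rw [← h]
  exact F.commute_onComplement j hj

theorem bMap_mul (g g' : F.stabilizer) : F.bMap (g * g') = F.bMap g * F.bMap g' := by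
  refine LinearMap.ext fun q => ?_
  obtain ⟨x, rfl⟩ := Submodule.mkQ_surjective _ q
  rfl

theorem bMap_one : F.bMap 1 = 1 := by
  refine LinearMap.ext fun q => ?_
  obtain ⟨x, rfl⟩ := Submodule.mkQ_surjective _ q
  rfl

/-- The map `Q → Q` induced by `g`. -/
def bEquiv (g : F.stabilizer) : F.complement j ≃ₗ[ℝ] F.complement j :=
  LinearEquiv.ofLinearMap (F.onComplement j (F.bMap g)) (F.onComplement j (F.bMap g⁻¹))
    (by
      change F.onComplement j _ * F.onComplement j _ = 1
      rw [← onComplement_mul, ← bMap_mul, mul_inv_cancel, bMap_one, onComplement_one])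
    (by
      change F.onComplement j _ * F.onComplement j _ = 1
      rw [← onComplement_mul, ← bMap_mul, inv_mul_cancel, bMap_one, onComplement_one])

theorem bEquiv_toLinearMap (g : F.stabilizer) :
    (F.bEquiv j g).toLinearMap = F.onComplement j (F.bMap g) := rfl

theorem bEquiv_inv (g : F.stabilizer) : F.bEquiv j g⁻¹ = (F.bEquiv j g)⁻¹ := by
  apply LinearEquiv.toLinearMap_injective
  rfl

theorem bEquiv_mul (g g' : F.stabilizer) : F.bEquiv j (g * g') = F.bEquiv j g * F.bEquiv j g' := by
  apply LinearEquiv.toLinearMap_injective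
  rw [bEquiv_toLinearMap, bMap_mul, onComplement_mul]
  rfl

theorem apply_sub_bEquiv_mem (g : F.stabilizer) (q : F.complement j) :
    g.1 q - (F.bEquiv j g q : V) ∈ F.realPart := by
  let x : F.perp := ⟨g.1 q, F.stabilizer_perp g q (F.complement_le_perp j q.2)⟩
  let y : F.perp := ⟨F.bEquiv j g q, F.complement_le_perp j (F.bEquiv j g q).2⟩
  change ((x - y : F.perp) : V) ∈ F.realPart
  rw [← toReduced_eq_zero, map_sub, sub_eq_zero]
  have h : F.complementEquiv j (F.bEquiv j g q) = F.bMap g (F.complementEquiv j q) := by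
    change F.complementEquiv j ((F.complementEquiv j).symm.conj (F.bMap g) q) = _
    rw [LinearEquiv.conj_apply_apply, LinearEquiv.symm_symm, LinearEquiv.apply_symm_apply]
  exact h.symm

theorem form_perp {d x : V} (hd : d ∈ F.realPart) (hx : x ∈ F.perp) : Ω.form d x = 0 := hx d hd

theorem form_perp' {d x : V} (hd : d ∈ F.realPart) (hx : x ∈ F.perp) : Ω.form x d = 0 := by
  rw [Ω.neg, hx d hd, neg_zero]

/-- On Q the maps g and b differ by vectors of D, which are Ω-orthogonal to D^⊥. -/
theorem bEquiv_mem (g : F.stabilizer) : F.bEquiv j g ∈ Sp (F.complementForm j) := by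
  intro q q'
  rw [complementForm_apply, complementForm_apply, ← g.2.1 q q']
  have h1 := F.apply_sub_bEquiv_mem j g q
  have h2 := F.apply_sub_bEquiv_mem j g q'
  have m1 := F.stabilizer_perp g q (F.complement_le_perp j q.2)
  have m2 := F.complement_le_perp j (F.bEquiv j g q').2
  have e1 := F.form_perp h1 m2
  have e2 := F.form_perp' h2 m1
  rw [map_sub, LinearMap.sub_apply] at e1
  rw [map_sub] at e2
  change Ω.form (g.1 q) (g.1 q') - _ = 0 at e2
  linear_combination -e1 - e2

theorem bEquiv_commute (g : F.stabilizer) :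
    Commute (F.bEquiv j g).toLinearMap (F.complementStructure j).J :=
  F.commute_onComplement j (F.bMap_commute g)

/-- Here the invertibility of C_b matters, since `Ring.inverse` is zero on non-units. It is known on
Q, where b is symplectic and j is positive compatible, and is carried back to the quotient. -/
theorem zReduced_eq (g : F.stabilizer) : F.zReduced j g
    = zPart (F.complementPCCS j).toComplexStructure (F.bEquiv j g).toLinearMap := by
  have h := isUnit_linearPart (F.complementPCCS j) (F.bEquiv_mem j g)
  have h1 := linearPart_conj (c := F.inducedStructure j)
    (c' := (F.complementPCCS j).toComplexStructure) (F.complementEquiv j).symm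
    (F.complementEquiv_symm_J j) (F.bMap g)
  refine (zPart_conj (c := F.inducedStructure j)
    (c' := (F.complementPCCS j).toComplexStructure) (F.complementEquiv j).symm
    (F.complementEquiv_symm_J j) (F.bMap g) ?_).symm
  change IsUnit (linearPart (F.complementPCCS j).toComplexStructure
    ((F.complementEquiv j).symm.conj (F.bMap g))) at h
  rw [h1] at h
  exact (MulEquiv.isUnit_map ((F.complementEquiv j).symm.conjRingEquiv)).1 h

variable {j} in
theorem detMinus_eq (hj : Commute (F.inducedStructure j).J F.reducedStructure.J) (g : F.stabilizer) :
    F.detMinus j hj g = detOnMinus (F.complementPCCS j).toComplexStructure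
      (F.complementStructure j).J (F.commute_complementStructure hj) (F.bEquiv j g).toLinearMap
      (F.bEquiv_commute j g) :=
  (detOnMinus_conj_equiv (c := F.inducedStructure j)
    (c' := (F.complementPCCS j).toComplexStructure) (F.complementEquiv j).symm
    (F.complementEquiv_symm_J j) hj (F.commute_complementStructure hj)
    (F.complementEquiv_symm_reducedStructure j) (F.bMap_commute g) (F.bEquiv_commute j g)).symm

end ComplexLagrangian

/-! ### Block determinants relative to D, jD and Q -/

section Schur

variable {E₁ E₂ : Type*} [AddCommGroup E₁] [Module ℂ E₁] [FiniteDimensional ℂ E₁] [AddCommGroup E₂]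
  [Module ℂ E₂] [FiniteDimensional ℂ E₂]

theorem det_one_add_comp_eq_one {A : E₁ →ₗ[ℂ] E₂} {B : E₂ →ₗ[ℂ] E₁} (h : A ∘ₗ B = 0) :
    LinearMap.det (1 + B ∘ₗ A) = 1 := by
  have h1 := det_one_sub_comp_comm (-A) B
  rw [LinearMap.comp_neg, sub_neg_eq_add, LinearMap.neg_comp, h, neg_zero, sub_zero, map_one] at h1
  exact h1

/-- The Schur complement formula. -/
theorem det_block (P : Module.End ℂ E₁) (S : E₂ →ₗ[ℂ] E₁) (R : E₁ →ₗ[ℂ] E₂) (C Ci : Module.End ℂ E₂)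
    (h1 : C * Ci = 1) (h2 : Ci * C = 1) :
    LinearMap.det ((P.coprod S).prod (R.coprod C))
      = LinearMap.det C * LinearMap.det (P - S ∘ₗ Ci ∘ₗ R) := by
  -- Factorisation into upper unipotent, block diagonal and lower unipotent; the unipotent factors
  -- have determinant 1.
  have hf : (P.coprod S).prod (R.coprod C)
      = (1 + LinearMap.inl ℂ E₁ E₂ ∘ₗ (S ∘ₗ Ci ∘ₗ LinearMap.snd ℂ E₁ E₂))
        * ((P - S ∘ₗ Ci ∘ₗ R).prodMap C)
        * (1 + LinearMap.inr ℂ E₁ E₂ ∘ₗ (Ci ∘ₗ R ∘ₗ LinearMap.fst ℂ E₁ E₂)) := by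
    refine LinearMap.ext fun x => ?_
    have e1 : ∀ y, C (Ci y) = y := fun y => LinearMap.congr_fun h1 y
    have e2 : ∀ y, Ci (C y) = y := fun y => LinearMap.congr_fun h2 y
    apply Prod.ext
    · simp [Module.End.mul_apply, e1, e2]
    · simp [Module.End.mul_apply, e1]
      abel
  rw [hf, map_mul, map_mul, det_one_add_comp_eq_one, det_one_add_comp_eq_one,
    LinearMap.det_prodMap]
  · ring
  · refine LinearMap.ext fun x => ?_
    simp
  · refine LinearMap.ext fun x => ?_
    simp

end Schur

namespace ComplexLagrangian

variable {V : Type*} [AddCommGroup V] [Module ℝ V] [FiniteDimensional ℝ V] {Ω : SymplecticForm V}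
  (F : ComplexLagrangian Ω) (j : PCCS Ω)

theorem form_realPart {x y : V} (hx : x ∈ F.realPart) (hy : y ∈ F.realPart) : Ω.form x y = 0 :=
  F.form_perp hx (F.realPart_le_perp hy)

theorem G_realPart_J {x y : V} (hx : x ∈ F.realPart) (hy : y ∈ F.realPart) : j.G x (j.J y) = 0 := by
  rw [j.G_apply, j.sq, map_neg, F.form_realPart hx hy, neg_zero]

theorem G_realPart_complement {x q : V} (hx : x ∈ F.realPart) (hq : q ∈ F.complement j) :
    j.G x q = 0 :=
  ((F.mem_complement j _).1 (F.J_mem_complement j q hq)).1 x hx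

theorem G_J_realPart_complement {x q : V} (hx : x ∈ F.realPart) (hq : q ∈ F.complement j) :
    j.G (j.J x) q = 0 :=
  ((F.mem_complement j _).1 (F.J_mem_complement j q hq)).2 x hx

/-- `D^ℂ → (V, j)`. -/
def realPartToCx : ℂ ⊗[ℝ] F.realPart →ₗ[ℂ] CxSpace j.toComplexStructure :=
  LinearMap.liftBaseChange ℂ
    ((CxSpace.realEquiv j.toComplexStructure).symm.toLinearMap ∘ₗ F.realPart.subtype)

/-- `(Q, j) → (V, j)`. -/
def complementToCx : CxSpace (F.complementPCCS j).toComplexStructure →ₗ[ℂ]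
    CxSpace j.toComplexStructure where
  toFun q := CxSpace.of _ (q.val : V)
  map_add' _ _ := rfl
  map_smul' _ _ := rfl

theorem realPartToCx_apply (x y : F.realPart) :
    (F.realPartToCx j ((1 : ℂ) ⊗ₜ[ℝ] x + Complex.I ⊗ₜ[ℝ] y)).val = (x : V) + j.J y := by
  rw [map_add, realPartToCx, LinearMap.liftBaseChange_tmul, LinearMap.liftBaseChange_tmul, one_smul]
  change (x : V) + (Complex.I.re • (y : V) + Complex.I.im • j.J y) = _
  simp

theorem exists_decomposition (v : V) : ∃ (x y : F.realPart) (q : F.complement j),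
    v = x + j.J y + q := by
  set x := j.proj F.realPart v with hx
  set y := j.proj F.realPart (j.J v) with hy
  have hq : v - x + j.J y ∈ F.complement j := by
    rw [mem_complement]
    constructor
    · intro d hd
      have h1 := j.sub_proj_mem F.realPart (j.J v) d hd
      have h2 := F.form_realPart hd x.2
      rw [j.G_apply] at h1
      rw [map_sub, map_sub, j.sq, map_neg] at h1
      rw [map_add, map_sub, h2]
      linarith
    · intro d hd
      have h1 := j.sub_proj_mem F.realPart v d hd
      have h2 := F.form_realPart hd y.2
      have h3 : ∀ w, Ω.form (j.J d) w = -j.G d w := fun w => by rw [j.form_eq, j.G_JJ]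
      rw [map_add, h3, h1, j.compat, h2]
      simp
  refine ⟨x, -y, ⟨_, hq⟩, ?_⟩
  rw [Submodule.coe_neg, map_neg]
  change v = (x : V) + -j.J y + (v - x + j.J y)
  abel

theorem decomposition_eq_zero {x y : F.realPart} {q : F.complement j}
    (h : (x : V) + j.J y + q = 0) : x = 0 ∧ y = 0 ∧ q = 0 := by
  have h1 : x = 0 := by
    have := congrArg (j.G x) h
    rw [map_add, map_add, F.G_realPart_J j x.2 y.2, F.G_realPart_complement j x.2 q.2, map_zero,
      add_zero, add_zero] at this
    exact Subtype.ext (j.eq_zero this)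
  have h2 : y = 0 := by
    have := congrArg (j.G (j.J y)) h
    rw [map_add, map_add, j.G_JJ, F.G_J_realPart_complement j y.2 q.2, map_zero, h1,
      Submodule.coe_zero, map_zero, zero_add, add_zero] at this
    exact Subtype.ext (j.eq_zero this)
  refine ⟨h1, h2, Subtype.ext ?_⟩
  rw [h1, h2] at h
  simpa using h

/-- `D^ℂ ⊕ Q ≃ (V, j)`. -/
def decompositionEquiv : ((ℂ ⊗[ℝ] F.realPart) × CxSpace (F.complementPCCS j).toComplexStructure)
    ≃ₗ[ℂ] CxSpace j.toComplexStructure :=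
  LinearEquiv.ofBijective ((F.realPartToCx j).coprod (F.complementToCx j)) <| by
    constructor
    · rw [← LinearMap.ker_eq_bot, Submodule.eq_bot_iff]
      rintro ⟨t, q⟩ h
      obtain ⟨x, y, rfl⟩ := exists_tmul t
      have h1 : (F.realPartToCx j ((1 : ℂ) ⊗ₜ[ℝ] x + Complex.I ⊗ₜ[ℝ] y)).val + (q.val : V) = 0 := h
      rw [realPartToCx_apply] at h1
      obtain ⟨rfl, rfl, h3⟩ := F.decomposition_eq_zero j h1
      apply Prod.ext
      · simp
      · exact h3
    · intro v
      obtain ⟨x, y, q, h⟩ := F.exists_decomposition j v.val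
      refine ⟨((1 : ℂ) ⊗ₜ[ℝ] x + Complex.I ⊗ₜ[ℝ] y, CxSpace.of _ q), ?_⟩
      change (F.realPartToCx j ((1 : ℂ) ⊗ₜ[ℝ] x + Complex.I ⊗ₜ[ℝ] y)).val + (q : V) = v.val
      rw [realPartToCx_apply, h]

theorem decompositionEquiv_apply (x y : F.realPart) (q : F.complement j) :
    (F.decompositionEquiv j ((1 : ℂ) ⊗ₜ[ℝ] x + Complex.I ⊗ₜ[ℝ] y, CxSpace.of _ q)).val
      = (x : V) + j.J y + q := by
  rw [← realPartToCx_apply]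
  rfl

/-- The complex linear extension `q ↦ S q - i S (j q)` of a real linear map `S : Q → D`. -/
def complementToComplexification (S : F.complement j →ₗ[ℝ] F.realPart) :
    CxSpace (F.complementPCCS j).toComplexStructure →ₗ[ℂ] ℂ ⊗[ℝ] F.realPart where
  toFun q := (1 : ℂ) ⊗ₜ[ℝ] S q.val + Complex.I ⊗ₜ[ℝ] (-S ((F.complementPCCS j).J q.val))
  map_add' p q := by
    change (1 : ℂ) ⊗ₜ[ℝ] S (p.val + q.val)
      + Complex.I ⊗ₜ[ℝ] (-S ((F.complementPCCS j).J (p.val + q.val))) = _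
    simp only [map_add, neg_add, TensorProduct.tmul_add]
    abel
  map_smul' z q := by
    change (1 : ℂ) ⊗ₜ[ℝ] S (z.re • q.val + z.im • (F.complementPCCS j).J q.val)
      + Complex.I ⊗ₜ[ℝ] (-S ((F.complementPCCS j).J
        (z.re • q.val + z.im • (F.complementPCCS j).J q.val))) = _
    have hz : z = (z.re : ℂ) + (z.im : ℂ) * Complex.I := (Complex.re_add_im z).symm
    have key : ∀ (r : ℝ) (w : ℂ) (x : F.realPart), (r : ℂ) • (w ⊗ₜ[ℝ] x) = w ⊗ₜ[ℝ] (r • x) := by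
      intro r w x
      rw [TensorProduct.smul_tmul', smul_eq_mul, ← Complex.real_smul, TensorProduct.smul_tmul]
    simp only [RingHom.id_apply]
    nth_rewrite 5 [hz]
    rw [add_smul, mul_smul, smul_I_tmul]
    simp only [map_add, map_smul, (F.complementPCCS j).sq, map_neg, smul_add, neg_add, neg_neg,
      TensorProduct.tmul_add, smul_neg, key]
    abel

/-- The determinant of a complex linear map given by blocks relative to `V = D^ℂ ⊕ Q`. -/
theorem detLinearPart_block {X : Module.End ℝ V} (hX : Commute j.J X) {P₁ P₂ : Module.End ℝ F.realPart}
    {R : F.realPart →ₗ[ℝ] F.complement j} {S : F.complement j →ₗ[ℝ] F.realPart}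
    {C Ci : Module.End ℝ (F.complement j)} (hC : Commute (F.complementPCCS j).J C)
    (hCi : Commute (F.complementPCCS j).J Ci) (h1 : C * Ci = 1) (h2 : Ci * C = 1)
    (hD : ∀ d : F.realPart, X d = P₁ d + j.J (P₂ d) + R d)
    (hQ : ∀ q : F.complement j, X q = S q - j.J (S ((F.complementPCCS j).J q)) + C q) :
    detLinearPart j.toComplexStructure X
      = detLinearPart (F.complementPCCS j).toComplexStructure C * LinearMap.det
        ((P₁ - S ∘ₗ Ci ∘ₗ R).baseChange ℂ
          + Complex.I • (P₂ + S ∘ₗ (F.complementPCCS j).J ∘ₗ Ci ∘ₗ R).baseChange ℂ) := by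
  set c := (F.complementPCCS j).toComplexStructure
  have hC' : linearPart c C = C := linearPart_eq_of_commute c hC
  have hCi' : linearPart c Ci = Ci := linearPart_eq_of_commute c hCi
  let R' : ℂ ⊗[ℝ] F.realPart →ₗ[ℂ] CxSpace c :=
    LinearMap.liftBaseChange ℂ ((CxSpace.realEquiv c).symm.toLinearMap ∘ₗ R)
  have hR' : ∀ x y, (R' ((1 : ℂ) ⊗ₜ[ℝ] x + Complex.I ⊗ₜ[ℝ] y)).val = R x + c.J (R y) := by
    intro x y
    simp only [R']
    rw [map_add, LinearMap.liftBaseChange_tmul, LinearMap.liftBaseChange_tmul, one_smul]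
    change R x + (Complex.I.re • (R y) + Complex.I.im • c.J (R y)) = _
    simp
  have hbc : ∀ (A B : Module.End ℝ F.realPart) x y, (A.baseChange ℂ + Complex.I • B.baseChange ℂ)
      ((1 : ℂ) ⊗ₜ[ℝ] x + Complex.I ⊗ₜ[ℝ] y)
        = (1 : ℂ) ⊗ₜ[ℝ] (A x - B y) + Complex.I ⊗ₜ[ℝ] (A y + B x) := by
    intro A B x y
    rw [LinearMap.add_apply, LinearMap.smul_apply, map_add, map_add, LinearMap.baseChange_tmul,
      LinearMap.baseChange_tmul, LinearMap.baseChange_tmul, LinearMap.baseChange_tmul, smul_I_tmul,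
      TensorProduct.tmul_sub, TensorProduct.tmul_add, TensorProduct.tmul_neg]
    abel
  have hS' : ∀ q : CxSpace c, F.complementToComplexification j S q
      = (1 : ℂ) ⊗ₜ[ℝ] S q.val + Complex.I ⊗ₜ[ℝ] (-S (c.J q.val)) := fun q => rfl
  have hblk := det_block (P₁.baseChange ℂ + Complex.I • P₂.baseChange ℂ)
    (F.complementToComplexification j S) R' (linearPartCx c C) (linearPartCx c Ci)
    (LinearMap.ext fun q => by
      change linearPart c C (linearPart c Ci q.val) = q
      rw [hC', hCi']
      exact LinearMap.congr_fun h1 q.val)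
    (LinearMap.ext fun q => by
      change linearPart c Ci (linearPart c C q.val) = q
      rw [hC', hCi']
      exact LinearMap.congr_fun h2 q.val)
  have hconj : LinearMap.det (linearPartCx j.toComplexStructure X)
      = LinearMap.det (((P₁.baseChange ℂ + Complex.I • P₂.baseChange ℂ).coprod
        (F.complementToComplexification j S)).prod (R'.coprod (linearPartCx c C))) := by
    rw [← LinearMap.det_conj _ (F.decompositionEquiv j)]
    congr 1
    refine LinearMap.ext fun v => ?_
    obtain ⟨⟨t, q⟩, rfl⟩ := (F.decompositionEquiv j).surjective v
    obtain ⟨x, y, rfl⟩ := exists_tmul t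
    simp only [LinearMap.comp_apply, LinearEquiv.coe_coe, LinearEquiv.symm_apply_apply]
    change _ = F.decompositionEquiv j ((P₁.baseChange ℂ + Complex.I • P₂.baseChange ℂ)
      ((1 : ℂ) ⊗ₜ[ℝ] x + Complex.I ⊗ₜ[ℝ] y) + F.complementToComplexification j S q,
      R' ((1 : ℂ) ⊗ₜ[ℝ] x + Complex.I ⊗ₜ[ℝ] y) + linearPartCx c C q)
    rw [hbc, hS']
    change linearPart j.toComplexStructure X (F.decompositionEquiv j
      ((1 : ℂ) ⊗ₜ[ℝ] x + Complex.I ⊗ₜ[ℝ] y, CxSpace.of _ q.val)).val = _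
    rw [decompositionEquiv_apply, linearPart_eq_of_commute _ hX]
    have e1 : ((1 : ℂ) ⊗ₜ[ℝ] (P₁ x - P₂ y) + Complex.I ⊗ₜ[ℝ] (P₁ y + P₂ x)
        + ((1 : ℂ) ⊗ₜ[ℝ] S q.val + Complex.I ⊗ₜ[ℝ] (-S (c.J q.val))))
        = (1 : ℂ) ⊗ₜ[ℝ] (P₁ x - P₂ y + S q.val)
          + Complex.I ⊗ₜ[ℝ] (P₁ y + P₂ x - S (c.J q.val)) := by
      simp only [TensorProduct.tmul_add, TensorProduct.tmul_sub, TensorProduct.tmul_neg]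
      abel
    rw [e1]
    refine Eq.trans ?_ (F.decompositionEquiv_apply j _ _ (R x + c.J (R y) + C q.val)).symm
      |>.trans (congrArg (fun w => (F.decompositionEquiv j (_, w)).val) ?_)
    · have hXJ : ∀ w, X (j.J w) = j.J (X w) := fun w => (LinearMap.congr_fun hX w).symm
      have hcJ : ∀ q : F.complement j, ((c.J q : F.complement j) : V) = j.J q := fun q => rfl
      have hcJ' : ∀ q : F.complement j, (((F.complementPCCS j).J q : F.complement j) : V) = j.J q :=
        fun q => rfl
      rw [map_add, map_add, hXJ, hD, hD, hQ]
      simp only [map_add, map_sub, j.sq, Submodule.coe_add, Submodule.coe_sub, hcJ]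
      abel
    · change R x + c.J (R y) + C q.val = (R' _).val + linearPart c C q.val
      rw [hR', hC']
  rw [detLinearPart, hconj, hblk]
  congr 2
  refine LinearMap.ext fun t => ?_
  obtain ⟨x, y, rfl⟩ := exists_tmul t
  rw [LinearMap.sub_apply, hbc, hbc, LinearMap.comp_apply, LinearMap.comp_apply, hS']
  have e2 : (linearPartCx c Ci (R' ((1 : ℂ) ⊗ₜ[ℝ] x + Complex.I ⊗ₜ[ℝ] y))).val
      = Ci (R x) + c.J (Ci (R y)) := by
    change linearPart c Ci (R' _).val = _
    rw [hR', hCi', map_add]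
    congr 1
    exact (LinearMap.congr_fun hCi (R y)).symm
  rw [e2]
  simp only [LinearMap.sub_apply, LinearMap.add_apply, LinearMap.comp_apply, map_add, c.sq, map_neg,
    neg_add, neg_neg, TensorProduct.tmul_add, TensorProduct.tmul_sub, TensorProduct.tmul_neg]
  change _ = _
  abel

end ComplexLagrangian

theorem inverse_eq_of_mul_eq_one {R : Type*} [Ring R] {x y : R} (h1 : x * y = 1) (h2 : y * x = 1) :
    Ring.inverse x = y :=
  Ring.inverse_unit ⟨x, y, h1, h2⟩

section Projection

variable {V : Type*} [AddCommGroup V] [Module ℝ V] [FiniteDimensional ℝ V] {Ω : SymplecticForm V}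
  (j : PCCS Ω)

theorem PCCS.proj_eq (D : Submodule ℝ V) {v : V} {x : D} (h : ∀ d ∈ D, j.G d (v - x) = 0) :
    j.proj D v = x := by
  rw [← sub_eq_zero]
  apply Subtype.ext
  apply j.eq_zero
  have h1 := h _ (j.proj D v - x).2
  have h2 := j.sub_proj_mem D v _ (j.proj D v - x).2
  rw [map_sub] at h1 h2
  simp only [Submodule.coe_sub, map_sub] at h1 h2 ⊢
  linarith

theorem PCCS.G_transpose (D : Submodule ℝ V) (a : Module.End ℝ D) (x y : D) :
    j.G (j.transpose D a x) y = j.G x (a y) :=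
  LinearMap.BilinForm.isAdjointPairLeftAdjointOfNondegenerate (j.G.restrict D)
    (j.G_restrict_nondegenerate D) a x y

theorem PCCS.ext_G (D : Submodule ℝ V) {x y : D} (h : ∀ d : D, j.G x d = j.G y d) : x = y := by
  rw [← sub_eq_zero]
  apply Subtype.ext
  apply j.eq_zero
  have := h (x - y)
  simp only [Submodule.coe_sub, map_sub, LinearMap.sub_apply] at this ⊢
  linarith

theorem PCCS.transpose_mul (D : Submodule ℝ V) (a b : Module.End ℝ D) :
    j.transpose D (a * b) = j.transpose D b * j.transpose D a := by
  refine LinearMap.ext fun x => j.ext_G D fun d => ?_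
  rw [j.G_transpose, Module.End.mul_apply, Module.End.mul_apply, j.G_transpose, j.G_transpose]

theorem PCCS.transpose_one (D : Submodule ℝ V) : j.transpose D 1 = 1 := by
  refine LinearMap.ext fun x => j.ext_G D fun d => ?_
  rw [j.G_transpose]
  rfl

end Projection

section RealImag

variable {E : Type*} [AddCommGroup E] [Module ℝ E] [FiniteDimensional ℝ E]

theorem baseChange_real_smul (t : ℝ) (A : Module.End ℝ E) :
    (t • A).baseChange ℂ = (t : ℂ) • A.baseChange ℂ := by
  have key : ∀ (w : ℂ) (x : E), w ⊗ₜ[ℝ] (t • x) = (t : ℂ) • (w ⊗ₜ[ℝ] x) := fun w x => by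
    rw [TensorProduct.smul_tmul', smul_eq_mul, ← Complex.real_smul, TensorProduct.smul_tmul]
  refine LinearMap.ext fun v => ?_
  obtain ⟨x, y, rfl⟩ := exists_tmul v
  simp only [map_add, LinearMap.baseChange_tmul, LinearMap.smul_apply, key]

theorem baseChange_add_I_smul_apply (A B : Module.End ℝ E) (x y : E) :
    (A.baseChange ℂ + Complex.I • B.baseChange ℂ) ((1 : ℂ) ⊗ₜ[ℝ] x + Complex.I ⊗ₜ[ℝ] y)
      = (1 : ℂ) ⊗ₜ[ℝ] (A x - B y) + Complex.I ⊗ₜ[ℝ] (A y + B x) := by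
  rw [LinearMap.add_apply, LinearMap.smul_apply, map_add, map_add, LinearMap.baseChange_tmul,
    LinearMap.baseChange_tmul, LinearMap.baseChange_tmul, LinearMap.baseChange_tmul, smul_I_tmul,
    TensorProduct.tmul_sub, TensorProduct.tmul_add, TensorProduct.tmul_neg]
  abel

/-- A complex operator with positive definite real part and symmetric imaginary part is
invertible. -/
theorem det_baseChange_ne_zero (B : LinearMap.BilinForm ℝ E) (hB : ∀ x y, B x y = B y x)
    {M N : Module.End ℝ E} (hM : ∀ x, x ≠ 0 → 0 < B (M x) x) (hN : ∀ x y, B (N x) y = B x (N y)) :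
    LinearMap.det (M.baseChange ℂ + Complex.I • N.baseChange ℂ) ≠ 0 := by
  intro h
  obtain ⟨v, hv, hv0⟩ := (Submodule.ne_bot_iff _).1 (LinearMap.bot_lt_ker_of_det_eq_zero h).ne'
  obtain ⟨x, y, rfl⟩ := exists_tmul v
  rw [LinearMap.mem_ker, baseChange_add_I_smul_apply] at hv
  have h0 : (1 : ℂ) ⊗ₜ[ℝ] (0 : E) + Complex.I ⊗ₜ[ℝ] (0 : E) = 0 := by simp
  rw [← h0] at hv
  obtain ⟨h1, h2⟩ := tmul_injective hv
  -- For a kernel vector x + iy, pairing the real part with x and the imaginary part with y gives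
  -- cross terms that cancel because N is symmetric. There remains B(Mx, x) + B(My, y) = 0.
  have e1 := congrArg (fun z => B z x) h1
  have e2 := congrArg (fun z => B z y) h2
  simp only [map_sub, map_add, LinearMap.sub_apply, LinearMap.add_apply, map_zero,
    LinearMap.zero_apply] at e1 e2
  have e3 : B (N x) y = B (N y) x := by rw [hN, hB]
  have hp : ∀ x, 0 ≤ B (M x) x := fun x => by
    by_cases hx : x = 0
    · simp [hx]
    · exact (hM x hx).le
  have hx : x = 0 := by
    by_contra hx
    linarith [hM x hx, hp y]
  have hy : y = 0 := by
    by_contra hy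
    linarith [hM y hy, hp x]
  apply hv0
  simp [hx, hy]

theorem segmentDet_baseChange (M N : Module.End ℝ E) (t : ℝ) :
    segmentDet (M.baseChange ℂ + Complex.I • N.baseChange ℂ) t
      = LinearMap.det (((1 - t) • 1 + t • M).baseChange ℂ + Complex.I • (t • N).baseChange ℂ) := by
  rw [segmentDet]
  congr 1
  have h1 : (1 : Module.End ℝ E).baseChange ℂ = 1 := LinearMap.baseChange_id
  rw [sub_smul, one_smul, LinearMap.baseChange_add, LinearMap.baseChange_sub,
    baseChange_real_smul, baseChange_real_smul, baseChange_real_smul, h1]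
  module

end RealImag

/-! ### The components a, b, e, s of an element of the stabiliser -/

namespace ComplexLagrangian

variable {V : Type*} [AddCommGroup V] [Module ℝ V] [FiniteDimensional ℝ V] {Ω : SymplecticForm V}
  (F : ComplexLagrangian Ω) (j : PCCS Ω) (g : F.stabilizer)

theorem aMap_mul (g g' : F.stabilizer) : F.aMap (g * g') = F.aMap g * F.aMap g' := rfl

theorem aMap_inv_mul : F.aMap g⁻¹ * F.aMap g = 1 := by
  rw [← aMap_mul, inv_mul_cancel]
  rfl

theorem aMap_mul_inv : F.aMap g * F.aMap g⁻¹ = 1 := by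
  rw [← aMap_mul, mul_inv_cancel]
  rfl

theorem aMap_apply_inv (x : F.realPart) : F.aMap g (F.aMap g⁻¹ x) = x :=
  LinearMap.congr_fun (F.aMap_mul_inv g) x

theorem aMap_inv_apply (x : F.realPart) : F.aMap g⁻¹ (F.aMap g x) = x :=
  LinearMap.congr_fun (F.aMap_inv_mul g) x

theorem aMap_coe (x : F.realPart) : (F.aMap g x : V) = g.1 x := rfl

theorem proj_realPart (x y : F.realPart) (q : F.complement j) :
    j.proj F.realPart (x + j.J y + q) = x := by
  refine j.proj_eq _ fun d hd => ?_
  have : (x : V) + j.J y + q - x = j.J y + q := by abel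
  rw [this, map_add, F.G_realPart_J j hd y.2, F.G_realPart_complement j hd q.2, add_zero]

theorem proj_complement (x y : F.realPart) (q : F.complement j) :
    j.proj (F.complement j) (x + j.J y + q) = q := by
  refine j.proj_eq _ fun d hd => ?_
  have : (x : V) + j.J y + q - q = x + j.J y := by abel
  rw [this, map_add, j.G_comm d x, j.G_comm d (j.J y), F.G_realPart_complement j x.2 hd,
    F.G_J_realPart_complement j y.2 hd, add_zero]

/-- The `D`-component of `a⁻¹ g j`. -/
def mMap : Module.End ℝ F.realPart :=
  F.sMap j g - (1 / 2 : ℝ) • (F.eStar j g ∘ₗ F.eMap j g)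

theorem mMap_eq : F.mMap j g = F.aMap g⁻¹ * (j.proj F.realPart ∘ₗ g.1.toLinearMap ∘ₗ j.J ∘ₗ
    F.realPart.subtype) := by
  rw [mMap, sMap, add_sub_cancel_right]

theorem form_complement {d q : V} (hd : d ∈ F.realPart) (hq : q ∈ F.complement j) :
    Ω.form d q = 0 := ((F.mem_complement j _).1 hq).1 d hd

theorem form_J_complement {d q : V} (hd : d ∈ F.realPart) (hq : q ∈ F.complement j) :
    Ω.form (j.J d) q = 0 := ((F.mem_complement j _).1 hq).2 d hd

/-- The components along D and Q are those by which s and e were defined; the component along jD is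
forced to be (aᵀ)⁻¹ v by pairing with D and using that g is symplectic. -/
theorem apply_J (v : F.realPart) : g.1 (j.J v) = F.aMap g (F.mMap j g v)
    + j.J (j.transpose F.realPart (F.aMap g⁻¹) v) + F.bEquiv j g (F.eMap j g v) := by
  obtain ⟨x, y, q, h⟩ := F.exists_decomposition j (g.1 (j.J v))
  have h1 : F.aMap g (F.mMap j g v) = x := by
    rw [mMap_eq]
    change F.aMap g (F.aMap g⁻¹ (j.proj F.realPart (g.1 (j.J v)))) = x
    rw [aMap_apply_inv, h, proj_realPart]
  have h2 : F.bEquiv j g (F.eMap j g v) = q := by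
    change F.bEquiv j g (F.bEquiv j g⁻¹ (j.proj (F.complement j) (g.1 (j.J v)))) = q
    rw [h, proj_complement, bEquiv_inv]
    exact (F.bEquiv j g).apply_symm_apply q
  have h3 : j.transpose F.realPart (F.aMap g⁻¹) v = y := by
    refine j.ext_G _ fun d => ?_
    rw [j.G_transpose]
    have h4 : Ω.form d (g.1 (j.J v)) = Ω.form (F.aMap g⁻¹ d) (j.J v) := by
      have h5 := g.2.1 (F.aMap g⁻¹ d) (j.J v)
      rwa [← aMap_coe, aMap_apply_inv] at h5
    rw [h, map_add, map_add, F.form_realPart d.2 x.2, F.form_complement j d.2 q.2] at h4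
    rw [j.G_comm v, j.G_comm y, j.G_apply, j.G_apply, ← h4]
    ring
  rw [h1, h2, h3, h]

/-- The component of g q along D is not free: q is Ω-orthogonal to jD, so g q is Ω-orthogonal to
g(jD), and this determines it from e. -/
theorem apply_complement (q : F.complement j) :
    g.1 q = F.bEquiv j g q - F.aMap g (F.eStar j g q) := by
  let d : F.realPart := ⟨_, F.apply_sub_bEquiv_mem j g q⟩
  have hd : g.1 q = F.bEquiv j g q + d := by
    change g.1 q = F.bEquiv j g q + (g.1 q - F.bEquiv j g q)
    abel
  have h : F.aMap g⁻¹ d = -F.eStar j g q := by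
    refine j.ext_G _ fun v => ?_
    have h1 : Ω.form (g.1 q) (g.1 (j.J v)) = 0 := by
      rw [g.2.1, Ω.neg, F.form_J_complement j v.2 q.2, neg_zero]
    have h2 : Ω.form (F.bEquiv j g q) (F.bEquiv j g (F.eMap j g v)) = Ω.form q (F.eMap j g v) :=
      F.bEquiv_mem j g q (F.eMap j g v)
    have h3 := F.form_J_complement j (j.transpose F.realPart (F.aMap g⁻¹) v).2 (F.bEquiv j g q).2
    have h4 : Ω.form d (j.J (j.transpose F.realPart (F.aMap g⁻¹) v)) = j.G (F.aMap g⁻¹ d) v := by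
      rw [← j.G_apply, j.G_comm, j.G_transpose, j.G_comm]
    rw [hd, apply_J] at h1
    simp only [map_add, LinearMap.add_apply] at h1
    rw [h2, h4,
      Ω.neg _ (j.J _), h3, F.form_realPart d.2 (F.aMap g (F.mMap j g v)).2,
      F.form_complement j d.2 (F.bEquiv j g (F.eMap j g v)).2,
      Ω.neg _ (F.aMap g (F.mMap j g v) : V),
      F.form_complement j (F.aMap g (F.mMap j g v)).2 (F.bEquiv j g q).2] at h1
    rw [Submodule.coe_neg, map_neg, LinearMap.neg_apply, eStar, j.G_mixedTranspose]
    linarith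
  have h5 : d = -F.aMap g (F.eStar j g q) := by
    rw [← map_neg, ← h, aMap_apply_inv]
  rw [hd, h5, Submodule.coe_neg, sub_eq_add_neg]

theorem G_eStar (q : F.complement j) (v : F.realPart) :
    j.G (F.eStar j g q) v = Ω.form q (F.eMap j g v) := j.G_mixedTranspose _ _ _ q v

/-- The relation Ω(g j v, g j w) = 0 says that the antisymmetric part of the D-component of a⁻¹ g j
comes from Ω(e v, e w). The summand ½ e* e in the definition of s is there to remove it. -/
theorem sMap_symm (v w : F.realPart) : j.G (F.sMap j g v) w = j.G v (F.sMap j g w) := by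
  have h1 : Ω.form (g.1 (j.J v)) (g.1 (j.J w)) = 0 := by
    rw [g.2.1, j.compat, F.form_realPart v.2 w.2]
  have hb : Ω.form (F.bEquiv j g (F.eMap j g v)) (F.bEquiv j g (F.eMap j g w))
      = Ω.form (F.eMap j g v) (F.eMap j g w) := F.bEquiv_mem j g _ _
  have hm : ∀ v w : F.realPart, Ω.form (F.aMap g (F.mMap j g v))
      (j.J (j.transpose F.realPart (F.aMap g⁻¹) w)) = j.G (F.mMap j g v) w := by
    intro v w
    rw [← j.G_apply, j.G_comm, j.G_transpose, aMap_inv_apply, j.G_comm]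
  have hs : ∀ v : F.realPart, F.sMap j g v
      = F.mMap j g v + (1 / 2 : ℝ) • F.eStar j g (F.eMap j g v) := by
    intro v
    simp [mMap]
  set A := F.aMap g (F.mMap j g v)
  set A' := F.aMap g (F.mMap j g w)
  set T := j.transpose F.realPart (F.aMap g⁻¹) v
  set T' := j.transpose F.realPart (F.aMap g⁻¹) w
  rw [apply_J, apply_J] at h1
  simp only [map_add, LinearMap.add_apply] at h1
  rw [hm, hb, F.form_realPart A.2 A'.2, Ω.neg (j.J T) A', hm, F.form_complement j A.2 (F.bEquiv j g _).2,
    F.form_J_complement j T.2 (F.bEquiv j g _).2, j.compat, F.form_realPart T.2 T'.2,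
    Ω.neg _ (A' : V), F.form_complement j A'.2 (F.bEquiv j g _).2, Ω.neg _ (j.J (T' : V)),
    F.form_J_complement j T'.2 (F.bEquiv j g _).2] at h1
  rw [hs, hs]
  simp only [Submodule.coe_add, Submodule.coe_smul, map_add, map_smul, LinearMap.add_apply,
    LinearMap.smul_apply, smul_eq_mul]
  rw [j.G_comm v (F.eStar j g _), G_eStar, G_eStar, j.G_comm v (F.mMap j g w),
    Ω.neg (F.eMap j g w : V) (F.eMap j g v)]
  linarith

/-- The real part of `M(g)`. -/
def deltaRe : Module.End ℝ F.realPart :=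
  (1 / 2 : ℝ) • (1 + F.aMap g⁻¹ * j.transpose F.realPart (F.aMap g⁻¹))
    - (1 / 4 : ℝ) • (F.eStar j g ∘ₗ (F.complementPCCS j).J ∘ₗ F.eMap j g)
    - (1 / 4 : ℝ) • (F.eStar j g ∘ₗ (F.complementPCCS j).J ∘ₗ F.zReduced j g ∘ₗ F.eMap j g)

/-- The imaginary part of `M(g)`. -/
def deltaIm : Module.End ℝ F.realPart :=
  -(1 / 2 : ℝ) • F.sMap j g - (1 / 4 : ℝ) • (F.eStar j g ∘ₗ F.zReduced j g ∘ₗ F.eMap j g)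

theorem inverse_transpose_mul : Ring.inverse (j.transpose F.realPart (F.aMap g) * F.aMap g)
    = F.aMap g⁻¹ * j.transpose F.realPart (F.aMap g⁻¹) := by
  apply inverse_eq_of_mul_eq_one
  · rw [mul_assoc, ← mul_assoc (F.aMap g), aMap_mul_inv, one_mul, ← j.transpose_mul,
      aMap_inv_mul, j.transpose_one]
  · rw [mul_assoc, ← mul_assoc (j.transpose _ _), ← j.transpose_mul, aMap_mul_inv, j.transpose_one,
      one_mul, aMap_inv_mul]

theorem deltaArg_eq : F.deltaArg j g
    = (F.deltaRe j g).baseChange ℂ + Complex.I • (F.deltaIm j g).baseChange ℂ := by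
  have h1 : (1 : Module.End ℝ F.realPart).baseChange ℂ = 1 := LinearMap.baseChange_id
  rw [deltaArg, deltaRe, deltaIm, inverse_transpose_mul, LinearMap.baseChange_sub,
    LinearMap.baseChange_sub, LinearMap.baseChange_sub, baseChange_real_smul, baseChange_real_smul,
    baseChange_real_smul, baseChange_real_smul, baseChange_real_smul, LinearMap.baseChange_add, h1]
  change _ - _ • LinearMap.baseChange ℂ (F.eStar j g ∘ₗ (F.complementPCCS j).J ∘ₗ F.eMap j g) - _
    - _ • LinearMap.baseChange ℂ (F.eStar j g ∘ₗ (F.complementPCCS j).J ∘ₗ F.zReduced j g ∘ₗ F.eMap j g)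
    = _
  push_cast
  match_scalars <;> ring

end ComplexLagrangian

/-! ### Det C_g in terms of a, b and M(g), and the square of f_F -/

namespace ComplexLagrangian

variable {V : Type*} [AddCommGroup V] [Module ℝ V] [FiniteDimensional ℝ V] {Ω : SymplecticForm V}
  (F : ComplexLagrangian Ω) (j : PCCS Ω) (g : F.stabilizer)

theorem isSymmAnti_zReduced : (F.complementPCCS j).IsSymmAnti (F.zReduced j g) := by
  rw [zReduced_eq]
  exact isSymmAnti_zPart _ (F.bEquiv_mem j g)

theorem isContr_zReduced : (F.complementPCCS j).IsContr (F.zReduced j g) := by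
  rw [zReduced_eq]
  exact norm_zPart_lt _ (F.bEquiv_mem j g)

theorem linearPart_realPart (d : F.realPart) : linearPart j.toComplexStructure g.1.toLinearMap d
    = ((1 / 2 : ℝ) • (F.aMap g + j.transpose F.realPart (F.aMap g⁻¹))) d
      + j.J (((-(1 / 2 : ℝ)) • (F.aMap g * F.mMap j g)) d)
      + ((-(1 / 2 : ℝ)) • ((F.complementPCCS j).J ∘ₗ (F.bEquiv j g).toLinearMap ∘ₗ F.eMap j g)) d := by
  change (1 / 2 : ℝ) • (g.1 d - j.J (g.1 (j.J d))) = _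
  rw [apply_J, ← aMap_coe]
  change _ = (((1 / 2 : ℝ) • (F.aMap g d + j.transpose F.realPart (F.aMap g⁻¹) d) : F.realPart) : V)
    + j.J ((-(1 / 2 : ℝ)) • F.aMap g (F.mMap j g d) : F.realPart)
    + ((-(1 / 2 : ℝ)) • (F.complementPCCS j).J (F.bEquiv j g (F.eMap j g d)) : F.complement j)
  simp only [Submodule.coe_add, Submodule.coe_smul, map_add, map_smul, complementPCCS_J, j.sq]
  module

theorem linearPart_complement (q : F.complement j) :
    linearPart j.toComplexStructure g.1.toLinearMap q
    = ((-(1 / 2 : ℝ)) • (F.aMap g ∘ₗ F.eStar j g)) q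
      - j.J (((-(1 / 2 : ℝ)) • (F.aMap g ∘ₗ F.eStar j g)) ((F.complementPCCS j).J q))
      + linearPart (F.complementPCCS j).toComplexStructure (F.bEquiv j g).toLinearMap q := by
  change (1 / 2 : ℝ) • (g.1 q - j.J (g.1 (j.J q)))
    = ((-(1 / 2 : ℝ)) • F.aMap g (F.eStar j g q) : F.realPart)
      - j.J ((-(1 / 2 : ℝ)) • F.aMap g (F.eStar j g ((F.complementPCCS j).J q)) : F.realPart)
      + ((1 / 2 : ℝ) • (F.bEquiv j g q - (F.complementPCCS j).J
        (F.bEquiv j g ((F.complementPCCS j).J q))) : F.complement j)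
  rw [← complementPCCS_J, apply_complement, apply_complement]
  simp only [Submodule.coe_sub, Submodule.coe_smul, map_sub, map_smul, complementPCCS_J]
  module

/-- `Det_j C_g = Det a · Det_{j'} C_b · Det M(g)`. -/
theorem detLinearPart_eq : detLinearPart j.toComplexStructure g.1.toLinearMap
    = LinearMap.det (F.aMap g)
      * detLinearPart (F.complementPCCS j).toComplexStructure (F.bEquiv j g).toLinearMap
      * LinearMap.det (F.deltaArg j g) := by
  have hb := F.bEquiv_mem j g
  have h := F.detLinearPart_block j (linearPart_commute j.toComplexStructure g.1.toLinearMap)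
    (linearPart_commute (F.complementPCCS j).toComplexStructure (F.bEquiv j g).toLinearMap)
    (commute_inverse_linearPart _ hb) (linearPart_mul_inverse _ hb) (inverse_linearPart_mul _ hb)
    (F.linearPart_realPart j g) (F.linearPart_complement j g)
  rw [detLinearPart_linearPart, detLinearPart_linearPart] at h
  have hz := inverse_linearPart_mul_self (F.complementPCCS j) hb
  have hcm := commute_inverse_linearPart (F.complementPCCS j) hb
  rw [← zReduced_eq] at hz
  set Ci := Ring.inverse (linearPart (F.complementPCCS j).toComplexStructure
    (F.bEquiv j g).toLinearMap)
  -- The relation C_b⁻¹ b = 1 + Z'_b converts the Schur complement into the terms of M(g), with a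
  -- factored out on the left.
  have hz' : ∀ x, Ci (F.bEquiv j g x) = x + F.zReduced j g x := fun x => LinearMap.congr_fun hz x
  have hcm' : ∀ x, Ci ((F.complementPCCS j).J x) = (F.complementPCCS j).J (Ci x) := fun x =>
    (LinearMap.congr_fun hcm x).symm
  have e1 : (1 / 2 : ℝ) • (F.aMap g + j.transpose F.realPart (F.aMap g⁻¹))
      - ((-(1 / 2 : ℝ)) • (F.aMap g ∘ₗ F.eStar j g)) ∘ₗ Ci ∘ₗ
        ((-(1 / 2 : ℝ)) • ((F.complementPCCS j).J ∘ₗ (F.bEquiv j g).toLinearMap ∘ₗ F.eMap j g))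
      = F.aMap g * F.deltaRe j g := by
    refine LinearMap.ext fun v => ?_
    simp only [deltaRe, LinearMap.sub_apply, LinearMap.smul_apply, LinearMap.add_apply,
      LinearMap.comp_apply, Module.End.mul_apply, Module.End.one_apply, map_smul, map_sub, map_add,
      LinearEquiv.coe_coe, hz', hcm', aMap_apply_inv]
    module
  have e2 : (-(1 / 2 : ℝ)) • (F.aMap g * F.mMap j g)
      + ((-(1 / 2 : ℝ)) • (F.aMap g ∘ₗ F.eStar j g)) ∘ₗ (F.complementPCCS j).J ∘ₗ Ci ∘ₗ
        ((-(1 / 2 : ℝ)) • ((F.complementPCCS j).J ∘ₗ (F.bEquiv j g).toLinearMap ∘ₗ F.eMap j g))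
      = F.aMap g * F.deltaIm j g := by
    refine LinearMap.ext fun v => ?_
    simp only [deltaIm, mMap, LinearMap.sub_apply, LinearMap.smul_apply, LinearMap.add_apply,
      LinearMap.comp_apply, Module.End.mul_apply, map_smul, map_sub, map_add,
      LinearEquiv.coe_coe, hz', hcm', (F.complementPCCS j).sq, map_neg]
    module
  rw [e1, e2, LinearMap.baseChange_mul, LinearMap.baseChange_mul, ← mul_smul_comm, ← mul_add,
    ← deltaArg_eq, map_mul, LinearMap.det_baseChange] at h
  rw [h, Complex.coe_algebraMap]
  ring

/-- Paired with v, the terms in e contribute ¼|e v|² + ¼ G_j(Z' e v, e v), which is nonnegative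
because Z' is a contraction; the term ½(1 + (aᵀa)⁻¹) is positive definite. -/
theorem G_deltaRe_pos (v : F.realPart) (hv : v ≠ 0) : 0 < j.G (F.deltaRe j g v) v := by
  have h0 : 0 < j.G v v := j.G_pos v fun h => hv (Subtype.ext h)
  have h1 := j.G_nonneg (j.transpose F.realPart (F.aMap g⁻¹) v : V)
  have h1' : j.G (F.aMap g⁻¹ (j.transpose F.realPart (F.aMap g⁻¹) v)) v
      = j.G (j.transpose F.realPart (F.aMap g⁻¹) v) (j.transpose F.realPart (F.aMap g⁻¹) v) := by
    rw [j.G_comm, ← j.G_transpose]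
  have h2 := (F.isContr_zReduced j g).le (F.eMap j g v)
  have h3 := (F.complementPCCS j).two_G_le (F.eMap j g v) (-F.zReduced j g (F.eMap j g v))
  have h4 : ∀ q : F.complement j, j.G (F.eStar j g ((F.complementPCCS j).J q)) v = -(F.complementPCCS j).G q (F.eMap j g v) := by
    intro q
    rw [G_eStar, ← complementForm_apply, (F.complementPCCS j).form_eq, (F.complementPCCS j).G_JJ]
  simp only [map_neg, LinearMap.neg_apply, neg_neg] at h3
  simp only [deltaRe, LinearMap.sub_apply, LinearMap.smul_apply, LinearMap.add_apply,
      LinearMap.comp_apply, Module.End.mul_apply, Module.End.one_apply, Submodule.coe_sub,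
      Submodule.coe_smul, Submodule.coe_add, map_smul, map_sub, map_add, smul_eq_mul, h1', h4]
  rw [(F.complementPCCS j).G_comm (F.zReduced j g _)]
  linarith

theorem G_deltaIm (v w : F.realPart) : j.G (F.deltaIm j g v) w = j.G v (F.deltaIm j g w) := by
  have h1 := F.sMap_symm j g v w
  set Q := F.complementPCCS j
  have hZ := F.isSymmAnti_zReduced j g
  have h2 : j.G (F.eStar j g (F.zReduced j g (F.eMap j g v))) w
      = j.G v (F.eStar j g (F.zReduced j g (F.eMap j g w))) := by
    rw [j.G_comm v, G_eStar, G_eStar, ← complementForm_apply, ← complementForm_apply, Q.form_eq,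
      Q.form_eq, hZ.symm, hZ.anti, map_neg, Q.G_comm (F.zReduced j g (F.eMap j g w)), Q.G_J]
  simp only [deltaIm, LinearMap.sub_apply, LinearMap.smul_apply,
      LinearMap.comp_apply, Submodule.coe_sub,
      Submodule.coe_smul, map_smul, map_sub, smul_eq_mul, h1, h2]

/-- Operators with positive real part and symmetric imaginary part form a convex set containing 1
and consist of invertible operators. This makes the integral defining log Det M(g) meaningful and
lets it exponentiate to Det M(g). -/
theorem segmentDet_deltaArg_ne_zero {t : ℝ} (ht : t ∈ Set.Icc (0 : ℝ) 1) :
    segmentDet (F.deltaArg j g) t ≠ 0 := by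
  rw [deltaArg_eq, segmentDet_baseChange]
  refine det_baseChange_ne_zero (j.G.restrict F.realPart) (fun x y => j.G_comm x y) ?_ ?_
  · intro x hx
    have h0 : 0 < j.G x x := j.G_pos x fun h => hx (Subtype.ext h)
    have h1 := F.G_deltaRe_pos j g x hx
    change 0 < j.G ((1 - t) • x + t • F.deltaRe j g x : F.realPart) x
    simp only [Submodule.coe_add, Submodule.coe_smul, map_add, map_smul, LinearMap.add_apply,
      LinearMap.smul_apply, smul_eq_mul]
    rcases eq_or_lt_of_le ht.1 with h | h
    · subst h
      linarith
    · have := mul_pos h h1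
      have := mul_nonneg (sub_nonneg.2 ht.2) h0.le
      linarith
  · intro x y
    have h := F.G_deltaIm j g x y
    change j.G (t • F.deltaIm j g x : F.realPart) y = j.G x (t • F.deltaIm j g y : F.realPart)
    simp only [Submodule.coe_smul, map_smul, LinearMap.smul_apply, smul_eq_mul, h]

theorem delta_sq : F.delta j g ^ 2 = LinearMap.det (F.deltaArg j g) := by
  rw [← exp_logDet _ fun t ht => F.segmentDet_deltaArg_ne_zero j g ht, delta, ← Complex.exp_nat_mul]
  congr 1
  push_cast
  ring

theorem delta_ne_zero : F.delta j g ≠ 0 := Complex.exp_ne_zero _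

theorem det_aMap_ne_zero : LinearMap.det (F.aMap g) ≠ 0 := by
  intro h
  have := congrArg LinearMap.det (F.aMap_mul_inv g)
  rw [map_mul, h, zero_mul, map_one] at this
  exact zero_ne_one this

variable {j} (hj : Commute (F.inducedStructure j).J F.reducedStructure.J)

/-- The ratio `Det C'⁻_b / Det C'⁺_b`. -/
def reducedRatio : ℂ := minusRatio (F.complementPCCS j) (F.complementStructure j)
  (F.commute_complementStructure hj) (F.bEquiv j g) (F.bEquiv_commute j g)

theorem reducedRatio_mul (g g' : F.stabilizer) :
    F.reducedRatio (g * g') hj = F.reducedRatio g hj * F.reducedRatio g' hj := by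
  rw [reducedRatio, reducedRatio, reducedRatio, ← minusRatio_mul _ _ _ (F.bEquiv_mem j g)
    (F.bEquiv_mem j g') _ _ (by rw [← bEquiv_mul]; exact F.bEquiv_commute j _)]
  congr 1
  exact F.bEquiv_mul j g g'

theorem norm_reducedRatio : ‖F.reducedRatio g hj‖ = 1 :=
  norm_minusRatio _ _ _ (F.bEquiv_mem j g) _

theorem detMinus_ne_zero : F.detMinus j hj g ≠ 0 := by
  rw [detMinus_eq]
  exact (detOnMinus_ne_zero _ _ _ (F.bEquiv_mem j g) _).1

theorem detLinearPart_bEquiv : F.reducedRatio g hj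
    * detLinearPart (F.complementPCCS j).toComplexStructure (F.bEquiv j g).toLinearMap
      = F.detMinus j hj g ^ 2 := by
  have hc := F.commute_complementStructure hj
  rw [detMinus_eq, detLinearPart_eq_mul _ _ hc (F.complementStructure j).sq (F.bEquiv_commute j g),
    reducedRatio, minusRatio]
  have := (detOnMinus_ne_zero _ (F.complementStructure j) hc (F.bEquiv_mem j g) (F.bEquiv_commute j g)).2
  field_simp

theorem liftFunction_ne_zero : F.liftFunction j hj g ≠ 0 := by
  have h := Real.sqrt_pos.2 (abs_pos.2 (F.det_aMap_ne_zero g))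
  refine inv_ne_zero (mul_ne_zero (mul_ne_zero ?_ (F.detMinus_ne_zero g hj)) (F.delta_ne_zero j g))
  exact_mod_cast h.ne'

/-- Inserting Det C_g = Det a · Det C_b · δ² and χ Det C_b = (Det C'⁻_b)², all factors cancel except
Det a / |Det a|. The right side and χ are characters, so f_F² obeys the multiplication law of 1 /
Det C_g up to a character. -/
theorem liftFunction_sq : F.liftFunction j hj g ^ 2
    * detLinearPart j.toComplexStructure g.1.toLinearMap * F.reducedRatio g hj
      = ((SignType.sign (LinearMap.det (F.aMap g)) : ℝ) : ℂ) := by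
  have h0 := F.det_aMap_ne_zero g
  have h1 : ((Real.sqrt |LinearMap.det (F.aMap g)| : ℝ) : ℂ) ^ 2
      = ((|LinearMap.det (F.aMap g)| : ℝ) : ℂ) := by
    rw [← Complex.ofReal_pow, Real.sq_sqrt (abs_nonneg _)]
  have h2 := F.detLinearPart_bEquiv g hj
  have h3 := F.detMinus_ne_zero g hj
  have h4 := F.delta_ne_zero j g
  have h5 : ((|LinearMap.det (F.aMap g)| : ℝ) : ℂ) ≠ 0 := by exact_mod_cast abs_ne_zero.2 h0
  have h6 : ((SignType.sign (LinearMap.det (F.aMap g)) : ℝ) : ℂ)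
      * ((|LinearMap.det (F.aMap g)| : ℝ) : ℂ) = ((LinearMap.det (F.aMap g) : ℝ) : ℂ) := by
    rw [← Complex.ofReal_mul, sign_mul_abs]
  rw [liftFunction, detLinearPart_eq, ← delta_sq, inv_pow, mul_pow, mul_pow, h1, ← h6, ← h2]
  have h7 := pow_ne_zero 2 h3
  rw [← h2] at h7
  obtain ⟨h8, h9⟩ := mul_ne_zero_iff.1 h7
  field_simp

theorem norm_liftFunction_sq :
    ‖F.liftFunction j hj g ^ 2 * detLinearPart j.toComplexStructure g.1.toLinearMap‖ = 1 := by
  have h := congrArg norm (F.liftFunction_sq g hj)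
  rw [norm_mul, norm_reducedRatio, mul_one] at h
  rw [h, Complex.norm_real, Real.norm_eq_abs]
  rcases lt_or_gt_of_ne (F.det_aMap_ne_zero g) with h | h
  · simp [sign_neg h]
  · simp [sign_pos h]

end ComplexLagrangian

/-! ### Degeneration of the stabiliser to elements preserving D, jD and Q -/

namespace ComplexLagrangian

variable {V : Type*} [AddCommGroup V] [Module ℝ V] [FiniteDimensional ℝ V] {Ω : SymplecticForm V}
  (F : ComplexLagrangian Ω) (j : PCCS Ω) (g g' : F.stabilizer)

theorem proj_J_realPart (x y : F.realPart) (q : F.complement j) :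
    j.proj F.realPart (-j.J (x + j.J y + q)) = y := by
  have h := F.proj_realPart j y (-x) (-(F.complementPCCS j).J q)
  refine Eq.trans (congrArg _ ?_) h
  rw [map_add, map_add, j.sq]
  simp only [Submodule.coe_neg, map_neg, complementPCCS_J]
  abel

/-- The family `h_τ g h_τ⁻¹`, where `h_τ` acts by `τ` on `D`, by `τ⁻¹` on
`jD` and trivially on `Q`; the family extends to `τ = 0`. -/
def degenerateMap (τ : ℝ) : Module.End ℝ V :=
  F.realPart.subtype ∘ₗ (F.aMap g ∘ₗ j.proj F.realPart
      - τ • (F.aMap g ∘ₗ F.eStar j g ∘ₗ j.proj (F.complement j))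
      - τ ^ 2 • (F.aMap g ∘ₗ F.mMap j g ∘ₗ j.proj F.realPart ∘ₗ j.J))
    - j.J ∘ₗ F.realPart.subtype ∘ₗ j.transpose F.realPart (F.aMap g⁻¹) ∘ₗ j.proj F.realPart ∘ₗ j.J
    + (F.complement j).subtype ∘ₗ ((F.bEquiv j g).toLinearMap ∘ₗ j.proj (F.complement j)
      - τ • ((F.bEquiv j g).toLinearMap ∘ₗ F.eMap j g ∘ₗ j.proj F.realPart ∘ₗ j.J))

theorem degenerateMap_apply (τ : ℝ) (x y : F.realPart) (q : F.complement j) :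
    F.degenerateMap j g τ (x + j.J y + q)
      = (F.aMap g x - τ • F.aMap g (F.eStar j g q) + τ ^ 2 • F.aMap g (F.mMap j g y) : F.realPart)
        + j.J (j.transpose F.realPart (F.aMap g⁻¹) y)
        + (F.bEquiv j g q + τ • F.bEquiv j g (F.eMap j g y) : F.complement j) := by
  have h1 := F.proj_realPart j x y q
  have h2 := F.proj_J_realPart j x y q
  have h3 := F.proj_complement j x y q
  rw [map_neg, neg_eq_iff_eq_neg] at h2
  set v := (x : V) + j.J y + q
  simp only [degenerateMap, LinearMap.add_apply, LinearMap.sub_apply, LinearMap.smul_apply,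
    LinearMap.comp_apply, LinearEquiv.coe_coe, Submodule.subtype_apply, h1, h2, h3,
    Submodule.coe_add, Submodule.coe_sub, Submodule.coe_smul, map_neg, smul_neg, Submodule.coe_neg]
  module

theorem apply_decomposition (x y : F.realPart) (q : F.complement j) : g.1 (x + j.J y + q)
    = (F.aMap g x - F.aMap g (F.eStar j g q) + F.aMap g (F.mMap j g y) : F.realPart)
        + j.J (j.transpose F.realPart (F.aMap g⁻¹) y)
        + (F.bEquiv j g q + F.bEquiv j g (F.eMap j g y) : F.complement j) := by
  rw [map_add, map_add, apply_J, apply_complement, ← aMap_coe]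
  simp only [Submodule.coe_add, Submodule.coe_sub]
  abel

theorem decomposition_injective {x y x' y' : F.realPart} {q q' : F.complement j}
    (h : (x : V) + j.J y + q = x' + j.J y' + q') : x = x' ∧ y = y' ∧ q = q' := by
  have h0 : ((x - x' : F.realPart) : V) + j.J (y - y' : F.realPart) + (q - q' : F.complement j)
      = 0 := by
    rw [← sub_eq_zero] at h
    rw [← h]
    simp only [Submodule.coe_sub, map_sub]
    abel
  obtain ⟨h1, h2, h3⟩ := F.decomposition_eq_zero j h0
  exact ⟨sub_eq_zero.1 h1, sub_eq_zero.1 h2, sub_eq_zero.1 h3⟩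

theorem degenerateMap_one : F.degenerateMap j g 1 = g.1.toLinearMap := by
  refine LinearMap.ext fun v => ?_
  obtain ⟨x, y, q, rfl⟩ := F.exists_decomposition j v
  rw [degenerateMap_apply, LinearEquiv.coe_coe, apply_decomposition]
  simp

theorem transpose_aMap_inv_mul (y : F.realPart) : j.transpose F.realPart (F.aMap (g * g')⁻¹) y
    = j.transpose F.realPart (F.aMap g⁻¹) (j.transpose F.realPart (F.aMap g'⁻¹) y) := by
  rw [mul_inv_rev, aMap_mul, j.transpose_mul]
  rfl

theorem components_mul_apply_J (y : F.realPart) :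
    F.aMap (g * g') (F.mMap j (g * g') y) = F.aMap g (F.aMap g' (F.mMap j g' y))
        - F.aMap g (F.eStar j g (F.bEquiv j g' (F.eMap j g' y)))
        + F.aMap g (F.mMap j g (j.transpose F.realPart (F.aMap g'⁻¹) y)) ∧
      F.bEquiv j (g * g') (F.eMap j (g * g') y) = F.bEquiv j g (F.bEquiv j g' (F.eMap j g' y))
        + F.bEquiv j g (F.eMap j g (j.transpose F.realPart (F.aMap g'⁻¹) y)) := by
  have h1 : (g * g').1 (j.J y) = g.1 (g'.1 (j.J y)) := rfl
  rw [apply_J, apply_J, apply_decomposition] at h1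
  obtain ⟨h2, -, h3⟩ := F.decomposition_injective j h1
  exact ⟨h2, h3⟩

theorem components_mul_apply_complement (q : F.complement j) :
    F.aMap (g * g') (F.eStar j (g * g') q) = F.aMap g (F.aMap g' (F.eStar j g' q))
        + F.aMap g (F.eStar j g (F.bEquiv j g' q)) := by
  have h1 : (g * g').1 (((0 : F.realPart) : V) + j.J ((0 : F.realPart) : V) + q)
    = g.1 (g'.1 (((0 : F.realPart) : V) + j.J ((0 : F.realPart) : V) + q)) := rfl
  rw [apply_decomposition, apply_decomposition, apply_decomposition] at h1
  obtain ⟨h2, -, -⟩ := F.decomposition_injective j h1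
  simp only [map_zero, zero_sub, add_zero, map_neg] at h2
  rw [← neg_inj, h2]
  abel

/-- The relations between the components of g, g' and gg' are homogeneous: m has weight τ², e and e*
have weight τ, a and b have weight 0. Hence the product law survives for every τ, including τ = 0,
where no conjugating element exists. -/
theorem degenerateMap_mul (τ : ℝ) :
    F.degenerateMap j (g * g') τ = F.degenerateMap j g τ * F.degenerateMap j g' τ := by
  refine LinearMap.ext fun v => ?_
  obtain ⟨x, y, q, rfl⟩ := F.exists_decomposition j v
  obtain ⟨h1, h2⟩ := F.components_mul_apply_J j g g' y
  have h3 := F.components_mul_apply_complement j g g' q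
  rw [Module.End.mul_apply, degenerateMap_apply, degenerateMap_apply, degenerateMap_apply, h1, h2,
    h3, transpose_aMap_inv_mul, bEquiv_mul, aMap_mul]
  simp only [Module.End.mul_apply, LinearEquiv.mul_apply, map_add, map_sub, map_smul]
  refine congrArg₂ (· + ·) (congrArg₂ (· + ·) (congrArg Subtype.val ?_) rfl)
    (congrArg Subtype.val ?_)
  · module
  · module

theorem form_decomposition (x y x' y' : F.realPart) (q q' : F.complement j) :
    Ω.form ((x : V) + j.J y + q) (x' + j.J y' + q') = j.G x y' - j.G y x' + Ω.form q q' := by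
  simp only [map_add, LinearMap.add_apply]
  rw [F.form_realPart x.2 x'.2, F.form_complement j x.2 q'.2, F.form_J_complement j y.2 q'.2,
    j.compat, F.form_realPart y.2 y'.2, Ω.neg (q : V) (x' : V), F.form_complement j x'.2 q.2,
    Ω.neg (q : V) (j.J y'), F.form_J_complement j y'.2 q.2, ← j.G_apply, Ω.neg _ (x' : V),
    ← j.G_apply, j.G_comm x' y]
  ring

theorem G_aMap_transpose (u y : F.realPart) :
    j.G (F.aMap g u) (j.transpose F.realPart (F.aMap g⁻¹) y) = j.G u y := by
  rw [j.G_comm, j.G_transpose, aMap_inv_apply, j.G_comm]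

theorem G_mMap_sub (y y' : F.realPart) : j.G (F.mMap j g y) y' - j.G y (F.mMap j g y')
    + Ω.form (F.eMap j g y) (F.eMap j g y') = 0 := by
  have h1 := F.sMap_symm j g y y'
  simp only [mMap, LinearMap.sub_apply, LinearMap.smul_apply, LinearMap.comp_apply,
    Submodule.coe_sub, Submodule.coe_smul, map_sub, map_smul, smul_eq_mul]
  rw [j.G_comm y (F.eStar j g _), G_eStar, G_eStar, Ω.neg (F.eMap j g y' : V) (F.eMap j g y)]
  linarith

/-- The terms linear in τ cancel by the definition of e*, and the coefficient of τ² is the relation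
`G_mMap_sub`. No division by τ occurs, so τ = 0 is covered. -/
theorem degenerateMap_form (τ : ℝ) (v w : V) :
    Ω.form (F.degenerateMap j g τ v) (F.degenerateMap j g τ w) = Ω.form v w := by
  obtain ⟨x, y, q, rfl⟩ := F.exists_decomposition j v
  obtain ⟨x', y', q', rfl⟩ := F.exists_decomposition j w
  have hb : ∀ p p' : F.complement j, Ω.form (F.bEquiv j g p) (F.bEquiv j g p') = Ω.form p p' :=
    fun p p' => F.bEquiv_mem j g p p'
  have h1 := F.G_mMap_sub j g y y'
  rw [degenerateMap_apply, degenerateMap_apply, form_decomposition, form_decomposition]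
  simp only [← map_smul, ← map_add, ← map_sub, hb, G_aMap_transpose]
  rw [j.G_comm (j.transpose F.realPart (F.aMap g⁻¹) y), G_aMap_transpose, j.G_comm _ y]
  simp only [Submodule.coe_add, Submodule.coe_sub, Submodule.coe_smul, map_add, map_sub, map_smul,
    LinearMap.add_apply, LinearMap.sub_apply, LinearMap.smul_apply, smul_eq_mul]
  rw [G_eStar, j.G_comm y (F.eStar j g q'), G_eStar, Ω.neg (q' : V)]
  linear_combination τ ^ 2 * h1

theorem degenerateMap_injective (τ : ℝ) : Function.Injective (F.degenerateMap j g τ) := by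
  rw [injective_iff_map_eq_zero]
  intro v hv
  apply j.eq_zero
  rw [j.G_apply, ← F.degenerateMap_form j g τ, hv, map_zero, LinearMap.zero_apply]

theorem exists_of_mem_perp {v : V} (hv : v ∈ F.perp) :
    ∃ (x : F.realPart) (q : F.complement j), v = x + q := by
  obtain ⟨x, y, q, rfl⟩ := F.exists_decomposition j v
  have hy : y = 0 := by
    apply Subtype.ext
    apply j.eq_zero
    have h := F.form_perp y.2 hv
    rw [map_add, map_add, F.form_realPart y.2 x.2, F.form_complement j y.2 q.2, ← j.G_apply] at h
    linarith
  exact ⟨x, q, by simp [hy]⟩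

theorem add_realPart_mem_iff {x y : V} {d d' : V} (hd : d ∈ F.realPart) (hd' : d' ∈ F.realPart) :
    (1 : ℂ) ⊗ₜ[ℝ] (d + x) + Complex.I ⊗ₜ[ℝ] (d' + y) ∈ F.space
      ↔ (1 : ℂ) ⊗ₜ[ℝ] x + Complex.I ⊗ₜ[ℝ] y ∈ F.space := by
  have h1 := (F.mem_realPart d).1 hd
  have h2 := F.space.smul_mem Complex.I ((F.mem_realPart d').1 hd')
  rw [TensorProduct.smul_tmul', smul_eq_mul, mul_one] at h2
  have h3 : (1 : ℂ) ⊗ₜ[ℝ] (d + x) + Complex.I ⊗ₜ[ℝ] (d' + y)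
      = ((1 : ℂ) ⊗ₜ[ℝ] d + Complex.I ⊗ₜ[ℝ] d') + ((1 : ℂ) ⊗ₜ[ℝ] x + Complex.I ⊗ₜ[ℝ] y) := by
    rw [TensorProduct.tmul_add, TensorProduct.tmul_add]
    abel
  rw [h3]
  exact F.space.add_mem_iff_right (F.space.add_mem h1 h2)

theorem degenerateMap_complement (τ : ℝ) (x : F.realPart) (q : F.complement j) :
    ∃ d ∈ F.realPart, F.degenerateMap j g τ (x + q) = d + F.bEquiv j g q := by
  have h := F.degenerateMap_apply j g τ x 0 q
  simp only [Submodule.coe_zero, map_zero, add_zero, smul_zero] at h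
  exact ⟨_, Subtype.property _, h⟩

/-- The family `h_τ g h_τ⁻¹` in the stabiliser of `F`. -/
def degenerate (τ : ℝ) : F.stabilizer :=
  ⟨LinearEquiv.ofInjectiveEndo (F.degenerateMap j g τ) (F.degenerateMap_injective j g τ),
    F.degenerateMap_form j g τ, by
      intro t ht
      obtain ⟨u, v, rfl⟩ := exists_tmul t
      obtain ⟨x, q, rfl⟩ := F.exists_of_mem_perp j (F.left_mem_perp ht)
      obtain ⟨x', q', rfl⟩ := F.exists_of_mem_perp j (F.right_mem_perp ht)
      -- As F contains D^ℂ and lies in (D^⊥)^ℂ, membership in F depends only on the Q-components. On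
      -- these the family acts by b(g) for every τ.
      rw [add_realPart_mem_iff F x.2 x'.2] at ht
      obtain ⟨d, hd, h1⟩ := F.degenerateMap_complement j g τ x q
      obtain ⟨d', hd', h1'⟩ := F.degenerateMap_complement j g τ x' q'
      change (F.degenerateMap j g τ).baseChange ℂ _ ∈ _
      rw [map_add, LinearMap.baseChange_tmul, LinearMap.baseChange_tmul, h1, h1',
        add_realPart_mem_iff F hd hd']
      have h2 := F.stabilizer_tmul g ht
      have h3 : ∀ q : F.complement j, g.1 q = (-F.aMap g (F.eStar j g q) : F.realPart)
          + F.bEquiv j g q := fun q => by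
        rw [apply_complement, Submodule.coe_neg]
        abel
      rwa [h3, h3, add_realPart_mem_iff F (Subtype.property _) (Subtype.property _)] at h2⟩

theorem degenerate_toLinearMap (τ : ℝ) :
    (F.degenerate j g τ).1.toLinearMap = F.degenerateMap j g τ := LinearMap.ext fun _ => rfl

theorem degenerate_one : F.degenerate j g 1 = g :=
  Subtype.ext (LinearEquiv.toLinearMap_injective
    ((F.degenerate_toLinearMap j g 1).trans (F.degenerateMap_one j g)))

theorem degenerate_mul (τ : ℝ) :
    F.degenerate j (g * g') τ = F.degenerate j g τ * F.degenerate j g' τ := by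
  apply Subtype.ext
  apply LinearEquiv.toLinearMap_injective
  rw [degenerate_toLinearMap, degenerateMap_mul, ← degenerate_toLinearMap, ← degenerate_toLinearMap]
  rfl

/-- `g` preserves the subspaces `jD` and `Q`. -/
def IsLevi : Prop := (∀ y : F.realPart, ∃ y' : F.realPart, g.1 (j.J y) = j.J y') ∧
  ∀ q ∈ F.complement j, g.1 q ∈ F.complement j

theorem isLevi_degenerate_zero : F.IsLevi j (F.degenerate j g 0) := by
  have h : ∀ v, (F.degenerate j g 0).1 v = F.degenerateMap j g 0 v := fun _ => rfl
  constructor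
  · intro y
    have h1 := F.degenerateMap_apply j g 0 0 y 0
    refine ⟨j.transpose F.realPart (F.aMap g⁻¹) y, (h _).trans ?_⟩
    simpa using h1
  · intro q hq
    have h1 := F.degenerateMap_apply j g 0 0 0 ⟨q, hq⟩
    simp only [Submodule.coe_zero, map_zero, zero_smul, zero_add, add_zero, smul_zero, sub_zero,
      ne_eq, OfNat.ofNat_ne_zero, not_false_eq_true, zero_pow] at h1
    rw [h, h1]
    exact Subtype.property _

end ComplexLagrangian

/-! ### Elements preserving D, jD and Q -/

section LogDet

variable {E : Type*} [AddCommGroup E] [Module ℂ E] [FiniteDimensional ℂ E]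

/-- If the determinant is a positive real along the segment from `1` to `A`, then so is
`exp (½ log Det A)`. -/
theorem exp_logDet_half_pos (A : Module.End ℂ E) (r : ℝ → ℝ) (h : ∀ t, segmentDet A t = r t) :
    ∃ x : ℝ, 0 < x ∧ Complex.exp (logDet A / 2) = x := by
  have h1 : segmentDet A = fun t => (r t : ℂ) := funext h
  have h2 : ∀ t, HasDerivAt r (deriv (segmentDet A) t).re t := by
    intro t
    have h3 := ((contDiff_segmentDet A).differentiable one_ne_zero t).hasDerivAt
    have h4 := Complex.reCLM.hasFDerivAt.comp_hasDerivAt t h3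
    have h5 : (⇑Complex.reCLM ∘ segmentDet A) = r := by
      funext t
      simp [h]
    rw [h5] at h4
    exact h4
  have h3 : logDeriv (segmentDet A) = fun t => ((logDeriv r t : ℝ) : ℂ) := by
    funext t
    rw [logDeriv_apply, logDeriv_apply, h1, (h2 t).differentiableAt.hasDerivAt.ofReal_comp.deriv,
      Complex.ofReal_div]
  refine ⟨Real.exp ((∫ t in (0 : ℝ)..1, logDeriv r t) / 2), Real.exp_pos _, ?_⟩
  rw [logDet, h3, intervalIntegral.integral_ofReal]
  push_cast
  rfl

end LogDet

namespace ComplexLagrangian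

variable {V : Type*} [AddCommGroup V] [Module ℝ V] [FiniteDimensional ℝ V] {Ω : SymplecticForm V}
  (F : ComplexLagrangian Ω) (j : PCCS Ω) {g g' : F.stabilizer}

theorem degenerate_inv (g : F.stabilizer) (τ : ℝ) : F.degenerate j g⁻¹ τ = (F.degenerate j g τ)⁻¹ :=
  map_inv (MonoidHom.mk' (fun g => F.degenerate j g τ) fun g g' => F.degenerate_mul j g g' τ) g

variable {F j}

theorem IsLevi.mMap_eq_zero (h : F.IsLevi j g) (y : F.realPart) : F.mMap j g y = 0 := by
  obtain ⟨y', hy⟩ := h.1 y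
  have h1 := F.apply_J j g y
  rw [hy] at h1
  have h2 : ((0 : F.realPart) : V) + j.J y' + (0 : F.complement j) = j.J y' := by simp
  rw [← h2] at h1
  have h3 := (F.decomposition_injective j h1).1
  rw [← F.aMap_inv_apply g (F.mMap j g y), ← h3, map_zero]

theorem IsLevi.eMap_eq_zero (h : F.IsLevi j g) : F.eMap j g = 0 := by
  refine LinearMap.ext fun y => ?_
  obtain ⟨y', hy⟩ := h.1 y
  have h1 := F.apply_J j g y
  rw [hy] at h1
  have h2 : ((0 : F.realPart) : V) + j.J y' + (0 : F.complement j) = j.J y' := by simp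
  rw [← h2] at h1
  have h3 := (F.decomposition_injective j h1).2.2
  exact (F.bEquiv j g).map_eq_zero_iff.1 h3.symm

theorem IsLevi.sMap_eq_zero (h : F.IsLevi j g) : F.sMap j g = 0 := by
  refine LinearMap.ext fun y => ?_
  have h1 := h.mMap_eq_zero y
  rw [mMap, h.eMap_eq_zero] at h1
  simpa using h1

theorem IsLevi.apply_complement (h : F.IsLevi j g) (q : F.complement j) :
    g.1 q = F.bEquiv j g q := by
  have h1 := F.apply_sub_bEquiv_mem j g q
  have h2 : g.1 q - F.bEquiv j g q ∈ F.complement j :=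
    Submodule.sub_mem _ (h.2 q q.2) (F.bEquiv j g q).2
  have h3 := F.G_realPart_complement j h1 h2
  exact sub_eq_zero.1 (j.eq_zero h3)

/-- With e = 0 and s = 0 the operator M(g) is the base change of a real one, so the determinant is
real along the whole segment and its logarithm is a real integral. -/
theorem IsLevi.delta_pos (h : F.IsLevi j g) : ∃ x : ℝ, 0 < x ∧ F.delta j g = x := by
  have h1 : F.deltaArg j g = (F.deltaRe j g).baseChange ℂ + Complex.I •
      (0 : Module.End ℝ F.realPart).baseChange ℂ := by
    rw [deltaArg_eq, deltaIm, h.sMap_eq_zero, h.eMap_eq_zero]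
    simp
  apply exp_logDet_half_pos _ fun t => LinearMap.det ((1 - t) • 1 + t • F.deltaRe j g)
  intro t
  rw [h1, segmentDet_baseChange, smul_zero, LinearMap.baseChange_zero, smul_zero, add_zero,
    LinearMap.det_baseChange]
  rfl

theorem IsLevi.linearPart_complement (h : F.IsLevi j g) (q : F.complement j) :
    linearPart j.toComplexStructure g.1.toLinearMap q
      = linearPart (F.complementPCCS j).toComplexStructure (F.bEquiv j g).toLinearMap q := by
  change (1 / 2 : ℝ) • (g.1 q - j.J (g.1 (j.J q))) = ((1 / 2 : ℝ) • (F.bEquiv j g q -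
    (F.complementPCCS j).J (F.bEquiv j g ((F.complementPCCS j).J q))) : F.complement j)
  rw [← complementPCCS_J, h.apply_complement, h.apply_complement]
  rfl

theorem IsLevi.antilinearPart_complement (h : F.IsLevi j g) (q : F.complement j) :
    antilinearPart j.toComplexStructure g.1.toLinearMap q
      = antilinearPart (F.complementPCCS j).toComplexStructure (F.bEquiv j g).toLinearMap q := by
  change (1 / 2 : ℝ) • (g.1 q + j.J (g.1 (j.J q))) = ((1 / 2 : ℝ) • (F.bEquiv j g q +
    (F.complementPCCS j).J (F.bEquiv j g ((F.complementPCCS j).J q))) : F.complement j)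
  rw [← complementPCCS_J, h.apply_complement, h.apply_complement]
  rfl

theorem linearPart_mul_zPart {g : V ≃ₗ[ℝ] V} (hg : g ∈ Sp Ω) (v : V) :
    linearPart j.toComplexStructure g.toLinearMap (zPart j.toComplexStructure g.toLinearMap v)
      = antilinearPart j.toComplexStructure g.toLinearMap v := by
  rw [zPart, ← Module.End.mul_apply, ← mul_assoc, linearPart_mul_inverse j hg, one_mul]

theorem linearPart_injective {g : V ≃ₗ[ℝ] V} (hg : g ∈ Sp Ω) :
    Function.Injective (linearPart j.toComplexStructure g.toLinearMap) :=
  Function.LeftInverse.injective 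
    (g := ⇑(Ring.inverse (linearPart j.toComplexStructure g.toLinearMap) : Module.End ℝ V))
    fun v => LinearMap.congr_fun (inverse_linearPart_mul j hg) v

theorem IsLevi.zPart_complement (h : F.IsLevi j g) (q : F.complement j) :
    zPart j.toComplexStructure g.1.toLinearMap q = F.zReduced j g q := by
  apply linearPart_injective g.2.1
  rw [linearPart_mul_zPart g.2.1, h.linearPart_complement, h.antilinearPart_complement, zReduced_eq,
    linearPart_mul_zPart (F.bEquiv_mem j g)]

theorem IsLevi.linearPart_realPart (h : F.IsLevi j g) : ∀ d ∈ F.realPart,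
    linearPart j.toComplexStructure g.1.toLinearMap d ∈ F.realPart := by
  intro d hd
  obtain ⟨y', hy⟩ := h.1 ⟨d, hd⟩
  change (1 / 2 : ℝ) • (g.1 d - j.J (g.1 (j.J d))) ∈ _
  rw [hy, j.sq]
  exact F.realPart.smul_mem _ (F.realPart.sub_mem (F.stabilizer_realPart g d hd)
    (F.realPart.neg_mem y'.2))

theorem IsLevi.antilinearPart_realPart (h : F.IsLevi j g) : ∀ d ∈ F.realPart,
    antilinearPart j.toComplexStructure g.1.toLinearMap d ∈ F.realPart := by
  intro d hd
  obtain ⟨y', hy⟩ := h.1 ⟨d, hd⟩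
  change (1 / 2 : ℝ) • (g.1 d + j.J (g.1 (j.J d))) ∈ _
  rw [hy, j.sq]
  exact F.realPart.smul_mem _ (F.realPart.add_mem (F.stabilizer_realPart g d hd)
    (F.realPart.neg_mem y'.2))

/-- C_g maps the finite-dimensional space D injectively into itself, hence onto; so C_g⁻¹ preserves
D, and D_g does as well. -/
theorem IsLevi.zPart_realPart (h : F.IsLevi j g) : ∀ d ∈ F.realPart,
    zPart j.toComplexStructure g.1.toLinearMap d ∈ F.realPart := by
  intro d hd
  let A := (linearPart j.toComplexStructure g.1.toLinearMap).restrict h.linearPart_realPart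
  have hA : Function.Injective A := fun x y hxy =>
    Subtype.ext (linearPart_injective g.2.1 (congrArg Subtype.val hxy))
  obtain ⟨x, hx⟩ := LinearMap.injective_iff_surjective.1 hA ⟨_, h.antilinearPart_realPart d hd⟩
  have h1 : zPart j.toComplexStructure g.1.toLinearMap d = x := by
    apply linearPart_injective g.2.1
    rw [linearPart_mul_zPart g.2.1]
    exact (congrArg Subtype.val hx).symm
  rw [h1]
  exact x.2

end ComplexLagrangian

section Block

variable {V : Type*} [AddCommGroup V] [Module ℝ V] [FiniteDimensional ℝ V] {Ω : SymplecticForm V}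
  (j : PCCS Ω)

theorem PCCS.G_one_sub_mul_pos {Y Z : Module.End ℝ V} (hY : j.IsSymmAnti Y)
    (hYc : j.IsContr Y) (hZc : j.IsContr Z) (v : V) (hv : v ≠ 0) : 0 < j.G ((1 - Y * Z) v) v := by
  have h1 := hYc v hv
  have h2 := hZc v hv
  have h3 := j.two_G_le (Z v) (Y v)
  rw [LinearMap.sub_apply, Module.End.mul_apply, Module.End.one_apply, map_sub, LinearMap.sub_apply,
    hY.symm]
  linarith

theorem commute_one_sub_mul_J {Y Z : Module.End ℝ V} (hY : j.IsSymmAnti Y) (hZ : j.IsSymmAnti Z) :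
    Commute j.J (1 - Y * Z) := by
  refine (Commute.one_right _).sub_right (LinearMap.ext fun v => ?_)
  simp only [Module.End.mul_apply, hZ.anti, hY.anti, map_neg, neg_neg]

end Block

/-! ### Continuous and smooth dependence on g -/

section Determinants

variable {E : Type*} [AddCommGroup E] [Module ℂ E] [FiniteDimensional ℂ E]

theorem contDiff_det {X : Type*} [NormedAddCommGroup X] [NormedSpace ℝ X] {n : WithTop ℕ∞}
    {L : X → Module.End ℂ E} (hL : ∀ (φ : E →ₗ[ℂ] ℂ) v, ContDiff ℝ n fun x => φ (L x v)) :
    ContDiff ℝ n fun x => LinearMap.det (L x) := by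
  let b := Module.finBasis ℂ E
  have h : (fun x => LinearMap.det (L x)) = fun x => (LinearMap.toMatrix b b (L x)).det := by
    funext x
    rw [LinearMap.det_toMatrix]
  rw [h]
  simp only [Matrix.det_apply]
  refine ContDiff.sum fun σ _ => ContDiff.const_smul _ (contDiff_prod fun i _ => ?_)
  simp only [LinearMap.toMatrix_apply]
  exact hL (b.coord (σ i)) (b i)

end Determinants

section LinearPart

variable {W : Type*} [NormedAddCommGroup W] [NormedSpace ℝ W] [FiniteDimensional ℝ W]
  (c : ComplexStructure W)

theorem contDiff_linearMap {E : Type*} [NormedAddCommGroup E] [NormedSpace ℝ E] (l : W →ₗ[ℝ] E)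
    {n : WithTop ℕ∞} : ContDiff ℝ n l := (LinearMap.toContinuousLinearMap l).contDiff

theorem contDiff_linearPartCx {n : WithTop ℕ∞} (φ : CxSpace c →ₗ[ℂ] ℂ) (v : CxSpace c) :
    ContDiff ℝ n fun A : W →L[ℝ] W => φ (linearPartCx c A.toLinearMap v) := by
  let ψ : W →ₗ[ℝ] ℂ := φ.restrictScalars ℝ ∘ₗ (CxSpace.realEquiv c).symm.toLinearMap
  have h1 : ∀ w, ContDiff ℝ n fun A : W →L[ℝ] W => A w := fun w => contDiff_id.clm_apply contDiff_const
  have h2 : (fun A : W →L[ℝ] W => φ (linearPartCx c A.toLinearMap v)) = fun A : W →L[ℝ] W =>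
      ψ ((1 / 2 : ℝ) • (A v.val - c.J (A (c.J v.val)))) := rfl
  rw [h2]
  exact (contDiff_linearMap ψ).comp
    (contDiff_const.smul ((h1 _).sub ((contDiff_linearMap c.J).comp (h1 _))))

theorem contDiff_detLinearPart {n : WithTop ℕ∞} :
    ContDiff ℝ n fun A : W →L[ℝ] W => detLinearPart c A.toLinearMap :=
  contDiff_det fun φ v => contDiff_linearPartCx c φ v

variable (K : Module.End ℝ W) (hK : Commute c.J K)

/-- Smoothness is tested on open subsets of End(V), whose elements need not preserve {K = -J}.
Compressing with a projection extends the determinant to all of them. -/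
theorem exists_projection_minusSpace : ∃ π : CxSpace c →ₗ[ℂ] minusSpace c K hK,
    π ∘ₗ (minusSpace c K hK).subtype = LinearMap.id :=
  LinearMap.exists_leftInverse_of_injective _ (Submodule.ker_subtype _)

/-- The determinant of the compression of the complex linear part of `A` to `{K = -J}`. -/
def detCompression (A : Module.End ℝ W) : ℂ :=
  LinearMap.det ((exists_projection_minusSpace c K hK).choose ∘ₗ linearPartCx c A ∘ₗ
    (minusSpace c K hK).subtype)

theorem detCompression_eq {A : Module.End ℝ W} (hA : Commute A K) :
    detCompression c K hK A = detOnMinus c K hK A hA := by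
  rw [detCompression, detOnMinus]
  congr 1
  refine LinearMap.ext fun v => ?_
  exact LinearMap.congr_fun (exists_projection_minusSpace c K hK).choose_spec
    ((linearPartCx c A).restrict (linearPartCx_mem_minusSpace c K hK A hA) v)

theorem contDiff_detCompression {n : WithTop ℕ∞} :
    ContDiff ℝ n fun A : W →L[ℝ] W => detCompression c K hK A.toLinearMap :=
  contDiff_det fun φ v => contDiff_linearPartCx c
    (φ ∘ₗ (exists_projection_minusSpace c K hK).choose) v

end LinearPart

section Pointwise

variable {E E' : Type*} [NormedAddCommGroup E] [NormedSpace ℝ E] [FiniteDimensional ℝ E]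
  [NormedAddCommGroup E'] [NormedSpace ℝ E'] [FiniteDimensional ℝ E']
  {X : Type*} [TopologicalSpace X]

theorem continuous_toContinuousLinearMap {A : X → E →ₗ[ℝ] E'} (hA : ∀ v, Continuous fun x => A x v) :
    Continuous fun x => LinearMap.toContinuousLinearMap (A x) :=
  continuous_clm_apply.2 hA

theorem continuous_apply_of_pointwise {A : X → E →ₗ[ℝ] E'} (hA : ∀ v, Continuous fun x => A x v)
    {u : X → E} (hu : Continuous u) : Continuous fun x => A x (u x) :=
  (continuous_toContinuousLinearMap hA).clm_apply hu

theorem continuous_det_of_pointwise {A : X → Module.End ℝ E} (hA : ∀ v, Continuous fun x => A x v) :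
    Continuous fun x => LinearMap.det (A x) :=
  ContinuousLinearMap.continuous_det.comp (continuous_toContinuousLinearMap hA)

theorem continuous_inverse_of_pointwise {A B : X → Module.End ℝ E}
    (hA : ∀ v, Continuous fun x => A x v) (h1 : ∀ x, A x * B x = 1) (h2 : ∀ x, B x * A x = 1)
    (v : E) : Continuous fun x => B x v := by
  have hA' := continuous_toContinuousLinearMap hA
  let u : X → (E →L[ℝ] E)ˣ := fun x =>
    ⟨LinearMap.toContinuousLinearMap (A x), LinearMap.toContinuousLinearMap (B x),
      ContinuousLinearMap.ext fun w => LinearMap.congr_fun (h1 x) w,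
      ContinuousLinearMap.ext fun w => LinearMap.congr_fun (h2 x) w⟩
  have h : Continuous fun x => Ring.inverse (LinearMap.toContinuousLinearMap (A x)) := by
    rw [continuous_iff_continuousAt]
    intro x
    exact (NormedRing.inverse_continuousAt (u x)).comp (f := fun x =>
      LinearMap.toContinuousLinearMap (A x)) hA'.continuousAt
  have h3 : (fun x => B x v) = fun x => Ring.inverse (LinearMap.toContinuousLinearMap (A x)) v := by
    funext x
    exact congrArg (fun T : E →L[ℝ] E => T v) (Ring.inverse_unit (u x)).symm
  rw [h3]
  exact h.clm_apply continuous_const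

theorem continuous_of_pairing (B : E →ₗ[ℝ] E' →ₗ[ℝ] ℝ) (hB : ∀ v, (∀ w, B v w = 0) → v = 0)
    {u : X → E} (hu : ∀ w, Continuous fun x => B (u x) w) : Continuous u := by
  let L : E →ₗ[ℝ] (E' → ℝ) :=
    { toFun := fun v w => B v w
      map_add' := fun v v' => by
        funext w
        simp
      map_smul' := fun r v => by
        funext w
        simp }
  have hL : L.ker = ⊥ := by
    rw [Submodule.eq_bot_iff]
    intro v hv
    exact hB v fun w => congrFun (LinearMap.mem_ker.1 hv) w
  rw [(LinearMap.isClosedEmbedding_of_injective hL).isInducing.continuous_iff]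
  exact continuous_pi hu

theorem continuous_linearMap (l : E →ₗ[ℝ] E') {u : X → E} (hu : Continuous u) :
    Continuous fun x => l (u x) := (LinearMap.continuous_of_finiteDimensional l).comp hu

theorem continuous_detOnMinus (c : ComplexStructure E) (K : Module.End ℝ E) (hK : Commute c.J K)
    {A : X → Module.End ℝ E} (hAK : ∀ x, Commute (A x) K) (hA : ∀ v, Continuous fun x => A x v) :
    Continuous fun x => detOnMinus c K hK (A x) (hAK x) := by
  have h := (contDiff_detCompression (n := 1) c K hK).continuous.comp
    (continuous_toContinuousLinearMap hA)
  have h1 : (fun x => detOnMinus c K hK (A x) (hAK x)) = fun x => detCompression c K hK (A x) :=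
    funext fun x => (detCompression_eq c K hK (hAK x)).symm
  rw [h1]
  exact h

end Pointwise

section LogDet

variable {E : Type*} [NormedAddCommGroup E] [NormedSpace ℝ E] [FiniteDimensional ℝ E]

theorem contDiff_segmentDet_baseChange {n : WithTop ℕ∞} :
    ContDiff ℝ n fun p : ((E →L[ℝ] E) × (E →L[ℝ] E)) × ℝ =>
      segmentDet (p.1.1.toLinearMap.baseChange ℂ + Complex.I • p.1.2.toLinearMap.baseChange ℂ) p.2 := by
  simp only [segmentDet_baseChange]
  refine contDiff_det fun φ v => ?_
  obtain ⟨x, y, rfl⟩ := exists_tmul v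
  let ψ : E →ₗ[ℝ] ℂ := φ.restrictScalars ℝ ∘ₗ TensorProduct.mk ℝ ℂ E 1
  let ψ' : E →ₗ[ℝ] ℂ := φ.restrictScalars ℝ ∘ₗ TensorProduct.mk ℝ ℂ E Complex.I
  have h1 : ∀ w, ContDiff ℝ n fun p : ((E →L[ℝ] E) × (E →L[ℝ] E)) × ℝ =>
      (1 - p.2) • w + p.2 • p.1.1 w := fun w =>
    ((contDiff_const.sub contDiff_snd).smul contDiff_const).add
      (contDiff_snd.smul ((contDiff_fst.comp contDiff_fst).clm_apply contDiff_const))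
  have h2 : ∀ w, ContDiff ℝ n fun p : ((E →L[ℝ] E) × (E →L[ℝ] E)) × ℝ => p.2 • p.1.2 w := fun w =>
    contDiff_snd.smul ((contDiff_snd.comp contDiff_fst).clm_apply contDiff_const)
  simp only [baseChange_add_I_smul_apply, map_add φ]
  exact ((contDiff_linearMap ψ).comp ((h1 x).sub (h2 y))).add
    ((contDiff_linearMap ψ').comp ((h1 y).add (h2 x)))

theorem continuous_logDet {X : Type*} [TopologicalSpace X] {M N : X → Module.End ℝ E}
    (hM : ∀ v, Continuous fun x => M x v) (hN : ∀ v, Continuous fun x => N x v)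
    (h0 : ∀ x, ∀ t ∈ Set.Icc (0 : ℝ) 1,
      segmentDet ((M x).baseChange ℂ + Complex.I • (N x).baseChange ℂ) t ≠ 0) :
    Continuous fun x => logDet ((M x).baseChange ℂ + Complex.I • (N x).baseChange ℂ) := by
  let D : ((E →L[ℝ] E) × (E →L[ℝ] E)) × ℝ → ℂ := fun p =>
    segmentDet (p.1.1.toLinearMap.baseChange ℂ + Complex.I • p.1.2.toLinearMap.baseChange ℂ) p.2
  have hD : ContDiff ℝ 1 D := contDiff_segmentDet_baseChange
  let p : X → (E →L[ℝ] E) × (E →L[ℝ] E) := fun x =>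
    (LinearMap.toContinuousLinearMap (M x), LinearMap.toContinuousLinearMap (N x))
  have hp : Continuous p :=
    (continuous_toContinuousLinearMap hM).prodMk (continuous_toContinuousLinearMap hN)
  -- Nonvanishing of the denominator is known only for t in [0, 1]. Clamping t to this interval
  -- makes the integrand continuous on all of X × ℝ without changing the integral.
  let k : ℝ → ℝ := fun t => Set.projIcc (0 : ℝ) 1 zero_le_one t
  have hk : Continuous k := continuous_subtype_val.comp continuous_projIcc
  have h1 : ∀ x t, logDeriv (segmentDet ((M x).baseChange ℂ + Complex.I • (N x).baseChange ℂ)) t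
      = fderiv ℝ D (p x, t) (0, 1) / D (p x, t) := by
    intro x t
    rw [logDeriv_apply]
    congr 1
    have h2 : HasDerivAt (fun t : ℝ => (p x, t)) ((0, 1) : ((E →L[ℝ] E) × (E →L[ℝ] E)) × ℝ) t :=
      (hasDerivAt_const t (p x)).prodMk (hasDerivAt_id t)
    exact (((hD.differentiable one_ne_zero) (p x, t)).hasFDerivAt.comp_hasDerivAt t h2).deriv
  have h2 : ∀ x, logDet ((M x).baseChange ℂ + Complex.I • (N x).baseChange ℂ)
      = ∫ t in (0 : ℝ)..1, fderiv ℝ D (p x, k t) (0, 1) / D (p x, k t) := by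
    intro x
    rw [logDet]
    apply intervalIntegral.integral_congr
    intro t ht
    rw [Set.uIcc_of_le zero_le_one] at ht
    have hkt : k t = t := congrArg Subtype.val (Set.projIcc_of_mem zero_le_one ht)
    simp only [hkt, h1]
  simp only [h2]
  apply intervalIntegral.continuous_parametric_intervalIntegral_of_continuous'
  have h3 : Continuous fun q : X × ℝ => (p q.1, k q.2) :=
    (hp.comp continuous_fst).prodMk (hk.comp continuous_snd)
  exact (((hD.continuous_fderiv one_ne_zero).comp h3).clm_apply continuous_const).div
    (hD.continuous.comp h3) fun q => h0 q.1 (k q.2) (Subtype.property _)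

end LogDet

section ZPart

variable {V : Type*} [NormedAddCommGroup V] [NormedSpace ℝ V] [FiniteDimensional ℝ V]
  {Ω : SymplecticForm V} (j : PCCS Ω) {X : Type*} [TopologicalSpace X]

theorem continuous_linearPart (c : ComplexStructure V) {A : X → Module.End ℝ V}
    (hA : ∀ v, Continuous fun x => A x v) (v : V) : Continuous fun x => linearPart c (A x) v :=
  ((hA v).sub (continuous_linearMap c.J (hA (c.J v)))).const_smul (1 / 2 : ℝ)

theorem continuous_antilinearPart (c : ComplexStructure V) {A : X → Module.End ℝ V}
    (hA : ∀ v, Continuous fun x => A x v) (v : V) : Continuous fun x => antilinearPart c (A x) v :=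
  ((hA v).add (continuous_linearMap c.J (hA (c.J v)))).const_smul (1 / 2 : ℝ)

theorem continuous_zPart {γ : X → V ≃ₗ[ℝ] V} (hγ : ∀ x, γ x ∈ Sp Ω)
    (hc : ∀ v, Continuous fun x => γ x v) (v : V) :
    Continuous fun x => zPart j.toComplexStructure (γ x).toLinearMap v :=
  continuous_apply_of_pointwise
    (continuous_inverse_of_pointwise (continuous_linearPart j.toComplexStructure hc)
      (fun x => linearPart_mul_inverse j (hγ x)) (fun x => inverse_linearPart_mul j (hγ x)))
    (continuous_antilinearPart j.toComplexStructure hc v)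

theorem PCCS.continuous_of_G (D : Submodule ℝ V) {u : X → D}
    (hu : ∀ w : D, Continuous fun x => j.G (u x) w) : Continuous u := by
  refine continuous_of_pairing (j.G.restrict D) (fun v hv => ?_) hu
  exact Subtype.ext (j.eq_zero (hv v))

end ZPart

namespace ComplexLagrangian

variable {V : Type*} [NormedAddCommGroup V] [NormedSpace ℝ V] [FiniteDimensional ℝ V]
  {Ω : SymplecticForm V} (F : ComplexLagrangian Ω) (j : PCCS Ω) {X : Type*} [TopologicalSpace X]
  {γ : X → F.stabilizer} (hγ : ∀ v, Continuous fun x => (γ x).1 v)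

theorem bEquiv_eq_proj (g : F.stabilizer) (q : F.complement j) :
    F.bEquiv j g q = j.proj (F.complement j) (g.1 q) := by
  have h1 := F.proj_complement j (-F.aMap g (F.eStar j g q)) 0 (F.bEquiv j g q)
  refine h1.symm.trans (congrArg _ ?_)
  rw [apply_complement]
  simp only [Submodule.coe_neg, Submodule.coe_zero, map_zero]
  abel

include hγ

theorem continuous_inv (v : V) : Continuous fun x => ((γ x)⁻¹).1 v :=
  continuous_inverse_of_pointwise (A := fun x => (γ x).1.toLinearMap)
    (B := fun x => ((γ x)⁻¹).1.toLinearMap) hγ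
    (fun x => LinearMap.ext fun v => (γ x).1.apply_symm_apply v)
    (fun x => LinearMap.ext fun v => (γ x).1.symm_apply_apply v) v

theorem continuous_aMap (v : F.realPart) : Continuous fun x => F.aMap (γ x) v :=
  (hγ v).subtype_mk _

theorem continuous_transpose_aMap (v : F.realPart) :
    Continuous fun x => j.transpose F.realPart (F.aMap (γ x)⁻¹) v := by
  refine j.continuous_of_G _ fun w => ?_
  simp only [j.G_transpose]
  exact continuous_linearMap (j.G v)
    (continuous_subtype_val.comp (F.continuous_aMap (F.continuous_inv hγ) w))

theorem continuous_bEquiv (q : F.complement j) : Continuous fun x => F.bEquiv j (γ x) q := by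
  simp only [bEquiv_eq_proj]
  exact continuous_linearMap (j.proj (F.complement j)) (hγ q)

theorem continuous_eMap (v : F.realPart) : Continuous fun x => F.eMap j (γ x) v :=
  continuous_apply_of_pointwise (A := fun x => (F.bEquiv j (γ x)⁻¹).toLinearMap)
    (F.continuous_bEquiv j (F.continuous_inv hγ))
    (continuous_linearMap (j.proj (F.complement j)) (hγ (j.J v)))

theorem continuous_eStar (q : F.complement j) : Continuous fun x => F.eStar j (γ x) q := by
  refine j.continuous_of_G _ fun w => ?_
  simp only [G_eStar]
  exact continuous_linearMap (Ω.form q) (continuous_subtype_val.comp (F.continuous_eMap j hγ w))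

theorem continuous_sMap (v : F.realPart) : Continuous fun x => F.sMap j (γ x) v := by
  have h1 := continuous_apply_of_pointwise (A := fun x => F.aMap (γ x)⁻¹)
    (F.continuous_aMap (F.continuous_inv hγ))
    (continuous_linearMap (j.proj F.realPart) (hγ (j.J v)))
  have h2 := continuous_apply_of_pointwise (A := fun x => F.eStar j (γ x))
    (F.continuous_eStar j hγ) (F.continuous_eMap j hγ v)
  exact h1.add (h2.const_smul (1 / 2 : ℝ))

theorem continuous_zReduced (q : F.complement j) : Continuous fun x => F.zReduced j (γ x) q := by
  simp only [zReduced_eq]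
  exact continuous_zPart (F.complementPCCS j) (fun x => F.bEquiv_mem j (γ x))
    (F.continuous_bEquiv j hγ) q

theorem continuous_deltaRe (v : F.realPart) : Continuous fun x => F.deltaRe j (γ x) v := by
  have h1 := continuous_apply_of_pointwise (A := fun x => F.aMap (γ x)⁻¹)
    (F.continuous_aMap (F.continuous_inv hγ)) (F.continuous_transpose_aMap j hγ v)
  have h2 := continuous_apply_of_pointwise (A := fun x => F.eStar j (γ x))
    (F.continuous_eStar j hγ)
    (continuous_linearMap (F.complementPCCS j).J (F.continuous_eMap j hγ v))
  have h3 := continuous_apply_of_pointwise (A := fun x => F.eStar j (γ x))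
    (F.continuous_eStar j hγ) (continuous_linearMap (F.complementPCCS j).J
      (continuous_apply_of_pointwise (A := fun x => F.zReduced j (γ x))
        (F.continuous_zReduced j hγ) (F.continuous_eMap j hγ v)))
  exact (((continuous_const.add h1).const_smul (1 / 2 : ℝ)).sub (h2.const_smul (1 / 4 : ℝ))).sub
    (h3.const_smul (1 / 4 : ℝ))

theorem continuous_deltaIm (v : F.realPart) : Continuous fun x => F.deltaIm j (γ x) v := by
  have h3 := continuous_apply_of_pointwise (A := fun x => F.eStar j (γ x))
    (F.continuous_eStar j hγ)
      (continuous_apply_of_pointwise (A := fun x => F.zReduced j (γ x))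
        (F.continuous_zReduced j hγ) (F.continuous_eMap j hγ v))
  exact ((F.continuous_sMap j hγ v).const_smul (-(1 / 2 : ℝ))).sub (h3.const_smul (1 / 4 : ℝ))

theorem continuous_delta : Continuous fun x => F.delta j (γ x) := by
  have h := continuous_logDet (F.continuous_deltaRe j hγ) (F.continuous_deltaIm j hγ)
    (fun x t ht => by
      rw [← deltaArg_eq]
      exact F.segmentDet_deltaArg_ne_zero j (γ x) ht)
  simp only [← deltaArg_eq] at h
  exact Complex.continuous_exp.comp (h.div_const 2)

variable {j} in
theorem continuous_liftFunction (hj : Commute (F.inducedStructure j).J F.reducedStructure.J) :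
    Continuous fun x => F.liftFunction j hj (γ x) := by
  have h1 : Continuous fun x => ((Real.sqrt |LinearMap.det (F.aMap (γ x))| : ℝ) : ℂ) :=
    Complex.continuous_ofReal.comp (Real.continuous_sqrt.comp
      (continuous_det_of_pointwise (F.continuous_aMap hγ)).abs)
  have h2 : Continuous fun x => F.detMinus j hj (γ x) := by
    simp only [detMinus_eq]
    exact continuous_detOnMinus (A := fun x => (F.bEquiv j (γ x)).toLinearMap) _ _ _ _
      (F.continuous_bEquiv j hγ)
  exact ((h1.mul h2).mul (F.continuous_delta j hγ)).inv₀ fun x =>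
    fun h => F.liftFunction_ne_zero (γ x) hj (inv_eq_zero.2 h)

end ComplexLagrangian

/-! ### The multiplication law for f_F -/

namespace ComplexLagrangian

variable {V : Type*} [AddCommGroup V] [Module ℝ V] [FiniteDimensional ℝ V] {Ω : SymplecticForm V}
  (F : ComplexLagrangian Ω) {j : PCCS Ω}

/-- The j-linear operator 1 - YZ is block diagonal for (D ⊕ jD) ⊕ Q. On the first summand its
determinant is a real determinant on D, positive by contraction; on Q it is the product over {K =
-j} and {K = j}, whose two factors are equal. -/
theorem detLinearPart_one_sub_block (hj : Commute (F.inducedStructure j).J F.reducedStructure.J)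
    {Y Z : Module.End ℝ V} {Y' Z' : Module.End ℝ (F.complement j)}
    (hY : j.IsSymmAnti Y) (hZ : j.IsSymmAnti Z) (hYc : j.IsContr Y) (hZc : j.IsContr Z)
    (hY' : (F.complementPCCS j).IsSymmAnti Y') (hZ' : (F.complementPCCS j).IsSymmAnti Z')
    (hYc' : (F.complementPCCS j).IsContr Y') (hZc' : (F.complementPCCS j).IsContr Z')
    (hYK : Commute Y' (F.complementStructure j).J) (hZK : Commute Z' (F.complementStructure j).J)
    (hYD : ∀ d ∈ F.realPart, Y d ∈ F.realPart) (hZD : ∀ d ∈ F.realPart, Z d ∈ F.realPart)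
    (hYQ : ∀ q : F.complement j, Y q = Y' q) (hZQ : ∀ q : F.complement j, Z q = Z' q) :
    ∃ r : ℝ, 0 < r ∧ detLinearPart j.toComplexStructure (1 - Y * Z)
      = r * detOnMinus (F.complementPCCS j).toComplexStructure (F.complementStructure j).J
        (F.commute_complementStructure hj) (1 - Y' * Z') (commute_one_sub_mul hZK hYK) ^ 2 := by
  set Q := F.complementPCCS j
  have hXD : ∀ d ∈ F.realPart, (1 - Y * Z) d ∈ F.realPart := fun d hd =>
    F.realPart.sub_mem hd (hYD _ (hZD d hd))
  have hpos := j.G_one_sub_mul_pos hY hYc hZc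
  have hpos' := Q.G_one_sub_mul_pos hY' hYc' hZc'
  let P := (1 - Y * Z).restrict hXD
  have hP : 0 < LinearMap.det P := by
    have hne : ∀ A : Module.End ℝ F.realPart, (∀ v, v ≠ 0 → 0 < j.G (A v) v) →
        LinearMap.det A ≠ 0 := by
      intro A hA h
      obtain ⟨v, hv, hv0⟩ := (Submodule.ne_bot_iff _).1 (LinearMap.bot_lt_ker_of_det_eq_zero h).ne'
      have := hA v hv0
      rw [LinearMap.mem_ker.1 hv] at this
      simp at this
    by_contra hneg
    have hc := (continuous_det_one_add_smul (P - 1)).continuousOn (s := Set.Icc 0 1)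
    have h0 : LinearMap.det (1 + (0 : ℝ) • (P - 1)) = 1 := by simp
    have h1 : LinearMap.det (1 + (1 : ℝ) • (P - 1)) = LinearMap.det P := by simp
    obtain ⟨s, hs, hs0⟩ := intermediate_value_Icc' zero_le_one hc
      (show (0 : ℝ) ∈ Set.Icc _ _ from ⟨by rw [h1]; exact not_lt.1 hneg, by rw [h0]; exact zero_le_one⟩)
    refine hne (1 + s • (P - 1)) (fun v hv => ?_) hs0
    have hv' : (v : V) ≠ 0 := fun h => hv (Subtype.ext h)
    have h2 : 0 < j.G (P v : V) v := hpos v hv'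
    have h3 := j.G_pos (v : V) hv'
    simp only [LinearMap.add_apply, LinearMap.smul_apply, LinearMap.sub_apply, Module.End.one_apply,
      Submodule.coe_add, Submodule.coe_smul, Submodule.coe_sub,
      map_add, map_smul, map_sub, smul_eq_mul]
    rcases hs.1.eq_or_lt with h | h
    · rw [← h]
      linarith
    · have := mul_pos h h2
      have := mul_nonneg (sub_nonneg.2 hs.2) h3.le
      linarith
  have hC := commute_one_sub_mul_J Q hY' hZ'
  have hu : IsUnit (1 - Y' * Z') := by
    rw [LinearMap.isUnit_iff_ker_eq_bot, Submodule.eq_bot_iff]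
    intro v hv
    by_contra hv0
    have := hpos' v hv0
    rw [LinearMap.mem_ker.1 hv] at this
    simp at this
  have hCi : Commute Q.J (Ring.inverse (1 - Y' * Z')) := by
    obtain ⟨u, hu⟩ := hu
    rw [← hu] at hC ⊢
    rw [Ring.inverse_unit]
    exact hC.units_inv_right
  have h := F.detLinearPart_block j (commute_one_sub_mul_J j hY hZ) (P₁ := P) (P₂ := 0) (R := 0)
    (S := 0) hC hCi (Ring.mul_inverse_cancel _ hu) (Ring.inverse_mul_cancel _ hu)
    (fun d => by
      change (1 - Y * Z) d = (1 - Y * Z) d + j.J 0 + 0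
      rw [map_zero, add_zero, add_zero])
    (fun q => by
      change (q : V) - Y (Z q) = 0 - j.J 0 + ((q : V) - Y' (Z' q))
      rw [map_zero, sub_zero, zero_add, hZQ, hYQ])
  refine ⟨LinearMap.det P, hP, ?_⟩
  have hK := F.commute_complementStructure hj
  rw [h, detLinearPart_eq_mul _ _ hK (F.complementStructure j).sq (commute_one_sub_mul hZK hYK),
    ← detOnMinus_one_sub_mul Q (F.complementStructure j) hK hZ' hY' hZK hYK]
  simp only [LinearMap.zero_comp, sub_zero, add_zero, LinearMap.baseChange_zero, smul_zero,
    LinearMap.det_baseChange, Complex.coe_algebraMap]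
  ring

end ComplexLagrangian

namespace ComplexLagrangian

variable {V : Type*} [NormedAddCommGroup V] [NormedSpace ℝ V] [FiniteDimensional ℝ V]
  [MeasurableSpace V] [BorelSpace V] {Ω : SymplecticForm V} (F : ComplexLagrangian Ω) {j : PCCS Ω}
  {ħ : ℝ} (hħ : 0 < ħ)

theorem continuous_degenerate (g : F.stabilizer) (v : V) :
    Continuous fun τ => (F.degenerate j g τ).1 v := by
  change Continuous fun τ => F.degenerateMap j g τ v
  simp only [degenerateMap, LinearMap.add_apply, LinearMap.sub_apply, LinearMap.smul_apply,
    LinearMap.comp_apply, map_sub, map_smul]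
  fun_prop

include hħ

theorem gaussPairing_zero : gaussPairing j ħ 0 0 = 1 := by
  have h1 : j.IsSymmAnti 0 := ⟨fun w => by simp, fun v w => by simp⟩
  have h2 : j.IsContr 0 := fun v hv => by simpa using j.G_pos v hv
  rw [gaussPairing_self hħ h1 h2]
  simp

/-- Replacing Y, Z, Y', Z' by their multiples with t in [0, 1] gives a continuous function of t with
positive square and value 1 at t = 0. It must equal the positive root throughout. -/
theorem gaussPairing_mul_detOnMinus_pos
    (hj : Commute (F.inducedStructure j).J F.reducedStructure.J)
    {Y Z : Module.End ℝ V} {Y' Z' : Module.End ℝ (F.complement j)}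
    (hY : j.IsSymmAnti Y) (hZ : j.IsSymmAnti Z) (hYc : j.IsContr Y) (hZc : j.IsContr Z)
    (hY' : (F.complementPCCS j).IsSymmAnti Y') (hZ' : (F.complementPCCS j).IsSymmAnti Z')
    (hYc' : (F.complementPCCS j).IsContr Y') (hZc' : (F.complementPCCS j).IsContr Z')
    (hYK : Commute Y' (F.complementStructure j).J) (hZK : Commute Z' (F.complementStructure j).J)
    (hYD : ∀ d ∈ F.realPart, Y d ∈ F.realPart) (hZD : ∀ d ∈ F.realPart, Z d ∈ F.realPart)
    (hYQ : ∀ q : F.complement j, Y q = Y' q) (hZQ : ∀ q : F.complement j, Z q = Z' q) :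
    ∃ r : ℝ, 0 < r ∧ gaussPairing j ħ Z Y *
      detOnMinus (F.complementPCCS j).toComplexStructure (F.complementStructure j).J
        (F.commute_complementStructure hj) (1 - Y' * Z') (commute_one_sub_mul hZK hYK) = r := by
  have hK := F.commute_complementStructure hj
  let w : ℝ → ℂ := fun t => gaussPairing j ħ (t • Z) (t • Y) *
      detOnMinus (F.complementPCCS j).toComplexStructure (F.complementStructure j).J
        hK (1 - (t • Y') * (t • Z'))
        (commute_one_sub_mul (hZK.smul_left t) (hYK.smul_left t))
  have hw2 : ∀ t ∈ Set.Icc (0 : ℝ) 1, ∃ r : ℝ, 0 < r ∧ w t ^ 2 = r := by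
    intro t ht
    obtain ⟨r, hr, h⟩ := F.detLinearPart_one_sub_block hj (hY.smul t) (hZ.smul t) (hYc.smul ht)
      (hZc.smul ht) (hY'.smul t) (hZ'.smul t) (hYc'.smul ht) (hZc'.smul ht) (hYK.smul_left t)
      (hZK.smul_left t) (fun d hd => F.realPart.smul_mem t (hYD d hd))
      (fun d hd => F.realPart.smul_mem t (hZD d hd)) (fun q => by simp [hYQ]) (fun q => by simp [hZQ])
    have h1 := gaussPairing_sq_mul hħ (hY.smul t) (hZ.smul t) (hYc.smul ht) (hZc.smul ht)
    rw [h] at h1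
    refine ⟨r⁻¹, inv_pos.2 hr, ?_⟩
    rw [Complex.ofReal_inv]
    apply eq_inv_of_mul_eq_one_left
    rw [← h1]
    simp only [w]
    ring
  have hc : ContinuousOn w (Set.Icc 0 1) := by
    refine ContinuousOn.mul (fun t ht => ContinuousAt.continuousWithinAt ?_)
      (Continuous.continuousOn ?_)
    · exact continuousAt_gaussPairing hħ (fun t => hY.smul t) (fun t => hZ.smul t) (hYc.smul ht)
        (hZc.smul ht) (fun v => (continuous_id.smul continuous_const).continuousAt)
        (fun v => (continuous_id.smul continuous_const).continuousAt)
    · refine continuous_detOnMinus (A := fun t : ℝ => 1 - (t • Y') * (t • Z')) _ _ hK _ fun v => ?_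
      simp only [LinearMap.sub_apply, Module.End.mul_apply, LinearMap.smul_apply, map_smul]
      fun_prop
  have h0 : w 0 = 1 := by
    have : gaussPairing j ħ ((0 : ℝ) • Z) ((0 : ℝ) • Y) = 1 := by
      rw [zero_smul, zero_smul, gaussPairing_zero hħ]
    simp only [w, this, one_mul]
    rw [← detOnMinus_one (F.complementPCCS j).toComplexStructure (F.complementStructure j).J hK]
    congr 1
    simp
  have hre : ∀ t ∈ Set.Icc (0 : ℝ) 1, 0 < (w t ^ 2).re ∧ w t ^ 2 = ((w t ^ 2).re : ℂ) := by
    intro t ht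
    obtain ⟨r, hr, h⟩ := hw2 t ht
    rw [h, Complex.ofReal_re]
    exact ⟨hr, rfl⟩
  have hmain := isPreconnected_Icc.eq_of_sq_eq (f := w)
    (g := fun t => ((Real.sqrt (w t ^ 2).re : ℝ) : ℂ)) hc
    (Complex.continuous_ofReal.comp_continuousOn (Real.continuous_sqrt.comp_continuousOn
      (Complex.continuous_re.comp_continuousOn (hc.pow 2))))
    (fun t ht => by
      obtain ⟨h1, h2⟩ := hre t ht
      simp only [Pi.pow_apply]
      rw [← Complex.ofReal_pow, Real.sq_sqrt h1.le, ← h2])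
    (fun ht => by
      have := Real.sqrt_pos.2 (hre _ ht).1
      exact_mod_cast this.ne')
    (Set.left_mem_Icc.2 zero_le_one) (by simp [h0])
  have h1 := hmain (Set.right_mem_Icc.2 zero_le_one)
  refine ⟨_, Real.sqrt_pos.2 (hre 1 (Set.right_mem_Icc.2 zero_le_one)).1, Eq.trans ?_ h1⟩
  simp only [w, one_smul]

variable (hj : Commute (F.inducedStructure j).J F.reducedStructure.J) (g g' : F.stabilizer)

/-- In f_F² Det C_g χ = sign Det a both χ and the sign are multiplicative, and the defect Det(1 -
Z_g Z_{g'⁻¹}) of Det C is inverse to the square of the Gaussian pairing. -/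
theorem liftFunction_mul_sq : (F.liftFunction j hj g * F.liftFunction j hj g' * gaussPairing j ħ
      (zPart j.toComplexStructure (g'.1⁻¹).toLinearMap) (zPart j.toComplexStructure g.1.toLinearMap)) ^ 2
    = F.liftFunction j hj (g * g') ^ 2 := by
  have hg := g.2.1
  have hg' := g'.2.1
  have hgi : g'.1⁻¹ ∈ Sp Ω := inv_mem hg'
  have h1 := F.liftFunction_sq g hj
  have h2 := F.liftFunction_sq g' hj
  have h3 := F.liftFunction_sq (g * g') hj
  have h4 := gaussPairing_sq_mul hħ (isSymmAnti_zPart j hg) (isSymmAnti_zPart j hgi)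
    (norm_zPart_lt j hg) (norm_zPart_lt j hgi)
  have h5 : detLinearPart j.toComplexStructure (g * g').1.toLinearMap
      = detLinearPart j.toComplexStructure g.1.toLinearMap
        * (detLinearPart j.toComplexStructure (1 - zPart j.toComplexStructure g.1.toLinearMap
            * zPart j.toComplexStructure (g'.1⁻¹).toLinearMap)
          * detLinearPart j.toComplexStructure g'.1.toLinearMap) := by
    have h := linearPart_mul_eq j hg hg'
    rw [← detLinearPart_linearPart]
    change detLinearPart _ (linearPart j.toComplexStructure (g.1 * g'.1).toLinearMap) = _
    rw [h, detLinearPart_mul _ (linearPart_commute _ _), detLinearPart_mul _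
      (commute_one_sub_mul_J j (isSymmAnti_zPart j hg) (isSymmAnti_zPart j hgi)),
      detLinearPart_linearPart, detLinearPart_linearPart]
  have h6 := detLinearPart_ne_zero j (g * g').2.1
  have h7 : F.reducedRatio (g * g') hj ≠ 0 := by
    rw [← norm_ne_zero_iff, norm_reducedRatio]
    exact one_ne_zero
  have h8 : ((SignType.sign (LinearMap.det (F.aMap (g * g'))) : ℝ) : ℂ)
      = ((SignType.sign (LinearMap.det (F.aMap g)) : ℝ) : ℂ)
        * ((SignType.sign (LinearMap.det (F.aMap g')) : ℝ) : ℂ) := by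
    rw [aMap_mul, map_mul, sign_mul]
    push_cast
    rfl
  rw [h8, ← h1, ← h2, F.reducedRatio_mul hj g g'] at h3
  rw [F.reducedRatio_mul hj g g'] at h7
  apply mul_right_cancel₀ (mul_ne_zero h6 h7)
  rw [← mul_assoc (F.liftFunction j hj (g * g') ^ 2), h3, h5]
  linear_combination (F.liftFunction j hj g ^ 2 * detLinearPart j.toComplexStructure g.1.toLinearMap
    * F.reducedRatio g hj * (F.liftFunction j hj g' ^ 2
    * detLinearPart j.toComplexStructure g'.1.toLinearMap * F.reducedRatio g' hj)) * h4

variable {g g'} in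
-- In this case δ_D is positive and |Det a| is multiplicative. The defect of Det C'⁻ is the
-- determinant of 1 - Z'_b Z'_{b'⁻¹} on {K = -j}, whose product with the Gaussian pairing is
-- positive. So the two sides differ by a positive factor with square 1.
theorem IsLevi.liftFunction_mul (hg : F.IsLevi j g) (hg' : F.IsLevi j g') (hi : F.IsLevi j g'⁻¹)
    (hgg' : F.IsLevi j (g * g')) : F.liftFunction j hj g * F.liftFunction j hj g' * gaussPairing j ħ
      (zPart j.toComplexStructure (g'.1⁻¹).toLinearMap) (zPart j.toComplexStructure g.1.toLinearMap)
    = F.liftFunction j hj (g * g') := by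
  have hK := F.commute_complementStructure hj
  have hsq := F.liftFunction_mul_sq hħ hj g g'
  have hgi : g'.1⁻¹ ∈ Sp Ω := inv_mem g'.2.1
  have hb := F.bEquiv_mem j g
  have hb' := F.bEquiv_mem j g'
  have hc := F.bEquiv_commute j g
  have hc' := F.bEquiv_commute j g'
  have hz := zPart_commute _ hb hK hc
  have hz' := zPart_commute _ (F.bEquiv_mem j g'⁻¹) hK (F.bEquiv_commute j g'⁻¹)
  rw [← zReduced_eq] at hz hz'
  obtain ⟨r, hr, h⟩ := F.gaussPairing_mul_detOnMinus_pos hħ hj (isSymmAnti_zPart j g.2.1)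
    (isSymmAnti_zPart j hgi) (norm_zPart_lt j g.2.1) (norm_zPart_lt j hgi)
    (F.isSymmAnti_zReduced j g) (F.isSymmAnti_zReduced j g'⁻¹) (F.isContr_zReduced j g)
    (F.isContr_zReduced j g'⁻¹) hz hz' hg.zPart_realPart hi.zPart_realPart hg.zPart_complement
    hi.zPart_complement
  have h1 : F.detMinus j hj (g * g') = F.detMinus j hj g
      * detOnMinus (F.complementPCCS j).toComplexStructure (F.complementStructure j).J hK
        (1 - F.zReduced j g * F.zReduced j g'⁻¹) (commute_one_sub_mul hz' hz)
      * F.detMinus j hj g' := by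
    have hAA : Commute (F.bEquiv j g * F.bEquiv j g').toLinearMap (F.complementStructure j).J :=
      hc.mul_left hc'
    have hzz := commute_one_sub_mul hz' hz
    simp only [zReduced_eq, bEquiv_inv] at hzz
    have h2 := detOnMinus_apply_mul (F.complementPCCS j) hK hb hb' hc hc' hAA hzz
    simp only [detMinus_eq, zReduced_eq, bEquiv_inv, bEquiv_mul]
    rw [h2]
    ring
  obtain ⟨d, hd, hd'⟩ := hg.delta_pos
  obtain ⟨d', hd0, hd1⟩ := hg'.delta_pos
  obtain ⟨d'', hd2, hd3⟩ := hgg'.delta_pos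
  have n1 := F.detMinus_ne_zero g hj
  have n2 := F.detMinus_ne_zero g' hj
  have s1 := Real.sqrt_pos.2 (abs_pos.2 (F.det_aMap_ne_zero g))
  have s2 := Real.sqrt_pos.2 (abs_pos.2 (F.det_aMap_ne_zero g'))
  have hdet : Real.sqrt |LinearMap.det (F.aMap (g * g'))|
      = Real.sqrt |LinearMap.det (F.aMap g)| * Real.sqrt |LinearMap.det (F.aMap g')| := by
    rw [aMap_mul, map_mul, abs_mul, Real.sqrt_mul (abs_nonneg _)]
  have hne := F.liftFunction_ne_zero (g * g') hj
  have key : F.liftFunction j hj g * F.liftFunction j hj g' * gaussPairing j ħ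
      (zPart j.toComplexStructure (g'.1⁻¹).toLinearMap) (zPart j.toComplexStructure g.1.toLinearMap)
      = ((r * d'' / (d * d') : ℝ) : ℂ) * F.liftFunction j hj (g * g') := by
    have n3 : F.detMinus j hj (g * g') ≠ 0 := F.detMinus_ne_zero _ hj
    rw [h1] at n3
    have n4 := right_ne_zero_of_mul (left_ne_zero_of_mul n3)
    rw [liftFunction, liftFunction, liftFunction, h1, hdet, hd', hd1, hd3]
    push_cast
    rw [← h]
    have t1 : (d : ℂ) ≠ 0 := by exact_mod_cast hd.ne'
    have t2 : (d' : ℂ) ≠ 0 := by exact_mod_cast hd0.ne'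
    have t3 : (d'' : ℂ) ≠ 0 := by exact_mod_cast hd2.ne'
    have t4 : ((Real.sqrt |LinearMap.det (F.aMap g)| : ℝ) : ℂ) ≠ 0 := by exact_mod_cast s1.ne'
    have t5 : ((Real.sqrt |LinearMap.det (F.aMap g')| : ℝ) : ℂ) ≠ 0 := by exact_mod_cast s2.ne'
    field_simp
  have hx : 0 < r * d'' / (d * d') := by positivity
  rw [key, mul_pow] at hsq
  have h3 : ((r * d'' / (d * d') : ℝ) : ℂ) ^ 2 = 1 := mul_right_cancel₀ (pow_ne_zero 2 hne)
    (hsq.trans (one_mul _).symm)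
  have h4 : (r * d'' / (d * d')) ^ 2 = 1 := by exact_mod_cast h3
  have h5 : r * d'' / (d * d') = 1 :=
    (pow_eq_one_iff_of_nonneg hx.le two_ne_zero).1 h4
  rw [key, h5, Complex.ofReal_one, one_mul]

theorem continuous_gaussPairing {Y Z : ℝ → Module.End ℝ V}
    (hY : ∀ t, j.IsSymmAnti (Y t)) (hZ : ∀ t, j.IsSymmAnti (Z t)) (hYc : ∀ t, j.IsContr (Y t))
    (hZc : ∀ t, j.IsContr (Z t)) (hYt : ∀ v, Continuous fun t => Y t v)
    (hZt : ∀ v, Continuous fun t => Z t v) : Continuous fun t => gaussPairing j ħ (Z t) (Y t) :=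
  continuous_iff_continuousAt.2 fun t => continuousAt_gaussPairing hħ hY hZ (hYc t) (hZc t)
    (fun v => (hYt v).continuousAt) (fun v => (hZt v).continuousAt)

/-- The multiplication law of the parameters. -/
theorem liftFunction_mul : F.liftFunction j hj g * F.liftFunction j hj g' * gaussPairing j ħ
      (zPart j.toComplexStructure (g'.1⁻¹).toLinearMap) (zPart j.toComplexStructure g.1.toLinearMap)
    = F.liftFunction j hj (g * g') := by
  let γ := F.degenerate j g
  let γ' := F.degenerate j g'
  have hγ : ∀ v, Continuous fun τ => (γ τ).1 v := F.continuous_degenerate g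
  have hγ' : ∀ v, Continuous fun τ => (γ' τ).1 v := F.continuous_degenerate g'
  have hγγ : ∀ v, Continuous fun τ => (γ τ * γ' τ).1 v := fun v =>
    continuous_apply_of_pointwise (A := fun τ => (γ τ).1.toLinearMap) hγ (hγ' v)
  have hinv : ∀ τ, (γ' τ).1⁻¹ ∈ Sp Ω := fun τ => inv_mem (γ' τ).2.1
  have hJ : Continuous fun τ => gaussPairing j ħ
      (zPart j.toComplexStructure ((γ' τ).1⁻¹).toLinearMap)
      (zPart j.toComplexStructure (γ τ).1.toLinearMap) :=
    continuous_gaussPairing hħ (fun τ => isSymmAnti_zPart j (γ τ).2.1)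
      (fun τ => isSymmAnti_zPart j (hinv τ)) (fun τ => norm_zPart_lt j (γ τ).2.1)
      (fun τ => norm_zPart_lt j (hinv τ)) (continuous_zPart j (fun τ => (γ τ).2.1) hγ)
      (continuous_zPart j hinv (F.continuous_inv hγ'))
  -- Along the degeneration both sides are continuous with equal squares, the right one never
  -- vanishes, and they agree at τ = 0; hence they agree at τ = 1, where the family returns g and
  -- g'.
  have hmain := (isPreconnected_univ (α := ℝ)).eq_of_sq_eq
    (((F.continuous_liftFunction hγ hj).mul (F.continuous_liftFunction hγ' hj)).mul hJ).continuousOn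
    (F.continuous_liftFunction hγγ hj).continuousOn
    (fun τ _ => F.liftFunction_mul_sq hħ hj (γ τ) (γ' τ))
    (fun _ => F.liftFunction_ne_zero _ hj) (Set.mem_univ 0)
    (IsLevi.liftFunction_mul F hħ hj (F.isLevi_degenerate_zero j g) (F.isLevi_degenerate_zero j g')
      (by
        have h := F.isLevi_degenerate_zero j g'⁻¹
        rwa [degenerate_inv] at h)
      (by
        have h := F.isLevi_degenerate_zero j (g * g')
        rwa [degenerate_mul] at h))
  have h1 := hmain (Set.mem_univ 1)
  simp only [γ, γ', degenerate_one, Pi.mul_apply] at h1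
  exact h1

end ComplexLagrangian

/-! ### Smoothness of f_F and the lift -/

namespace ComplexLagrangian

variable {V : Type*} [NormedAddCommGroup V] [NormedSpace ℝ V] [FiniteDimensional ℝ V]
  {Ω : SymplecticForm V} (F : ComplexLagrangian Ω) {j : PCCS Ω}
  (hj : Commute (F.inducedStructure j).J F.reducedStructure.J)

/-- The compression of an endomorphism of `V` to a subspace. -/
def compress (j : PCCS Ω) (D : Submodule ℝ V) (A : V →L[ℝ] V) : D →L[ℝ] D :=
  (LinearMap.toContinuousLinearMap (j.proj D)).comp (A.comp D.subtypeL)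

theorem contDiff_compress (D : Submodule ℝ V) {n : WithTop ℕ∞} : ContDiff ℝ n (compress j D) :=
  contDiff_const.clm_comp (contDiff_id.clm_comp contDiff_const)

theorem compress_complement (g : F.stabilizer) :
    (compress j (F.complement j) (toEnd g.1)).toLinearMap = (F.bEquiv j g).toLinearMap :=
  LinearMap.ext fun q => (F.bEquiv_eq_proj j g q).symm

theorem compress_realPart (g : F.stabilizer) :
    (compress j F.realPart (toEnd g.1)).toLinearMap = F.aMap g := by
  refine LinearMap.ext fun d => ?_
  have h := F.proj_realPart j (F.aMap g d) 0 0
  simp only [Submodule.coe_zero, map_zero, add_zero] at h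
  exact h

/-- A smooth extension of `f_F²`, up to sign, to endomorphisms of `V`. -/
def squareExtension (A : V →L[ℝ] V) : ℂ :=
  detLinearPart (F.complementPCCS j).toComplexStructure
      (compress j (F.complement j) A).toLinearMap
    / (detLinearPart j.toComplexStructure A.toLinearMap
      * detCompression (F.complementPCCS j).toComplexStructure (F.complementStructure j).J
        (F.commute_complementStructure hj) (compress j (F.complement j) A).toLinearMap ^ 2)

theorem liftFunction_sq_eq (g : F.stabilizer) : F.liftFunction j hj g ^ 2
    = ((SignType.sign (LinearMap.det (F.aMap g)) : ℝ) : ℂ) * F.squareExtension hj (toEnd g.1) := by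
  have h1 := F.liftFunction_sq g hj
  have h2 := F.detLinearPart_bEquiv g hj
  have h3 := detLinearPart_ne_zero j g.2.1
  have h4 := F.detMinus_ne_zero g hj
  have h5 : (toEnd g.1).toLinearMap = g.1.toLinearMap := rfl
  rw [squareExtension, compress_complement, h5,
    detCompression_eq _ _ _ (F.bEquiv_commute j g), ← F.detMinus_eq hj, ← h1]
  field_simp
  rw [← h2]
  ring

theorem squareExtension_ne_zero (g : F.stabilizer) : F.squareExtension hj (toEnd g.1) ≠ 0 := by
  have h := F.liftFunction_sq_eq hj g
  intro h0
  rw [h0, mul_zero] at h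
  exact F.liftFunction_ne_zero g hj (pow_eq_zero_iff two_ne_zero |>.1 h)

/-- Continuity of f_F is used to recover the sign lost by squaring: on this neighbourhood f_F(h) /
f_F(g) is the principal root of its square. -/
theorem exists_isOpen_re_pos (g : F.stabilizer) :
    ∃ W : Set (V →L[ℝ] V), IsOpen W ∧ toEnd g.1 ∈ W ∧ ∀ h : F.stabilizer, toEnd h.1 ∈ W →
      0 < (F.liftFunction j hj h / F.liftFunction j hj g).re := by
  let : TopologicalSpace F.stabilizer :=
    TopologicalSpace.induced (fun h : F.stabilizer => toEnd h.1) inferInstance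
  have hc : Continuous fun h : F.stabilizer => toEnd h.1 := continuous_induced_dom
  have h1 := F.continuous_liftFunction (γ := fun h : F.stabilizer => h)
    (fun v => hc.clm_apply continuous_const) hj
  have h2 : IsOpen {h : F.stabilizer | 0 < (F.liftFunction j hj h / F.liftFunction j hj g).re} :=
    isOpen_lt continuous_const (Complex.continuous_re.comp (h1.div_const _))
  obtain ⟨W, hW, hW'⟩ := isOpen_induced_iff.1 h2
  refine ⟨W, hW, ?_, fun h hh => ?_⟩
  · have : g ∈ (fun h : F.stabilizer => toEnd h.1) ⁻¹' W := by
      rw [hW', Set.mem_ofPred_eq, div_self (F.liftFunction_ne_zero g hj)]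
      exact one_pos
    exact this
  · have : h ∈ (fun h : F.stabilizer => toEnd h.1) ⁻¹' W := hh
    rwa [hW'] at this

/-- Near g one has f_F(h) = f_F(g) (f_F(h)² / f_F(g)²)^{1/2} with the principal root, and the
quotient of squares extends smoothly to an open subset of End(V). -/
theorem smooth_liftFunction : SmoothOnSubgroup F.stabilizer (F.liftFunction j hj) := by
  intro g
  obtain ⟨W, hW, hgW, hre⟩ := F.exists_isOpen_re_pos hj g
  have hf0 := F.liftFunction_ne_zero g hj
  have hs0 := F.squareExtension_ne_zero hj g
  let c1 : (V →L[ℝ] V) → ℂ := fun A => detLinearPart j.toComplexStructure A.toLinearMap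
    * detCompression (F.complementPCCS j).toComplexStructure (F.complementStructure j).J
        (F.commute_complementStructure hj) (compress j (F.complement j) A).toLinearMap ^ 2
  have hc1 : ContDiff ℝ ∞ c1 := (contDiff_detLinearPart _).mul
    (((contDiff_detCompression _ _ _).comp (contDiff_compress _)).pow 2)
  let U : Set (V →L[ℝ] V) := {A | c1 A ≠ 0}
  have hU : IsOpen U := isOpen_ne_fun hc1.continuous continuous_const
  let R : (V →L[ℝ] V) → ℂ := fun A => F.squareExtension hj A / F.squareExtension hj (toEnd g.1)
  have hR : ContDiffOn ℝ ∞ R U := by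
    have h := (contDiff_detLinearPart (F.complementPCCS j).toComplexStructure (n := ∞)).comp
      (contDiff_compress (j := j) (F.complement j))
    have h' := (h.contDiffOn.mul (hc1.contDiffOn.inv fun A (hA : A ∈ U) => hA)).mul
      (contDiffOn_const (c := (F.squareExtension hj (toEnd g.1))⁻¹))
    refine h'.congr fun A hA => ?_
    simp only [R, squareExtension, c1, div_eq_mul_inv, Function.comp_apply, Pi.inv_apply]
  let a : (V →L[ℝ] V) → ℝ := fun A => LinearMap.det (compress j F.realPart A).toLinearMap
  have ha : Continuous a := ContinuousLinearMap.continuous_det.comp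
    (contDiff_compress (n := 1) F.realPart).continuous
  have hag : ∀ h : F.stabilizer, a (toEnd h.1) = LinearMap.det (F.aMap h) := fun h => by
    simp only [a, compress_realPart]
  -- The four conditions make the extension of the square smooth, keep the quotient off the cut of
  -- the root, keep the sign of Det a equal to that at g, and select the principal root.
  let N : Set (V →L[ℝ] V) := (U ∩ R ⁻¹' Complex.slitPlane) ∩ {A | 0 < a (toEnd g.1) * a A} ∩ W
  have hgU : ∀ h : F.stabilizer, toEnd h.1 ∈ U := fun h h0 =>
    F.squareExtension_ne_zero hj h (div_eq_zero_iff.2 (Or.inr h0))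
  refine ⟨N, fun A => F.liftFunction j hj g * R A ^ (2⁻¹ : ℂ), ?_, ?_, ?_, ?_⟩
  · exact ((hR.continuousOn.isOpen_inter_preimage hU Complex.isOpen_slitPlane).inter
      (isOpen_lt continuous_const (continuous_const.mul ha))).inter hW
  · refine ⟨⟨⟨hgU g, ?_⟩, ?_⟩, hgW⟩
    · rw [Set.mem_preimage]
      simp only [R]
      rw [div_self hs0]
      exact Complex.one_mem_slitPlane
    · exact mul_self_pos.2 ((hag g).symm ▸ F.det_aMap_ne_zero g)
  · refine contDiffOn_const.mul ?_
    have h1 : ContDiffOn ℝ ∞ R N := hR.mono fun A hA => hA.1.1.1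
    have h2 : ContDiffOn ℝ ∞ (fun A => Complex.exp (Complex.log (R A) * 2⁻¹)) N := by
      refine ContDiffOn.cexp (ContDiffOn.mul (fun A hA => ?_) contDiffOn_const)
      have h3 : ContDiffAt ℝ ∞ Complex.log (R A) :=
        (Complex.contDiffAt_log hA.1.1.2).restrict_scalars ℝ
      exact h3.comp_contDiffWithinAt A (h1 A hA)
    exact h2.congr fun A hA => Complex.cpow_def_of_ne_zero (Complex.slitPlane_ne_zero hA.1.1.2) _
  · intro h hh
    have h1 := F.liftFunction_sq_eq hj g
    have h2 := F.liftFunction_sq_eq hj h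
    have h3 : SignType.sign (LinearMap.det (F.aMap h)) = SignType.sign (LinearMap.det (F.aMap g)) := by
      have h4 : 0 < a (toEnd g.1) * a (toEnd h.1) := hh.1.2
      rw [hag, hag] at h4
      rcases mul_pos_iff.1 h4 with ⟨h5, h6⟩ | ⟨h5, h6⟩
      · rw [sign_pos h5, sign_pos h6]
      · rw [sign_neg h5, sign_neg h6]
    have h4 : R (toEnd h.1) = (F.liftFunction j hj h / F.liftFunction j hj g) ^ 2 := by
      have h5 : ((SignType.sign (LinearMap.det (F.aMap g)) : ℝ) : ℂ) ≠ 0 := by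
        intro h6
        rw [h6, zero_mul] at h1
        exact hf0 (pow_eq_zero_iff two_ne_zero |>.1 h1)
      rw [div_pow, h1, h2, h3, mul_div_mul_left _ _ h5]
    change _ * R (toEnd h.1) ^ (2⁻¹ : ℂ) = _
    rw [h4, Complex.sq_cpow_two_inv (hre h hh.2)]
    field_simp

section Lift

variable [MeasurableSpace V] [BorelSpace V] {ħ : ℝ} (hħ : 0 < ħ)

/-- The elements with parameters (g, f_F(g)) multiply correctly because Φ(gg') and Φ(g)Φ(g') lie
over the same element of Sp and have the same nonzero λ, by `liftFunction_mul`. -/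
theorem exists_lift : ∃ Φ : F.stabilizer →* MpC j ħ,
    (∀ g : F.stabilizer, MpC.HasParameters hħ (Φ g) g.1 (F.liftFunction j hj g)) ∧
      IsLift hħ Φ := by
  choose Φ hΦ using fun g : F.stabilizer => exists_hasParameters hħ g.2.1 (F.norm_liftFunction_sq g hj)
  have hmul : ∀ g g', Φ (g * g') = Φ g * Φ g' := by
    intro g g'
    have h1 : MpC.lam hħ (Φ (g * g')) = F.liftFunction j hj (g * g') := (hΦ _).lam_eq
    refine MpC.ext_of_lam hħ ?_ ?_ ?_
    · apply Subtype.ext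
      rw [map_mul, (hΦ _).sigma_eq]
      exact (congrArg₂ (· * ·) (hΦ g).sigma_eq (hΦ g').sigma_eq).symm
    · rw [h1, (hΦ g).lam_mul hħ (hΦ g'), F.liftFunction_mul hħ hj]
    · rw [h1]
      exact F.liftFunction_ne_zero _ hj
  refine ⟨MonoidHom.mk' Φ hmul, hΦ, fun g => (hΦ g).sigma_eq, ?_⟩
  intro g
  obtain ⟨N, φ, hN, hg, hφ, h⟩ := F.smooth_liftFunction hj g
  refine ⟨N, fun A => (A, φ A), hN, hg, contDiffOn_id.prodMk hφ, fun g' hg' => ?_⟩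
  exact Prod.ext (congrArg toEnd (hΦ g').sigma_eq.symm) ((h g' hg').trans (hΦ g').lam_eq.symm)

end Lift

end ComplexLagrangian

end

end SymplecticLift

theorem mainTheorem3 {V : Type*} [NormedAddCommGroup V] [NormedSpace ℝ V] [FiniteDimensional ℝ V]
    [MeasurableSpace V] [BorelSpace V] (Ω : SymplecticLift.SymplecticForm V)
    (ħ : ℝ) (hħ : 0 < ħ) (F : SymplecticLift.ComplexLagrangian Ω) (j : SymplecticLift.PCCS Ω)
    (hj : Commute (F.inducedStructure j).J F.reducedStructure.J) :
    ∃ Φ : F.stabilizer →* SymplecticLift.MpC j ħ,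
      (∀ g : F.stabilizer,
        SymplecticLift.MpC.HasParameters hħ (Φ g) g.1 (F.liftFunction j hj g)) ∧
      SymplecticLift.IsLift hħ Φ := by
  exact F.exists_lift hj hħ
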